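/- Let $\sigma,\rho$ be nonempty subsets of $\mathbb N$, each finite or co-finite. Put $d(\mathbb N)=0$, $d(\mu)=1+\min(\max\mu,\max(\mathbb N\setminus\mu))$ for other such $\mu$ (the maximum of an infinite set being $\infty$), and $d=\max\{1,d(\sigma),d(\rho)\}$. For a graph $G$, a set $D\subseteq V(G)$ *$(\sigma,\rho)$-dominates* $V(G)$ if $|N(u)\cap D|\in\sigma$ for every $u\in D$ and $|N(u)\cap D|\in\rho$ for every $u\in V(G)\setminus D$. A *connected co-$(\sigma,\rho)$-dominating set* of $G$ is a set $D\subseteq V(G)$ such that $G[D]$ is connected (in particular $D\ne\emptyset$) and $V(G)\setminus D$ $(\sigma,\rho)$-dominates $V(G)$. For $A\subseteq V(G)$ and $k\ge 1$, call $X,Y\subseteq A$ *$k$-neighbor equivalent over $A$* if $\min(k,|X\cap N(u)|)=\min(k,|Y\cap N(u)|)$ for all $u\in V(G)\setminus A$; let $\mathsf{nec}_k(A)$ be the number of equivalence classes and $\mathsf{s\text{-}nec}_k(A)=\max(\mathsf{nec}_k(A),\mathsf{nec}_k(V(G)\setminus A))$. A *rooted layout* $(T,\delta)$ of $G$ is a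 rooted binary tree $T$, each inner node having two children, with a bijection $\delta$ from $V(G)$ to the leaves of $T$; for a node $x$ let $V_x$ be the set of vertices mapped to leaves below $x$ (including $x$ itself if it is a leaf), and let $\mathsf{s\text{-}nec}_k(T,\delta)=\max_x \mathsf{s\text{-}nec}_k(V_x)$. Running times are those of a random access machine with unit-cost operations, on which a computation within time $O(\tau)$ uses integers of $O(\log\tau)$ bits and adds and compares rational vertex weights at unit cost. Let $\omega\ge 2$ be a real number such that two $k\times k$ matrices over $GF(2)$ can be multiplied in time $O(k^\omega)$. Then there is an algorithm that, given an $n$-vertex graph $G$ with vertex weights $\mathsf w:V(G)\to\mathbb Q$ and a rooted layout $(T,\delta)$ of $G$, computes a connected co-$(\sigma,\rho)$-dominating set of $G$ of maximum total weight, or reports that $G$ has no connected co-$(\sigma,\rho)$-dominating set, in time $$O\big(\mathsf{s\text{-}nec}_d(T,\delta)^{3}\cdot \mathsf{s\text{-}nec}_1(T,\delta)^{2\omega+5}\cdot \log_2(1+\mathsf{s\text{-}nec}_d(T,\delta))\cdot n^{3}\big),$$ where the implied constant depends only on $\sigma$, $\rho$ and $\omega$. There is also such an algorithm for minimum total weight.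 -/

import Mathlib

namespace CoDom

/-! ### A random access machine with a step count

Programs are finite pieces of code over finitely many integer registers, integer arrays and
arrays of rational weights.  Integers are machine words: every index and every result of an
arithmetic operation has to be at most a word bound `B`, otherwise the run is stuck.  Weights
can only be set to zero, added and compared, each at unit cost. -/

/-- Memory: registers, integer arrays (array name, index) and weight arrays (array name, index). -/
structure State where
  reg : ℕ → ℕ
  mem : ℕ → ℕ → ℕ
  wt : ℕ → ℕ → ℚ

/-- Operations on words; comparisons return `1` for true and `0` for false. -/
inductive Op
  | add | sub | mul | div | mod | eq | lt

def Op.eval : Op → ℕ → ℕ → ℕ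
  | .add, x, y => x + y
  | .sub, x, y => x - y
  | .mul, x, y => x * y
  | .div, x, y => x / y
  | .mod, x, y => x % y
  | .eq, x, y => if x = y then 1 else 0
  | .lt, x, y => if x < y then 1 else 0

/-- Integer expressions. `get a i` reads cell `i` of the integer array `a`. -/
inductive Expr
  | lit (k : ℕ)
  | var (x : ℕ)
  | get (a : ℕ) (i : Expr)
  | bin (o : Op) (e f : Expr)

namespace Expr

def eval (s : State) : Expr → ℕ
  | lit k => k
  | var x => s.reg x
  | get a i => s.mem a (i.eval s)
  | bin o e f => o.eval (e.eval s) (f.eval s)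

/-- The number of steps that the evaluation of an expression takes: one for each constant,
register access, array access and operation. -/
def cost : Expr → ℕ
  | lit _ => 1
  | var _ => 1
  | get _ i => i.cost + 1
  | bin _ e f => e.cost + f.cost + 1

/-- During the evaluation all constants, indices and results of operations are at most `B`. -/
def Fits (B : ℕ) (s : State) : Expr → Prop
  | lit k => k ≤ B
  | var _ => True
  | get _ i => i.Fits B s ∧ i.eval s ≤ B
  | bin o e f => e.Fits B s ∧ f.Fits B s ∧ o.eval (e.eval s) (f.eval s) ≤ B

end Expr

/-- Programs.
* `assign x e` : register `x` becomes `e`;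
* `store a i e` : cell `i` of the integer array `a` becomes `e`;
* `wzero a i` : the weight `a[i]` becomes `0`;
* `wadd a i b j c k` : the weight `a[i]` becomes `b[j] + c[k]`;
* `wle x b j c k` : register `x` becomes `1` if the weight `b[j]` is at most the weight `c[k]`,
  and `0` otherwise;
* `ite e p q` and `loop e p` : branch and while-loop, where a value other than `0` is true. -/
inductive Prog
  | skip
  | assign (x : ℕ) (e : Expr)
  | store (a : ℕ) (i e : Expr)
  | wzero (a : ℕ) (i : Expr)
  | wadd (a : ℕ) (i : Expr) (b : ℕ) (j : Expr) (c : ℕ) (k : Expr)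
  | wle (x : ℕ) (b : ℕ) (j : Expr) (c : ℕ) (k : Expr)
  | seq (p q : Prog)
  | ite (e : Expr) (p q : Prog)
  | loop (e : Expr) (p : Prog)

def State.setReg (s : State) (x v : ℕ) : State :=
  { s with reg := Function.update s.reg x v }

def State.setMem (s : State) (a i v : ℕ) : State :=
  { s with mem := Function.update s.mem a (Function.update (s.mem a) i v) }

def State.setWt (s : State) (a i : ℕ) (v : ℚ) : State :=
  { s with wt := Function.update s.wt a (Function.update (s.wt a) i v) }

/-- `Exec B p s t s'`: with word bound `B`, program `p` started in state `s` halts in state `s'`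
after exactly `t` steps. -/
inductive Exec (B : ℕ) : Prog → State → ℕ → State → Prop
  | skip (s : State) : Exec B .skip s 1 s
  | assign (s : State) (x : ℕ) (e : Expr) (he : e.Fits B s) :
      Exec B (.assign x e) s (e.cost + 1) (s.setReg x (e.eval s))
  | store (s : State) (a : ℕ) (i e : Expr) (hi : i.Fits B s) (hB : i.eval s ≤ B)
      (he : e.Fits B s) :
      Exec B (.store a i e) s (i.cost + e.cost + 1) (s.setMem a (i.eval s) (e.eval s))
  | wzero (s : State) (a : ℕ) (i : Expr) (hi : i.Fits B s) (hB : i.eval s ≤ B) :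
      Exec B (.wzero a i) s (i.cost + 1) (s.setWt a (i.eval s) 0)
  | wadd (s : State) (a : ℕ) (i : Expr) (b : ℕ) (j : Expr) (c : ℕ) (k : Expr)
      (hi : i.Fits B s) (hiB : i.eval s ≤ B) (hj : j.Fits B s) (hjB : j.eval s ≤ B)
      (hk : k.Fits B s) (hkB : k.eval s ≤ B) :
      Exec B (.wadd a i b j c k) s (i.cost + j.cost + k.cost + 1)
        (s.setWt a (i.eval s) (s.wt b (j.eval s) + s.wt c (k.eval s)))
  | wle (s : State) (x : ℕ) (b : ℕ) (j : Expr) (c : ℕ) (k : Expr)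
      (hj : j.Fits B s) (hjB : j.eval s ≤ B) (hk : k.Fits B s) (hkB : k.eval s ≤ B) :
      Exec B (.wle x b j c k) s (j.cost + k.cost + 1)
        (s.setReg x (if s.wt b (j.eval s) ≤ s.wt c (k.eval s) then 1 else 0))
  | seq {p q : Prog} {s s' s'' : State} {t t' : ℕ} (hp : Exec B p s t s')
      (hq : Exec B q s' t' s'') : Exec B (.seq p q) s (t + t') s''
  | ite_true {e : Expr} {p q : Prog} {s s' : State} {t : ℕ} (he : e.Fits B s)
      (h : e.eval s ≠ 0) (hp : Exec B p s t s') : Exec B (.ite e p q) s (e.cost + t) s'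
  | ite_false {e : Expr} {p q : Prog} {s s' : State} {t : ℕ} (he : e.Fits B s)
      (h : e.eval s = 0) (hq : Exec B q s t s') : Exec B (.ite e p q) s (e.cost + t) s'
  | loop_done {e : Expr} {p : Prog} {s : State} (he : e.Fits B s) (h : e.eval s = 0) :
      Exec B (.loop e p) s e.cost s
  | loop_step {e : Expr} {p : Prog} {s s' s'' : State} {t t' : ℕ} (he : e.Fits B s)
      (h : e.eval s ≠ 0) (hp : Exec B p s t s') (hl : Exec B (.loop e p) s' t' s'') :
      Exec B (.loop e p) s (e.cost + t + t') s''

/-- Started in `s`, the program `p` halts after at most `C * τ` steps in a state satisfying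
`post`, on words of `O(log τ)` bits, that is, with integers that are at most `C * τ ^ C`. -/
def RunsWithin (p : Prog) (s : State) (C : ℕ) (τ : ℝ) (post : State → Prop) : Prop :=
  ∃ (B t : ℕ) (s' : State), Exec B p s t s' ∧ (t : ℝ) ≤ C * τ ∧ (B : ℝ) ≤ C * τ ^ C ∧ post s'

/-! ### Matrix multiplication -/

/-- Array `a` holds the square matrix `M` over `GF(2)`, row by row. -/
def HoldsMatrix {k : ℕ} (s : State) (a : ℕ) (M : Matrix (Fin k) (Fin k) (ZMod 2)) : Prop :=
  ∀ i j : Fin k, s.mem a (i * k + j) = (M i j).val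

/-- Two `k × k` matrices over `GF(2)` can be multiplied in time `O(k ^ ω)`.  As `2 * k ^ 2`
entries have to be read, such an `ω` is never less than `2`.  The factors are given in arrays
`0` and `1`, their size in register `0`, and the product is returned in array `2`; the contents
of the memory outside the input are arbitrary. -/
def IsMatMulExponent (ω : ℝ) : Prop :=
  2 ≤ ω ∧ ∃ (p : Prog) (C : ℕ), ∀ k : ℕ, 1 ≤ k →
    ∀ (M N : Matrix (Fin k) (Fin k) (ZMod 2)) (s : State),
      s.reg 0 = k → HoldsMatrix s 0 M → HoldsMatrix s 1 N →
      RunsWithin p s C ((k : ℝ) ^ ω) fun s' => HoldsMatrix s' 2 (M * N)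

/-! ### Rooted layouts and width -/

/-- Rooted binary trees with leaves labelled by `V`; each inner node has two children. -/
inductive BinTree (V : Type) : Type
  | leaf (v : V) : BinTree V
  | node (l r : BinTree V) : BinTree V

namespace BinTree

variable {V : Type}

/-- The labels of the leaves, from left to right. -/
def leaves : BinTree V → List V
  | leaf v => [v]
  | node l r => l.leaves ++ r.leaves

/-- The maximum of `f V_x` over all nodes `x` of the tree, where `V_x` is the set of labels of
the leaves below `x`. -/
def width (f : Set V → ℕ) : BinTree V → ℕ
  | leaf v => f {v}
  | node l r => max (f {v | v ∈ l.leaves ++ r.leaves}) (max (l.width f) (r.width f))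

/-- The nodes of a tree in postorder: `v + 1` for a leaf with label `v`, and `0` for an inner
node. -/
def code {n : ℕ} : BinTree (Fin n) → List ℕ
  | leaf v => [(v : ℕ) + 1]
  | node l r => l.code ++ r.code ++ [0]

end BinTree

/-- A rooted layout: a rooted binary tree whose leaves are in bijection with `V`. -/
structure RootedLayout (V : Type) where
  tree : BinTree V
  nodup : tree.leaves.Nodup
  complete : ∀ v : V, v ∈ tree.leaves

/-- `d`-neighbor equivalence over `A`. -/
def neighborEquiv {V : Type} (G : SimpleGraph V) (d : ℕ) (A : Set V) :
    Setoid {X : Set V // X ⊆ A} where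
  r X Y := ∀ u, u ∉ A →
    min d (X.1 ∩ G.neighborSet u).ncard = min d (Y.1 ∩ G.neighborSet u).ncard
  iseqv := ⟨fun _ _ _ => rfl, fun h u hu => (h u hu).symm,
    fun h h' u hu => (h u hu).trans (h' u hu)⟩

/-- The number of `d`-neighbor equivalence classes over `A`. -/
noncomputable def nec {V : Type} (G : SimpleGraph V) (d : ℕ) (A : Set V) : ℕ :=
  Nat.card (Quotient (neighborEquiv G d A))

noncomputable def snec {V : Type} (G : SimpleGraph V) (d : ℕ) (A : Set V) : ℕ :=
  max (nec G d A) (nec G d Aᶜ)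

/-- The `d`-neighbor-width of a rooted layout. -/
noncomputable def layoutSnec {V : Type} (G : SimpleGraph V) (d : ℕ) (L : RootedLayout V) : ℕ :=
  L.tree.width (snec G d)

/-! ### Connected co-`(σ, ρ)`-dominating sets -/

open Classical in
/-- `d(ℕ) = 0`, and `d(μ) = 1 + min (max μ) (max (ℕ \ μ))` for every other nonempty finite or
cofinite `μ`; here the maximum of an infinite set is infinite. -/
noncomputable def domDepth (μ : Set ℕ) : ℕ :=
  if μ = Set.univ then 0 else if μ.Finite then 1 + sSup μ else 1 + sSup μᶜ

noncomputable def domD (σ ρ : Set ℕ) : ℕ := max 1 (max (domDepth σ) (domDepth ρ))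

/-- `D` `(σ, ρ)`-dominates `U`. -/
def Dominates {V : Type} (G : SimpleGraph V) (σ ρ : Set ℕ) (D U : Set V) : Prop :=
  ∀ u ∈ U, (u ∈ D → (G.neighborSet u ∩ D).ncard ∈ σ) ∧
    (u ∉ D → (G.neighborSet u ∩ D).ncard ∈ ρ)

/-- `D` induces a connected (in particular nonempty) subgraph, and its complement
`(σ, ρ)`-dominates all vertices. -/
def IsConnectedCoDom {V : Type} (G : SimpleGraph V) (σ ρ : Set ℕ) (D : Finset V) : Prop :=
  (G.induce (D : Set V)).Connected ∧ Dominates G σ ρ (D : Set V)ᶜ Set.univ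

inductive Goal
  | maximum | minimum

/-- `D` is a connected co-`(σ, ρ)`-dominating set of maximum, respectively minimum, weight. -/
def IsOptimal {V : Type} (goal : Goal) (G : SimpleGraph V) (σ ρ : Set ℕ) (w : V → ℚ)
    (D : Finset V) : Prop :=
  IsConnectedCoDom G σ ρ D ∧ ∀ D' : Finset V, IsConnectedCoDom G σ ρ D' →
    match goal with
    | .maximum => ∑ v ∈ D', w v ≤ ∑ v ∈ D, w v
    | .minimum => ∑ v ∈ D, w v ≤ ∑ v ∈ D', w v

open Classical in
/-- The input: the number of vertices in register `0`, the adjacency matrix in array `0`, the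
tree of the layout in array `1`, the vertex weights in weight array `0`.  The contents of the
memory outside the input are arbitrary. -/
def IsInput {n : ℕ} (G : SimpleGraph (Fin n)) (w : Fin n → ℚ) (L : RootedLayout (Fin n))
    (s : State) : Prop :=
  s.reg 0 = n ∧
  (∀ i j : Fin n, s.mem 0 (i * n + j) = if G.Adj i j then 1 else 0) ∧
  (∀ (k : ℕ) (hk : k < L.tree.code.length), s.mem 1 k = L.tree.code[k]) ∧
  (∀ i : Fin n, s.wt 0 i = w i)

open Classical in
/-- The output: either register `1` is `0` and there is no solution, or register `1` is `1` and
array `2` holds the characteristic vector of an optimal solution. -/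
def IsOutput {n : ℕ} (goal : Goal) (G : SimpleGraph (Fin n)) (σ ρ : Set ℕ) (w : Fin n → ℚ)
    (s : State) : Prop :=
  (s.reg 1 = 0 ∧ ∀ D : Finset (Fin n), ¬ IsConnectedCoDom G σ ρ D) ∨
  (s.reg 1 = 1 ∧ ∃ D : Finset (Fin n), IsOptimal goal G σ ρ w D ∧
    ∀ i : Fin n, s.mem 2 i = if i ∈ D then 1 else 0)

/-- The bound on the running time.  The logarithm is taken of `1 + s-nec_d`, as `s-nec_d` is `1`
for graphs without edges. -/
noncomputable def timeBound {n : ℕ} (σ ρ : Set ℕ) (ω : ℝ) (G : SimpleGraph (Fin n))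
    (L : RootedLayout (Fin n)) : ℝ :=
  (layoutSnec G (domD σ ρ) L : ℝ) ^ 3 * (layoutSnec G 1 L : ℝ) ^ (2 * ω + 5) *
    Real.logb 2 (1 + layoutSnec G (domD σ ρ) L) * (n : ℝ) ^ 3

end CoDom

/-! The algorithm is a dynamic programme over the layout in which connectivity is handled by linear
algebra over GF(2). Write `S` for s-nec_d and `S₁` for s-nec_1 of the layout.

Domination. Since σ and ρ are finite or cofinite, membership of a number depends only on its
truncation at `d` (`mem_min_iff`). Hence, at a cut `(A, Aᶜ)`, a partial solution `X ⊆ A` interacts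
with the rest only through the `d`-neighbor class of `A \ X`, and the rest acts on `A` only through
the class over `Aᶜ` of the outer part of the dominating set. The table of a node has a cell for each
pair of such classes, so at most `S²` cells, and within a cell partial solutions may replace each
other as far as domination is concerned (`Sol.exchange`, `Sol.join`).

Connectivity. Call a split of a vertex set into two sides without edges between them a cut. The
number of cuts with a given vertex on the first side is odd exactly if the induced graph is
connected (`sum_cuts_anchor`). A cut of `G[X ∪ Y]` is a cut of `G[X]` together with a cut of `G[Y]`
that is compatible with it, and compatibility depends only on the 1-neighbor classes of the two
sides of `Y`. So `X` gets a vector `row` with one entry for each pair of classes, at most `S₁²`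
entries, and connectedness of `G[X ∪ Y]` is a linear functional of this vector that depends on `Y`
only (`exists_functional`).

Sparsification. A cell stores at most one nonempty set per coordinate, namely those of an echelon
basis in which heavier sets are preferred. Ties are broken by an injective `key`, so the best set of
the cell on which a given functional does not vanish is unique, and such a basis has to retain it
(`BasisInv.retained`). The tables need not represent all solutions. It is enough that their entries
are partial solutions and that the unique best solution `D` leaves its trace `D ∩ A` in every table:
if a set `X` of the same cell has `X ∪ (D \ A)` connected, then this union is a solution by
exchange, so its key is at most that of `D`, and therefore the key of `X` is at most that of `D ∩ A`
(`TableInv.of_cells`). The property passes to a parent because the parent tries all unions of stored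
sets (`JoinTabs.complete`). At the root the vectors have a single entry, which tells whether the set
is connected (`TableInv.root`).

Time. To insert a set, its components are labelled in O(n²), each entry of its vector is evaluated
in O(n) as a product over components (`cutSum_eq_prod`), and the vector is eliminated in O(S₁²(n +
S₁²)). An inner node needs at most one insertion for each triple of classes and each pair of stored
sets, that is O(S³S₁⁴) insertions. This gives O(S³S₁⁸n²) for a node (`nodeTime_le`) and O(S³S₁⁸n³)
for the fewer than 2n nodes. As ω ≥ 2, the exponent 2ω + 5 is at least 9, and the logarithm is at
least 1, so the stated bound holds (`le_timeBound`); schoolbook elimination suffices.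

The programs are written for the given machine and verified with the judgement `Runs` for total
correctness within a time bound, where everything that a program does not syntactically write is
known to be preserved (`Exec.agree`). -/

namespace CoDom

/-! ### A program logic with time bounds for the machine. -/

/-! ### Expressions -/

namespace Expr

instance : Add Expr := ⟨.bin .add⟩
instance : Sub Expr := ⟨.bin .sub⟩
instance : Mul Expr := ⟨.bin .mul⟩
instance : Div Expr := ⟨.bin .div⟩
instance : Mod Expr := ⟨.bin .mod⟩
instance (k : ℕ) : OfNat Expr k := ⟨.lit k⟩

def equ (e f : Expr) : Expr := .bin .eq e f
def less (e f : Expr) : Expr := .bin .lt e f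

variable (s : State) (B : ℕ) (e f : Expr)

@[simp] theorem eval_lit (k : ℕ) : (lit k).eval s = k := rfl
@[simp] theorem eval_ofNat (k : ℕ) : (no_index (OfNat.ofNat k) : Expr).eval s = k := rfl
@[simp] theorem eval_var (x : ℕ) : (var x).eval s = s.reg x := rfl
@[simp] theorem eval_get (a : ℕ) : (get a e).eval s = s.mem a (e.eval s) := rfl
@[simp] theorem eval_add : (e + f).eval s = e.eval s + f.eval s := rfl
@[simp] theorem eval_sub : (e - f).eval s = e.eval s - f.eval s := rfl
@[simp] theorem eval_mul : (e * f).eval s = e.eval s * f.eval s := rfl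
@[simp] theorem eval_div : (e / f).eval s = e.eval s / f.eval s := rfl
@[simp] theorem eval_mod : (e % f).eval s = e.eval s % f.eval s := rfl
@[simp] theorem eval_equ : (equ e f).eval s = if e.eval s = f.eval s then 1 else 0 := rfl
@[simp] theorem eval_less : (less e f).eval s = if e.eval s < f.eval s then 1 else 0 := rfl

@[simp] theorem fits_lit (k : ℕ) : (lit k).Fits B s ↔ k ≤ B := Iff.rfl
@[simp] theorem fits_ofNat (k : ℕ) : (no_index (OfNat.ofNat k) : Expr).Fits B s ↔ k ≤ B := Iff.rfl
@[simp] theorem fits_var (x : ℕ) : (var x).Fits B s := trivial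
@[simp] theorem fits_get (a : ℕ) : (get a e).Fits B s ↔ e.Fits B s ∧ e.eval s ≤ B := Iff.rfl
@[simp] theorem fits_add :
    (e + f).Fits B s ↔ e.Fits B s ∧ f.Fits B s ∧ e.eval s + f.eval s ≤ B := Iff.rfl
@[simp] theorem fits_sub :
    (e - f).Fits B s ↔ e.Fits B s ∧ f.Fits B s ∧ e.eval s - f.eval s ≤ B := Iff.rfl
@[simp] theorem fits_mul :
    (e * f).Fits B s ↔ e.Fits B s ∧ f.Fits B s ∧ e.eval s * f.eval s ≤ B := Iff.rfl
@[simp] theorem fits_div :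
    (e / f).Fits B s ↔ e.Fits B s ∧ f.Fits B s ∧ e.eval s / f.eval s ≤ B := Iff.rfl
@[simp] theorem fits_mod :
    (e % f).Fits B s ↔ e.Fits B s ∧ f.Fits B s ∧ e.eval s % f.eval s ≤ B := Iff.rfl
@[simp] theorem fits_equ :
    (equ e f).Fits B s ↔ e.Fits B s ∧ f.Fits B s ∧ (if e.eval s = f.eval s then 1 else 0) ≤ B :=
  Iff.rfl
@[simp] theorem fits_less :
    (less e f).Fits B s ↔ e.Fits B s ∧ f.Fits B s ∧ (if e.eval s < f.eval s then 1 else 0) ≤ B :=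
  Iff.rfl

@[simp] theorem cost_lit (k : ℕ) : (lit k).cost = 1 := rfl
@[simp] theorem cost_ofNat (k : ℕ) : (no_index (OfNat.ofNat k) : Expr).cost = 1 := rfl
@[simp] theorem cost_var (x : ℕ) : (var x).cost = 1 := rfl
@[simp] theorem cost_get (a : ℕ) : (get a e).cost = e.cost + 1 := rfl
@[simp] theorem cost_add : (e + f).cost = e.cost + f.cost + 1 := rfl
@[simp] theorem cost_sub : (e - f).cost = e.cost + f.cost + 1 := rfl
@[simp] theorem cost_mul : (e * f).cost = e.cost + f.cost + 1 := rfl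
@[simp] theorem cost_div : (e / f).cost = e.cost + f.cost + 1 := rfl
@[simp] theorem cost_mod : (e % f).cost = e.cost + f.cost + 1 := rfl
@[simp] theorem cost_equ : (equ e f).cost = e.cost + f.cost + 1 := rfl
@[simp] theorem cost_less : (less e f).cost = e.cost + f.cost + 1 := rfl

end Expr

/-! ### State updates -/

section State

variable (s : State)

@[simp] theorem setReg_reg (x v y : ℕ) :
    (s.setReg x v).reg y = if y = x then v else s.reg y := Function.update_apply ..
@[simp] theorem setReg_mem (x v : ℕ) : (s.setReg x v).mem = s.mem := rfl
@[simp] theorem setReg_wt (x v : ℕ) : (s.setReg x v).wt = s.wt := rfl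
@[simp] theorem setMem_reg (a i v : ℕ) : (s.setMem a i v).reg = s.reg := rfl
@[simp] theorem setMem_wt (a i v : ℕ) : (s.setMem a i v).wt = s.wt := rfl
@[simp] theorem setMem_mem (a i v b j : ℕ) :
    (s.setMem a i v).mem b j = if b = a ∧ j = i then v else s.mem b j := by
  by_cases h : b = a
  · subst h; simp [State.setMem, Function.update_apply]
  · simp [State.setMem, h]
@[simp] theorem setWt_reg (a i : ℕ) (v : ℚ) : (s.setWt a i v).reg = s.reg := rfl
@[simp] theorem setWt_mem (a i : ℕ) (v : ℚ) : (s.setWt a i v).mem = s.mem := rfl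
@[simp] theorem setWt_wt (a i : ℕ) (v : ℚ) (b j : ℕ) :
    (s.setWt a i v).wt b j = if b = a ∧ j = i then v else s.wt b j := by
  by_cases h : b = a
  · subst h; simp [State.setWt, Function.update_apply]
  · simp [State.setWt, h]

end State

/-! ### Frames: what a program can change -/

namespace Prog

def writesR : Prog → ℕ → Bool
  | skip, _ => false
  | assign x _, y => x == y
  | store _ _ _, _ => false
  | wzero _ _, _ => false
  | wadd _ _ _ _ _ _, _ => false
  | wle x _ _ _ _, y => x == y
  | seq p q, y => p.writesR y || q.writesR y
  | ite _ p q, y => p.writesR y || q.writesR y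
  | loop _ p, y => p.writesR y

def writesM : Prog → ℕ → Bool
  | skip, _ => false
  | assign _ _, _ => false
  | store a _ _, b => a == b
  | wzero _ _, _ => false
  | wadd _ _ _ _ _ _, _ => false
  | wle _ _ _ _ _, _ => false
  | seq p q, y => p.writesM y || q.writesM y
  | ite _ p q, y => p.writesM y || q.writesM y
  | loop _ p, y => p.writesM y

def writesW : Prog → ℕ → Bool
  | skip, _ => false
  | assign _ _, _ => false
  | store _ _ _, _ => false
  | wzero a _, b => a == b
  | wadd a _ _ _ _ _, b => a == b
  | wle _ _ _ _ _, _ => false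
  | seq p q, y => p.writesW y || q.writesW y
  | ite _ p q, y => p.writesW y || q.writesW y
  | loop _ p, y => p.writesW y

end Prog

/-- `s'` agrees with `s` on everything that `p` does not write. -/
structure Agree (p : Prog) (s s' : State) : Prop where
  reg : ∀ x, p.writesR x = false → s'.reg x = s.reg x
  mem : ∀ a, p.writesM a = false → s'.mem a = s.mem a
  wt : ∀ a, p.writesW a = false → s'.wt a = s.wt a

theorem Agree.refl (p : Prog) (s : State) : Agree p s s :=
  ⟨fun _ _ => rfl, fun _ _ => rfl, fun _ _ => rfl⟩

theorem Agree.trans {p : Prog} {s s' s'' : State} (h : Agree p s s') (h' : Agree p s' s'') :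
    Agree p s s'' :=
  ⟨fun x hx => (h'.reg x hx).trans (h.reg x hx), fun x hx => (h'.mem x hx).trans (h.mem x hx),
    fun x hx => (h'.wt x hx).trans (h.wt x hx)⟩

theorem Agree.mono {p q : Prog} {s s' : State} (h : Agree p s s')
    (hR : ∀ x, q.writesR x = false → p.writesR x = false)
    (hM : ∀ x, q.writesM x = false → p.writesM x = false)
    (hW : ∀ x, q.writesW x = false → p.writesW x = false) : Agree q s s' :=
  ⟨fun x hx => h.reg x (hR x hx), fun x hx => h.mem x (hM x hx), fun x hx => h.wt x (hW x hx)⟩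

/-- The written registers and arrays are computed from the syntax of a program, so that frame
conditions for concrete programs reduce to `rfl` or `decide`. -/
theorem Exec.agree {B : ℕ} {p : Prog} {s : State} {t : ℕ} {s' : State} (h : Exec B p s t s') :
    Agree p s s' := by
  induction h with
  | skip s => exact .refl _ _
  | assign s x e he =>
    refine ⟨fun y hy => ?_, fun _ _ => rfl, fun _ _ => rfl⟩
    have : x ≠ y := by simpa [Prog.writesR] using hy
    simp [this.symm]
  | store s a i e hi hB he =>
    refine ⟨fun y hy => rfl, fun b hb => ?_, fun _ _ => rfl⟩
    have : a ≠ b := by simpa [Prog.writesM] using hb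
    funext j; simp [this.symm]
  | wzero s a i hi hB =>
    refine ⟨fun y hy => rfl, fun _ _ => rfl, fun b hb => ?_⟩
    have : a ≠ b := by simpa [Prog.writesW] using hb
    funext j; simp [this.symm]
  | wadd s a i b j c k =>
    refine ⟨fun y hy => rfl, fun _ _ => rfl, fun b hb => ?_⟩
    have : a ≠ b := by simpa [Prog.writesW] using hb
    funext j; simp [this.symm]
  | wle s x b j c k =>
    refine ⟨fun y hy => ?_, fun _ _ => rfl, fun _ _ => rfl⟩
    have : x ≠ y := by simpa [Prog.writesR] using hy
    simp [this.symm]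
  | seq _ _ ih ih' =>
    exact (ih.mono (by simp +contextual [Prog.writesR]) (by simp +contextual [Prog.writesM])
      (by simp +contextual [Prog.writesW])).trans
      (ih'.mono (by simp +contextual [Prog.writesR]) (by simp +contextual [Prog.writesM])
      (by simp +contextual [Prog.writesW]))
  | ite_true _ _ _ ih | ite_false _ _ _ ih =>
    exact (ih.mono (by simp +contextual [Prog.writesR]) (by simp +contextual [Prog.writesM])
      (by simp +contextual [Prog.writesW]))
  | loop_done => exact .refl _ _
  | loop_step _ _ _ _ ih ih' =>
    exact (ih.mono (by simp +contextual [Prog.writesR]) (by simp +contextual [Prog.writesM])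
      (by simp +contextual [Prog.writesW])).trans ih'

/-! ### Total correctness with time bounds -/

/-- Started in `s`, the program `p` halts within `T` steps in a state satisfying `Q`. -/
def Runs (B : ℕ) (p : Prog) (s : State) (T : ℕ) (Q : State → Prop) : Prop :=
  ∃ t s', Exec B p s t s' ∧ t ≤ T ∧ Q s'

namespace Runs

variable {B : ℕ} {p q : Prog} {s : State} {T T' : ℕ} {Q Q' : State → Prop}

/-- The weakening of the postcondition may use agreement with the initial state, so specifications
only have to mention what changes. -/
theorem mono (h : Runs B p s T Q) (hT : T ≤ T') (hQ : ∀ s', Agree p s s' → Q s' → Q' s') :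
    Runs B p s T' Q' := by
  obtain ⟨t, s', hx, ht, hq⟩ := h
  exact ⟨t, s', hx, ht.trans hT, hQ s' hx.agree hq⟩

theorem seq {T₁ T₂ : ℕ} {R : State → Prop} (h : Runs B p s T₁ R)
    (h' : ∀ s', Agree p s s' → R s' → Runs B q s' T₂ Q) (hT : T₁ + T₂ ≤ T) :
    Runs B (.seq p q) s T Q := by
  obtain ⟨t, s', hx, ht, hr⟩ := h
  obtain ⟨t', s'', hx', ht', hq⟩ := h' s' hx.agree hr
  exact ⟨t + t', s'', .seq hx hx', by omega, hq⟩

theorem ite {e : Expr} (he : e.Fits B s) (h : e.eval s ≠ 0 → Runs B p s T Q)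
    (h' : e.eval s = 0 → Runs B q s T Q) (hT : e.cost + T ≤ T') :
    Runs B (.ite e p q) s T' Q := by
  by_cases h0 : e.eval s = 0
  · obtain ⟨t, s', hx, ht, hr⟩ := h' h0
    exact ⟨_, s', .ite_false he h0 hx, by omega, hr⟩
  · obtain ⟨t, s', hx, ht, hr⟩ := h h0
    exact ⟨_, s', .ite_true he h0 hx, by omega, hr⟩

end Runs

/-! ### Straight-line programs -/

namespace Prog

/-- The value at `loop` is a placeholder; `safe` excludes loops. -/
def run : Prog → State → State
  | skip, s => s
  | assign x e, s => s.setReg x (e.eval s)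
  | store a i e, s => s.setMem a (i.eval s) (e.eval s)
  | wzero a i, s => s.setWt a (i.eval s) 0
  | wadd a i b j c k, s => s.setWt a (i.eval s) (s.wt b (j.eval s) + s.wt c (k.eval s))
  | wle x b j c k, s => s.setReg x (if s.wt b (j.eval s) ≤ s.wt c (k.eval s) then 1 else 0)
  | seq p q, s => q.run (p.run s)
  | ite e p q, s => if e.eval s = 0 then q.run s else p.run s
  | loop _ _, s => s

def safe (B : ℕ) : Prog → State → Prop
  | skip, _ => True
  | assign _ e, s => e.Fits B s
  | store _ i e, s => i.Fits B s ∧ i.eval s ≤ B ∧ e.Fits B s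
  | wzero _ i, s => i.Fits B s ∧ i.eval s ≤ B
  | wadd _ i _ j _ k, s => i.Fits B s ∧ i.eval s ≤ B ∧ j.Fits B s ∧ j.eval s ≤ B ∧
      k.Fits B s ∧ k.eval s ≤ B
  | wle _ _ j _ k, s => j.Fits B s ∧ j.eval s ≤ B ∧ k.Fits B s ∧ k.eval s ≤ B
  | seq p q, s => p.safe B s ∧ q.safe B (p.run s)
  | ite e p q, s => e.Fits B s ∧ (e.eval s ≠ 0 → p.safe B s) ∧ (e.eval s = 0 → q.safe B s)
  | loop _ _, _ => False

/-- For a branch the durations of both alternatives are added, which overestimates the time but does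
not depend on the state. -/
def dur : Prog → ℕ
  | skip => 1
  | assign _ e => e.cost + 1
  | store _ i e => i.cost + e.cost + 1
  | wzero _ i => i.cost + 1
  | wadd _ i _ j _ k => i.cost + j.cost + k.cost + 1
  | wle _ _ j _ k => j.cost + k.cost + 1
  | seq p q => p.dur + q.dur
  | ite e p q => e.cost + (p.dur + q.dur)
  | loop _ _ => 0

/-- A list of programs, run one after the other. -/
def block : List Prog → Prog
  | [] => skip
  | [p] => p
  | p :: q :: l => seq p (block (q :: l))

@[simp] theorem block_one (p : Prog) : block [p] = p := rfl
@[simp] theorem block_cons (p q : Prog) (l : List Prog) :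
    block (p :: q :: l) = seq p (block (q :: l)) := rfl

theorem safe.exec {B : ℕ} {p : Prog} {s : State} (h : p.safe B s) :
    ∃ t, Exec B p s t (p.run s) ∧ t ≤ p.dur := by
  induction p generalizing s with
  | skip => exact ⟨1, .skip s, le_rfl⟩
  | assign x e => exact ⟨_, .assign s x e h, le_rfl⟩
  | store a i e => exact ⟨_, .store s a i e h.1 h.2.1 h.2.2, le_rfl⟩
  | wzero a i => exact ⟨_, .wzero s a i h.1 h.2, le_rfl⟩
  | wadd a i b j c k =>
    obtain ⟨h1, h2, h3, h4, h5, h6⟩ := h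
    exact ⟨_, .wadd s a i b j c k h1 h2 h3 h4 h5 h6, le_rfl⟩
  | wle x b j c k =>
    obtain ⟨h1, h2, h3, h4⟩ := h
    exact ⟨_, .wle s x b j c k h1 h2 h3 h4, le_rfl⟩
  | seq p q ihp ihq =>
    obtain ⟨t, ht, h1⟩ := ihp h.1
    obtain ⟨t', ht', h2⟩ := ihq h.2
    exact ⟨_, .seq ht ht', Nat.add_le_add h1 h2⟩
  | ite e p q ihp ihq =>
    by_cases h0 : e.eval s = 0
    · obtain ⟨t, ht, h1⟩ := ihq (h.2.2 h0)
      refine ⟨_, .ite_false h.1 h0 (by simpa [run, h0] using ht), ?_⟩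
      simp only [dur]; omega
    · obtain ⟨t, ht, h1⟩ := ihp (h.2.1 h0)
      refine ⟨_, .ite_true h.1 h0 (by simpa [run, h0] using ht), ?_⟩
      simp only [dur]; omega
  | loop e p => exact h.elim

end Prog

theorem Runs.straight {B : ℕ} {p : Prog} {s : State} {T : ℕ} {Q : State → Prop}
    (h : p.safe B s) (hQ : Q (p.run s)) (hT : p.dur ≤ T) : Runs B p s T Q := by
  obtain ⟨t, ht, h1⟩ := h.exec
  exact ⟨t, _, ht, h1.trans hT, hQ⟩

theorem Runs.step {B : ℕ} {p q : Prog} {s : State} {T₂ T : ℕ} {Q : State → Prop}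
    (h : p.safe B s) (hq : Runs B q (p.run s) T₂ Q) (hT : p.dur + T₂ ≤ T) :
    Runs B (.seq p q) s T Q := by
  obtain ⟨t, ht, h1⟩ := h.exec
  obtain ⟨t', s', ht', h2, h3⟩ := hq
  exact ⟨_, s', .seq ht ht', by omega, h3⟩

/-! ### For-loops -/

theorem ite_le {c : Prop} [Decidable c] {B : ℕ} (h : 1 ≤ B) : (if c then 1 else 0) ≤ B := by
  split_ifs <;> omega

/-- `for x := 0, …, y - 1 do p`. -/
def forLoop (x y : ℕ) (p : Prog) : Prog :=
  .seq (.assign x 0) (.loop (.less (.var x) (.var y)) (.seq p (.assign x (.var x + 1))))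

theorem Agree.of_forLoop {x y : ℕ} {p : Prog} {s s' : State} (h : Agree p s s') :
    Agree (forLoop x y p) s s' :=
  h.mono (by simp +contextual [Prog.writesR, forLoop]) (by simp +contextual [Prog.writesM, forLoop])
      (by simp +contextual [Prog.writesW, forLoop])

theorem Agree.setReg_forLoop {x y : ℕ} {p : Prog} {s : State} (v : ℕ) :
    Agree (forLoop x y p) s (s.setReg x v) := by
  refine ⟨fun z hz => ?_, fun _ _ => rfl, fun _ _ => rfl⟩
  have : x ≠ z := by
    simp [forLoop, Prog.writesR] at hz; exact hz.1
  simp [this.symm]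

/-- The iterations of a for-loop: `m` times the body, each followed by an increment. -/
theorem Runs.loop_iter {B : ℕ} {x y : ℕ} {p : Prog} {N Tb : ℕ} (Inv : ℕ → State → Prop)
    (hxp : p.writesR x = false) (hy : p.writesR y = false) (hxy : x ≠ y)
    (hB : N ≤ B) (h1 : 1 ≤ B)
    (hs : ∀ i < N, ∀ s, s.reg x = i → s.reg y = N → Inv i s →
      Runs B p s Tb (fun s' => Inv (i + 1) (s'.setReg x (i + 1))))
    (i m : ℕ) (hi : i + m = N) (s : State) (hx : s.reg x = i) (hN : s.reg y = N) (h : Inv i s) :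
    Runs B (.loop (.less (.var x) (.var y)) (.seq p (.assign x (.var x + 1)))) s
      (m * (Tb + 7) + 3) (Inv N) := by
  induction m generalizing i s with
  | zero =>
    have : i = N := by omega
    subst this
    refine ⟨3, s, .loop_done (by simp [hx, hN]) (by simp [hx, hN]), by omega, h⟩
  | succ m ih =>
    obtain ⟨t, s', hx', ht, hq⟩ := hs i (by omega) s hx hN h
    have hag := hx'.agree
    have e1 : s'.reg x = i := (hag.reg x hxp).trans hx
    have e2 : s'.reg y = N := (hag.reg y hy).trans hN
    obtain ⟨t', s'', hx'', ht', hq'⟩ := ih (i + 1) (by omega) (s'.setReg x (i + 1))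
      (by simp) (by simp [hxy.symm, e2]) hq
    have hl : (Expr.less (.var x) (.var y)).eval s ≠ 0 := by
      simp [hx, hN]; omega
    have ha : Exec B (.assign x (.var x + 1)) s' 4 (s'.setReg x (i + 1)) := by
      have := Exec.assign (B := B) s' x (.var x + 1) (by simp [e1]; omega)
      have hc : (Expr.var x + 1 : Expr).cost = 3 := rfl
      simpa [e1, hc] using this
    have he : (Expr.less (.var x) (.var y)).Fits B s := by
      simp only [Expr.fits_less, Expr.fits_var, true_and]; exact ite_le h1
    refine ⟨_, s'', .loop_step he hl (.seq hx' ha) hx'', ?_, hq'⟩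
    have : (Expr.less (.var x) (.var y)).cost = 3 := rfl
    rw [this, Nat.succ_mul]; omega

/-- An iteration costs 7 besides the body: 3 for the test and 4 for the increment. The 5 extra steps
are the initialization (2) and the failing test (3). The body has to establish the invariant for the
state in which the counter is already increased. -/
theorem Runs.for {B : ℕ} {x y : ℕ} {p : Prog} {s : State} {N Tb T : ℕ} (Inv : ℕ → State → Prop)
    (hN : s.reg y = N) (hB : N ≤ B) (h1 : 1 ≤ B)
    (h0 : Inv 0 (s.setReg x 0))
    (hs : ∀ i < N, ∀ s1, s1.reg x = i → Agree (forLoop x y p) s s1 → Inv i s1 →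
      Runs B p s1 Tb (fun s2 => Inv (i + 1) (s2.setReg x (i + 1))))
    (hT : N * (Tb + 7) + 5 ≤ T)
    (hxp : p.writesR x = false := by rfl) (hy : p.writesR y = false := by rfl)
    (hxy : x ≠ y := by decide) :
    Runs B (forLoop x y p) s T (Inv N) := by
  have hx0 : Runs B (.assign x 0) s 2 (fun s' => s' = s.setReg x 0) :=
    ⟨2, _, .assign s x 0 (by simp), le_rfl, rfl⟩
  refine hx0.seq (fun s' _ hs' => ?_) (T₂ := N * (Tb + 7) + 3) (by omega)
  subst hs'
  have key := Runs.loop_iter (B := B) (x := x) (y := y) (p := p) (N := N) (Tb := Tb)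
    (fun i s1 => Agree (forLoop x y p) s s1 ∧ Inv i s1) hxp hy hxy hB h1 (by
      rintro i hi s1 hx1 hN1 ⟨ha, hi1⟩
      refine (hs i hi s1 hx1 ha hi1).mono le_rfl (fun s2 ha2 h2 => ⟨?_, h2⟩)
      exact (ha.trans ha2.of_forLoop).trans (Agree.setReg_forLoop _)) 0 N (by omega) (s.setReg x 0)
      (by simp) (by simp [hxy.symm, hN]) ⟨Agree.setReg_forLoop _, h0⟩
  exact key.mono le_rfl (fun _ _ h => h.2)

open CoDom.Expr CoDom.Prog

/-! ### Registers and arrays -/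

notation "rN" => (0 : ℕ)
notation "rRes" => (1 : ℕ)
notation "rSt" => (2 : ℕ)
notation "rCn" => (3 : ℕ)
notation "rF" => (4 : ℕ)
notation "rFi" => (5 : ℕ)
notation "rFu" => (6 : ℕ)
notation "rFe" => (7 : ℕ)
notation "rVp" => (8 : ℕ)
notation "rGv" => (9 : ℕ)
notation "rGc" => (10 : ℕ)
notation "rGi" => (11 : ℕ)
notation "rGu" => (12 : ℕ)
notation "rSa" => (13 : ℕ)
notation "rCa" => (14 : ℕ)
notation "rSb" => (15 : ℕ)
notation "rCb" => (16 : ℕ)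
notation "rPi" => (17 : ℕ)
notation "rPj" => (18 : ℕ)
notation "rPu" => (19 : ℕ)

notation "aAdj" => (0 : ℕ)
notation "aCode" => (1 : ℕ)
notation "aOut" => (2 : ℕ)
notation "aIns" => (3 : ℕ)
notation "aSize" => (4 : ℕ)
notation "aVec" => (5 : ℕ)
notation "aW" => (6 : ℕ)
notation "aMsk" => (7 : ℕ)

theorem idx_lt {i m u n : ℕ} (hi : i < m) (hu : u < n) : i * n + u < m * n := by
  calc i * n + u < i * n + n := by omega
    _ = (i + 1) * n := by ring
    _ ≤ m * n := Nat.mul_le_mul_right _ hi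

theorem idx_inj {i j u v n : ℕ} (hu : u < n) (hv : v < n) :
    i * n + u = j * n + v ↔ i = j ∧ u = v := by
  constructor
  · intro h
    have hn : 0 < n := by omega
    have h1 : (i * n + u) / n = i := by
      rw [Nat.add_comm, Nat.add_mul_div_right _ _ hn, Nat.div_eq_of_lt hu]; simp
    have h2 : (j * n + v) / n = j := by
      rw [Nat.add_comm, Nat.add_mul_div_right _ _ hn, Nat.div_eq_of_lt hv]; simp
    have : i = j := by rw [← h1, ← h2, h]
    subst this
    exact ⟨rfl, by omega⟩
  · rintro ⟨rfl, rfl⟩; rfl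

/-! ### Enumerating neighbor equivalence classes as truncated degree vectors. -/

/-! ### Searching a list of vectors -/

/-- Search the vector in `aW` among the `rCn` vectors from number `rSt` on. -/
def find : Prog := block [
  assign rF (var rCn),
  forLoop rFi rCn (block [
    assign rFe 1,
    forLoop rFu rN (assign rFe (var rFe *
      equ (get aVec ((var rSt + var rFi) * var rN + var rFu)) (get aW (var rFu)))),
    Prog.ite (var rFe) (assign rF (var rFi)) skip])]

/-- The result `cn`, one more than the last valid number, signals that the vector is absent. The
search never stops early, and O(cn · n) is affordable everywhere. -/
theorem find_spec {n B st cn : ℕ} {f : Fin n → ℕ} {s : State} (hn : s.reg rN = n)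
    (hst : s.reg rSt = st) (hcn : s.reg rCn = cn) (hW : ∀ u : Fin n, s.mem aW u = f u)
    (hB : (st + cn) * n ≤ B) (hB' : st + cn ≤ B) (h1 : 1 ≤ B) (hnB : n ≤ B) :
    Runs B find s (60 * ((cn + 1) * (n + 1))) fun s' => s'.reg rF ≤ cn ∧
      (s'.reg rF < cn → ∀ u : Fin n, s.mem aVec ((st + s'.reg rF) * n + u) = f u) ∧
      (s'.reg rF = cn → ∀ i < cn, ∃ u : Fin n, s.mem aVec ((st + i) * n + u) ≠ f u) := by
  refine Runs.seq (T₁ := 2) (R := fun s' => s' = s.setReg rF cn)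
    (Runs.straight (by simp [safe]) (by simp [run, hcn]) (by decide))
    (T₂ := cn * ((n * 22 + 12) + 7) + 5) ?_ (by nlinarith)
  rintro s0 - rfl
  have key := Runs.for (B := B) (x := rFi) (y := rCn) (s := s.setReg rF cn) (N := cn)
    (Tb := n * 22 + 12) (T := cn * ((n * 22 + 12) + 7) + 5)
    (fun m s' => s'.reg rF ≤ cn ∧
      (s'.reg rF < cn → ∀ u : Fin n, s.mem aVec ((st + s'.reg rF) * n + u) = f u) ∧
      (s'.reg rF = cn → ∀ i < m, ∃ u : Fin n, s.mem aVec ((st + i) * n + u) ≠ f u))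
    (p := block [
    assign rFe 1,
    forLoop rFu rN (assign rFe (var rFe *
      equ (get aVec ((var rSt + var rFi) * var rN + var rFu)) (get aW (var rFu)))),
    Prog.ite (var rFe) (assign rF (var rFi)) skip])
    (by simp [hcn]) (by omega) h1 (by simp) ?_ le_rfl
  · exact key
  · intro i hi s1 hx ha hinv
    have e0 := ha.reg rN rfl
    have e2 := ha.reg rSt rfl
    have em := ha.mem aVec rfl
    have ew := ha.mem aW rfl
    simp only [setReg_reg, setReg_mem] at e0 e2 em ew
    simp [hn, hst] at e0 e2
    refine Runs.seq (T₁ := 2) (R := fun s' => s' = s1.setReg rFe 1)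
      (Runs.straight (by simp [safe, h1]) (by simp [run]) (by decide)) (T₂ := n * 22 + 10) ?_
      (by omega)
    rintro s2 - rfl
    refine Runs.seq (T₁ := n * (15 + 7) + 5) (R := fun s' => s'.reg rFe =
        if ∀ u : Fin n, s.mem aVec ((st + i) * n + u) = f u then 1 else 0) ?_ (T₂ := 4) ?_ (by omega)
    · refine (Runs.for (N := n) (Tb := 15) (fun m s' => s'.reg rFe =
        if ∀ u : Fin n, (u : ℕ) < m → s.mem aVec ((st + i) * n + u) = f u then 1 else 0)
        (by simp [e0]) hnB h1 (by simp) ?_ le_rfl).mono le_rfl (by simp)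
      intro u hu s3 hx3 ha3 hinv3
      have e0' := ha3.reg rN rfl
      have e2' := ha3.reg rSt rfl
      have e5' := ha3.reg rFi rfl
      have em' := ha3.mem aVec rfl
      have ew' := ha3.mem aW rfl
      simp [e0, e2, hx, em, ew] at e0' e2' e5' em' ew'
      have hidx := idx_lt (show st + i < st + cn by omega) hu
      have hfu := hW ⟨u, hu⟩
      simp only at hfu
      have hle : s3.reg rFe ≤ 1 := by rw [hinv3]; exact ite_le le_rfl
      refine Runs.straight ?_ ?_ (by decide)
      · simp [safe, e0', e2', e5', hx3, ite_le h1, em', ew']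
        constructorm* _ ∧ _ <;> (try split_ifs) <;> omega
      · simp [run, e0', e2', e5', hx3, hinv3, em', ew', hfu]
        rw [← ite_and]
        congr 1
        rw [eq_iff_iff]
        constructor
        · rintro ⟨h1, h2⟩ v hv
          rcases Nat.lt_or_eq_of_le hv with h | h
          · exact h2 v h
          · have : v = ⟨u, hu⟩ := Fin.ext h
            subst this; rw [h1]
        · intro h
          exact ⟨hfu ▸ h ⟨u, hu⟩ le_rfl, fun v hv => h v (by omega)⟩
    · intro s3 ha3 h3
      have e5 := ha3.reg rFi rfl
      have e4 := ha3.reg rF rfl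
      simp [hx] at e4 e5
      refine Runs.straight ?_ ?_ (by decide)
      · simp [safe]
      · obtain ⟨i1, i2, i3⟩ := hinv
        by_cases hall : ∀ u : Fin n, s.mem aVec ((st + i) * n + u) = f u
        · rw [if_pos hall] at h3
          simp [run, h3, e5]
          refine ⟨hi.le, fun _ => hall, by omega⟩
        · rw [if_neg hall] at h3
          simp [run, h3, e4]
          refine ⟨i1, i2, fun h j hj => ?_⟩
          rcases Nat.lt_or_eq_of_le hj with h' | h'
          · exact i3 h j h'
          · subst h'; push Not at hall; exact hall

/-! ### Classes of neighbor equivalence as vectors -/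

section Classes

variable {n : ℕ} (G : SimpleGraph (Fin n))

open Classical in
/-- The adjacency matrix. -/
noncomputable def adj (u v : Fin n) : ℕ := if G.Adj u v then 1 else 0

theorem adj_comm (u v : Fin n) : adj G u v = adj G v u := by
  unfold adj; congr 1; exact propext (G.adj_comm u v)

theorem adj_self (u : Fin n) : adj G u u = 0 := by simp [adj]

theorem adj_le_one (u v : Fin n) : adj G u v ≤ 1 := by unfold adj; split_ifs <;> simp

/-- The number of neighbors of `u` in `X`. -/
noncomputable def deg (u : Fin n) (X : Finset (Fin n)) : ℕ := ∑ v ∈ X, adj G u v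

theorem ncard_neighborSet_inter (u : Fin n) (X : Finset (Fin n)) :
    ((X : Set (Fin n)) ∩ G.neighborSet u).ncard = deg G u X := by
  classical
  have : ((X : Set (Fin n)) ∩ G.neighborSet u) = ((X.filter (G.Adj u) : Finset (Fin n)) : Set _) := by
    ext; simp
  rw [this, Set.ncard_coe_finset, Finset.card_filter]
  simp [deg, adj]

theorem deg_union {u : Fin n} {X Y : Finset (Fin n)} (h : Disjoint X Y) :
    deg G u (X ∪ Y) = deg G u X + deg G u Y := Finset.sum_union h

/-- The class of `X` for `t`-neighbor equivalence over `A`, as a vector. -/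
noncomputable def classVec (t : ℕ) (A X : Finset (Fin n)) (u : Fin n) : ℕ :=
  if u ∈ A then 0 else min t (deg G u X)

/-- The list `L` of length `c` enumerates without repetitions classes of subsets of `A`, among
them those of all subsets of `F`. -/
structure ClassList (t : ℕ) (A F : Finset (Fin n)) (L : ℕ → Fin n → ℕ) (c : ℕ) : Prop where
  mem : ∀ i < c, ∃ X ⊆ A, X ⊆ F ∧ L i = classVec G t A X
  inj : ∀ i < c, ∀ j < c, L i = L j → i = j
  surj : ∀ X ⊆ A, X ⊆ F → ∃ i < c, L i = classVec G t A X

variable {G}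

theorem ClassList.congr {t c : ℕ} {A F : Finset (Fin n)} {L L' : ℕ → Fin n → ℕ}
    (h : ClassList G t A F L c) (hL : ∀ i < c, L' i = L i) : ClassList G t A F L' c := by
  refine ⟨fun i hi => hL i hi ▸ h.mem i hi, fun i hi j hj => ?_, fun X hA hF => ?_⟩
  · rw [hL i hi, hL j hj]; exact h.inj i hi j hj
  · obtain ⟨i, hi, h⟩ := h.surj X hA hF
    exact ⟨i, hi, (hL i hi).trans h⟩

/-- Distinct vectors come from inequivalent sets, because a class vector records exactly the
truncated degrees that define the equivalence. This is where the lengths of lists get bounded by the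
width. Completeness of the list is not required, so the bound also applies while a list is under
construction. -/
theorem ClassList.card_le_of {t c : ℕ} {A : Finset (Fin n)} {L : ℕ → Fin n → ℕ}
    (hm : ∀ i < c, ∃ X ⊆ A, L i = classVec G t A X)
    (inj : ∀ i < c, ∀ j < c, L i = L j → i = j) : c ≤ nec G t (A : Set (Fin n)) := by
  choose! X hX hL using hm
  have : Function.Injective (fun i : Fin c =>
      (Quotient.mk (neighborEquiv G t (A : Set (Fin n)))
        ⟨(X i : Set (Fin n)), Finset.coe_subset.2 (hX i i.2)⟩)) := by
    intro i j hij
    have hij := Quotient.exact hij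
    apply Fin.ext
    apply inj i i.2 j j.2
    rw [hL i i.2, hL j j.2]
    funext u
    unfold classVec
    split_ifs with hu
    · rfl
    · have := hij u (by simpa using hu)
      simpa [ncard_neighborSet_inter] using this
  have h2 := Nat.card_le_card_of_injective _ this
  simpa [nec] using h2

theorem ClassList.card_le {t c : ℕ} {A F : Finset (Fin n)} {L : ℕ → Fin n → ℕ}
    (h : ClassList G t A F L c) : c ≤ nec G t (A : Set (Fin n)) :=
  card_le_of (fun i hi => (h.mem i hi).imp fun _ hX => ⟨hX.1, hX.2.2⟩) h.inj

theorem ClassList.one_le {t c : ℕ} {A F : Finset (Fin n)} {L : ℕ → Fin n → ℕ}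
    (h : ClassList G t A F L c) : 1 ≤ c := by
  obtain ⟨i, hi, -⟩ := h.surj ∅ (by simp) (by simp)
  omega

/-- Truncating summands before truncating the sum changes nothing. Hence the class of a disjoint
union depends only on the classes of its parts, which makes dynamic programming over classes
possible. -/
theorem classVec_union {t : ℕ} {A A' X Y : Finset (Fin n)} (hXY : Disjoint X Y) {u : Fin n}
    (hu : u ∉ A) (hu' : u ∉ A') :
    classVec G t (A ∪ A') (X ∪ Y) u = min t (classVec G t A X u + classVec G t A' Y u) := by
  simp only [classVec, Finset.mem_union, hu, hu', or_self, if_false, deg_union G hXY]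
  omega

/-- The class after adding a vertex is computable from the old class alone, so classes can be
enumerated without enumerating sets. -/
theorem classVec_cons {t : ℕ} {A X : Finset (Fin n)} {v : Fin n} (hv : v ∉ X) (u : Fin n) :
    classVec G t A (insert v X) u = if u ∈ A then 0 else min t (classVec G t A X u + adj G v u) := by
  unfold classVec
  split_ifs with hu
  · rfl
  · rw [deg, Finset.sum_insert hv, deg, adj_comm G v u]; omega

end Classes

/-! ### Listing the classes -/

/-- The vectors of the pool. -/
def State.vec (s : State) {n : ℕ} (i : ℕ) (u : Fin n) : ℕ := s.mem aVec (i * n + u)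

/-- A minimum expressed by truncated subtraction. -/
def minE (t : ℕ) (e : Expr) : Expr := e - (e - lit t)

@[simp] theorem eval_minE (s : State) (t : ℕ) (e : Expr) : (minE t e).eval s = min t (e.eval s) := by
  simp [minE]; omega

@[simp] theorem fits_minE (s : State) (B t : ℕ) (e : Expr) :
    (minE t e).Fits B s ↔ e.Fits B s ∧ t ≤ B ∧ e.eval s - t ≤ B ∧ min t (e.eval s) ≤ B := by
  have : e.eval s - (e.eval s - t) = min t (e.eval s) := by omega
  simp [minE, this]; tauto

/-- Append the class of the union of a member of class number `rGi` and vertex `rGv`. -/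
def genAdd (t : ℕ) : Prog := block [
  forLoop rGu rN (store aW (var rGu) (get aMsk (var rGu) * minE t
    (get aVec ((var rSt + var rGi) * var rN + var rGu) +
      get aAdj (var rGv * var rN + var rGu)))),
  find,
  Prog.ite (equ (var rF) (var rCn)) (block [
    forLoop rGu rN (store aVec ((var rSt + var rCn) * var rN + var rGu) (get aW (var rGu))),
    assign rCn (var rCn + 1)]) skip]

/-- The candidate vector is either found in the list or appended to it, so the list stays free of
repetitions, and the vectors already listed keep their places. -/
theorem genAdd_spec {n B st cn i v t : ℕ} {G : SimpleGraph (Fin n)} {A : Finset (Fin n)} {s : State}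
    (hn : s.reg rN = n) (hadj : ∀ u v : Fin n, s.mem aAdj (u * n + v) = adj G u v)
    (hmsk : ∀ u : Fin n, s.mem aMsk u = if u ∈ A then 0 else 1)
    (hst : s.reg rSt = st) (hcn : s.reg rCn = cn) (hi : s.reg rGi = i) (hv : s.reg rGv = v)
    (hicn : i < cn) (hvn : v < n) (hle : ∀ u : Fin n, s.vec (st + i) u ≤ t)
    (hB : (st + cn + 1) * n ≤ B) (hB' : st + cn + 1 ≤ B) (hnB : n * n ≤ B) (ht : t + 1 ≤ B) :
    Runs B (genAdd t) s (130 * ((cn + 1) * (n + 1))) fun s' => ∃ cn',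
      s'.reg rCn = cn' ∧ cn ≤ cn' ∧ cn' ≤ cn + 1 ∧
      (∀ j < (st + cn) * n, s'.mem aVec j = s.mem aVec j) ∧
      (∃ j < cn', s'.vec (st + j) =
        fun u => if u ∈ A then 0 else min t (s.vec (st + i) u + adj G ⟨v, hvn⟩ u)) ∧
      (cn' = cn + 1 → (∀ j < cn, s.vec (n := n) (st + j) ≠ s'.vec (st + cn)) ∧ s'.vec (st + cn) =
        fun u => if u ∈ A then 0 else min t (s.vec (st + i) u + adj G ⟨v, hvn⟩ u)) := by
  set g : Fin n → ℕ := fun u => if u ∈ A then 0 else min t (s.vec (st + i) u + adj G ⟨v, hvn⟩ u)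
    with hg
  have h1 : 1 ≤ B := by omega
  have hnB' : n ≤ B := le_trans (Nat.le_mul_self n) hnB
  have hstn : (st + cn) * n ≤ B := le_trans (Nat.mul_le_mul_right _ (by omega)) hB
  refine Runs.seq (T₁ := n * 52 + 5) (R := fun s' => ∀ u : Fin n, s'.mem aW u = g u) ?_
    (T₂ := 60 * ((cn + 1) * (n + 1)) + (n * 32 + 20)) ?_ (by nlinarith)
  · refine (Runs.for (N := n) (Tb := 45) (fun m s' => ∀ u : Fin n, (u : ℕ) < m → s'.mem aW u = g u)
        hn hnB' h1 (by simp) ?_ le_rfl).mono le_rfl (fun s' _ h u => h u u.2)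
    intro u hu s3 hx3 ha3 hinv3
    have e0 := ha3.reg rN rfl
    have e1 := ha3.reg rSt rfl
    have e2 := ha3.reg rGi rfl
    have e3 := ha3.reg rGv rfl
    have em := ha3.mem aVec rfl
    have em1 := ha3.mem aMsk rfl
    have em2 := ha3.mem aAdj rfl
    rw [hn] at e0; rw [hst] at e1; rw [hi] at e2; rw [hv] at e3
    have hidx := idx_lt (show st + i < st + cn by omega) hu
    have hidx2 := idx_lt hvn hu
    have hl := hle ⟨u, hu⟩
    have h2 := hadj ⟨v, hvn⟩ ⟨u, hu⟩
    have h3 := hmsk ⟨u, hu⟩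
    have h5 := adj_le_one G ⟨v, hvn⟩ ⟨u, hu⟩
    simp only [State.vec] at hl h2 h3
    have h4 : s.mem aMsk u ≤ 1 := by rw [h3]; split_ifs <;> simp
    have h6 : s.mem aMsk u * min t (s.mem aVec ((st + i) * n + u) + s.mem aAdj (v * n + u)) ≤ t := by
      calc _ ≤ 1 * t := Nat.mul_le_mul h4 (by omega)
        _ = t := one_mul t
    refine Runs.straight ?_ ?_ (by simp [dur, minE])
    · simp [safe, e0, e1, e2, e3, em, em1, em2, hx3]
      constructorm* _ ∧ _ <;> omega
    · simp [run, e0, e1, e2, e3, em, em1, em2, hx3]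
      intro w hw
      by_cases hwu : (w : ℕ) = u
      · have : w = ⟨u, hu⟩ := Fin.ext hwu
        subst this
        simp only [if_true, h2, h3, hg, State.vec]
        split_ifs <;> simp
      · rw [if_neg hwu]
        exact hinv3 w (by omega)
  · intro s1 ha1 hW
    have e0 := ha1.reg rN rfl
    have e1 := ha1.reg rSt rfl
    have e2 := ha1.reg rCn rfl
    have em := ha1.mem aVec rfl
    rw [hn] at e0; rw [hst] at e1; rw [hcn] at e2
    refine Runs.seq (find_spec e0 e1 e2 hW hstn (by omega) h1 hnB') (T₂ := n * 32 + 20) ?_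
      le_rfl
    rintro s2 ha2 ⟨i1, i2, i3⟩
    have e0' := ha2.reg rN rfl
    have e1' := ha2.reg rSt rfl
    have e2' := ha2.reg rCn rfl
    have em' := ha2.mem aVec rfl
    have ew' := ha2.mem aW rfl
    rw [e0] at e0'; rw [e1] at e1'; rw [e2] at e2'; rw [em] at em'
    simp only [em] at i2 i3
    refine Runs.ite (T := n * 32 + 15) ?_ ?_ ?_ (by simp [cost, equ]; omega)
    · simp [e2', ite_le h1]
    · intro hF
      have hF : s2.reg rF = cn := by
        by_contra h
        apply hF; simp [e2', h]
      refine Runs.seq (T₁ := n * 27 + 5) (R := fun s' => ∀ j, s'.mem aVec j =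
          if h : ∃ u : Fin n, j = (st + cn) * n + u then g h.choose else s.mem aVec j) ?_
        (T₂ := 4) ?_ (by omega)
      · refine (Runs.for (N := n) (Tb := 20) (fun m s' =>
          (∀ u : Fin n, (u : ℕ) < m → s'.mem aVec ((st + cn) * n + u) = g u) ∧
          ∀ j, (∀ u : Fin n, j ≠ (st + cn) * n + u) → s'.mem aVec j = s.mem aVec j)
          e0' hnB' h1 (by simp [em']) ?_ le_rfl).mono le_rfl ?_
        · rintro u hu s3 hx3 ha3 ⟨hinv3, hinv4⟩
          have f0 := ha3.reg rN rfl
          have f1 := ha3.reg rSt rfl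
          have f2 := ha3.reg rCn rfl
          have fw := ha3.mem aW rfl
          rw [e0'] at f0; rw [e1'] at f1; rw [e2'] at f2; rw [ew'] at fw
          have hidx := idx_lt (show st + cn < st + cn + 1 by omega) hu
          have hWu := hW ⟨u, hu⟩
          refine Runs.straight ?_ ?_ (by decide)
          · simp [safe, f0, f1, f2, hx3]
            constructorm* _ ∧ _ <;> omega
          · simp [run, f0, f1, f2, fw, hx3]
            refine ⟨fun w hw => ?_, fun j hj => ?_⟩
            · split_ifs with hwu
              · have : w = ⟨u, hu⟩ := Fin.ext hwu
                subst this; exact hWu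
              · exact hinv3 w (by omega)
            · rw [if_neg (hj ⟨u, hu⟩)]; exact hinv4 j hj
        · rintro s' - ⟨h, h'⟩ j
          split_ifs with hj
          · have := hj.choose_spec
            rw [← h _ hj.choose.2]; congr 1
          · push Not at hj
            exact h' j hj
      · intro s3 ha3 h3
        have f2 := ha3.reg rCn rfl
        rw [e2'] at f2
        have hnew : s3.vec (st + cn) = g := by
          funext u
          have hex : ∃ u' : Fin n, (st + cn) * n + (u : ℕ) = (st + cn) * n + u' := ⟨u, rfl⟩
          rw [State.vec, h3, dif_pos hex]
          congr 1
          have := hex.choose_spec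
          apply Fin.ext; omega
        have hold : ∀ j < (st + cn) * n, s3.mem aVec j = s.mem aVec j := by
          intro j hj
          rw [h3, dif_neg]
          rintro ⟨u, rfl⟩; omega
        have hv3 : ∀ v : ℕ, (s3.setReg rCn v).vec (n := n) = s3.vec := fun v => rfl
        refine Runs.straight (by simp [safe, f2]; omega) ?_ (by decide)
        simp only [block, run]
        refine ⟨cn + 1, by simp [f2], by omega, le_rfl, hold, ⟨cn, by omega, hnew⟩, fun _ => ⟨?_, hnew⟩⟩
        intro j hj heq
        obtain ⟨u, hu⟩ := i3 hF j hj
        rw [hv3, hnew] at heq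
        exact hu (congrFun heq u)
    · intro hF
      have hF : s2.reg rF < cn := by
        by_contra h
        have : s2.reg rF = cn := by omega
        simp [e2', this] at hF
      refine Runs.straight (by simp [safe]) ?_ (by simp [dur])
      refine ⟨cn, e2', le_rfl, by omega, fun j _ => by simp [run, em'], ⟨s2.reg rF, hF, ?_⟩,
        by omega⟩
      funext u
      simp only [run, State.vec, em']
      exact i2 hF u

/-- List the classes of `t`-neighbor equivalence over the set of all `u` with `aMsk[u] = 0`. -/
def gen (t : ℕ) : Prog := block [
  assign rSt (var rVp),
  forLoop rGu rN (store aVec (var rSt * var rN + var rGu) 0),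
  assign rCn 1,
  forLoop rGv rN (Prog.ite (get aMsk (var rGv)) skip (block [
    assign rGc (var rCn),
    forLoop rGi rGc (genAdd t)])),
  assign rVp (var rSt + var rCn)]

theorem classVec_le {n t : ℕ} {G : SimpleGraph (Fin n)} {A X : Finset (Fin n)} (u : Fin n) :
    classVec G t A X u ≤ t := by
  unfold classVec; split_ifs
  · simp
  · exact min_le_left _ _

/-- A subset of the first `v + 1` vertices of the ground set either avoids `v` or arises from a
subset of the earlier ones by adding `v`. So it suffices to extend every known class by `v`, and the
number of known classes never exceeds the number of equivalence classes over `A`. Only `n * S`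
extensions are made, instead of one for each subset. -/
theorem gen_spec {n B st S t : ℕ} {G : SimpleGraph (Fin n)} {A : Finset (Fin n)} {s : State}
    (hn : s.reg rN = n) (hadj : ∀ u v : Fin n, s.mem aAdj (u * n + v) = adj G u v)
    (hmsk : ∀ u : Fin n, s.mem aMsk u = if u ∈ A then 0 else 1)
    (hvp : s.reg rVp = st) (hS : nec G t (A : Set (Fin n)) ≤ S)
    (hB : (st + S + 1) * n ≤ B) (hB' : st + S + 1 ≤ B) (hnB : n * n ≤ B) (ht : t + 1 ≤ B) :
    Runs B (gen t) s (250 * ((n + 1) * (S + 1) * ((S + 1) * (n + 1)))) fun s' => ∃ cn,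
      s'.reg rSt = st ∧ s'.reg rCn = cn ∧ s'.reg rVp = st + cn ∧ cn ≤ S ∧
      ClassList G t A Finset.univ (fun i => s'.vec (st + i)) cn ∧
      ∀ j < st * n, s'.mem aVec j = s.mem aVec j := by
  have h1 : 1 ≤ B := by omega
  have hnB' : n ≤ B := le_trans (Nat.le_mul_self n) hnB
  have hF : ∀ v : ℕ, (Finset.univ.filter fun u : Fin n => (u : ℕ) < v) ⊆
      Finset.univ.filter fun u : Fin n => (u : ℕ) < v + 1 := fun v u hu => by
    simp at hu ⊢; omega
  have hpos : 1 ≤ (n + 1) * (S + 1) * ((S + 1) * (n + 1)) := Nat.succ_le_of_lt (by positivity)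
  have hn1 : n + 1 ≤ (n + 1) * (S + 1) * ((S + 1) * (n + 1)) := by
    calc n + 1 = (n + 1) * 1 * (1 * 1) := by ring
      _ ≤ _ := by gcongr <;> omega
  refine Runs.step (T₂ := 248 * ((n + 1) * (S + 1) * ((S + 1) * (n + 1)))) (by simp [safe]) ?_
    (by simp [dur]; omega)
  simp only [run, eval_var, hvp]
  refine Runs.seq (T₁ := n * 27 + 5) (R := fun s' => (∀ u : Fin n, s'.vec st u = 0) ∧
    ∀ j < st * n, s'.mem aVec j = s.mem aVec j) ?_
    (T₂ := 200 * ((n + 1) * (S + 1) * ((S + 1) * (n + 1)))) ?_ (by omega)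
  · refine (Runs.for (N := n) (Tb := 20) (fun m s' =>
        (∀ u : Fin n, (u : ℕ) < m → s'.vec st u = 0) ∧ ∀ j < st * n, s'.mem aVec j = s.mem aVec j)
        (by simp [hn]) hnB' h1 (by simp) ?_ le_rfl).mono le_rfl
        (fun s' _ h => ⟨fun u => h.1 u u.2, h.2⟩)
    rintro u hu s3 hx3 ha3 ⟨hinv3, hinv4⟩
    have e0 := ha3.reg rN rfl
    have e1 := ha3.reg rSt rfl
    simp [hn] at e0 e1
    have hidx := idx_lt (show st < st + S + 1 by omega) hu
    refine Runs.straight ?_ ?_ (by decide)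
    · simp [safe, e0, e1, hx3]
      constructorm* _ ∧ _ <;> omega
    · simp only [run, eval_add, eval_mul, eval_var, e0, e1, hx3, State.vec, setReg_mem, setMem_mem,
        eval_ofNat, true_and]
      refine ⟨fun w hw => ?_, fun j hj => ?_⟩
      · split_ifs with h
        · rfl
        · exact hinv3 w (by omega)
      · rw [if_neg (by omega)]; exact hinv4 j hj
  rintro s1 ha1 ⟨hz, hold⟩
  have e0 := ha1.reg rN rfl
  have e1 := ha1.reg rSt rfl
  have em0 := ha1.mem aAdj rfl
  have em1 := ha1.mem aMsk rfl
  simp [hn] at e0 e1 em0 em1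
  refine Runs.step (T₂ := 190 * ((n + 1) * (S + 1) * ((S + 1) * (n + 1)))) (by simp [safe, h1]) ?_
    (by simp [dur]; omega)
  simp only [run, eval_ofNat]
  refine Runs.seq (T₁ := n * ((S * (130 * ((S + 1) * (n + 1)) + 7) + 20) + 7) + 5)
    (R := fun s' => ∃ cn,
      s'.reg rCn = cn ∧ cn ≤ S ∧
      ClassList G t A Finset.univ (fun i => s'.vec (st + i)) cn ∧
      ∀ j < st * n, s'.mem aVec j = s.mem aVec j) ?_ (T₂ := 4) ?_ ?_
  · refine (Runs.for (N := n) (Tb := S * (130 * ((S + 1) * (n + 1)) + 7) + 20)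
      (fun m s' => ∃ cn,
      s'.reg rCn = cn ∧ cn ≤ S ∧
      ClassList G t A (Finset.univ.filter fun u : Fin n => (u : ℕ) < m) (fun i => s'.vec (st + i)) cn ∧
      ∀ j < st * n, s'.mem aVec j = s.mem aVec j)
      (by simp [e0]) hnB' h1 ?_ ?_ le_rfl).mono le_rfl ?_
    · have hcl : ClassList G t A (Finset.univ.filter fun u : Fin n => (u : ℕ) < 0)
          (fun i => s1.vec (st + i)) 1 := by
        have h0 : s1.vec st = classVec G t A ∅ := by
          funext u
          simp [classVec, deg, hz u]
        refine ⟨fun i hi => ⟨∅, by simp, by simp, ?_⟩, fun i hi j hj _ => by omega, fun X _ hX => ⟨0, by simp, ?_⟩⟩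
        · have : i = 0 := by omega
          subst this; simpa using h0
        · have : X = ∅ := by simpa using hX
          subst this; simpa using h0
      exact ⟨1, by simp, hcl.card_le.trans hS, hcl, hold⟩
    · rintro v hv s2 hx2 ha2 ⟨cn, hcn, hcnS, hcl, hold2⟩
      have f0 := ha2.reg rN rfl
      have f1 := ha2.reg rSt rfl
      have fm0 := ha2.mem aAdj rfl
      have fm1 := ha2.mem aMsk rfl
      simp [e0, e1, em0, em1] at f0 f1 fm0 fm1
      have hmv := hmsk ⟨v, hv⟩
      simp only at hmv
      refine Runs.ite (T := S * (130 * ((S + 1) * (n + 1)) + 7) + 18) ?_ ?_ ?_ (by simp; omega)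
      · simp [hx2]; omega
      · intro h
        refine Runs.straight trivial ?_ (by simp [dur])
        have hvA : ⟨v, hv⟩ ∉ A := by
          intro hA
          simp [hx2, fm1, hmv, hA] at h
        refine ⟨cn, by simp [run, hcn], hcnS, ⟨fun i hi => ?_, hcl.inj, fun X hXA hX => ?_⟩, hold2⟩
        · obtain ⟨X, h1, h2, h3⟩ := hcl.mem i hi
          exact ⟨X, h1, h2.trans (hF v), h3⟩
        refine hcl.surj X hXA (fun u hu => ?_)
        have h1 := hX hu
        simp only [Finset.mem_filter, Finset.mem_univ, true_and] at h1 ⊢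
        have : u ≠ ⟨v, hv⟩ := fun h => hvA (h ▸ hXA hu)
        have : (u : ℕ) ≠ v := fun h => this (Fin.ext h)
        omega
      · intro h
        have hvA : ⟨v, hv⟩ ∈ A := by
          by_contra hA
          simp [hx2, fm1, hmv, hA] at h
        refine Runs.step (T₂ := S * (130 * ((S + 1) * (n + 1)) + 7) + 5) (by simp [safe]) ?_
          (by simp [dur]; omega)
        simp only [run, eval_var, hcn]
        have hcn0 := hcl.one_le
        have hB2 : (st + cn) * n ≤ B := le_trans (Nat.mul_le_mul_right _ (by omega)) hB
        -- The loop bound is the length `cn` that was saved before the loop. Vectors appended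
        -- meanwhile contain `v` already and are not extended again, while the first `cn` vectors
        -- remain those of the state `s2`.
        refine (Runs.for (N := cn) (Tb := 130 * ((S + 1) * (n + 1)))
          (fun m s' => ∃ cn', s'.reg rCn = cn' ∧ cn ≤ cn' ∧
            (∀ j < (st + cn) * n, s'.mem aVec j = s2.mem aVec j) ∧
            (∀ i < cn', ∃ X ⊆ A, X ⊆ (Finset.univ.filter fun u : Fin n => (u : ℕ) < v + 1) ∧
              s'.vec (st + i) = classVec G t A X) ∧
            (∀ i < cn', ∀ j < cn', s'.vec (n := n) (st + i) = s'.vec (st + j) → i = j) ∧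
            (∀ i < m, ∃ j < cn', s'.vec (st + j) = fun u => if u ∈ A then 0 else
              min t (s2.vec (st + i) u + adj G ⟨v, hv⟩ u)))
          (by simp) (by omega) h1 ?_ ?_ le_rfl).mono ?_ ?_
        · exact ⟨cn, by simp [hcn], le_rfl, by simp, fun i hi => by
            obtain ⟨X, h1, h2, h3⟩ := hcl.mem i hi
            exact ⟨X, h1, h2.trans (hF v), h3⟩, hcl.inj, by simp⟩
        · rintro i hi s3 hx3 ha3 ⟨cn3, hcn3, hle3, hold3, hmem3, hinj3, hnew3⟩
          have hcn3S := (ClassList.card_le_of (fun k hk => (hmem3 k hk).imp fun X h => ⟨h.1, h.2.2⟩)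
            hinj3).trans hS
          have g0 := ha3.reg rN rfl
          have g1 := ha3.reg rSt rfl
          have g2 := ha3.reg rGv rfl
          have gm0 := ha3.mem aAdj rfl
          have gm1 := ha3.mem aMsk rfl
          simp [f0, f1, fm0, fm1, hx2] at g0 g1 g2 gm0 gm1
          have hB3 : (st + cn3 + 1) * n ≤ B := le_trans (Nat.mul_le_mul_right _ (by omega)) hB
          have hbody := genAdd_spec (B := B) (i := i) (t := t) (G := G) (A := A) (v := v) g0 (by simpa [gm0] using hadj)
            (by simpa [gm1] using hmsk) g1 hcn3 hx3 g2 (by omega) hv (by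
              intro u
              obtain ⟨X, -, -, hX⟩ := hmem3 i (by omega)
              rw [hX]; exact classVec_le u) hB3 (by omega) hnB ht
          have hsame : s3.vec (n := n) (st + i) = s2.vec (st + i) := by
            funext u
            exact hold3 _ (idx_lt (by omega) u.2)
          have hB4 : (st + cn) * n ≤ (st + cn3) * n := Nat.mul_le_mul_right _ (by omega)
          refine hbody.mono ?_ ?_
          · gcongr
          · rintro s4 ha4 ⟨cn4, k1, k2, k3, k4, k5, k6⟩
            rw [hsame] at k5 k6
            have hkeep : ∀ j < cn3, s4.vec (n := n) (st + j) = s3.vec (st + j) := by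
              intro j hj; funext u
              exact k4 _ (idx_lt (by omega) u.2)
            refine ⟨cn4, by simp [k1], by omega, fun j hj => ?_, fun j hj => ?_, ?_, fun j hj => ?_⟩
            · exact (k4 j (by omega)).trans (hold3 j hj)
            · show ∃ X ⊆ A, X ⊆ _ ∧ s4.vec (st + j) = _
              rcases Nat.lt_or_ge j cn3 with h | h
              · rw [hkeep j h]; exact hmem3 j h
              · have hj3 : j = cn3 := by omega
                subst hj3
                rw [(k6 (by omega)).2]
                obtain ⟨X, hXA, hXv, hX⟩ := hcl.mem i hi
                have hvX : ⟨v, hv⟩ ∉ X := fun h => by simpa using hXv h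
                refine ⟨insert ⟨v, hv⟩ X, Finset.insert_subset hvA hXA, ?_, ?_⟩
                · exact Finset.insert_subset (by simp) (hXv.trans (hF v))
                · funext u
                  rw [classVec_cons hvX, hX]
            · show ∀ i < cn4, ∀ j < cn4, s4.vec (n := n) (st + i) = s4.vec (st + j) → i = j
              intro a ha b hb hab
              rcases Nat.lt_or_ge a cn3 with h | h <;> rcases Nat.lt_or_ge b cn3 with h' | h'
              · rw [hkeep a h, hkeep b h'] at hab
                exact hinj3 a h b h' hab
              · have : b = cn3 := by omega
                subst this
                rw [hkeep a h] at hab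
                exact absurd hab ((k6 (by omega)).1 a h)
              · have : a = cn3 := by omega
                subst this
                rw [hkeep b h'] at hab
                exact absurd hab.symm ((k6 (by omega)).1 b h')
              · omega
            · show ∃ k < cn4, s4.vec (st + k) = _
              rcases Nat.lt_or_eq_of_le (Nat.lt_succ_iff.1 hj) with h | h
              · obtain ⟨k, hk, hk'⟩ := hnew3 j h
                exact ⟨k, by omega, (hkeep k hk).trans hk'⟩
              · subst h; exact k5
        · have : cn * (130 * ((S + 1) * (n + 1)) + 7) ≤ S * (130 * ((S + 1) * (n + 1)) + 7) :=
            Nat.mul_le_mul_right _ hcnS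
          omega
        · rintro s3 ha3 ⟨cn3, hcn3, hle3, hold3, hmem3, hinj3, hnew3⟩
          have hcl3 : ClassList G t A (Finset.univ.filter fun u : Fin n => (u : ℕ) < v + 1)
              (fun i => s3.vec (st + i)) cn3 := by
            refine ⟨hmem3, hinj3, fun X hXA hX => ?_⟩
            have hX' : ∀ u ∈ X, (u : ℕ) < v + 1 := by
              intro u hu; simpa using hX hu
            by_cases hvX : ⟨v, hv⟩ ∈ X
            · obtain ⟨i, hi, hL⟩ := hcl.surj (X.erase ⟨v, hv⟩)
                ((Finset.erase_subset _ _).trans hXA) (by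
                  intro u hu
                  have h1 := hX' u (Finset.mem_of_mem_erase hu)
                  have h2 : (u : ℕ) ≠ v := fun h => (Finset.ne_of_mem_erase hu) (Fin.ext h)
                  simp; omega)
              obtain ⟨j, hj, hj'⟩ := hnew3 i hi
              refine ⟨j, hj, hj'.trans ?_⟩
              funext u
              rw [← Finset.insert_erase hvX, classVec_cons (by simp)]
              rw [hL]
            · obtain ⟨i, hi, hL⟩ := hcl.surj X hXA (by
                intro u hu
                have h1 := hX' u hu
                have h2 : (u : ℕ) ≠ v := fun h => hvX (by
                  have : u = ⟨v, hv⟩ := Fin.ext h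
                  rwa [← this])
                simp; omega)
              refine ⟨i, by omega, ?_⟩
              rw [← hL]
              funext u
              exact hold3 _ (idx_lt (by omega) u.2)
          refine ⟨cn3, by simp [hcn3], hcl3.card_le.trans hS, hcl3, fun j hj => ?_⟩
          have : st * n ≤ (st + cn) * n := Nat.mul_le_mul_right _ (by omega)
          exact (hold3 j (by omega)).trans (hold2 j hj)
    · rintro s' - ⟨cn, h1, h2, h3, h4⟩
      refine ⟨cn, h1, h2, ⟨fun i hi => ?_, h3.inj, fun X hX _ => h3.surj X hX ?_⟩, h4⟩
      · obtain ⟨X, k1, -, k3⟩ := h3.mem i hi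
        exact ⟨X, k1, Finset.subset_univ X, k3⟩
      · intro u _; simp
  · rintro s2 ha2 ⟨cn, hcn, hcnS, hcl, hold2⟩
    have f1 := ha2.reg rSt rfl
    simp [e1] at f1
    refine Runs.straight (by simp [safe, f1, hcn]; omega) ?_ (by decide)
    exact ⟨cn, by simp [run, block, f1], by simp [run, block, hcn], by simp [run, block, f1, hcn], hcnS, hcl, hold2⟩
  · nlinarith [Nat.zero_le (n * S), Nat.zero_le (n * S * S), Nat.zero_le (n * n * S), Nat.zero_le (n * n * S * S), Nat.zero_le n, Nat.zero_le S]

/-- For all pairs of vectors of the lists `rSa, rCa` and `rSb, rCb`, find the number of their sum,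
cut off at `d` and restricted to `aMsk`, in the list `rSt, rCn`, and store it in array `o`. -/
def pair (d o : ℕ) : Prog :=
  forLoop rPi rCa (forLoop rPj rCb (block [
    forLoop rPu rN (store aW (var rPu) (get aMsk (var rPu) * minE d
      (get aVec ((var rSa + var rPi) * var rN + var rPu) +
        get aVec ((var rSb + var rPj) * var rN + var rPu)))),
    find,
    store o (var rPi * var rCb + var rPj) (var rF)]))

/-- The mask `m` cancels the coordinates inside the ground set of the target list, where class
vectors are 0 by convention. By `hex` every search succeeds. -/
theorem pair_spec {n B d o sa ca sb cb st cn : ℕ} {m : Fin n → ℕ} {s : State}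
    (ho : o ≠ aVec) (ho' : o ≠ aMsk) (ho'' : o ≠ aW) (hn : s.reg rN = n)
    (hmsk : ∀ u : Fin n, s.mem aMsk u = m u) (hm : ∀ u, m u ≤ 1)
    (hsa : s.reg rSa = sa) (hca : s.reg rCa = ca) (hsb : s.reg rSb = sb) (hcb : s.reg rCb = cb)
    (hst : s.reg rSt = st) (hcn : s.reg rCn = cn)
    (hla : ∀ i < ca, ∀ u : Fin n, s.vec (sa + i) u ≤ d)
    (hlb : ∀ i < cb, ∀ u : Fin n, s.vec (sb + i) u ≤ d)
    (hex : ∀ i < ca, ∀ j < cb, ∃ k < cn, ∀ u : Fin n,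
      s.vec (st + k) u = m u * min d (s.vec (sa + i) u + s.vec (sb + j) u))
    (hBa : (sa + ca) * n ≤ B) (hBa' : sa + ca ≤ B) (hBb : (sb + cb) * n ≤ B) (hBb' : sb + cb ≤ B)
    (hB : (st + cn) * n ≤ B) (hB' : st + cn ≤ B) (hcc : ca * cb ≤ B)
    (hnB : n ≤ B) (hd : 2 * d + 1 ≤ B) :
    Runs B (pair d o) s (250 * ((ca + 1) * (cb + 1) * ((cn + 1) * (n + 1)))) fun s' =>
      ∀ i < ca, ∀ j < cb, s'.mem o (i * cb + j) < cn ∧ ∀ u : Fin n,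
        s.vec (st + s'.mem o (i * cb + j)) u = m u * min d (s.vec (sa + i) u + s.vec (sb + j) u) := by
  have h1 : 1 ≤ B := by omega
  have hpos : 1 ≤ (cn + 1) * (n + 1) := Nat.succ_le_of_lt (by positivity)
  have hn1 : n + 1 ≤ (cn + 1) * (n + 1) := Nat.le_mul_of_pos_left _ (by omega)
  refine (Runs.for (N := ca) (Tb := cb * (150 * ((cn + 1) * (n + 1)) + 7) + 5) (fun m' s' =>
    ∀ i < m', ∀ j < cb, s'.mem o (i * cb + j) < cn ∧ ∀ u : Fin n,
      s.vec (st + s'.mem o (i * cb + j)) u = m u * min d (s.vec (sa + i) u + s.vec (sb + j) u))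
    hca (by omega) h1 (by simp) ?_ ?_).mono le_rfl (fun _ _ h => h)
  swap
  · generalize (cn + 1) * (n + 1) = q at *
    nlinarith [Nat.zero_le (ca * cb), Nat.zero_le (ca * cb * q), Nat.zero_le (ca * q), Nat.zero_le (cb * q),
      Nat.mul_le_mul_left (ca * cb) hpos, Nat.mul_le_mul_left ca hpos, Nat.mul_le_mul_left cb hpos]
  intro i hi s1 hx1 ha1 hinv1
  have wf5 : ∀ p : Prog, p = forLoop rPi rCa (forLoop rPj rCb (block [
    forLoop rPu rN (store aW (var rPu) (get aMsk (var rPu) * minE d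
      (get aVec ((var rSa + var rPi) * var rN + var rPu) +
        get aVec ((var rSb + var rPj) * var rN + var rPu)))),
    find,
    store o (var rPi * var rCb + var rPj) (var rF)])) →
      p.writesM aVec = false ∧ p.writesM aMsk = false := by
    rintro p rfl
    simp [forLoop, block, writesM, find, ho, ho']
  have e0 := ha1.reg rN rfl
  have e1 := ha1.reg rSa rfl
  have e2 := ha1.reg rCb rfl
  have e3 := ha1.reg rSb rfl
  have e4 := ha1.reg rSt rfl
  have e5 := ha1.reg rCn rfl
  have em := ha1.mem aVec (wf5 _ rfl).1
  have em1 := ha1.mem aMsk (wf5 _ rfl).2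
  rw [hn] at e0; rw [hsa] at e1; rw [hcb] at e2; rw [hsb] at e3; rw [hst] at e4; rw [hcn] at e5
  refine (Runs.for (N := cb) (Tb := 150 * ((cn + 1) * (n + 1))) (fun m' s' =>
    (∀ k < i, ∀ j < cb, s'.mem o (k * cb + j) < cn ∧ ∀ u : Fin n,
      s.vec (st + s'.mem o (k * cb + j)) u = m u * min d (s.vec (sa + k) u + s.vec (sb + j) u)) ∧
    (∀ j < m', s'.mem o (i * cb + j) < cn ∧ ∀ u : Fin n,
      s.vec (st + s'.mem o (i * cb + j)) u = m u * min d (s.vec (sa + i) u + s.vec (sb + j) u)))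
    e2 (by omega) h1 ?_ ?_ le_rfl).mono le_rfl ?_
  · simp; exact hinv1
  swap
  · rintro s' - ⟨h, h'⟩ i' hi'
    simp only [setReg_mem]
    rcases Nat.lt_or_eq_of_le (Nat.lt_succ_iff.1 hi') with h2 | h2
    · exact h i' h2
    · subst h2; exact h'
  rintro j hj s2 hx2 ha2 ⟨hinv2, hinv2'⟩
  have wf5' : ∀ p : Prog, p = forLoop rPj rCb (block [
    forLoop rPu rN (store aW (var rPu) (get aMsk (var rPu) * minE d
      (get aVec ((var rSa + var rPi) * var rN + var rPu) +
        get aVec ((var rSb + var rPj) * var rN + var rPu)))),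
    find,
    store o (var rPi * var rCb + var rPj) (var rF)]) →
      p.writesM aVec = false ∧ p.writesM aMsk = false := by
    rintro p rfl
    simp [forLoop, block, writesM, find, ho, ho']
  have f0 := ha2.reg rN rfl
  have f1 := ha2.reg rSa rfl
  have f2 := ha2.reg rCb rfl
  have f3 := ha2.reg rSb rfl
  have f4 := ha2.reg rSt rfl
  have f5 := ha2.reg rCn rfl
  have f6 := ha2.reg rPi rfl
  have fm := ha2.mem aVec (wf5' _ rfl).1
  have fm1 := ha2.mem aMsk (wf5' _ rfl).2
  rw [e0] at f0; rw [e1] at f1; rw [e2] at f2; rw [e3] at f3; rw [e4] at f4; rw [e5] at f5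
  rw [hx1] at f6; rw [em] at fm; rw [em1] at fm1
  have hij := idx_lt hi hj
  refine Runs.seq (T₁ := n * 57 + 5) (R := fun s' => ∀ u : Fin n, s'.mem aW u =
    m u * min d (s.vec (sa + i) u + s.vec (sb + j) u)) ?_
    (T₂ := 60 * ((cn + 1) * (n + 1)) + 10) ?_ (by omega)
  · refine (Runs.for (N := n) (Tb := 50) (fun m' s' => ∀ u : Fin n, (u : ℕ) < m' → s'.mem aW u =
        m u * min d (s.vec (sa + i) u + s.vec (sb + j) u))
        f0 hnB h1 (by simp) ?_ le_rfl).mono le_rfl (fun s' _ h u => h u u.2)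
    intro u hu s3 hx3 ha3 hinv3
    have g0 := ha3.reg rN rfl
    have g1 := ha3.reg rSa rfl
    have g2 := ha3.reg rSb rfl
    have g3 := ha3.reg rPi rfl
    have g4 := ha3.reg rPj rfl
    have gm := ha3.mem aVec rfl
    have gm1 := ha3.mem aMsk rfl
    rw [f0] at g0; rw [f1] at g1; rw [f3] at g2; rw [f6] at g3; rw [hx2] at g4; rw [fm] at gm
    rw [fm1] at gm1
    have hidx := idx_lt (show sa + i < sa + ca by omega) hu
    have hidx2 := idx_lt (show sb + j < sb + cb by omega) hu
    have k1 := hla i hi ⟨u, hu⟩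
    have k2 := hlb j hj ⟨u, hu⟩
    have k3 := hmsk ⟨u, hu⟩
    have k4 := hm ⟨u, hu⟩
    simp only [State.vec] at k1 k2 k3
    have k6 : m ⟨u, hu⟩ * min d (s.mem aVec ((sa + i) * n + u) + s.mem aVec ((sb + j) * n + u)) ≤ d := by
      calc _ ≤ 1 * d := Nat.mul_le_mul k4 (by omega)
        _ = d := one_mul d
    refine Runs.straight ?_ ?_ (by simp [dur, minE])
    · simp [safe, g0, g1, g2, g3, g4, gm, gm1, hx3, k3]
      constructorm* _ ∧ _ <;> omega
    · simp [run, g0, g1, g2, g3, g4, gm, gm1, hx3]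
      intro w hw
      split_ifs with hwu
      · have : w = ⟨u, hu⟩ := Fin.ext hwu
        subst this
        simp only [k3, State.vec]
      · exact hinv3 w (by omega)
  · intro s3 ha3 hW
    have g0 := ha3.reg rN rfl
    have g1 := ha3.reg rSt rfl
    have g2 := ha3.reg rCn rfl
    have g3 := ha3.reg rPi rfl
    have g4 := ha3.reg rPj rfl
    have g5 := ha3.reg rCb rfl
    have gm := ha3.mem aVec rfl
    have gmo := ha3.mem o (by simp [forLoop, writesM, ho''.symm])
    rw [f0] at g0; rw [f4] at g1; rw [f5] at g2; rw [f6] at g3; rw [hx2] at g4; rw [f2] at g5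
    rw [fm] at gm
    refine Runs.seq (find_spec g0 g1 g2 hW hB hB' h1 hnB) (T₂ := 8) ?_
      (by omega)
    rintro s4 ha4 ⟨i1, i2, i3⟩
    have kmo := ha4.mem o (by simp [find, forLoop, block, writesM])
    rw [gmo] at kmo
    have k3 := ha4.reg rPi rfl
    have k4 := ha4.reg rPj rfl
    have k5 := ha4.reg rCb rfl
    rw [g3] at k3; rw [g4] at k4; rw [g5] at k5
    simp only [gm] at i2 i3
    have hF : s4.reg rF < cn := by
      by_contra h
      obtain ⟨k, hk, hk'⟩ := hex i hi j hj
      obtain ⟨u, hu⟩ := i3 (by omega) k hk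
      exact hu (hk' u)
    have hold : ∀ i' j', j' < cb → i' * cb + j' ≠ i * cb + j →
        (if i' * cb + j' = i * cb + j then s4.reg rF else s2.mem o (i' * cb + j')) =
          s2.mem o (i' * cb + j') := fun i' j' _ h => if_neg h
    refine Runs.straight ?_ ?_ (by simp [dur])
    · simp [block, safe, k3, k4, k5]
      constructorm* _ ∧ _ <;> omega
    · simp only [block, run, eval_add, eval_mul, eval_var, k3, k4, k5, setReg_mem, setMem_mem, true_and, kmo]
      refine ⟨fun i' hi' j' hj' => ?_, fun j' hj' => ?_⟩
      · rw [hold i' j' hj' (by rw [Ne, idx_inj hj' hj]; omega)]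
        exact hinv2 i' hi' j' hj'
      · by_cases hjj : j' = j
        · subst hjj
          rw [if_pos rfl]
          refine ⟨hF, fun u => ?_⟩
          exact i2 hF u
        · rw [hold i j' (by omega) (by omega)]
          exact hinv2' j' (by omega)

/-! ### Connectedness as a linear functional over GF(2). -/

/-! ### Counting cuts modulo two -/

section Cuts

variable {n : ℕ} (G : SimpleGraph (Fin n))

/-- `W` is a union of connected components of `G[X]`, provided that it is a subset of `X`. -/
def CutIn (X W : Finset (Fin n)) : Prop := ∀ u ∈ W, ∀ v ∈ X, G.Adj u v → v ∈ W

open Classical in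
/-- The weighted number of cuts of `G[X]`. -/
noncomputable def cutSum (X : Finset (Fin n)) (α β : Fin n → ZMod 2) : ZMod 2 :=
  ∑ W ∈ X.powerset with CutIn G X W, (∏ u ∈ W, α u) * ∏ u ∈ X \ W, β u

/-- `lab` assigns to the vertices of `X` representatives of their components. -/
structure IsLabel (X : Finset (Fin n)) (lab : Fin n → Fin n) : Prop where
  adj : ∀ u ∈ X, ∀ v ∈ X, G.Adj u v → lab u = lab v
  cut : ∀ W ⊆ X, CutIn G X W → ∀ u ∈ X, ∀ v ∈ X, lab u = lab v → u ∈ W → v ∈ W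
  mem : ∀ u ∈ X, lab u ∈ X
  idem : ∀ u ∈ X, lab (lab u) = lab u

variable {G}

/-- A cut chooses a side for every component independently, so the sum over all cuts factors over
the components. This replaces an exponential sum by an evaluation in O(n) once the components are
labelled. -/
theorem cutSum_eq_prod {X : Finset (Fin n)} {lab : Fin n → Fin n} (h : IsLabel G X lab)
    (α β : Fin n → ZMod 2) :
    cutSum G X α β = ∏ c ∈ X with lab c = c,
      ((∏ u ∈ X with lab u = c, α u) + ∏ u ∈ X with lab u = c, β u) := by
  classical
  have hW : ∀ (γ : Fin n → ZMod 2) (T : Finset (Fin n)),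
      T ⊆ (X.filter fun c => lab c = c) →
      ∏ c ∈ T, ∏ u ∈ X with lab u = c, γ u = ∏ u ∈ X with lab u ∈ T, γ u := by
    intro γ T hT
    rw [← Finset.prod_fiberwise_of_maps_to (s := X.filter fun u => lab u ∈ T) (t := T) (g := lab)
      (fun u hu => (Finset.mem_filter.1 hu).2)]
    refine Finset.prod_congr rfl fun c hc => Finset.prod_congr ?_ fun _ _ => rfl
    ext u
    simp only [Finset.mem_filter]
    constructor
    · rintro ⟨h1, h2⟩; exact ⟨⟨h1, h2 ▸ hc⟩, h2⟩
    · rintro ⟨⟨h1, _⟩, h2⟩; exact ⟨h1, h2⟩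
  rw [Finset.prod_add]
  unfold cutSum
  -- A cut corresponds to the set of the representatives that lie on its first side.
  refine Finset.sum_bij' (fun W _ => (X.filter fun c => lab c = c).filter (· ∈ W))
    (fun T _ => X.filter fun u => lab u ∈ T) ?_ ?_ ?_ ?_ ?_
  · intro W _; simp
  · intro T hT
    simp only [Finset.mem_filter, Finset.mem_powerset, Finset.filter_subset, true_and]
    intro u hu v hv huv
    simp only [Finset.mem_filter] at hu ⊢
    exact ⟨hv, h.adj u hu.1 v hv huv ▸ hu.2⟩
  · intro W hW
    simp only [Finset.mem_filter, Finset.mem_powerset] at hW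
    ext u
    simp only [Finset.mem_filter]
    constructor
    · rintro ⟨hu, ⟨h1, h2⟩, h3⟩
      exact h.cut W hW.1 hW.2 _ h1 _ hu h2 h3
    · intro hu
      have huX := hW.1 hu
      exact ⟨huX, ⟨h.mem u huX, h.idem u huX⟩,
        h.cut W hW.1 hW.2 u huX _ (h.mem u huX) (h.idem u huX).symm hu⟩
  · intro T hT
    have hT := Finset.mem_powerset.1 hT
    ext u
    simp only [Finset.mem_filter]
    constructor
    · rintro ⟨⟨h1, h2⟩, h3, h4⟩; exact h2 ▸ h4
    · intro hu
      have := Finset.mem_filter.1 (hT hu)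
      exact ⟨this, this.1, this.2.symm ▸ hu⟩
  · intro W hWm
    simp only [Finset.mem_filter, Finset.mem_powerset] at hWm
    have key : ∀ u ∈ X, (lab u ∈ (X.filter fun c => lab c = c).filter (· ∈ W)) ↔ u ∈ W := by
      intro u hu
      simp only [Finset.mem_filter]
      constructor
      · rintro ⟨⟨h1, h2⟩, h3⟩
        exact h.cut W hWm.1 hWm.2 _ h1 _ hu h2 h3
      · intro huW
        exact ⟨⟨h.mem u hu, h.idem u hu⟩,
          h.cut W hWm.1 hWm.2 u hu _ (h.mem u hu) (h.idem u hu).symm huW⟩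
    rw [hW α _ (Finset.filter_subset _ _), hW β _ Finset.sdiff_subset]
    congr 1
    · refine Finset.prod_congr ?_ fun _ _ => rfl
      ext u
      simp only [Finset.mem_filter]
      constructor
      · intro hu; exact ⟨hWm.1 hu, by simpa using (key u (hWm.1 hu)).2 hu⟩
      · rintro ⟨h1, h2⟩; exact (key u h1).1 (by simpa using h2)
    · refine Finset.prod_congr ?_ fun _ _ => rfl
      ext u
      have hc : ∀ v ∈ X, lab v ∈ (X.filter fun c => lab c = c) := fun v hv => by
        simp [h.mem v hv, h.idem v hv]
      simp only [Finset.mem_filter, Finset.mem_sdiff]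
      constructor
      · rintro ⟨h1, h2⟩
        refine ⟨h1, ⟨h.mem u h1, h.idem u h1⟩, fun h3 => h2 ((key u h1).1 (by simpa using h3))⟩
      · rintro ⟨h1, -, h2⟩
        exact ⟨h1, fun h3 => h2 (by simpa using (key u h1).2 h3)⟩

open Classical in
/-- The number of cuts of `G[D]` with a given vertex on the first side is odd if and only if
`G[D]` is connected. -/
theorem sum_cuts_anchor {D : Finset (Fin n)} {a : Fin n} (ha : a ∈ D) :
    (∑ W ∈ D.powerset with (CutIn G D W ∧ a ∈ W), (1 : ZMod 2)) =
      if (G.induce (D : Set (Fin n))).Connected then 1 else 0 := by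
  split_ifs with hc
  · have : (D.powerset.filter fun W => CutIn G D W ∧ a ∈ W) = {D} := by
      ext W
      simp only [Finset.mem_filter, Finset.mem_powerset, Finset.mem_singleton]
      constructor
      · rintro ⟨hWD, hcut, haW⟩
        refine hWD.antisymm fun v hv => ?_
        obtain ⟨p⟩ := hc.preconnected ⟨a, ha⟩ ⟨v, hv⟩
        have : ∀ (x y : (D : Set (Fin n))) (p : (G.induce (D : Set (Fin n))).Walk x y),
            (x : Fin n) ∈ W → (y : Fin n) ∈ W := by
          intro x y p
          induction p with
          | nil => exact id
          | cons hadj _ ih =>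
            intro hx
            exact ih (hcut _ hx _ (Subtype.property _) (by simpa using hadj))
        exact this _ _ p haW
      · rintro rfl; exact ⟨subset_rfl, fun u _ v hv _ => hv, ha⟩
    rw [this, Finset.sum_singleton]
  -- `E` is the part of `D` that cannot be reached from `a`. As no edge joins it to the rest of `D`,
  -- exchanging the sides on `E` is an involution of the cuts that respects the anchor. It has no
  -- fixed point because `E` is nonempty, so the cuts cancel in pairs.
  · set E : Finset (Fin n) := D.filter fun v => ∃ hv : v ∈ D,
      ¬ (G.induce (D : Set (Fin n))).Reachable ⟨a, ha⟩ ⟨v, hv⟩ with hE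
    have hEne : E.Nonempty := by
      by_contra hne
      rw [Finset.not_nonempty_iff_eq_empty] at hne
      apply hc
      have hreach : ∀ v (hv : v ∈ D), (G.induce (D : Set (Fin n))).Reachable ⟨a, ha⟩ ⟨v, hv⟩ := by
        intro v hv
        by_contra hr
        have : v ∈ E := by simp [hE, hv]; exact hr
        simp [hne] at this
      have : Nonempty (D : Set (Fin n)) := ⟨⟨a, ha⟩⟩
      exact ⟨fun x y => (hreach x x.2).symm.trans (hreach y y.2)⟩
    have haE : a ∉ E := by
      simp [hE]
    have hEcut : ∀ u ∈ D, ∀ v ∈ D, G.Adj u v → (u ∈ E ↔ v ∈ E) := by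
      have : ∀ u ∈ D, ∀ v ∈ D, G.Adj u v → u ∈ E → v ∈ E := by
        intro u hu v hv huv huE
        obtain ⟨-, _, hr⟩ := Finset.mem_filter.1 huE
        refine Finset.mem_filter.2 ⟨hv, hv, fun hr' => hr (hr'.trans ?_)⟩
        exact SimpleGraph.Adj.reachable (by simpa using huv.symm)
      exact fun u hu v hv huv => ⟨this u hu v hv huv, this v hv u hu huv.symm⟩
    refine Finset.sum_involution (fun W _ => symmDiff W E) ?_ ?_ ?_ ?_
    · intro W _; exact CharTwo.add_self_eq_zero 1
    · intro W _ _ h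
      have : E = ⊥ := by
        have := congrArg (symmDiff W) h
        rw [← symmDiff_assoc] at this
        simpa using this
      exact hEne.ne_empty this
    · intro W hW
      simp only [Finset.mem_filter, Finset.mem_powerset] at hW ⊢
      obtain ⟨h1, h2, h3⟩ := hW
      refine ⟨?_, ?_, ?_⟩
      · intro v hv
        rcases Finset.mem_symmDiff.1 hv with h | h
        · exact h1 h.1
        · exact (Finset.mem_filter.1 h.1).1
      · intro u hu v hv huv
        rcases Finset.mem_symmDiff.1 hu with h | h
        · refine Finset.mem_symmDiff.2 (Or.inl ⟨h2 u h.1 v hv huv, fun hvE => h.2 ?_⟩)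
          exact (hEcut u (h1 h.1) v hv huv).2 hvE
        · have huD := (Finset.mem_filter.1 h.1).1
          refine Finset.mem_symmDiff.2 (Or.inr ⟨(hEcut u huD v hv huv).1 h.1, fun hvW => h.2 ?_⟩)
          exact h2 v hvW u huD huv.symm
      · exact Finset.mem_symmDiff.2 (Or.inl ⟨h3, haE⟩)
    · intro W _
      show symmDiff (symmDiff W E) E = W
      rw [symmDiff_assoc]; simp

variable (G)

/-- The vector of the numbers of cuts of `G[X]` with the last vertex on the first side, one for
each pair of classes of 1-neighbor equivalence. -/
noncomputable def row (S : ℕ → Fin n → ℕ) (k : ℕ) (X : Finset (Fin n)) (q : ℕ) : ZMod 2 :=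
  cutSum G X (fun u => if S (q % k) u = 0 then 1 else 0)
    (fun u => if S (q / k) u = 0 ∧ (u : ℕ) ≠ X.sup Fin.val then 1 else 0)

variable {G}

theorem exists_sup_eq {X : Finset (Fin n)} (hX : X.Nonempty) :
    ∃ a ∈ X, X.sup Fin.val = (a : ℕ) := by
  obtain ⟨a, ha, h⟩ := Finset.exists_mem_eq_sup X hX Fin.val
  exact ⟨a, ha, h⟩

theorem deg_eq_zero {u : Fin n} {X : Finset (Fin n)} : deg G u X = 0 ↔ ∀ v ∈ X, ¬ G.Adj u v := by
  simp [deg, adj]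

-- The coefficient `y q` counts the cuts of `G[Y]` whose sides have the pair `q` of classes, while
-- `row` counts the anchored cuts of `G[X]` compatible with `q`. So the sum counts the anchored cuts
-- of `G[X ∪ Y]`, which `sum_cuts_anchor` evaluates. The anchor is the last vertex of `X`: it has to
-- be visible from `X` alone, and therefore `X` must not be empty.
open Classical in
theorem exists_functional {A Y : Finset (Fin n)} (hAY : Disjoint A Y) {S : ℕ → Fin n → ℕ} {k : ℕ}
    (hS : ClassList G 1 Aᶜ Finset.univ S k) :
    ∃ y : ℕ → ZMod 2, ∀ X ⊆ A, X.Nonempty → ∑ q ∈ Finset.range (k * k), y q * row G S k X q =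
      if (G.induce ((X ∪ Y : Finset (Fin n)) : Set (Fin n))).Connected then 1 else 0 := by
  have hex : ∀ Z : Finset (Fin n), ∃ i, Z ⊆ Y → i < k ∧ S i = classVec G 1 Aᶜ Z := by
    intro Z
    by_cases hZ : Z ⊆ Y
    · obtain ⟨i, hi, h⟩ := hS.surj Z (hZ.trans (by
        intro u hu; simpa using Finset.disjoint_right.1 hAY hu)) (Finset.subset_univ _)
      exact ⟨i, fun _ => ⟨hi, h⟩⟩
    · exact ⟨0, fun h => absurd h hZ⟩
  choose idx hidx using hex
  refine ⟨fun q => ∑ Z ∈ Y.powerset with CutIn G Y Z,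
    if q = idx Z * k + idx (Y \ Z) then 1 else 0, fun X hXA hX => ?_⟩
  obtain ⟨a, haX, ha⟩ := exists_sup_eq hX
  have hXY : Disjoint X Y := hAY.mono_left hXA
  -- Truncation at 1 is enough here, as compatibility only asks whether `u` has any neighbor in `Z`.
  have hzero : ∀ Z ⊆ Y, ∀ u ∈ X, S (idx Z) u = 0 ↔ ∀ v ∈ Z, ¬ G.Adj u v := by
    intro Z hZ u hu
    rw [(hidx Z hZ).2, ← deg_eq_zero]
    have : u ∉ Aᶜ := by simpa using hXA hu
    rw [classVec, if_neg this]; omega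
  simp only [Finset.sum_mul]
  rw [Finset.sum_comm]
  -- For the pair belonging to `Z` and `Y \ Z`, the first weight forbids edges from `W` to `Y \ Z`.
  -- The second forbids edges from `X \ W` to `Z`, and it vanishes at the anchor, which forces the
  -- anchor into `W`.
  have step1 : ∀ Z ∈ Y.powerset.filter (CutIn G Y),
      ∑ q ∈ Finset.range (k * k), (if q = idx Z * k + idx (Y \ Z) then 1 else 0) * row G S k X q =
      ∑ W ∈ X.powerset, if CutIn G X W ∧ (∀ u ∈ W, ∀ v ∈ Y \ Z, ¬ G.Adj u v) ∧
        (∀ u ∈ X \ W, ∀ v ∈ Z, ¬ G.Adj u v) ∧ a ∈ W then 1 else 0 := by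
    intro Z hZ
    simp only [Finset.mem_filter, Finset.mem_powerset] at hZ
    have h1 := (hidx Z hZ.1).1
    have h2 := (hidx (Y \ Z) Finset.sdiff_subset).1
    rw [Finset.sum_eq_single (idx Z * k + idx (Y \ Z))]
    · rw [if_pos rfl, one_mul, row, cutSum, Finset.sum_filter]
      have e1 : (idx Z * k + idx (Y \ Z)) % k = idx (Y \ Z) := by
        rw [Nat.add_comm, Nat.add_mul_mod_self_right, Nat.mod_eq_of_lt h2]
      have e2 : (idx Z * k + idx (Y \ Z)) / k = idx Z := by
        rw [Nat.add_comm, Nat.add_mul_div_right _ _ (by omega), Nat.div_eq_of_lt h2, Nat.zero_add]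
      rw [e1, e2]
      refine Finset.sum_congr rfl fun W hW => ?_
      have hW := Finset.mem_powerset.1 hW
      by_cases hcut : CutIn G X W
      · simp only [hcut, if_true, true_and]
        rw [Finset.prod_ite_zero, Finset.prod_ite_zero]
        simp only [Finset.prod_const_one]
        rw [ite_zero_mul_ite_zero, one_mul]
        congr 1
        rw [eq_iff_iff]
        refine and_congr ?_ ?_
        · exact forall₂_congr fun u hu => hzero _ Finset.sdiff_subset u (hW hu)
        · rw [ha]
          constructor
          · intro h
            refine ⟨fun u hu => (hzero _ hZ.1 u (Finset.mem_sdiff.1 hu).1).1 (h u hu).1, ?_⟩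
            by_contra haW
            exact (h a (Finset.mem_sdiff.2 ⟨haX, haW⟩)).2 rfl
          · rintro ⟨h, haW⟩ u hu
            refine ⟨(hzero _ hZ.1 u (Finset.mem_sdiff.1 hu).1).2 (h u hu), fun h => ?_⟩
            exact (Finset.mem_sdiff.1 hu).2 (Fin.ext h ▸ haW)
      · simp [hcut]
    · intro q _ hq; simp [hq]
    · intro h; exact absurd (Finset.mem_range.2 (idx_lt h1 h2)) h
  rw [Finset.sum_congr rfl step1, ← sum_cuts_anchor (D := X ∪ Y) (Finset.mem_union_left _ haX)]
  -- The gluing of cuts: an edge of `G[X ∪ Y]` runs inside `X`, inside `Y` or between them, and the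
  -- four cases match the conditions on the left.
  have hP : ∀ Z ⊆ Y, ∀ W ⊆ X, (CutIn G Y Z ∧ CutIn G X W ∧ (∀ u ∈ W, ∀ v ∈ Y \ Z, ¬ G.Adj u v) ∧
      (∀ u ∈ X \ W, ∀ v ∈ Z, ¬ G.Adj u v) ∧ a ∈ W) ↔ CutIn G (X ∪ Y) (W ∪ Z) ∧ a ∈ W ∪ Z := by
    intro Z hZ W hW
    have haZ : a ∉ Z := fun h => Finset.disjoint_left.1 hXY haX (hZ h)
    constructor
    · rintro ⟨h1, h2, h3, h4, h5⟩
      refine ⟨fun u hu v hv huv => ?_, Finset.mem_union_left _ h5⟩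
      rcases Finset.mem_union.1 hu with hu | hu <;> rcases Finset.mem_union.1 hv with hv | hv
      · exact Finset.mem_union_left _ (h2 u hu v hv huv)
      · refine Finset.mem_union_right _ ?_
        by_contra hvZ
        exact h3 u hu v (Finset.mem_sdiff.2 ⟨hv, hvZ⟩) huv
      · refine Finset.mem_union_left _ ?_
        by_contra hvW
        exact h4 v (Finset.mem_sdiff.2 ⟨hv, hvW⟩) u hu huv.symm
      · exact Finset.mem_union_right _ (h1 u hu v hv huv)
    · rintro ⟨h1, h2⟩
      refine ⟨fun u hu v hv huv => ?_, fun u hu v hv huv => ?_, fun u hu v hv huv => ?_,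
        fun u hu v hv huv => ?_, (Finset.mem_union.1 h2).resolve_right haZ⟩
      · have := h1 u (Finset.mem_union_right _ hu) v (Finset.mem_union_right _ hv) huv
        exact (Finset.mem_union.1 this).resolve_left fun h =>
          Finset.disjoint_left.1 hXY (hW h) hv
      · have := h1 u (Finset.mem_union_left _ hu) v (Finset.mem_union_left _ hv) huv
        exact (Finset.mem_union.1 this).resolve_right fun h =>
          Finset.disjoint_left.1 hXY hv (hZ h)
      · obtain ⟨hvY, hvZ⟩ := Finset.mem_sdiff.1 hv
        have := h1 u (Finset.mem_union_left _ hu) v (Finset.mem_union_right _ hvY) huv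
        exact (Finset.mem_union.1 this).elim
          (fun h => Finset.disjoint_left.1 hXY (hW h) hvY) hvZ
      · obtain ⟨huX, huW⟩ := Finset.mem_sdiff.1 hu
        have := h1 v (Finset.mem_union_right _ hv) u (Finset.mem_union_left _ huX) huv.symm
        exact (Finset.mem_union.1 this).elim huW
          (fun h => Finset.disjoint_left.1 hXY huX (hZ h))
  rw [Finset.sum_filter, Finset.sum_filter]
  have step2 : ∀ Z ∈ Y.powerset, (if CutIn G Y Z then
      ∑ W ∈ X.powerset, (if CutIn G X W ∧ (∀ u ∈ W, ∀ v ∈ Y \ Z, ¬ G.Adj u v) ∧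
        (∀ u ∈ X \ W, ∀ v ∈ Z, ¬ G.Adj u v) ∧ a ∈ W then (1 : ZMod 2) else 0) else 0) =
      ∑ W ∈ X.powerset, if CutIn G (X ∪ Y) (W ∪ Z) ∧ a ∈ W ∪ Z then 1 else 0 := by
    intro Z hZ
    by_cases hcut : CutIn G Y Z
    · rw [if_pos hcut]
      refine Finset.sum_congr rfl fun W hW => ?_
      have := hP Z (Finset.mem_powerset.1 hZ) W (Finset.mem_powerset.1 hW)
      simp only [hcut, true_and] at this
      simp only [this]
    · rw [if_neg hcut]
      refine (Finset.sum_eq_zero fun W hW => if_neg fun h => hcut ?_).symm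
      exact ((hP Z (Finset.mem_powerset.1 hZ) W (Finset.mem_powerset.1 hW)).2 h).1
  rw [Finset.sum_congr rfl step2, ← Finset.sum_product']
  refine Finset.sum_bij' (fun p _ => p.2 ∪ p.1) (fun W _ => (W ∩ Y, W ∩ X)) ?_ ?_ ?_ ?_ ?_
  · rintro ⟨Z, W⟩ h
    simp only [Finset.mem_product, Finset.mem_powerset] at h ⊢
    exact Finset.union_subset_union h.2 h.1
  · intro W _; simp
  · rintro ⟨Z, W⟩ h
    simp only [Finset.mem_product, Finset.mem_powerset] at h
    ext u
    · simp
      constructor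
      · rintro ⟨h1 | h1, h2⟩
        · exact absurd h2 (Finset.disjoint_left.1 hXY (h.2 h1))
        · exact h1
      · intro h1; exact ⟨Or.inr h1, h.1 h1⟩
    · simp
      constructor
      · rintro ⟨h1 | h1, h2⟩
        · exact h1
        · exact absurd (h.1 h1) (Finset.disjoint_left.1 hXY h2)
      · intro h1; exact ⟨Or.inl h1, h.2 h1⟩
  · intro W hW
    have hW := Finset.mem_powerset.1 hW
    ext u
    simp only [Finset.mem_union, Finset.mem_inter]
    constructor
    · rintro (h | h) <;> exact h.1
    · intro h
      rcases Finset.mem_union.1 (hW h) with h' | h'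
      · exact Or.inl ⟨h, h'⟩
      · exact Or.inr ⟨h, h'⟩
  · intro p _; rfl

end Cuts

notation "rLv" => (20 : ℕ)
notation "rLu" => (21 : ℕ)
notation "rAnc" => (22 : ℕ)
notation "rQ" => (23 : ℕ)
notation "rRu" => (24 : ℕ)
notation "rProd" => (25 : ℕ)
notation "rStC" => (26 : ℕ)
notation "rKo" => (27 : ℕ)
notation "rKp" => (28 : ℕ)

notation "aX" => (8 : ℕ)
notation "aU" => (9 : ℕ)
notation "aLab" => (10 : ℕ)
notation "aMrk" => (11 : ℕ)
notation "aPa" => (12 : ℕ)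
notation "aPb" => (13 : ℕ)

/-! ### Computing the components and the cut vector of a set. -/

/-! ### Labelling the components of an induced subgraph -/

/-- Array `a` holds the characteristic vector of `X`, from index `o` on. -/
def State.HoldsSet {n : ℕ} (s : State) (a o : ℕ) (X : Finset (Fin n)) : Prop :=
  ∀ u : Fin n, s.mem a (o + u) = if u ∈ X then 1 else 0

theorem State.HoldsSet.ne_zero {n : ℕ} {s : State} {a : ℕ} {X : Finset (Fin n)}
    (h : s.HoldsSet a 0 X) (u : Fin n) : s.mem a u ≠ 0 ↔ u ∈ X := by
  have := h u
  rw [Nat.zero_add] at this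
  rw [this]; split_ifs with h' <;> simp [h']

/-- The labels after a new vertex `v` is added. -/
def addLabel {n : ℕ} (X : Finset (Fin n)) (lab : Fin n → Fin n) (G : SimpleGraph (Fin n))
    (v : Fin n) [DecidablePred fun c => ∃ w ∈ X, G.Adj v w ∧ lab w = c] (u : Fin n) : Fin n :=
  if u = v then v else if ∃ w ∈ X, G.Adj v w ∧ lab w = lab u then v else lab u

-- The components that contain a neighbor of `v` are merged, with `v` as their representative. This
-- cannot clash with an older label, since labels belong to `X` and `v` does not.
open Classical in
theorem IsLabel.insert {n : ℕ} {G : SimpleGraph (Fin n)} {X : Finset (Fin n)}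
    {lab : Fin n → Fin n} (h : IsLabel G X lab) {v : Fin n} (hv : v ∉ X) :
    IsLabel G (insert v X) (addLabel X lab G v) := by
  have hne : ∀ u ∈ X, u ≠ v := fun u hu h => hv (h ▸ hu)
  have hself : addLabel X lab G v v = v := by simp [addLabel]
  have hX : ∀ u ∈ X, addLabel X lab G v u = if ∃ w ∈ X, G.Adj v w ∧ lab w = lab u then v
    else lab u := fun u hu => by simp [addLabel, hne u hu]
  have hX1 : ∀ u ∈ X, (∃ w ∈ X, G.Adj v w ∧ lab w = lab u) → addLabel X lab G v u = v :=
    fun u hu h => by rw [hX u hu, if_pos h]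
  have hX2 : ∀ u ∈ X, (¬ ∃ w ∈ X, G.Adj v w ∧ lab w = lab u) → addLabel X lab G v u = lab u :=
    fun u hu h => by rw [hX u hu, if_neg h]
  refine ⟨?_, ?_, ?_, ?_⟩
  · intro u hu w hw huw
    rcases Finset.mem_insert.1 hu with rfl | hu' <;> rcases Finset.mem_insert.1 hw with rfl | hw'
    · rfl
    · rw [hself, hX1 w hw' ⟨w, hw', huw, rfl⟩]
    · rw [hself, hX1 u hu' ⟨u, hu', huw.symm, rfl⟩]
    · rw [hX u hu', hX w hw', h.adj u hu' w hw' huw]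
  · intro W hW hcut
    have hcut' : CutIn G X (W ∩ X) := by
      intro u hu w hw huw
      simp only [Finset.mem_inter] at hu ⊢
      exact ⟨hcut u hu.1 w (Finset.mem_insert_of_mem hw) huw, hw⟩
    have hlab : ∀ u ∈ X, ∀ w ∈ X, lab u = lab w → u ∈ W → w ∈ W := fun u hu w hw h1 h2 =>
      (Finset.mem_inter.1 (h.cut (W ∩ X) Finset.inter_subset_right hcut' u hu w hw h1
        (Finset.mem_inter.2 ⟨h2, hu⟩))).1
    -- A cut of the larger graph has `v` on the same side as every old component that touches `v`.
    have hv1 : ∀ u ∈ X, (∃ w ∈ X, G.Adj v w ∧ lab w = lab u) → (u ∈ W ↔ v ∈ W) := by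
      rintro u hu ⟨w, hw, h1, h2⟩
      constructor
      · intro huW
        exact hcut w (hlab u hu w hw h2.symm huW) v (Finset.mem_insert_self _ _) h1.symm
      · intro hvW
        exact hlab w hw u hu h2 (hcut v hvW w (Finset.mem_insert_of_mem hw) h1)
    have hnl : ∀ u ∈ X, lab u ≠ v := fun u hu h' => hv (h' ▸ h.mem u hu)
    intro u hu w hw huw huW
    rcases Finset.mem_insert.1 hu with rfl | hu' <;> rcases Finset.mem_insert.1 hw with rfl | hw'
    · exact huW
    · rw [hself, hX w hw'] at huw
      split_ifs at huw with hc
      · exact (hv1 w hw' hc).2 huW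
      · exact absurd huw.symm (hnl w hw')
    · rw [hself, hX u hu'] at huw
      split_ifs at huw with hc
      · exact (hv1 u hu' hc).1 huW
      · exact absurd huw (hnl u hu')
    · rw [hX u hu', hX w hw'] at huw
      split_ifs at huw with hc hc'
      · exact (hv1 w hw' hc').2 ((hv1 u hu' hc).1 huW)
      · exact absurd huw.symm (hnl w hw')
      · exact absurd huw (hnl u hu')
      · exact hlab u hu' w hw' huw huW
  · intro u hu
    rcases Finset.mem_insert.1 hu with rfl | hu
    · rw [hself]; exact Finset.mem_insert_self _ _
    · rw [hX u hu]; split_ifs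
      · exact Finset.mem_insert_self _ _
      · exact Finset.mem_insert_of_mem (h.mem u hu)
  · intro u hu
    rcases Finset.mem_insert.1 hu with rfl | hu
    · rw [hself, hself]
    · by_cases hc : ∃ w ∈ X, G.Adj v w ∧ lab w = lab u
      · rw [hX1 u hu hc, hself]
      · rw [hX2 u hu hc, hX2 (lab u) (h.mem u hu) (by rwa [h.idem u hu]), h.idem u hu]

/-- Label the components of the subgraph induced by the set in `aX`, and set `rAnc` to its last
vertex. -/
def label : Prog := block [
  assign rAnc (var rN),
  forLoop rLv rN (Prog.ite (get aX (var rLv)) (block [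
    forLoop rLu rN (store aMrk (var rLu) 0),
    forLoop rLu rLv (Prog.ite (get aX (var rLu) * get aAdj (var rLv * var rN + var rLu))
      (store aMrk (get aLab (var rLu)) 1) skip),
    forLoop rLu rLv (Prog.ite (get aX (var rLu)) (Prog.ite (get aMrk (get aLab (var rLu)))
      (store aLab (var rLu) (var rLv)) skip) skip),
    store aLab (var rLv) (var rLv),
    assign rAnc (var rLv)]) skip)]

/-- For each new vertex the labels of its earlier neighbors are marked, and then all vertices with a
marked label are relabelled. This takes O(n) per vertex. For the empty set the anchor register gets
the value `n`, which is no vertex and serves as a test for emptiness. -/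
theorem label_spec {n B : ℕ} {G : SimpleGraph (Fin n)} {X : Finset (Fin n)} {s : State}
    (hn : s.reg rN = n) (hadj : ∀ u v : Fin n, s.mem aAdj (u * n + v) = adj G u v)
    (hX : s.HoldsSet aX 0 X) (hnB : n * n ≤ B) (h1 : 1 ≤ B) :
    Runs B label s (100 * ((n + 1) * (n + 1))) fun s' => ∃ lab : Fin n → Fin n, IsLabel G X lab ∧
      (∀ u ∈ X, s'.mem aLab u = lab u) ∧ s'.reg rAnc = if X = ∅ then n else X.sup Fin.val := by
  classical
  have hnB' : n ≤ B := le_trans (Nat.le_mul_self n) hnB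
  have hXle : ∀ u : Fin n, s.mem aX u ≤ 1 := fun u => by
    have := hX u
    rw [Nat.zero_add] at this
    rw [this]; split_ifs <;> omega
  -- The part of `X` that has been treated when the loop reaches `v`.
  set F : ℕ → Finset (Fin n) := fun v => X.filter fun u : Fin n => (u : ℕ) < v with hF
  have hFn : F n = X := by simp [hF]
  refine Runs.step (T₂ := 90 * ((n + 1) * (n + 1))) (by simp [safe]) ?_ (by simp [dur]; nlinarith)
  simp only [run, eval_var, hn, block_one]
  refine (Runs.for (N := n) (Tb := 68 * n + 45) (fun v s' => ∃ lab : Fin n → Fin n,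
    IsLabel G (F v) lab ∧ (∀ u ∈ F v, s'.mem aLab u = lab u) ∧
    s'.reg rAnc = if F v = ∅ then n else (F v).sup Fin.val) (by simp [hn]) hnB' h1 ?_ ?_ ?_).mono le_rfl ?_
  · have h0 : F 0 = ∅ := by simp [hF]
    rw [h0]
    exact ⟨id, ⟨by simp, by simp, by simp, by simp⟩, by simp, by simp⟩
  · rintro v hv s1 hx1 ha1 ⟨lab, hlab, hmem, hanc⟩
    have e0 := ha1.reg rN rfl
    have em := ha1.mem aX rfl
    have em' := ha1.mem aAdj rfl
    simp [hn] at e0 em em'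
    have hXv := hX.ne_zero ⟨v, hv⟩
    simp only at hXv
    refine Runs.ite (T := 68 * n + 40) (by simp [hx1]; omega) ?_ ?_ (by simp; omega)
    swap
    · intro h
      have hvX : (⟨v, hv⟩ : Fin n) ∉ X := fun h' => by
        simp [hx1, em] at h; exact hXv.2 h' h
      have hFv : F (v + 1) = F v := by
        ext u
        simp only [hF, Finset.mem_filter]
        refine and_congr_right fun hu => ?_
        have : (u : ℕ) ≠ v := fun h => hvX (by rwa [← show u = ⟨v, hv⟩ from Fin.ext h])
        omega
      refine Runs.straight trivial ?_ (by simp [dur])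
      rw [hFv]
      exact ⟨lab, hlab, hmem, by simpa [run] using hanc⟩
    · intro h
      have hvX : (⟨v, hv⟩ : Fin n) ∈ X := by
        simp [hx1, em] at h; exact hXv.1 h
      have hFv : F (v + 1) = insert ⟨v, hv⟩ (F v) := by
        ext u
        simp only [hF, Finset.mem_filter, Finset.mem_insert]
        constructor
        · rintro ⟨h1, h2⟩
          rcases Nat.lt_or_eq_of_le (Nat.lt_succ_iff.1 h2) with h | h
          · exact Or.inr ⟨h1, h⟩
          · exact Or.inl (Fin.ext h)
        · rintro (rfl | ⟨h1, h2⟩)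
          · exact ⟨hvX, by simp⟩
          · exact ⟨h1, by omega⟩
      have hvF : (⟨v, hv⟩ : Fin n) ∉ F v := by simp [hF]
      refine Runs.seq (T₁ := n * 10 + 5) (R := fun s' => ∀ u : Fin n, s'.mem aMrk u = 0) ?_
        (T₂ := 58 * n + 35) ?_ (by omega)
      · refine (Runs.for (N := n) (Tb := 3) (fun m s' => ∀ u : Fin n, (u : ℕ) < m →
          s'.mem aMrk u = 0) e0 hnB' h1 (by simp) ?_ le_rfl).mono le_rfl (fun s' _ h u => h u u.2)
        intro u hu s3 hx3 ha3 hinv3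
        refine Runs.straight (by simp [safe, hx3]; omega) ?_ (by decide)
        intro w hw
        simp [run, hx3]
        intro h; exact hinv3 w (by omega)
      intro s2 ha2 hmrk
      have f0 := ha2.reg rN rfl
      have f1 := ha2.reg rLv rfl
      have fm := ha2.mem aX rfl
      have fm' := ha2.mem aAdj rfl
      have fm2 := ha2.mem aLab rfl
      rw [e0] at f0; rw [hx1] at f1; rw [em] at fm; rw [em'] at fm'
      refine Runs.seq (T₁ := v * (16 + 7) + 5) (R := fun s' => ∀ c : Fin n,
        (s'.mem aMrk c ≠ 0 ↔ ∃ w ∈ F v, G.Adj ⟨v, hv⟩ w ∧ lab w = c)) ?_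
        (T₂ := 35 * n + 30) ?_ (by omega)
      · refine (Runs.for (N := v) (Tb := 16) (fun m s' => ∀ c : Fin n,
          (s'.mem aMrk c ≠ 0 ↔ ∃ w ∈ F m, G.Adj ⟨v, hv⟩ w ∧ lab w = c)) f1 (by omega) h1
          (by simp [hmrk, hF]) ?_ le_rfl).mono le_rfl (fun s' _ h => h)
        intro u hu s3 hx3 ha3 hinv3
        have g0 := ha3.reg rN rfl
        have g1 := ha3.reg rLv rfl
        have gm := ha3.mem aX rfl
        have gm' := ha3.mem aAdj rfl
        have gm2 := ha3.mem aLab rfl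
        rw [f0] at g0; rw [f1] at g1; rw [fm] at gm; rw [fm'] at gm'; rw [fm2] at gm2
        have hidx := idx_lt hv (show u < n by omega)
        have hXu := hX.ne_zero ⟨u, by omega⟩
        have hXle' := hXle ⟨u, by omega⟩
        have hadj' := hadj ⟨v, hv⟩ ⟨u, by omega⟩
        have hadj1 := adj_le_one G ⟨v, hv⟩ ⟨u, by omega⟩
        have hmm : s.mem aX u * s.mem aAdj (v * n + u) ≤ 1 * 1 :=
          Nat.mul_le_mul (hXle ⟨u, by omega⟩) (by rw [hadj']; exact hadj1)
        have hadj0 : s.mem aAdj (v * n + u) ≠ 0 ↔ G.Adj ⟨v, hv⟩ ⟨u, by omega⟩ := by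
          rw [hadj']; simp [adj]
        have hFu : ∀ c, (∃ w ∈ F (u + 1), G.Adj ⟨v, hv⟩ w ∧ lab w = c) ↔
            (∃ w ∈ F u, G.Adj ⟨v, hv⟩ w ∧ lab w = c) ∨
            ((⟨u, by omega⟩ : Fin n) ∈ X ∧ G.Adj ⟨v, hv⟩ ⟨u, by omega⟩ ∧ lab ⟨u, by omega⟩ = c) := by
          intro c
          constructor
          · rintro ⟨w, hw, hw'⟩
            simp only [hF, Finset.mem_filter] at hw
            rcases Nat.lt_or_eq_of_le (Nat.lt_succ_iff.1 hw.2) with h | h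
            · exact Or.inl ⟨w, by simp [hF, hw.1, h], hw'⟩
            · have hwu : w = ⟨u, by omega⟩ := Fin.ext h
              rw [hwu] at hw hw'; exact Or.inr ⟨hw.1, hw'⟩
          · rintro (⟨w, hw, hw'⟩ | ⟨h, h'⟩)
            · simp only [hF, Finset.mem_filter] at hw
              exact ⟨w, by simp [hF, hw.1]; omega, hw'⟩
            · exact ⟨_, by simp [hF, h], h'⟩
        refine Runs.ite (T := 5) (by simp [g0, g1, hx3, gm, gm']; omega) ?_ ?_ (by simp)
        · intro h
          simp [g0, g1, hx3, gm, gm'] at h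
          have huX := hXu.1 h.1
          have hl := hmem ⟨u, by omega⟩ (by simp [hF, huX, hu])
          simp only at hl
          have := (lab ⟨u, by omega⟩).2
          refine Runs.straight (by simp [safe, hx3, gm2, hl]; omega) ?_ (by decide)
          intro c
          simp only [run, setReg_mem, setMem_mem, eval_get, eval_var, hx3, gm2, hl, true_and,
            eval_ofNat]
          rw [hFu c]
          by_cases hc : (c : ℕ) = lab ⟨u, by omega⟩
          · rw [if_pos hc]
            simp only [ne_eq, one_ne_zero, not_false_eq_true, true_iff]
            exact Or.inr ⟨huX, hadj0.1 h.2, (Fin.ext hc).symm⟩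
          · rw [if_neg hc, hinv3 c]
            constructor
            · exact Or.inl
            · rintro (h | ⟨-, -, h⟩)
              · exact h
              · exact absurd (congrArg Fin.val h).symm hc
        · intro h
          simp [g0, g1, hx3, gm, gm'] at h
          refine Runs.straight trivial ?_ (by decide)
          intro c
          simp only [run, setReg_mem]
          rw [hFu c, hinv3 c]
          constructor
          · exact Or.inl
          · rintro (h' | ⟨h2, h3, h4⟩)
            · exact h'
            · exact absurd h (by
                push Not; exact ⟨hXu.2 h2, hadj0.2 h3⟩)
      intro s3 ha3 hmrk3
      have g0 := ha3.reg rN rfl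
      have g1 := ha3.reg rLv rfl
      have gm := ha3.mem aX rfl
      have gm2 := ha3.mem aLab rfl
      rw [f0] at g0; rw [f1] at g1; rw [fm] at gm; rw [fm2] at gm2
      have hnew : ∀ u ∈ F v, addLabel (F v) lab G ⟨v, hv⟩ u =
          if s3.mem aMrk (lab u) ≠ 0 then ⟨v, hv⟩ else lab u := by
        intro u hu
        have : u ≠ ⟨v, hv⟩ := fun h => hvF (h ▸ hu)
        rw [addLabel, if_neg this]
        simp only [hmrk3 (lab u)]
      refine Runs.seq (T₁ := v * (16 + 7) + 5) (R := fun s' => ∀ u ∈ F v,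
        s'.mem aLab u = addLabel (F v) lab G ⟨v, hv⟩ u) ?_ (T₂ := 10) ?_ (by omega)
      -- Labels are overwritten in place. The marks are not touched by this loop, and the vertices
      -- from `m` on still have their old labels, so every decision is based on old data.
      · refine (Runs.for (N := v) (Tb := 16) (fun m s' =>
          (∀ u ∈ F v, (u : ℕ) < m → s'.mem aLab u = addLabel (F v) lab G ⟨v, hv⟩ u) ∧
          ∀ u ∈ F v, m ≤ (u : ℕ) → s'.mem aLab u = lab u) g1 (by omega) h1 ?_ ?_ le_rfl).mono
          le_rfl (fun s' _ h u hu => h.1 u hu (Finset.mem_filter.1 hu).2)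
        · simp [gm2]; exact fun u hu => hmem u hu
        · rintro u hu s4 hx4 ha4 ⟨hinv4, hinv4'⟩
          have k0 := ha4.reg rN rfl
          have k1 := ha4.reg rLv rfl
          have km := ha4.mem aX rfl
          have kmm := ha4.mem aMrk rfl
          rw [g0] at k0; rw [g1] at k1; rw [gm] at km
          have hXu := hX.ne_zero ⟨u, by omega⟩
          have hrec : ∀ s' : State, (∀ w ∈ F v, (w : ℕ) ≠ u → s'.mem aLab w = s4.mem aLab w) →
              (∀ (h : (⟨u, by omega⟩ : Fin n) ∈ F v), s'.mem aLab u =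
                addLabel (F v) lab G ⟨v, hv⟩ ⟨u, by omega⟩) →
              (∀ w ∈ F v, (w : ℕ) < u + 1 → s'.mem aLab w = addLabel (F v) lab G ⟨v, hv⟩ w) ∧
              ∀ w ∈ F v, u + 1 ≤ (w : ℕ) → s'.mem aLab w = lab w := by
            intro s' h1 h2
            refine ⟨fun w hw hwu => ?_, fun w hw hwu => ?_⟩
            · by_cases h : (w : ℕ) = u
              · have : w = ⟨u, by omega⟩ := Fin.ext h
                rw [this] at hw ⊢; exact h2 hw
              · rw [h1 w hw h]; exact hinv4 w hw (by omega)
            · rw [h1 w hw (by omega)]; exact hinv4' w hw (by omega)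
          refine Runs.ite (T := 12) (by simp [hx4]; omega) ?_ ?_ (by simp)
          · intro h
            simp [hx4, km] at h
            have huX := hXu.1 h
            have huF : (⟨u, by omega⟩ : Fin n) ∈ F v := by simp [hF, huX, hu]
            have hl := hinv4' ⟨u, by omega⟩ huF le_rfl
            simp only at hl
            have := (lab ⟨u, by omega⟩).2
            have hnu := hnew _ huF
            refine Runs.ite (T := 5) (by simp [hx4, hl]; omega) ?_ ?_ (by simp)
            · intro h2
              simp [hx4, kmm, hl] at h2
              refine Runs.straight (by simp [safe, hx4]; omega) ?_ (by decide)
              refine hrec _ (fun w _ hwu => ?_) fun _ => ?_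
              · simp [run, hx4, hwu]
              · simp [run, hx4, k1, hnu, h2]
            · intro h2
              simp [hx4, kmm, hl] at h2
              refine Runs.straight trivial ?_ (by decide)
              refine hrec _ (fun w _ hwu => ?_) fun _ => ?_
              · simp [run]
              · simp [run, hnu, h2, hl]
          · intro h
            simp [hx4, km] at h
            refine Runs.straight trivial ?_ (by decide)
            refine hrec _ (fun w _ hwu => ?_) fun hu => ?_
            · simp [run]
            · exact absurd h (hXu.2 (Finset.mem_filter.1 hu).1)
      intro s4 ha4 hlab4
      have k1 := ha4.reg rLv rfl
      rw [g1] at k1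
      refine Runs.straight (by simp [safe, k1]; omega) ?_ (by decide)
      refine ⟨addLabel (F v) lab G ⟨v, hv⟩, ?_, ?_, ?_⟩
      · rw [hFv]; exact hlab.insert hvF
      · intro u hu
        rw [hFv] at hu
        rcases Finset.mem_insert.1 hu with rfl | hu
        · simp [run, block, k1, addLabel]
        · have : (u : ℕ) ≠ v := fun h => hvF (by rwa [← show u = ⟨v, hv⟩ from Fin.ext h])
          simp [run, block, k1, this]
          exact hlab4 u hu
      · have hne : F (v + 1) ≠ ∅ := by rw [hFv]; exact Finset.insert_ne_empty _ _
        rw [if_neg hne, hFv, Finset.sup_insert]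
        simp [run, block, k1]
        intro u hu
        exact (Finset.mem_filter.1 hu).2.le
  · nlinarith
  · rintro s' - ⟨lab, k1, k2, k3⟩
    rw [hFn] at k1 k2 k3
    exact ⟨lab, k1, k2, k3⟩

/-! ### Computing the cut vector of a set -/

/-- Entry `rQ` of the vector. -/
def rowEntry : Prog := block [
  forLoop rRu rN (block [store aPa (var rRu) 1, store aPb (var rRu) 1]),
  forLoop rRu rN (Prog.ite (get aX (var rRu)) (block [
    store aPa (get aLab (var rRu)) (get aPa (get aLab (var rRu)) *
      equ (get aVec ((var rStC + var rQ % var rKo) * var rN + var rRu)) 0),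
    store aPb (get aLab (var rRu)) (get aPb (get aLab (var rRu)) *
      (equ (get aVec ((var rStC + var rQ / var rKo) * var rN + var rRu)) 0 *
        (1 - equ (var rRu) (var rAnc))))]) skip),
  assign rProd 1,
  forLoop rRu rN (Prog.ite (get aX (var rRu)) (Prog.ite (equ (get aLab (var rRu)) (var rRu))
    (assign rProd (var rProd * ((get aPa (var rRu) + get aPb (var rRu)) % 2))) skip) skip),
  store aU (var rQ) (var rProd)]

def rowAll : Prog := forLoop rQ rKp rowEntry

-- At the position of a representative `c`, the arrays `aPa` and `aPb` accumulate the two products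
-- over the component of `c`. By `cutSum_eq_prod` the entry is the product of their sums over the
-- representatives, which are the vertices labelled by themselves.
open Classical in
theorem rowEntry_spec {n B k q st : ℕ} {G : SimpleGraph (Fin n)} {X : Finset (Fin n)}
    {lab : Fin n → Fin n} {s : State} (hn : s.reg rN = n) (hX : s.HoldsSet aX 0 X)
    (hlab : IsLabel G X lab) (hl : ∀ u ∈ X, s.mem aLab u = lab u)
    (hanc : s.reg rAnc = X.sup Fin.val)
    (hst : s.reg rStC = st) (hk : s.reg rKo = k) (hq : s.reg rQ = q) (hqk : q < k * k)
    (hB : (st + k) * n ≤ B) (hB' : st + k ≤ B) (hkB : k * k ≤ B) (hnB : n ≤ B) (h1 : 2 ≤ B) :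
    Runs B rowEntry s (150 * (n + 1)) fun s' =>
      s'.mem aU q = (row G (fun i => s.vec (st + i)) k X q).val ∧
      ∀ q' ≠ q, s'.mem aU q' = s.mem aU q' := by
  have hk0 : 0 < k := by
    rcases Nat.eq_zero_or_pos k with h | h
    · simp [h] at hqk
    · exact h
  have hmod : q % k < k := Nat.mod_lt _ hk0
  have hdiv : q / k < k := Nat.div_lt_of_lt_mul hqk
  have hkk : k ≤ B := le_trans (Nat.le_mul_self k) hkB
  set α : Fin n → Prop := fun u => s.vec (st + q % k) u = 0 with hα
  set β : Fin n → Prop := fun u => s.vec (st + q / k) u = 0 ∧ (u : ℕ) ≠ X.sup Fin.val with hβ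
  refine Runs.seq (T₁ := n * (13) + 5) (R := fun s' => ∀ c : Fin n, s'.mem aPa c = 1 ∧
    s'.mem aPb c = 1) ?_ (T₂ := 130 * (n + 1)) ?_ (by omega)
  · refine (Runs.for (N := n) (Tb := 6) (fun m s' => ∀ c : Fin n, (c : ℕ) < m →
      s'.mem aPa c = 1 ∧ s'.mem aPb c = 1) hn hnB (by omega) (by simp) ?_ le_rfl).mono le_rfl
      (fun s' _ h u => h u u.2)
    intro u hu s3 hx3 ha3 hinv3
    refine Runs.straight (by simp [safe, run, hx3]; omega) ?_ (by decide)
    intro w hw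
    simp [run, hx3]
    exact ⟨fun h => (hinv3 w (by omega)).1, fun h => (hinv3 w (by omega)).2⟩
  intro s1 ha1 hp1
  have e0 := ha1.reg rN rfl
  have e1 := ha1.reg rAnc rfl
  have e2 := ha1.reg rStC rfl
  have e3 := ha1.reg rKo rfl
  have e4 := ha1.reg rQ rfl
  have em := ha1.mem aX rfl
  have em1 := ha1.mem aLab rfl
  have em2 := ha1.mem aVec rfl
  have em3 := ha1.mem aU rfl
  rw [hn] at e0; rw [hanc] at e1; rw [hst] at e2; rw [hk] at e3; rw [hq] at e4
  refine Runs.seq (T₁ := n * (64 + 7) + 5) (R := fun s' => ∀ c : Fin n,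
    s'.mem aPa c = (if ∀ u ∈ X, lab u = c → α u then 1 else 0) ∧
    s'.mem aPb c = (if ∀ u ∈ X, lab u = c → β u then 1 else 0)) ?_ (T₂ := 50 * (n + 1)) ?_ (by omega)
  · refine (Runs.for (N := n) (Tb := 64) (fun m s' => ∀ c : Fin n,
      s'.mem aPa c = (if ∀ u ∈ X, (u : ℕ) < m → lab u = c → α u then 1 else 0) ∧
      s'.mem aPb c = (if ∀ u ∈ X, (u : ℕ) < m → lab u = c → β u then 1 else 0))
      e0 hnB (by omega) (by simpa using hp1) ?_ le_rfl).mono le_rfl (by simp)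
    intro u hu s3 hx3 ha3 hinv3
    have f0 := ha3.reg rN rfl
    have f1 := ha3.reg rAnc rfl
    have f2 := ha3.reg rStC rfl
    have f3 := ha3.reg rKo rfl
    have f4 := ha3.reg rQ rfl
    have fm := ha3.mem aX rfl
    have fm1 := ha3.mem aLab rfl
    have fm2 := ha3.mem aVec rfl
    rw [e0] at f0; rw [e1] at f1; rw [e2] at f2; rw [e3] at f3; rw [e4] at f4
    rw [em] at fm; rw [em1] at fm1; rw [em2] at fm2
    have hXu := hX.ne_zero ⟨u, hu⟩
    simp only at hXu
    have hsplit : ∀ (γ : Fin n → Prop) (c : Fin n), (∀ w ∈ X, (w : ℕ) < u + 1 → lab w = c → γ w) ↔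
        (∀ w ∈ X, (w : ℕ) < u → lab w = c → γ w) ∧
          ((⟨u, hu⟩ : Fin n) ∈ X → lab ⟨u, hu⟩ = c → γ ⟨u, hu⟩) := by
      intro γ c
      constructor
      · intro h
        exact ⟨fun w hw hwu => h w hw (by omega), fun h' => h _ h' (by simp)⟩
      · rintro ⟨h, h'⟩ w hw hwu hc
        rcases Nat.lt_or_eq_of_le (Nat.lt_succ_iff.1 hwu) with h2 | h2
        · exact h w hw h2 hc
        · have : w = ⟨u, hu⟩ := Fin.ext h2
          rw [this] at hw hc ⊢; exact h' hw hc
    refine Runs.ite (T := 60) (by simp [hx3]; omega) ?_ ?_ (by simp)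
    · intro h
      simp [hx3, fm] at h
      have huX := hXu.1 h
      have hlu := hl _ huX
      simp only at hlu
      have hlt := (lab ⟨u, hu⟩).2
      have hidx := idx_lt (show st + q % k < st + k by omega) hu
      have hidx2 := idx_lt (show st + q / k < st + k by omega) hu
      have hpa : s3.mem aPa (lab ⟨u, hu⟩) ≤ 1 := by
        rw [(hinv3 _).1]; exact ite_le le_rfl
      have hpb : s3.mem aPb (lab ⟨u, hu⟩) ≤ 1 := by
        rw [(hinv3 _).2]; exact ite_le le_rfl
      refine Runs.straight ?_ ?_ (by decide)
      · simp [safe, run, f0, f1, f2, f3, f4, fm1, fm2, hx3, hlu]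
        constructorm* _ ∧ _ <;> (try split_ifs) <;> omega
      · intro c
        simp only [hsplit α, hsplit β]
        simp only [huX, forall_true_left]
        simp only [run, block, setMem_mem, setReg_mem, eval_get, eval_mul, eval_var, eval_equ,
          eval_add, eval_sub, eval_div, eval_mod, eval_ofNat, f0, f1, f2, f3, f4, fm1, fm2, hx3, hlu,
          setMem_reg]
        have h1 := hinv3 c
        have hvα : α ⟨u, hu⟩ ↔ s.mem aVec ((st + q % k) * n + u) = 0 := Iff.rfl
        have hvβ : β ⟨u, hu⟩ ↔ s.mem aVec ((st + q / k) * n + u) = 0 ∧ u ≠ X.sup Fin.val := Iff.rfl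
        by_cases hc : lab ⟨u, hu⟩ = c
        · subst hc
          simp only [hvα, hvβ]
          simp [h1.1, h1.2]
          constructor
          · by_cases h3 : s.mem aVec ((st + q % k) * n + u) = 0 <;> simp [h3]
          · by_cases h3 : s.mem aVec ((st + q / k) * n + u) = 0 <;>
              by_cases h4 : u = X.sup Fin.val <;> simp [h3, h4]
        · have hc' : (c : ℕ) ≠ lab ⟨u, hu⟩ := fun h => hc (Fin.ext h.symm)
          simp [hc, hc', h1.1, h1.2]
    · intro h
      simp [hx3, fm] at h
      have huX : (⟨u, hu⟩ : Fin n) ∉ X := fun h' => hXu.2 h' h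
      refine Runs.straight trivial ?_ (by decide)
      intro c
      simp only [hsplit α, hsplit β]
      simp only [huX, false_imp_iff, and_true]
      exact hinv3 c
  intro s2 ha2 hp2
  have f0 := ha2.reg rN rfl
  have f4 := ha2.reg rQ rfl
  have fm := ha2.mem aX rfl
  have fm1 := ha2.mem aLab rfl
  have fm2 := ha2.mem aVec rfl
  have fm3 := ha2.mem aU rfl
  rw [e0] at f0; rw [e4] at f4
  rw [em] at fm; rw [em1] at fm1; rw [em2] at fm2; rw [em3] at fm3
  refine Runs.step (T₂ := 45 * (n + 1)) (by simp [safe]; omega) ?_ (by simp [dur]; omega)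
  simp only [run, eval_ofNat]
  set γ : Fin n → ZMod 2 := fun c => (if ∀ u ∈ X, lab u = c → α u then 1 else 0) +
    (if ∀ u ∈ X, lab u = c → β u then 1 else 0) with hγ
  refine Runs.seq (T₁ := n * (25 + 7) + 5) (R := fun s' => s'.reg rProd ≤ 1 ∧
    (s'.reg rProd : ZMod 2) = ∏ c ∈ X with lab c = c, γ c) ?_ (T₂ := 5) ?_ (by omega)
  · refine (Runs.for (N := n) (Tb := 25) (fun m s' => s'.reg rProd ≤ 1 ∧
      (s'.reg rProd : ZMod 2) = ∏ c ∈ X with lab c = c ∧ (c : ℕ) < m, γ c)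
      (by simp [f0]) hnB (by omega) (by simp) ?_ le_rfl).mono le_rfl (by simp)
    rintro u hu s3 hx3 ha3 ⟨hinv3, hinv4⟩
    have g0 := ha3.reg rN rfl
    have gm := ha3.mem aX rfl
    have gm1 := ha3.mem aLab rfl
    have gm2 := ha3.mem aPa rfl
    have gm3 := ha3.mem aPb rfl
    simp [f0, fm, fm1] at g0 gm gm1 gm2 gm3
    have hXu := hX.ne_zero ⟨u, hu⟩
    simp only at hXu
    have hskip : ¬ ((⟨u, hu⟩ : Fin n) ∈ X ∧ lab ⟨u, hu⟩ = ⟨u, hu⟩) →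
        (X.filter fun c => lab c = c ∧ (c : ℕ) < u + 1) = X.filter fun c => lab c = c ∧ (c : ℕ) < u := by
      intro h
      ext w
      simp only [Finset.mem_filter]
      constructor
      · rintro ⟨h1, h2, h3⟩
        have : (w : ℕ) ≠ u := by
          intro h4
          have : w = ⟨u, hu⟩ := Fin.ext h4
          rw [this] at h1 h2; exact h ⟨h1, h2⟩
        exact ⟨h1, h2, by omega⟩
      · rintro ⟨h1, h2, h3⟩; exact ⟨h1, h2, by omega⟩
    refine Runs.ite (T := 22) (by simp [hx3]; omega) ?_ ?_ (by simp)
    · intro h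
      simp [hx3, gm] at h
      have huX := hXu.1 h
      have hlu := hl _ huX
      simp only at hlu
      refine Runs.ite (T := 12) (by simp [hx3, gm1, hlu]; constructorm* _ ∧ _ <;> (try split_ifs) <;> omega)
        ?_ ?_ (by simp)
      · intro h
        have hlab' : lab ⟨u, hu⟩ = ⟨u, hu⟩ := by
          by_contra h'
          have : (lab ⟨u, hu⟩ : ℕ) ≠ u := fun h2 => h' (Fin.ext h2)
          simp [hx3, gm1, hlu, this] at h
        have hpa : s2.mem aPa u ≤ 1 := by
          rw [(hp2 ⟨u, hu⟩).1]; exact ite_le le_rfl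
        have hpb : s2.mem aPb u ≤ 1 := by
          rw [(hp2 ⟨u, hu⟩).2]; exact ite_le le_rfl
        have hmul : s3.reg rProd * ((s2.mem aPa u + s2.mem aPb u) % 2) ≤ 1 := by
          calc _ ≤ 1 * 1 := Nat.mul_le_mul hinv3 (by omega)
            _ = 1 := rfl
        refine Runs.straight ?_ ?_ (by decide)
        · simp [safe, hx3, gm2, gm3]
          constructorm* _ ∧ _ <;> omega
        · simp only [run, setReg_reg, eval_mul, eval_var, eval_mod, eval_add, eval_get, eval_ofNat,
            hx3, gm2, gm3]
          refine ⟨by simpa using hmul, ?_⟩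
          have hins : (X.filter fun c => lab c = c ∧ (c : ℕ) < u + 1) =
              insert ⟨u, hu⟩ (X.filter fun c => lab c = c ∧ (c : ℕ) < u) := by
            ext w
            simp only [Finset.mem_filter, Finset.mem_insert]
            constructor
            · rintro ⟨h1, h2, h3⟩
              rcases Nat.lt_or_eq_of_le (Nat.lt_succ_iff.1 h3) with h4 | h4
              · exact Or.inr ⟨h1, h2, h4⟩
              · exact Or.inl (Fin.ext h4)
            · rintro (rfl | ⟨h1, h2, h3⟩)
              · exact ⟨huX, hlab', by simp⟩
              · exact ⟨h1, h2, by omega⟩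
          rw [hins, Finset.prod_insert (by simp), ← hinv4, mul_comm]
          have := hp2 ⟨u, hu⟩
          simp only at this
          simp [this.1, this.2, hγ]
          try ring
      · intro h
        have hlab' : ¬ lab ⟨u, hu⟩ = ⟨u, hu⟩ := by
          intro h'
          rw [h'] at hlu
          simp [hx3, gm1, hlu] at h
        refine Runs.straight trivial ?_ (by decide)
        rw [hskip (fun h => hlab' h.2)]
        exact ⟨by simpa [run] using hinv3, by simpa [run] using hinv4⟩
    · intro h
      simp [hx3, gm] at h
      refine Runs.straight trivial ?_ (by decide)
      rw [hskip (fun h' => hXu.2 h'.1 h)]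
      exact ⟨by simpa [run] using hinv3, by simpa [run] using hinv4⟩
  · rintro s3 ha3 ⟨hle, hprod⟩
    have g4 := ha3.reg rQ rfl
    have gm3 := ha3.mem aU rfl
    simp [f4, fm3] at g4 gm3
    refine Runs.straight (by simp [block, safe, g4]; omega) ?_ (by decide)
    simp only [block, run, setMem_mem, eval_var, g4, true_and, gm3]
    refine ⟨?_, fun q' hq' => if_neg hq'⟩
    rw [if_pos trivial, row, cutSum_eq_prod hlab]
    -- The register holds 0 or 1, so it equals the value of its own residue modulo two.
    have : (s3.reg rProd) = ((s3.reg rProd : ZMod 2)).val := by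
      rw [ZMod.val_natCast, Nat.mod_eq_of_lt (by omega)]
    rw [this, hprod]
    congr 1
    refine Finset.prod_congr rfl fun c _ => ?_
    rw [hγ, Finset.prod_ite_zero, Finset.prod_ite_zero]
    simp only [Finset.prod_const_one, Finset.mem_filter, and_imp, hα, hβ]

theorem rowAll_spec {n B k st : ℕ} {G : SimpleGraph (Fin n)} {X : Finset (Fin n)}
    {lab : Fin n → Fin n} {s : State} (hn : s.reg rN = n) (hX : s.HoldsSet aX 0 X)
    (hlab : IsLabel G X lab) (hl : ∀ u ∈ X, s.mem aLab u = lab u)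
    (hanc : s.reg rAnc = X.sup Fin.val)
    (hst : s.reg rStC = st) (hk : s.reg rKo = k) (hkp : s.reg rKp = k * k)
    (hB : (st + k) * n ≤ B) (hB' : st + k ≤ B) (hkB : k * k ≤ B) (hnB : n ≤ B) (h1 : 2 ≤ B) :
    Runs B rowAll s (160 * ((k * k + 1) * (n + 1))) fun s' => ∀ q < k * k,
      s'.mem aU q = (row G (fun i => s.vec (st + i)) k X q).val := by
  refine (Runs.for (N := k * k) (Tb := 150 * (n + 1)) (fun m s' => ∀ q < m,
      s'.mem aU q = (row G (fun i => s.vec (st + i)) k X q).val) hkp hkB (by omega)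
      (by simp) ?_ ?_).mono le_rfl (fun _ _ h => h)
  · intro q hq s1 hx1 ha1 hinv
    have e0 := ha1.reg rN rfl
    have e1 := ha1.reg rAnc rfl
    have e2 := ha1.reg rStC rfl
    have e3 := ha1.reg rKo rfl
    have em := ha1.mem aX rfl
    have em1 := ha1.mem aLab rfl
    have em2 : s1.vec (n := n) = s.vec := by
      have := ha1.mem aVec rfl
      funext i u; simp [State.vec, this]
    rw [hn] at e0; rw [hanc] at e1; rw [hst] at e2; rw [hk] at e3
    have := rowEntry_spec (B := B) (st := st) (G := G) (X := X) (lab := lab) (s := s1) e0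
      (by intro u; rw [em]; exact hX u) hlab (by rw [em1]; exact hl) e1 e2 e3 hx1 hq hB hB' hkB hnB h1
    refine this.mono le_rfl ?_
    rintro s2 - ⟨h, h'⟩ q' hq'
    rw [setReg_mem]
    by_cases hqq : q' = q
    · subst hqq; rw [h, em2]
    · rw [h' q' hqq]; exact hinv q' (by omega)
  · nlinarith [Nat.zero_le (k * k * n)]

/-! ### Bases of optimal weight by incremental elimination. -/

/-! ### Maintaining an optimal basis -/

section Basis

/-- The product of two vectors of length `K`. -/
def dot (K : ℕ) (y u : ℕ → ZMod 2) : ZMod 2 := ∑ q ∈ Finset.range K, y q * u q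

theorem dot_add (K : ℕ) (y u v : ℕ → ZMod 2) : dot K y (u + v) = dot K y u + dot K y v := by
  simp [dot, mul_add, Finset.sum_add_distrib]

theorem dot_congr {K : ℕ} {y u v : ℕ → ZMod 2} (h : ∀ q < K, u q = v q) :
    dot K y u = dot K y v :=
  Finset.sum_congr rfl fun q hq => by rw [h q (Finset.mem_range.1 hq)]

theorem dot_single {K q : ℕ} (hq : q < K) (u : ℕ → ZMod 2) : dot K (Pi.single q 1) u = u q := by
  rw [dot, Finset.sum_eq_single q]
  · simp
  · intro b _ hb; simp [hb]
  · intro h; exact absurd (Finset.mem_range.2 hq) h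

variable {E Λ : Type} [LinearOrder Λ]

/-- The slots `q < K` hold some elements of `Z` together with vectors in echelon form, from which
one more element `cur` is being inserted, up to position `p`.  An element can be replaced only
by better ones. -/
structure BasisInv (K : ℕ) (r : E → ℕ → ZMod 2) (κ : E → Λ) (Z : Set E)
    (sl : ℕ → Option (E × (ℕ → ZMod 2))) (cur : Option (E × (ℕ → ZMod 2))) (p : ℕ) : Prop where
  mem : ∀ it, (∃ q < K, sl q = some it) ∨ cur = some it → it.1 ∈ Z
  -- Spans are expressed dually, by testing with functionals `y`. This field says that a stored
  -- vector lies in the span of the row of its own element and the rows of strictly better elements.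
  top : ∀ it, (∃ q < K, sl q = some it) ∨ cur = some it → ∀ y,
    (∀ e ∈ Z, κ it.1 < κ e → dot K y (r e) = 0) → dot K y it.2 ≠ 0 → dot K y (r it.1) ≠ 0
  -- Dually: the row of `e` lies in the span of those stored vectors whose elements are at least as
  -- good as `e`.
  cover : ∀ y, ∀ e ∈ Z, dot K y (r e) ≠ 0 →
    ∃ it, ((∃ q < K, sl q = some it) ∨ cur = some it) ∧ κ e ≤ κ it.1 ∧ dot K y it.2 ≠ 0
  pivot : ∀ q < K, ∀ it, sl q = some it → it.2 q = 1 ∧ ∀ q' < q, it.2 q' = 0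
  cur_zero : ∀ it, cur = some it → ∀ q < p, it.2 q = 0

namespace BasisInv

variable {K : ℕ} {r : E → ℕ → ZMod 2} {κ : E → Λ} {Z : Set E}
  {sl : ℕ → Option (E × (ℕ → ZMod 2))} {p : ℕ}

theorem empty : BasisInv K r κ ∅ (fun _ => none) none 0 :=
  ⟨by simp, by simp, by simp, by simp, by simp⟩

theorem start (h : BasisInv K r κ Z sl none 0) (e : E) :
    BasisInv K r κ (insert e Z) sl (some (e, r e)) 0 := by
  refine ⟨?_, ?_, ?_, h.pivot, fun it _ q hq => by omega⟩
  · rintro it (hit | hit)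
    · exact Or.inr (h.mem it (Or.inl hit))
    · obtain rfl := Option.some.inj hit; exact Or.inl rfl
  · rintro it (hit | hit) y hy
    · exact h.top it (Or.inl hit) y fun e' he' => hy e' (Or.inr he')
    · obtain rfl := Option.some.inj hit; exact id
  · rintro y e' (rfl | he') hne
    · exact ⟨_, Or.inr rfl, le_rfl, hne⟩
    · obtain ⟨it, hit, h1⟩ := h.cover y e' he' hne
      exact ⟨it, Or.inl (hit.resolve_right (by simp)), h1⟩

theorem skip {it : E × (ℕ → ZMod 2)} (h : BasisInv K r κ Z sl (some it) p) (h0 : it.2 p = 0) :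
    BasisInv K r κ Z sl (some it) (p + 1) := by
  refine ⟨h.mem, h.top, h.cover, h.pivot, fun it' hit' q hq => ?_⟩
  obtain rfl := Option.some.inj hit'
  rcases Nat.lt_or_eq_of_le (Nat.lt_succ_iff.1 hq) with h1 | rfl
  · exact h.cur_zero _ rfl q h1
  · exact h0

/-- After the element is put into the empty slot, the current vector becomes `u + u = 0`. Then an
empty slot and an occupied slot end with the same operation, the addition of the vector in the slot
to the current one. -/
theorem fill {e : E} {u : ℕ → ZMod 2} (h : BasisInv K r κ Z sl (some (e, u)) p) (hp : p < K)
    (h1 : u p = 1) (hsl : sl p = none) :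
    BasisInv K r κ Z (Function.update sl p (some (e, u))) (some (e, u + u)) (p + 1) := by
  have huu : u + u = 0 := by funext q; exact CharTwo.add_self_eq_zero _
  have hdot : ∀ y, dot K y 0 = 0 := fun y => by simp [dot]
  have hold : ∀ it, (∃ q < K, sl q = some it) →
      ∃ q < K, Function.update sl p (some (e, u)) q = some it := by
    rintro it ⟨q, hq, hit⟩
    refine ⟨q, hq, ?_⟩
    rw [Function.update_of_ne]; · exact hit
    rintro rfl; simp [hsl] at hit
  have hnew : ∀ it, (∃ q < K, Function.update sl p (some (e, u)) q = some it) →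
      (∃ q < K, sl q = some it) ∨ some (e, u) = some it := by
    rintro it ⟨q, hq, hit⟩
    by_cases hqp : q = p
    · subst hqp; rw [Function.update_self] at hit; exact Or.inr hit
    · rw [Function.update_of_ne hqp] at hit; exact Or.inl ⟨q, hq, hit⟩
  rw [huu]
  refine ⟨?_, ?_, ?_, ?_, ?_⟩
  · rintro it (hit | hit)
    · exact h.mem it (hnew it hit)
    · obtain rfl := Option.some.inj hit; exact h.mem (e, u) (Or.inr rfl)
  · rintro it (hit | hit) y hy
    · exact h.top it (hnew it hit) y hy
    · obtain rfl := Option.some.inj hit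
      intro h2; exact absurd (hdot y) h2
  · intro y e' he' hne
    obtain ⟨it, hit | hit, h2⟩ := h.cover y e' he' hne
    · exact ⟨it, Or.inl (hold it hit), h2⟩
    · exact ⟨it, Or.inl ⟨p, hp, by rw [Function.update_self]; exact hit⟩, h2⟩
  · intro q hq it hit
    by_cases hqp : q = p
    · subst hqp; rw [Function.update_self] at hit
      obtain rfl := Option.some.inj hit
      exact ⟨h1, h.cur_zero _ rfl⟩
    · rw [Function.update_of_ne hqp] at hit; exact h.pivot q hq it hit
  · intro it hit q _
    obtain rfl := Option.some.inj hit; rfl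

/-- One elimination step; `b` is the better and `c` the worse one of the element in slot `p` and
the current element. -/
theorem eliminate (hκ : Function.Injective κ) {a b c it : E × (ℕ → ZMod 2)} (h : BasisInv K r κ Z sl (some it) p) (hp : p < K)
    (hit1 : it.2 p = 1) (hsl : sl p = some a) (hbc : (b = a ∧ c = it) ∨ (b = it ∧ c = a))
    (hle : κ c.1 ≤ κ b.1) :
    BasisInv K r κ Z (Function.update sl p (some b)) (some (c.1, c.2 + b.2)) (p + 1) := by
  have ha1 := h.pivot p hp a hsl
  have hit0 := h.cur_zero it rfl
  have hbI : (∃ q < K, sl q = some b) ∨ some it = some b := by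
    rcases hbc with ⟨rfl, -⟩ | ⟨rfl, -⟩
    · exact Or.inl ⟨p, hp, hsl⟩
    · exact Or.inr rfl
  have hcI : (∃ q < K, sl q = some c) ∨ some it = some c := by
    rcases hbc with ⟨-, rfl⟩ | ⟨-, rfl⟩
    · exact Or.inr rfl
    · exact Or.inl ⟨p, hp, hsl⟩
  have hnew : ∀ i, (∃ q < K, Function.update sl p (some b) q = some i) →
      (∃ q < K, sl q = some i) ∨ some it = some i := by
    rintro i ⟨q, hq, hi⟩
    by_cases hqp : q = p
    · subst hqp; rw [Function.update_self] at hi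
      obtain rfl := Option.some.inj hi; exact hbI
    · rw [Function.update_of_ne hqp] at hi; exact Or.inl ⟨q, hq, hi⟩
  have hold : ∀ i, (∃ q < K, sl q = some i) ∨ some it = some i →
      (∃ q < K, Function.update sl p (some b) q = some i) ∨ i = c := by
    have hbnew : ∃ q < K, Function.update sl p (some b) q = some b :=
      ⟨p, hp, Function.update_self ..⟩
    rintro i (⟨q, hq, hi⟩ | hi)
    · by_cases hqp : q = p
      · subst hqp; rw [hsl] at hi
        obtain rfl := Option.some.inj hi
        rcases hbc with ⟨rfl, rfl⟩ | ⟨rfl, rfl⟩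
        · exact Or.inl hbnew
        · exact Or.inr rfl
      · exact Or.inl ⟨q, hq, by rw [Function.update_of_ne hqp]; exact hi⟩
    · obtain rfl := Option.some.inj hi
      rcases hbc with ⟨rfl, rfl⟩ | ⟨rfl, rfl⟩
      · exact Or.inr rfl
      · exact Or.inl hbnew
  refine ⟨?_, ?_, ?_, ?_, ?_⟩
  · rintro i (hi | hi)
    · exact h.mem i (hnew i hi)
    · obtain rfl := Option.some.inj hi; exact h.mem c hcI
  · rintro i (hi | hi) y hy
    · exact h.top i (hnew i hi) y hy
    · obtain rfl := Option.some.inj hi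
      simp only at hy ⊢
      intro hne
      rw [dot_add] at hne
      -- If `y` vanishes on the old vector of `c`, it does not vanish on that of `b`, and `top` for
      -- `b` gives a nonzero value on the row of `b`. A strictly better `b` would contradict the
      -- assumption on `y`, so the keys agree and `b` and `c` are the same element.
      by_cases hc : dot K y c.2 = 0
      · rw [hc, zero_add] at hne
        have hb := h.top b hbI y (fun e he hbe => hy e he (hle.trans_lt hbe)) hne
        rcases hle.lt_or_eq with hlt | heq
        · exact absurd (hy b.1 (h.mem b hbI) hlt) hb
        · rwa [hκ heq]
      · exact h.top c hcI y hy hc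
  · intro y e he hne
    obtain ⟨i, hi, h1, h2⟩ := h.cover y e he hne
    rcases hold i hi with hi' | rfl
    · exact ⟨i, Or.inl hi', h1, h2⟩
    -- The lost vector of `c` is the sum of the two new vectors. So `y` is nonzero on one of them,
    -- and both belong to elements no worse than `c`.
    · by_cases hb : dot K y b.2 = 0
      · refine ⟨_, Or.inr rfl, h1, ?_⟩
        simp only [dot_add, hb, add_zero]; exact h2
      · exact ⟨b, Or.inl ⟨p, hp, Function.update_self ..⟩, h1.trans hle, hb⟩
  · intro q hq i hi
    by_cases hqp : q = p
    · subst hqp; rw [Function.update_self] at hi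
      obtain rfl := Option.some.inj hi
      rcases hbc with ⟨rfl, -⟩ | ⟨rfl, -⟩
      · exact ha1
      · exact ⟨hit1, hit0⟩
    · rw [Function.update_of_ne hqp] at hi; exact h.pivot q hq i hi
  · intro i hi q hq
    obtain rfl := Option.some.inj hi
    -- Both vectors vanish before `p` and are 1 at `p`, so their sum vanishes up to `p`.
    rcases Nat.lt_or_eq_of_le (Nat.lt_succ_iff.1 hq) with h1 | rfl
    · rcases hbc with ⟨rfl, rfl⟩ | ⟨rfl, rfl⟩ <;>
        simp [ha1.2 q h1, hit0 q h1]
    · rcases hbc with ⟨rfl, rfl⟩ | ⟨rfl, rfl⟩ <;>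
        simp [ha1.1, hit1, CharTwo.add_self_eq_zero]

/-- After all `K` positions the current vector is zero. No functional is nonzero on it, so it
contributes nothing to `cover` and can be dropped. -/
theorem finish {it : E × (ℕ → ZMod 2)} (h : BasisInv K r κ Z sl (some it) K) :
    BasisInv K r κ Z sl none 0 := by
  have h0 : ∀ y, dot K y it.2 = 0 := fun y => by
    rw [dot_congr (v := 0) (fun q hq => h.cur_zero it rfl q hq)]; simp [dot]
  refine ⟨fun i hi => h.mem i (Or.inl (hi.resolve_right (by simp))),
    fun i hi => h.top i (Or.inl (hi.resolve_right (by simp))), fun y e he hne => ?_, h.pivot,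
    by simp⟩
  obtain ⟨i, hi | hi, h1, h2⟩ := h.cover y e he hne
  · exact ⟨i, Or.inl hi, h1, h2⟩
  · obtain rfl := Option.some.inj hi
    exact absurd (h0 y) h2

/-- By `cover`, the functional is nonzero on some stored vector whose element is at least as good as
`e`. By `top` it is then nonzero on the row of that element, which is therefore no better than `e`.
Injectivity of the keys makes it `e` itself. -/
theorem retained (h : BasisInv K r κ Z sl none 0) (hκ : Function.Injective κ) {e : E} (he : e ∈ Z)
    {y : ℕ → ZMod 2} (hy : dot K y (r e) ≠ 0)
    (hbest : ∀ e' ∈ Z, dot K y (r e') ≠ 0 → κ e' ≤ κ e) : ∃ q < K, ∃ u, sl q = some (e, u) := by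
  obtain ⟨it, hit, h1, h2⟩ := h.cover y e he hy
  obtain ⟨q, hq, hit'⟩ := hit.resolve_right (by simp)
  have h3 := h.top it hit y (fun e' he' hlt => by
    by_contra hne
    exact absurd (hbest e' he' hne) (not_le.2 (h1.trans_lt hlt))) h2
  have : κ it.1 = κ e := le_antisymm (hbest _ (h.mem it hit) h3) h1
  have := hκ this
  exact ⟨q, hq, it.2, by rw [hit', ← this]⟩

/-- The coordinate functional at `q` is nonzero on the stored vector because of the pivot. If it
were zero on all rows, `top` would be contradicted. At the root this shows that an occupied slot
certifies a connected solution. -/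
theorem witness (h : BasisInv K r κ Z sl none 0) {q : ℕ} (hq : q < K) {it : E × (ℕ → ZMod 2)}
    (hit : sl q = some it) : ∃ e ∈ Z, r e q ≠ 0 := by
  by_contra hno
  push Not at hno
  have hI : (∃ q < K, sl q = some it) ∨ none = some it := Or.inl ⟨q, hq, hit⟩
  have := h.top it hI (Pi.single q 1) (fun e he _ => by rw [dot_single hq]; exact hno e he)
    (by rw [dot_single hq, (h.pivot q hq it hit).1]; exact one_ne_zero)
  rw [dot_single hq] at this
  exact this (hno _ (h.mem it hI))

end BasisInv

end Basis

notation "rCell" => (29 : ℕ)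
notation "rP" => (30 : ℕ)
notation "rS" => (31 : ℕ)
notation "rRi" => (32 : ℕ)
notation "rTmp" => (33 : ℕ)
notation "rLex" => (34 : ℕ)
notation "rLa" => (35 : ℕ)
notation "rLb" => (36 : ℕ)
notation "rKs" => (37 : ℕ)

notation "aBase" => (14 : ℕ)
notation "aUsed" => (15 : ℕ)
notation "aSX" => (16 : ℕ)
notation "aSU" => (17 : ℕ)

/-! ### Comparing sets of vertices -/

section Key

variable {n : ℕ}

/-- The quantity to be maximized. -/
def Goal.value (goal : Goal) (w : Fin n → ℚ) (X : Finset (Fin n)) : ℚ :=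
  match goal with
  | .maximum => ∑ v ∈ X, w v
  | .minimum => -∑ v ∈ X, w v

/-- The weight of a set with a rule for breaking ties. -/
def key (goal : Goal) (w : Fin n → ℚ) (X : Finset (Fin n)) : ℚ ×ₗ ℕ :=
  toLex (goal.value w X, ∑ v ∈ X, 2 ^ (v : ℕ))

/-- The second component is the number whose binary digits form the characteristic vector.
Injectivity makes the best solution unique, which `BasisInv.retained` depends on. -/
theorem key_injective (goal : Goal) (w : Fin n → ℚ) : Function.Injective (key goal w) := by
  intro X Y h
  have h2 : ∑ v ∈ X, 2 ^ (v : ℕ) = ∑ v ∈ Y, 2 ^ (v : ℕ) := (Prod.ext_iff.1 (toLex.injective h)).2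
  have h3 := Finset.geomSum_injective (n := 2) le_rfl
    (a₁ := X.map Fin.valEmbedding) (a₂ := Y.map Fin.valEmbedding) (by simpa using h2)
  exact Finset.map_injective _ h3

theorem key_le_iff {goal : Goal} {w : Fin n → ℚ} {X Y : Finset (Fin n)} :
    key goal w X ≤ key goal w Y ↔ goal.value w X ≤ goal.value w Y ∧
      (¬ goal.value w Y ≤ goal.value w X ∨
        ∑ v ∈ X, 2 ^ (v : ℕ) ≤ ∑ v ∈ Y, 2 ^ (v : ℕ)) := by
  rw [key, key, Prod.Lex.toLex_le_toLex]
  simp only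
  constructor
  · rintro (h | ⟨h, h'⟩)
    · exact ⟨h.le, Or.inl (not_le.2 h)⟩
    · exact ⟨h.le, Or.inr h'⟩
  · rintro ⟨h, h' | h'⟩
    · exact Or.inl (not_le.1 h')
    · rcases h.lt_or_eq with h2 | h2
      · exact Or.inl h2
      · exact Or.inr ⟨h2, h'⟩

/-- Both components of the key are additive on disjoint unions. So comparing two partial solutions
amounts to comparing their completions by the same set. -/
theorem key_union_le_iff {goal : Goal} {w : Fin n → ℚ} {X X' Y : Finset (Fin n)}
    (h : Disjoint X Y) (h' : Disjoint X' Y) :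
    key goal w (X ∪ Y) ≤ key goal w (X' ∪ Y) ↔ key goal w X ≤ key goal w X' := by
  rw [key_le_iff, key_le_iff]
  simp only [Finset.sum_union h, Finset.sum_union h']
  cases goal <;> simp only [Goal.value, Finset.sum_union h, Finset.sum_union h', neg_add,
    add_le_add_iff_right]

end Key

/-- Decide whether the set in slot `rS` is at most as good as the set in `aX`. -/
def compare (goal : Goal) : Prog := block [
  wzero 2 0, wzero 2 1, assign rLex 1,
  forLoop rRi rN (block [
    Prog.ite (get aX (var rRi)) (wadd 2 0 2 0 0 (var rRi)) skip,
    Prog.ite (get aSX (var rS * var rN + var rRi)) (wadd 2 1 2 1 0 (var rRi)) skip,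
    Prog.ite (equ (get aX (var rRi)) (get aSX (var rS * var rN + var rRi))) skip
      (assign rLex (get aX (var rRi)))]),
  match goal with
  | .maximum => block [wle rLa 2 1 2 0, wle rLb 2 0 2 1]
  | .minimum => block [wle rLa 2 0 2 1, wle rLb 2 1 2 0]]

/-- A higher digit outweighs all lower digits together, so two characteristic numbers are compared
by the last vertex in which the sets differ. -/
theorem sum_two_pow_lt {n m : ℕ} (X : Finset (Fin n)) :
    ∑ v ∈ X.filter (fun v : Fin n => (v : ℕ) < m), 2 ^ (v : ℕ) < 2 ^ m := by
  have h : ∑ v ∈ X.filter (fun v : Fin n => (v : ℕ) < m), 2 ^ (v : ℕ) ≤ ∑ i ∈ Finset.range m, 2 ^ i := by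
    have e := Finset.sum_map (X.filter fun v : Fin n => (v : ℕ) < m) Fin.valEmbedding (fun i => 2 ^ i)
    simp only [Fin.valEmbedding_apply] at e
    rw [← e]
    refine Finset.sum_le_sum_of_subset fun i hi => ?_
    obtain ⟨v, hv, rfl⟩ := Finset.mem_map.1 hi
    simpa using (Finset.mem_filter.1 hv).2
  have := Nat.geomSum_eq (m := 2) le_rfl m
  have h2 : 0 < 2 ^ m := by positivity
  simp at this
  omega

theorem filter_lt_succ {n u : ℕ} (X : Finset (Fin n)) (hu : u < n) :
    (X.filter fun v : Fin n => (v : ℕ) < u + 1) = if ⟨u, hu⟩ ∈ X then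
      insert ⟨u, hu⟩ (X.filter fun v : Fin n => (v : ℕ) < u)
      else X.filter fun v : Fin n => (v : ℕ) < u := by
  ext w
  have hw : (w : ℕ) = u ↔ w = ⟨u, hu⟩ := ⟨fun h => Fin.ext h, fun h => by rw [h]⟩
  split_ifs with h <;> simp only [Finset.mem_filter, Finset.mem_insert, Nat.lt_succ_iff_lt_or_eq, hw]
  · constructor
    · rintro ⟨h1, h2 | h2⟩
      · exact Or.inr ⟨h1, h2⟩
      · exact Or.inl h2
    · rintro (h2 | ⟨h1, h2⟩)
      · exact ⟨h2 ▸ h, Or.inr h2⟩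
      · exact ⟨h1, Or.inl h2⟩
  · constructor
    · rintro ⟨h1, h2 | h2⟩
      · exact ⟨h1, h2⟩
      · exact absurd (h2 ▸ h1) h
    · rintro ⟨h1, h2⟩; exact ⟨h1, Or.inl h2⟩

theorem sum_filter_lt_succ {n u : ℕ} {M : Type} [AddCommMonoid M] (X : Finset (Fin n)) (hu : u < n)
    (f : Fin n → M) : ∑ v ∈ X.filter (fun v : Fin n => (v : ℕ) < u + 1), f v =
      (∑ v ∈ X.filter (fun v : Fin n => (v : ℕ) < u), f v) + if ⟨u, hu⟩ ∈ X then f ⟨u, hu⟩ else 0 := by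
  rw [filter_lt_succ X hu]
  split_ifs with h
  · rw [Finset.sum_insert (by simp), add_comm]
  · rw [add_zero]

/-- The tie-breaking numbers are too large for words and are never formed. The flag `rLex` starts at
1 for equality and is overwritten at each vertex in which the sets differ, so the last difference
decides. The weights of the two sets are accumulated in the cells 0 and 1 of weight array 2. -/
theorem compare_spec {n B S : ℕ} {goal : Goal} {w : Fin n → ℚ} {X Y : Finset (Fin n)} {s : State}
    (hn : s.reg rN = n) (hw : ∀ u : Fin n, s.wt 0 u = w u) (hS : s.reg rS = S)
    (hX : s.HoldsSet aX 0 X) (hY : s.HoldsSet aSX (S * n) Y)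
    (hB : (S + 1) * n ≤ B) (hnB : n ≤ B) (h1 : 1 ≤ B) :
    Runs B (compare goal) s (70 * (n + 1)) fun s' =>
      (s'.reg rLa ≠ 0 ∧ (s'.reg rLb = 0 ∨ s'.reg rLex ≠ 0)) ↔ key goal w Y ≤ key goal w X := by
  refine Runs.step (T₂ := 67 * (n + 1)) (by simp [safe]) ?_ (by simp [dur]; omega)
  refine Runs.step (T₂ := 65 * (n + 1)) (by simp [safe, h1]) ?_ (by simp [dur]; omega)
  refine Runs.step (T₂ := 60 * (n + 1)) (by simp [safe, h1]) ?_ (by simp [dur]; omega)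
  simp only [run, eval_ofNat]
  refine Runs.seq (T₁ := n * 57 + 5) (T₂ := 6) (R := fun s' => s'.wt 2 0 = ∑ v ∈ X, w v ∧
    s'.wt 2 1 = ∑ v ∈ Y, w v ∧
    (s'.reg rLex ≠ 0 ↔ ∑ v ∈ Y, 2 ^ (v : ℕ) ≤ ∑ v ∈ X, 2 ^ (v : ℕ))) ?_ ?_ (by omega)
  · refine (Runs.for (N := n) (Tb := 50) (fun m s' =>
      s'.wt 2 0 = ∑ v ∈ X.filter (fun v : Fin n => (v : ℕ) < m), w v ∧ s'.wt 2 1 = ∑ v ∈ Y.filter (fun v : Fin n => (v : ℕ) < m), w v ∧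
      (s'.reg rLex ≠ 0 ↔
        ∑ v ∈ Y.filter (fun v : Fin n => (v : ℕ) < m), 2 ^ (v : ℕ) ≤ ∑ v ∈ X.filter (fun v : Fin n => (v : ℕ) < m), 2 ^ (v : ℕ)))
      (by simp [hn]) hnB h1 (by simp) ?_ le_rfl).mono le_rfl (by simp)
    rintro u hu s1 hx1 ha1 ⟨i1, i2, i3⟩
    have e0 := ha1.reg rN rfl
    have e1 := ha1.reg rS rfl
    have em := ha1.mem aX rfl
    have em1 := ha1.mem aSX rfl
    have ew := ha1.wt 0 rfl
    simp [hn, hS] at e0 e1 em em1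
    have ew' : s1.wt 0 u = w ⟨u, hu⟩ := by
      rw [ew]; simpa using hw ⟨u, hu⟩
    have hidx := idx_lt (show S < S + 1 by omega) hu
    have hXu := hX ⟨u, hu⟩
    have hYu := hY ⟨u, hu⟩
    simp only [Nat.zero_add] at hXu hYu
    have p1 := sum_two_pow_lt (m := u) X
    have p2 := sum_two_pow_lt (m := u) Y
    refine Runs.straight ?_ ?_ (by decide)
    · by_cases hx : (⟨u, hu⟩ : Fin n) ∈ X <;> by_cases hy : (⟨u, hu⟩ : Fin n) ∈ Y <;>
        simp [safe, run, e0, e1, em, em1, hx1, hXu, hYu, hx, hy] <;>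
        (constructorm* _ ∧ _ <;> omega)
    · simp only [sum_filter_lt_succ _ hu]
      by_cases hx : (⟨u, hu⟩ : Fin n) ∈ X <;> by_cases hy : (⟨u, hu⟩ : Fin n) ∈ Y <;>
        simp [block, run, e0, e1, em, em1, hx1, hXu, hYu, hx, hy, i1, i2, i3, ew'] <;> omega
  · rintro s1 ha1 ⟨i1, i2, i3⟩
    rw [key_le_iff, ← i3]
    cases goal
    · refine Runs.straight (by simp [safe, h1]) ?_ (by decide)
      by_cases c1 : ∑ v ∈ Y, w v ≤ ∑ v ∈ X, w v <;> by_cases c2 : ∑ v ∈ X, w v ≤ ∑ v ∈ Y, w v <;>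
      simp [block, run, i1, i2, Goal.value, c1, c2]
    · refine Runs.straight (by simp [safe, h1]) ?_ (by decide)
      by_cases c1 : ∑ v ∈ Y, w v ≤ ∑ v ∈ X, w v <;> by_cases c2 : ∑ v ∈ X, w v ≤ ∑ v ∈ Y, w v <;>
      simp [block, run, i1, i2, Goal.value, c1, c2]

/-! ### Moving data between buffers and slots -/

/-- Exchange the first `y` entries of array `a` with those of array `b` from index `rS * m` on;
`y` and `m` are registers. -/
def swapArr (a b y m : ℕ) : Prog := forLoop rRi y (block [
  assign rTmp (get a (var rRi)),
  store a (var rRi) (get b (var rS * var m + var rRi)),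
  store b (var rS * var m + var rRi) (var rTmp)])

/-- Copy the first `y` entries of array `a` to array `b` from index `rS * m` on. -/
def copyArr (a b y m : ℕ) : Prog :=
  forLoop rRi y (store b (var rS * var m + var rRi) (get a (var rRi)))

theorem swapArr_spec {B a b y m l M S : ℕ} {s : State} (hab : a ≠ b)
    (hy : y ≠ rRi ∧ y ≠ rTmp) (hm : m ≠ rRi ∧ m ≠ rTmp) (hly : s.reg y = l) (hmM : s.reg m = M)
    (hS : s.reg rS = S) (hlM : l ≤ M) (hB : (S + 1) * M ≤ B) (h1 : 1 ≤ B) :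
    Runs B (swapArr a b y m) s (30 * (l + 1)) fun s' =>
      (∀ i < l, s'.mem a i = s.mem b (S * M + i) ∧ s'.mem b (S * M + i) = s.mem a i) ∧
      ∀ j, (∀ i < l, j ≠ S * M + i) → s'.mem b j = s.mem b j := by
  have hMB : M ≤ B := le_trans (Nat.le_mul_of_pos_left _ (by omega)) hB
  refine (Runs.for (N := l) (Tb := 18) (fun k s' =>
      (∀ i < k, s'.mem a i = s.mem b (S * M + i) ∧ s'.mem b (S * M + i) = s.mem a i) ∧
      (∀ i, k ≤ i → s'.mem a i = s.mem a i) ∧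
      ∀ j, (∀ i < k, j ≠ S * M + i) → s'.mem b j = s.mem b j)
      hly (by omega) h1 (by simp) ?_ (by omega) (by simp [block, writesR])
      (by simp [block, writesR, hy.2.symm]) hy.1.symm).mono le_rfl ?_
  · rintro i hi s1 hx1 ha1 ⟨i1, i2, i3⟩
    have e1 := ha1.reg rS (by simp [forLoop, block, writesR])
    have e2 := ha1.reg m (by simp [forLoop, block, writesR, hm.1.symm, hm.2.symm])
    rw [hS] at e1; rw [hmM] at e2
    have hidx := idx_lt (show S < S + 1 by omega) (show i < M by omega)
    refine Runs.straight ?_ ?_ (by simp [dur])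
    · simp [safe, run, e1, e2, hx1, hm.2]
      constructorm* _ ∧ _ <;> omega
    · simp [block, run, e1, e2, hx1, hm.2, hab, hab.symm]
      have h2 := i3 (S * M + i) (fun j hj => by omega)
      have h3 := i2 i le_rfl
      refine ⟨fun j hj => ?_, fun j hj => ?_, fun j hj => ?_⟩
      · by_cases hji : j = i
        · subst hji; simp [h2, h3]
        · simp [hji]; exact i1 j (by omega)
      · rw [if_neg (by omega)]; exact i2 j (by omega)
      · rw [if_neg (hj i (by omega))]
        exact i3 j fun k hk => hj k (by omega)
  · rintro s' - ⟨i1, -, i3⟩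
    exact ⟨i1, i3⟩

theorem copyArr_spec {B a b y m l M S : ℕ} {s : State} (hab : a ≠ b)
    (hy : y ≠ rRi) (hm : m ≠ rRi) (hly : s.reg y = l) (hmM : s.reg m = M)
    (hS : s.reg rS = S) (hlM : l ≤ M) (hB : (S + 1) * M ≤ B) (h1 : 1 ≤ B) :
    Runs B (copyArr a b y m) s (20 * (l + 1)) fun s' =>
      (∀ i < l, s'.mem b (S * M + i) = s.mem a i) ∧
      ∀ j, (∀ i < l, j ≠ S * M + i) → s'.mem b j = s.mem b j := by
  have hMB : M ≤ B := le_trans (Nat.le_mul_of_pos_left _ (by omega)) hB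
  refine (Runs.for (N := l) (Tb := 10) (fun k s' =>
      (∀ i < k, s'.mem b (S * M + i) = s.mem a i) ∧
      ∀ j, (∀ i < k, j ≠ S * M + i) → s'.mem b j = s.mem b j)
      hly (by omega) h1 (by simp) ?_ (by omega) (by simp [writesR])
      (by simp [writesR]) hy.symm).mono le_rfl (fun _ _ h => h)
  rintro i hi s1 hx1 ha1 ⟨i1, i3⟩
  have e1 := ha1.reg rS (by simp [forLoop, writesR])
  have e2 := ha1.reg m (by simp [forLoop, writesR, hm.symm])
  have em := ha1.mem a (by simp [forLoop, writesM, hab.symm])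
  rw [hS] at e1; rw [hmM] at e2
  have hidx := idx_lt (show S < S + 1 by omega) (show i < M by omega)
  refine Runs.straight ?_ ?_ (by simp [dur])
  · simp [safe, e1, e2, hx1]
    constructorm* _ ∧ _ <;> omega
  · simp [run, e1, e2, hx1, em]
    refine ⟨fun j hj => ?_, fun j hj => ?_⟩
    · by_cases hji : j = i
      · subst hji; simp
      · simp [hji]; exact i1 j (by omega)
    · rw [if_neg (hj i (by omega))]
      exact i3 j fun k hk => hj k (by omega)

/-! ### Slots -/

/-- Slot number `idx` holds a set together with a vector, or nothing. -/
def SlotMem {n : ℕ} (s : State) (K idx : ℕ) : Option (Finset (Fin n) × (ℕ → ZMod 2)) → Prop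
  | none => s.mem aUsed idx = 0
  | some (X, u) => s.mem aUsed idx = 1 ∧ s.HoldsSet aSX (idx * n) X ∧
      ∀ q < K, s.mem aSU (idx * (K + 1) + q) = (u q).val

/-- Slot number `idx` is the same in both states. -/
structure SlotSame (n K idx : ℕ) (s s' : State) : Prop where
  used : s'.mem aUsed idx = s.mem aUsed idx
  set : ∀ i < n, s'.mem aSX (idx * n + i) = s.mem aSX (idx * n + i)
  vec : ∀ q < K, s'.mem aSU (idx * (K + 1) + q) = s.mem aSU (idx * (K + 1) + q)

theorem SlotSame.rfl' {n K idx : ℕ} {s s' : State} (h1 : s'.mem aUsed = s.mem aUsed)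
    (h2 : s'.mem aSX = s.mem aSX) (h3 : s'.mem aSU = s.mem aSU) : SlotSame n K idx s s' :=
  ⟨by rw [h1], fun _ _ => by rw [h2], fun _ _ => by rw [h3]⟩

theorem SlotSame.trans {n K idx : ℕ} {s s' s'' : State} (h : SlotSame n K idx s s')
    (h' : SlotSame n K idx s' s'') : SlotSame n K idx s s'' :=
  ⟨h'.used.trans h.used, fun i hi => (h'.set i hi).trans (h.set i hi),
    fun i hi => (h'.vec i hi).trans (h.vec i hi)⟩

theorem SlotSame.holdsSet {n K idx : ℕ} {s s' : State} (h : SlotSame n K idx s s')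
    {X : Finset (Fin n)} (hX : s.HoldsSet aSX (idx * n) X) : s'.HoldsSet aSX (idx * n) X :=
  fun u => (h.set u u.2).trans (hX u)

theorem SlotMem.of_same {n K idx : ℕ} {s s' : State} {it : Option (Finset (Fin n) × (ℕ → ZMod 2))}
    (h : SlotMem s K idx it) (hs : SlotSame n K idx s s') : SlotMem s' K idx it := by
  rcases it with _ | ⟨X, u⟩
  · exact hs.used.trans h
  · exact ⟨hs.used.trans h.1, hs.holdsSet h.2.1, fun q hq => (hs.vec q hq).trans (h.2.2 q hq)⟩

/-! ### Gaussian elimination -/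

def swapTest : Expr := less 0 (var rLa) * (equ (var rLb) 0 + less 0 (var rLex))

theorem eval_swapTest {s : State} :
    swapTest.eval s ≠ 0 ↔ s.reg rLa ≠ 0 ∧ (s.reg rLb = 0 ∨ s.reg rLex ≠ 0) := by
  by_cases h1 : s.reg rLa = 0 <;> by_cases h2 : s.reg rLb = 0 <;> by_cases h3 : s.reg rLex = 0 <;>
    simp [swapTest, h1, h2, h3, Nat.pos_iff_ne_zero]

theorem fits_swapTest {B : ℕ} {s : State} (h : 2 ≤ B) : swapTest.Fits B s := by
  have hB : 1 ≤ B := by omega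
  by_cases h1 : s.reg rLa = 0 <;> by_cases h2 : s.reg rLb = 0 <;> by_cases h3 : s.reg rLex = 0 <;>
    simp [swapTest, h1, h2, h3, Nat.pos_iff_ne_zero, h, hB]

def reduceStep (goal : Goal) : Prog := Prog.ite (get aU (var rP)) (block [
  assign rS (var rCell + var rP),
  Prog.ite (get aUsed (var rS))
    (block [compare goal, Prog.ite swapTest
      (block [swapArr aX aSX rN rN, swapArr aU aSU rKp rKs]) skip])
    (block [copyArr aX aSX rN rN, copyArr aU aSU rKp rKs, store aUsed (var rS) 1]),
  forLoop rRi rKp (store aU (var rRi)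
    ((get aU (var rRi) + get aSU (var rS * var rKs + var rRi)) % 2))]) skip

def reduce (goal : Goal) : Prog := forLoop rP rKp (reduceStep goal)

/-- The buffers hold the set and the vector that are being inserted. -/
structure CurMem {n : ℕ} (s : State) (K : ℕ) (it : Finset (Fin n) × (ℕ → ZMod 2)) : Prop where
  set : s.HoldsSet aX 0 it.1
  vec : ∀ q < K, s.mem aU q = (it.2 q).val

theorem zmod_val_le (a : ZMod 2) : a.val ≤ 1 := Nat.lt_succ_iff.1 (ZMod.val_lt a)

theorem zmod_eq_one {a : ZMod 2} (h : a.val ≠ 0) : a = 1 := by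
  revert h; revert a; decide

theorem idx_ne {i j u v n : ℕ} (hu : u < n) (hv : v < n) (h : i ≠ j) : i * n + u ≠ j * n + v :=
  fun h' => h ((idx_inj hu hv).1 h').1

section Reduce

variable {n B K cell p : ℕ} {r : Finset (Fin n) → ℕ → ZMod 2} {goal : Goal} {w : Fin n → ℚ}
  {Z : Set (Finset (Fin n))} {sl : ℕ → Option (Finset (Fin n) × (ℕ → ZMod 2))}
  {it : Finset (Fin n) × (ℕ → ZMod 2)} {s : State}

theorem fill_spec {S : ℕ} (hn : s.reg rN = n) (hS : s.reg rS = S) (hK : s.reg rKp = K)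
    (hKs : s.reg rKs = K + 1) (hcur : CurMem s K it)
    (hB : (S + 1) * n ≤ B) (hB' : (S + 1) * (K + 1) ≤ B) (hSB : S ≤ B) (h1 : 2 ≤ B) :
    Runs B (block [copyArr aX aSX rN rN, copyArr aU aSU rKp rKs, store aUsed (var rS) 1]) s
      (50 * (n + K + 1)) fun s' => CurMem s' K it ∧ SlotMem s' K S (some it) ∧
        ∀ idx ≠ S, SlotSame n K idx s s' := by
  refine Runs.seq (copyArr_spec (by decide) (by decide) (by decide) hn hn hS le_rfl hB (by omega))
    (T₂ := 20 * (K + 1) + 5) ?_ (by omega)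
  rintro s1 ha1 ⟨c1, c2⟩
  refine Runs.seq (copyArr_spec (S := S) (l := K) (M := K + 1) (by decide) (by decide) (by decide)
    ((ha1.reg _ rfl).trans hK) ((ha1.reg _ rfl).trans hKs) ((ha1.reg _ rfl).trans hS) (by omega)
    hB' (by omega)) (T₂ := 5) ?_ (by omega)
  rintro s2 ha2 ⟨c3, c4⟩
  have e := (ha2.reg rS rfl).trans ((ha1.reg rS rfl).trans hS)
  have m1 := ha1.mem aX rfl
  have m2 := ha1.mem aU rfl
  have m3 := ha1.mem aUsed rfl
  have m4 := ha1.mem aSU rfl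
  have k1 := ha2.mem aX rfl
  have k2 := ha2.mem aU rfl
  have k3 := ha2.mem aUsed rfl
  have k4 := ha2.mem aSX rfl
  refine Runs.straight (by simp [block, safe, e]; omega) ?_ (by decide)
  simp only [block, run, eval_var, e, eval_ofNat]
  refine ⟨⟨fun u => ?_, fun q hq => ?_⟩, ⟨by simp, fun u => ?_, fun q hq => ?_⟩, fun idx hidx =>
    ⟨?_, fun i hi => ?_, fun q hq => ?_⟩⟩
  · simp [k1, m1]; simpa using hcur.set u
  · simp [k2, m2]; exact hcur.vec q hq
  · simp [k4, c1 u u.2]; simpa using hcur.set u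
  · simp [c3 q hq, m2]; exact hcur.vec q hq
  · simp [hidx, k3, m3]
  · simp [k4]; exact c2 _ fun j hj => idx_ne hi hj hidx
  · simp [c4 _ fun j hj => idx_ne (show q < K + 1 by omega) (show j < K + 1 by omega) hidx, m4]

theorem swap_spec {S : ℕ} {a : Finset (Fin n) × (ℕ → ZMod 2)} (hn : s.reg rN = n)
    (hS : s.reg rS = S) (hK : s.reg rKp = K) (hKs : s.reg rKs = K + 1) (hcur : CurMem s K it)
    (ha : SlotMem s K S (some a)) (hB : (S + 1) * n ≤ B) (hB' : (S + 1) * (K + 1) ≤ B)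
    (h1 : 2 ≤ B) :
    Runs B (block [swapArr aX aSX rN rN, swapArr aU aSU rKp rKs]) s
      (60 * (n + K + 1)) fun s' => CurMem s' K a ∧ SlotMem s' K S (some it) ∧
        ∀ idx ≠ S, SlotSame n K idx s s' := by
  refine Runs.seq (swapArr_spec (by decide) (by decide) (by decide) hn hn hS le_rfl hB (by omega))
    (T₂ := 30 * (K + 1)) ?_ (by omega)
  rintro s1 ha1 ⟨c1, c2⟩
  refine (swapArr_spec (S := S) (l := K) (M := K + 1) (by decide) (by decide) (by decide)
    ((ha1.reg _ rfl).trans hK) ((ha1.reg _ rfl).trans hKs) ((ha1.reg _ rfl).trans hS) (by omega)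
    hB' (by omega)).mono le_rfl ?_
  rintro s2 ha2 ⟨c3, c4⟩
  have m2 := ha1.mem aU rfl
  have m3 := ha1.mem aUsed rfl
  have m4 := ha1.mem aSU rfl
  have k1 := ha2.mem aX rfl
  have k3 := ha2.mem aUsed rfl
  have k4 := ha2.mem aSX rfl
  rw [m2, m4] at c3
  rw [m4] at c4
  refine ⟨⟨fun u => ?_, fun q hq => ?_⟩, ⟨?_, fun u => ?_, fun q hq => ?_⟩, fun idx hidx =>
    ⟨?_, fun i hi => ?_, fun q hq => ?_⟩⟩
  · rw [k1, Nat.zero_add, (c1 u u.2).1]; exact ha.2.1 u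
  · rw [(c3 q hq).1]; exact ha.2.2 q hq
  · rw [k3, m3]; exact ha.1
  · rw [k4, (c1 u u.2).2]; simpa using hcur.set u
  · rw [(c3 q hq).2]; exact hcur.vec q hq
  · rw [k3, m3]
  · rw [k4]; exact c2 _ fun j hj => idx_ne hi hj hidx
  · exact c4 _ fun j hj => idx_ne (show q < K + 1 by omega) (show j < K + 1 by omega) hidx

/-- If the current vector has the entry 1 at `p`, the better of the two competing sets stays in slot
`p` and the worse one goes on in the buffer. If the slot is empty, the set is copied there. In
either case the slot is then added to the buffer. -/
theorem reduceStep_spec (hn : s.reg rN = n) (hw : ∀ u : Fin n, s.wt 0 u = w u)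
    (hcell : s.reg rCell = cell) (hp : s.reg rP = p) (hpK : p < K) (hK : s.reg rKp = K)
    (hKs : s.reg rKs = K + 1) (hinv : BasisInv K r (key goal w) Z sl (some it) p)
    (hcur : CurMem s K it) (hsl : ∀ q < K, SlotMem s K (cell + q) (sl q))
    (hB : (cell + K + 1) * n ≤ B) (hB' : (cell + K + 1) * (K + 1) ≤ B) (hnB : n ≤ B) (h1 : 2 ≤ B) :
    Runs B (reduceStep goal) s (250 * (n + K + 1)) fun s' => ∃ sl' it',
      BasisInv K r (key goal w) Z sl' (some it') (p + 1) ∧ CurMem s' K it' ∧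
      (∀ q < K, SlotMem s' K (cell + q) (sl' q)) ∧ ∀ idx ≠ cell + p, SlotSame n K idx s s' := by
  have hle : cell + K + 1 ≤ B := le_trans (Nat.le_mul_of_pos_right _ (by omega)) hB'
  have hSn : (cell + p + 1) * n ≤ B := le_trans (Nat.mul_le_mul_right _ (by omega)) hB
  have hSK : (cell + p + 1) * (K + 1) ≤ B := le_trans (Nat.mul_le_mul_right _ (by omega)) hB'
  have hcp := hcur.vec p hpK
  refine Runs.ite (T := 240 * (n + K + 1)) (by simp [hp]; omega) ?_ ?_ (by simp; omega)
  swap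
  · intro h
    simp [hp, hcp] at h
    exact Runs.straight trivial ⟨sl, it, hinv.skip h, hcur, hsl, fun idx _ =>
      SlotSame.rfl' rfl rfl rfl⟩ (by simp [dur]; omega)
  intro h
  have hu1 : it.2 p = 1 := zmod_eq_one (by simpa [hp, hcp] using h)
  refine Runs.step (T₂ := 230 * (n + K + 1)) (by simp [safe, hcell, hp]; omega) ?_
    (by simp [dur]; omega)
  simp only [run, eval_add, eval_var, hcell, hp]
  set s0 := s.setReg rS (cell + p) with hs0
  have e0 : s0.reg rN = n := by simp [hs0, hn]
  have eS : s0.reg rS = cell + p := by simp [hs0]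
  have eK : s0.reg rKp = K := by simp [hs0, hK]
  have eKs : s0.reg rKs = K + 1 := by simp [hs0, hKs]
  have hcur0 : CurMem s0 K it := ⟨hcur.set, hcur.vec⟩
  have hsl0 : ∀ q < K, SlotMem s0 K (cell + q) (sl q) := fun q hq =>
    (hsl q hq).of_same (SlotSame.rfl' rfl rfl rfl)
  -- `b` is the pair that ends up in the slot and `c` the one in the buffer before the addition; if
  -- the slot was empty, both are `it`.
  refine Runs.seq (T₁ := 150 * (n + K + 1)) (T₂ := 30 * (K + 1)) (R := fun s' => ∃ b c,
    BasisInv K r (key goal w) Z (Function.update sl p (some b)) (some (c.1, c.2 + b.2)) (p + 1) ∧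
    CurMem s' K c ∧ SlotMem s' K (cell + p) (some b) ∧
    ∀ idx ≠ cell + p, SlotSame n K idx s s') ?_ ?_ (by omega)
  · refine Runs.ite (T := 140 * (n + K + 1)) (by simp [eS]; omega) ?_ ?_ (by simp; omega)
    · intro hused
      obtain ⟨a, ha⟩ : ∃ a, sl p = some a := by
        rcases hslp : sl p with _ | a
        · have := hsl0 p hpK
          rw [hslp] at this
          exact absurd (show s0.mem aUsed (cell + p) = 0 from this) (by simpa [eS] using hused)
        · exact ⟨a, rfl⟩
      have hslot := hsl0 p hpK
      rw [ha] at hslot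
      refine Runs.seq (compare_spec (goal := goal) (w := w) e0 (by simpa [hs0] using hw) eS
        hcur0.set hslot.2.1 hSn hnB (by omega)) (T₂ := 70 * (n + K + 1)) ?_ (by omega)
      intro s1 ha1 hcmp
      have hm : ∀ a, s1.mem a = s0.mem a := fun a => ha1.mem a (by
        cases goal <;> simp [compare, block, writesM, forLoop])
      have hr : ∀ x, x = rN ∨ x = rS ∨ x = rKp ∨ x = rKs → s1.reg x = s0.reg x := fun x hx =>
        ha1.reg x (by rcases hx with rfl | rfl | rfl | rfl <;>
          cases goal <;> simp [compare, block, writesR, forLoop])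
      have hcur1 : CurMem s1 K it := ⟨fun u => by rw [hm]; exact hcur0.set u, fun q hq => by
        rw [hm]; exact hcur0.vec q hq⟩
      have hslot1 := hslot.of_same (SlotSame.rfl' (s := s0) (s' := s1) (hm _) (hm _) (hm _))
      refine Runs.ite (T := 60 * (n + K + 1)) (fits_swapTest h1) ?_ ?_ (by simp [swapTest]; omega)
      · intro hc
        have hle2 : key goal w a.1 ≤ key goal w it.1 := by
          exact hcmp.1 (eval_swapTest.1 hc)
        refine (swap_spec ((hr _ (by simp)).trans e0) ((hr _ (by simp)).trans eS)
          ((hr _ (by simp)).trans eK) ((hr _ (by simp)).trans eKs) hcur1 hslot1 hSn hSK h1).mono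
          le_rfl ?_
        rintro s2 ha2 ⟨k1, k2, k3⟩
        exact ⟨it, a, hinv.eliminate (key_injective _ _) hpK hu1 ha (Or.inr ⟨rfl, rfl⟩) hle2,
          k1, k2, fun idx hidx => (SlotSame.rfl' (s := s) (s' := s1) (hm _) (hm _) (hm _)).trans (k3 idx hidx)⟩
      · intro hc
        have hle2 : key goal w it.1 ≤ key goal w a.1 := by
          exact (not_le.1 fun h => eval_swapTest.2 (hcmp.2 h) hc).le
        refine Runs.straight trivial ?_ (by simp [dur]; omega)
        exact ⟨a, it, hinv.eliminate (key_injective _ _) hpK hu1 ha (Or.inl ⟨rfl, rfl⟩) hle2,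
          hcur1, hslot1, fun idx hidx => SlotSame.rfl' (s := s) (s' := s1) (hm _) (hm _) (hm _)⟩
    · intro hused
      have hnone : sl p = none := by
        rcases hslp : sl p with _ | a
        · rfl
        · have := hsl0 p hpK
          rw [hslp] at this
          have h2 := this.1
          simp [eS, h2] at hused
      refine (fill_spec e0 eS eK eKs hcur0 hSn hSK (by omega) h1).mono (by omega) ?_
      rintro s2 ha2 ⟨k1, k2, k3⟩
      exact ⟨it, it, hinv.fill hpK hu1 hnone, k1, k2, fun idx hidx =>
        (SlotSame.rfl' (s := s) (s' := s0) rfl rfl rfl).trans (k3 idx hidx)⟩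
  · rintro s1 ha1 ⟨b, c, hinv1, hcur1, hslot1, hsame1⟩
    have hr : ∀ x, x = rS ∨ x = rKp ∨ x = rKs → s1.reg x = s0.reg x := fun x hx =>
        ha1.reg x (by rcases hx with rfl | rfl | rfl <;>
          cases goal <;> simp [compare, block, writesR, forLoop, swapArr, copyArr])
    have f1 := (hr rS (by simp)).trans eS
    have f2 := (hr rKp (by simp)).trans eK
    have f3 := (hr rKs (by simp)).trans eKs
    refine (Runs.for (N := K) (Tb := 18) (fun k s' =>
      (∀ q < k, s'.mem aU q = ((c.2 + b.2) q).val) ∧ (∀ q < K, k ≤ q → s'.mem aU q = (c.2 q).val))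
      f2 (by omega) (by omega) (by simpa using hcur1.vec) ?_ ?_).mono le_rfl ?_
    · rintro i hi s2 hx2 ha2 ⟨i1, i2⟩
      have g1 := (ha2.reg rS rfl).trans f1
      have g3 := (ha2.reg rKs rfl).trans f3
      have gm := ha2.mem aSU rfl
      have hidx := idx_lt (show cell + p < cell + p + 1 by omega) (show i < K + 1 by omega)
      have v1 := i2 i hi le_rfl
      have v2 := hslot1.2.2 i hi
      have v3 := zmod_val_le (c.2 i)
      have v4 := zmod_val_le (b.2 i)
      refine Runs.straight ?_ ?_ (by decide)
      · simp [safe, g1, g3, hx2, gm, v1, v2]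
        constructorm* _ ∧ _ <;> omega
      · simp only [run, eval_mod, eval_add, eval_get, eval_mul, eval_var, eval_ofNat, g1, g3, hx2, gm,
          v1, v2, setReg_mem, setMem_mem, true_and]
        refine ⟨fun q hq => ?_, fun q hq hiq => ?_⟩
        · by_cases hqi : q = i
          · subst hqi; simp [ZMod.val_add]
          · simp [hqi]; exact i1 q (by omega)
        · rw [if_neg (by omega)]; exact i2 q hq (by omega)
    · omega
    · rintro s2 ha2 ⟨i1, -⟩
      have gm := ha2.mem aX rfl
      have gm1 := ha2.mem aUsed rfl
      have gm2 := ha2.mem aSX rfl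
      have gm3 := ha2.mem aSU rfl
      have hsame2 : ∀ idx ≠ cell + p, SlotSame n K idx s s2 := fun idx hidx =>
        (hsame1 idx hidx).trans (SlotSame.rfl' gm1 gm2 gm3)
      refine ⟨_, _, hinv1, ⟨fun u => by rw [gm]; exact hcur1.set u, i1⟩, fun q hq => ?_, hsame2⟩
      by_cases hqp : q = p
      · subst hqp
        rw [Function.update_self]
        exact hslot1.of_same (SlotSame.rfl' gm1 gm2 gm3)
      · rw [Function.update_of_ne hqp]
        exact (hsl q hq).of_same (hsame2 _ (by omega))

theorem reduce_spec {X : Finset (Fin n)} (hn : s.reg rN = n) (hw : ∀ u : Fin n, s.wt 0 u = w u)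
    (hcell : s.reg rCell = cell) (hK : s.reg rKp = K)
    (hKs : s.reg rKs = K + 1) (hinv : BasisInv K r (key goal w) Z sl none 0)
    (hX : s.HoldsSet aX 0 X) (hU : ∀ q < K, s.mem aU q = (r X q).val)
    (hsl : ∀ q < K, SlotMem s K (cell + q) (sl q))
    (hB : (cell + K + 1) * n ≤ B) (hB' : (cell + K + 1) * (K + 1) ≤ B) (hnB : n ≤ B) (h1 : 2 ≤ B) :
    Runs B (reduce goal) s (260 * ((K + 1) * (n + K + 1))) fun s' => ∃ sl',
      BasisInv K r (key goal w) (insert X Z) sl' none 0 ∧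
      (∀ q < K, SlotMem s' K (cell + q) (sl' q)) ∧
      ∀ idx, (∀ q < K, idx ≠ cell + q) → SlotSame n K idx s s' := by
  have hle : cell + K + 1 ≤ B := le_trans (Nat.le_mul_of_pos_right _ (by omega)) hB'
  refine (Runs.for (N := K) (Tb := 250 * (n + K + 1)) (fun p s' => ∃ sl' it',
      BasisInv K r (key goal w) (insert X Z) sl' (some it') p ∧ CurMem s' K it' ∧
      (∀ q < K, SlotMem s' K (cell + q) (sl' q)) ∧
      ∀ idx, (∀ q < K, idx ≠ cell + q) → SlotSame n K idx s s')
      hK (by omega) (by omega) ?_ ?_ ?_ (by cases goal <;> rfl) (by cases goal <;> rfl)).mono le_rfl ?_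
  · exact ⟨sl, (X, r X), hinv.start X, ⟨hX, hU⟩, fun q hq => (hsl q hq).of_same
      (SlotSame.rfl' rfl rfl rfl), fun _ _ => SlotSame.rfl' rfl rfl rfl⟩
  · rintro p hp s1 hx1 ha1 ⟨sl', it', k1, k2, k3, k4⟩
    have hr : ∀ x, x = rN ∨ x = rCell ∨ x = rKp ∨ x = rKs → s1.reg x = s.reg x := fun x hx =>
        ha1.reg x (by rcases hx with rfl | rfl | rfl | rfl <;> cases goal <;> rfl)
    have hw1 := ha1.wt 0 (by cases goal <;> rfl)
    refine (reduceStep_spec (w := w) ((hr _ (by simp)).trans hn) (by rw [hw1]; exact hw)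
      ((hr _ (by simp)).trans hcell) hx1 hp ((hr _ (by simp)).trans hK)
      ((hr _ (by simp)).trans hKs) k1 k2 k3 hB hB' hnB h1).mono le_rfl ?_
    rintro s2 ha2 ⟨sl2, it2, j1, j2, j3, j4⟩
    exact ⟨sl2, it2, j1, ⟨j2.set, j2.vec⟩, fun q hq => (j3 q hq).of_same
      (SlotSame.rfl' rfl rfl rfl), fun idx hidx => ((k4 idx hidx).trans
        (j4 idx (hidx p hp))).trans (SlotSame.rfl' rfl rfl rfl)⟩
  · nlinarith
  · rintro s' - ⟨sl', it', k1, k2, k3, k4⟩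
    exact ⟨sl', k1.finish, k3, k4⟩

end Reduce

/-! ### Inserting a set into a cell -/

/-- Insert the set in `aX` into the cell that starts at slot `rCell`. -/
def insertSet (goal : Goal) : Prog := block [label, Prog.ite (equ (var rAnc) (var rN))
  (block [assign rS (var rCell + var rKp), copyArr aX aSX rN rN, store aUsed (var rS) 1])
  (block [rowAll, reduce goal])]

section Insert

variable {n : ℕ} (G : SimpleGraph (Fin n)) (w : Fin n → ℚ) (goal : Goal)

/-- The cell that starts at slot `cell` has a basis for the nonempty sets in `Z` in its first `K`
slots, and the empty set in one more slot if it belongs to `Z`. -/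
structure CellInv (L : ℕ → Fin n → ℕ) (k : ℕ) (s : State) (cell : ℕ)
    (Z : Set (Finset (Fin n))) : Prop where
  basis : ∃ sl, BasisInv (k * k) (row G L k) (key goal w) (Z \ {∅}) sl none 0 ∧
    ∀ q < k * k, SlotMem s (k * k) (cell + q) (sl q)
  used : ∅ ∈ Z → s.mem aUsed (cell + k * k) = 1 ∧
    s.HoldsSet aSX ((cell + k * k) * n) (∅ : Finset (Fin n))
  unused : ∅ ∉ Z → s.mem aUsed (cell + k * k) = 0

/-- The input and the registers that describe the layout of the current cells. -/
structure Env (k st : ℕ) (s : State) : Prop where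
  reg_n : s.reg rN = n
  adj : ∀ u v : Fin n, s.mem aAdj (u * n + v) = adj G u v
  w : ∀ u : Fin n, s.wt 0 u = w u
  stC : s.reg rStC = st
  ko : s.reg rKo = k
  kp : s.reg rKp = k * k
  ks : s.reg rKs = k * k + 1

variable {G w goal}

theorem CellInv.of_same {L : ℕ → Fin n → ℕ} {k cell : ℕ} {s s' : State} {Z : Set (Finset (Fin n))}
    (h : CellInv G w goal L k s cell Z) (hs : ∀ q ≤ k * k, SlotSame n (k * k) (cell + q) s s') :
    CellInv G w goal L k s' cell Z := by
  obtain ⟨⟨sl, h1, h2⟩, h3, h4⟩ := h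
  have hK := hs (k * k) le_rfl
  exact ⟨⟨sl, h1, fun q hq => (h2 q hq).of_same (hs q hq.le)⟩,
    fun h => ⟨hK.used.trans (h3 h).1, hK.holdsSet (h3 h).2⟩, fun h => hK.used.trans (h4 h)⟩

theorem CellInv.empty {L : ℕ → Fin n → ℕ} {k cell : ℕ} {s : State}
    (h : ∀ q ≤ k * k, s.mem aUsed (cell + q) = 0) : CellInv G w goal L k s cell ∅ :=
  ⟨⟨fun _ => none, by simpa using BasisInv.empty, fun q hq => h q hq.le⟩, fun h => h.elim, fun _ => h _ le_rfl⟩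

/-- The empty set has no vertex to anchor cuts at, so the functionals of `exists_functional` say
nothing about it. It gets a slot of its own after the `k * k` slots of the basis. -/
theorem insertSet_spec {B k st cell : ℕ} {X : Finset (Fin n)} {Z : Set (Finset (Fin n))} {s : State}
    (he : Env G w k st s) (hcell : s.reg rCell = cell)
    (hinv : CellInv G w goal (fun i => s.vec (st + i)) k s cell Z)
    (hX : s.HoldsSet aX 0 X) (hB : (cell + k * k + 1) * n ≤ B)
    (hB' : (cell + k * k + 1) * (k * k + 1) ≤ B) (hst : (st + k) * n ≤ B) (hst' : st + k ≤ B)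
    (hnB : n * n ≤ B) (h1 : 2 ≤ B) :
    Runs B (insertSet goal) s
      (100 * ((n + 1) * (n + 1)) + 450 * ((k * k + 1) * (n + k * k + 1))) fun s' =>
      CellInv G w goal (fun i => s.vec (st + i)) k s' cell (insert X Z) ∧
      ∀ idx, (∀ q ≤ k * k, idx ≠ cell + q) → SlotSame n (k * k) idx s s' := by
  have hnB' : n ≤ B := le_trans (Nat.le_mul_self n) hnB
  have hle : cell + k * k + 1 ≤ B := le_trans (Nat.le_mul_of_pos_right _ (by omega)) hB'
  refine Runs.seq (label_spec he.reg_n he.adj hX hnB (by omega))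
    (T₂ := 450 * ((k * k + 1) * (n + k * k + 1))) ?_ le_rfl
  rintro s1 ha1 ⟨lab, hlab, hl, hanc⟩
  have e0 := (ha1.reg rN rfl).trans he.reg_n
  have e1 := (ha1.reg rCell rfl).trans hcell
  have e2 := (ha1.reg rKp rfl).trans he.kp
  have e3 := (ha1.reg rKs rfl).trans he.ks
  have e4 := (ha1.reg rStC rfl).trans he.stC
  have e5 := (ha1.reg rKo rfl).trans he.ko
  have hw : ∀ u : Fin n, s1.wt 0 u = w u := fun u => (congrFun (ha1.wt 0 rfl) u).trans (he.w u)
  have hv : s1.mem aVec = s.mem aVec := ha1.mem aVec rfl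
  have hX1 : s1.HoldsSet aX 0 X := fun u => by rw [ha1.mem aX rfl]; exact hX u
  have hsame : ∀ idx, SlotSame n (k * k) idx s s1 := fun idx =>
    SlotSame.rfl' (ha1.mem _ rfl) (ha1.mem _ rfl) (ha1.mem _ rfl)
  have hinv1 := hinv.of_same (s' := s1) fun q _ => hsame _
  have hmul : n + k * k + 1 ≤ (k * k + 1) * (n + k * k + 1) := Nat.le_mul_of_pos_left _ (by omega)
  refine Runs.ite (T := 440 * ((k * k + 1) * (n + k * k + 1)))
    (by simp; exact ite_le (by omega)) ?_ ?_ (by simp; omega)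
  · intro h
    have hXe : X = ∅ := by
      by_contra hne
      rw [if_neg hne] at hanc
      obtain ⟨u, hu, hsup⟩ := exists_sup_eq (Finset.nonempty_iff_ne_empty.2 hne)
      have := u.2
      simp [hanc, e0] at h
      omega
    subst hXe
    refine Runs.step (T₂ := 30 * (n + 1)) (by simp [safe, e1, e2]; omega) ?_ (by simp [dur]; omega)
    simp only [run, eval_add, eval_var, e1, e2]
    refine Runs.seq (copyArr_spec (S := cell + k * k) (l := n) (M := n) (by decide) (by decide)
      (by decide) (by simp [e0]) (by simp [e0]) (by simp) le_rfl hB (by omega)) (T₂ := 5) ?_ (by omega)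
    rintro s2 ha2 ⟨c1, c2⟩
    have f := ha2.reg rS rfl
    have m1 := ha2.mem aUsed rfl
    have m2 := ha2.mem aSU rfl
    simp only [setReg_reg, setReg_mem, if_true] at f m1 m2 c1 c2
    refine Runs.straight (by simp [safe, f]; omega) ?_ (by decide)
    have hsm : ∀ idx ≠ cell + k * k, SlotSame n (k * k) idx s1 ((store aUsed (var rS) 1).run s2) := by
      intro idx hidx
      refine ⟨by simp [run, f, hidx, m1], fun i hi => ?_, by simp [run, m2]⟩
      simp [run]; exact c2 _ fun j hj => idx_ne hi hj hidx
    refine ⟨⟨?_, fun _ => ⟨by simp [run, f], fun u => ?_⟩, fun h => absurd (Set.mem_insert _ _) h⟩,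
      fun idx hidx => (hsame idx).trans (hsm idx (hidx _ le_rfl))⟩
    · obtain ⟨sl, h1, h2⟩ := hinv1.basis
      refine ⟨sl, by simpa using h1, fun q hq => (h2 q hq).of_same (hsm _ (by omega))⟩
    · simp [run, c1 u u.2]; simpa using hX1 u
  · intro h
    have hXe : X ≠ ∅ := by
      rintro rfl
      simp [hanc, e0] at h
    rw [if_neg hXe] at hanc
    refine Runs.seq (rowAll_spec e0 hX1 hlab hl hanc e4 e5 e2 hst hst' (by omega) hnB' h1)
      (T₂ := 260 * ((k * k + 1) * (n + k * k + 1))) ?_ ?_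
    · intro s2 ha2 hU
      have hsm : ∀ idx, SlotSame n (k * k) idx s1 s2 := fun idx =>
        SlotSame.rfl' (ha2.mem _ rfl) (ha2.mem _ rfl) (ha2.mem _ rfl)
      have hrow : row G (fun i => s1.vec (st + i)) k = row G (fun i => s.vec (st + i)) k := by
        congr 1; funext i u; simp only [State.vec, hv]
      rw [hrow] at hU
      obtain ⟨sl, k1, k2⟩ := hinv1.basis
      have hw2 : ∀ u : Fin n, s2.wt 0 u = w u := fun u => (congrFun (ha2.wt 0 rfl) u).trans (hw u)
      refine (reduce_spec (goal := goal) (w := w) ((ha2.reg _ rfl).trans e0) hw2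
        ((ha2.reg _ rfl).trans e1)
        ((ha2.reg _ rfl).trans e2) ((ha2.reg _ rfl).trans e3) k1
        (X := X) (fun u => by rw [ha2.mem aX rfl]; exact hX1 u) hU
        (fun q hq => (k2 q hq).of_same (hsm _)) hB hB' hnB' h1).mono le_rfl ?_
      rintro s3 ha3 ⟨sl', j1, j2, j3⟩
      have hsm3 : ∀ idx, (∀ q < k * k, idx ≠ cell + q) → SlotSame n (k * k) idx s1 s3 :=
        fun idx hidx => (hsm idx).trans (j3 idx hidx)
      have hK := hsm3 (cell + k * k) fun q hq => by omega
      refine ⟨⟨⟨sl', ?_, j2⟩, fun h => ?_, fun h => ?_⟩, fun idx hidx =>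
        (hsame idx).trans (hsm3 idx fun q hq => hidx q hq.le)⟩
      · rwa [Set.insert_sdiff_of_notMem _ (by simpa using hXe)]
      · have h := hinv1.used (h.resolve_left hXe.symm)
        exact ⟨hK.used.trans h.1, hK.holdsSet h.2⟩
      · exact hK.used.trans (hinv1.unused fun h' => h (Or.inr h'))
    · have : (k * k + 1) * (n + 1) ≤ (k * k + 1) * (n + k * k + 1) :=
        Nat.mul_le_mul_left _ (by omega)
      omega

end Insert

/-! ### Partial solutions, their exchange and the invariant of a table. -/

/-! ### Partial solutions -/

section Solutions

/-- From `domDepth μ` on, a finite set contains no number and a cofinite set contains every number,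
so all counts from `d` on behave alike. -/
theorem mem_min_iff {μ : Set ℕ} (hf : μ.Finite ∨ μᶜ.Finite) {d : ℕ} (hd : domDepth μ ≤ d) (c : ℕ) :
    min d c ∈ μ ↔ c ∈ μ := by
  rcases le_total c d with h | h
  · rw [min_eq_right h]
  rw [min_eq_left h]
  unfold domDepth at hd
  split_ifs at hd with h1 h2
  · simp [h1]
  · have : ∀ x, d ≤ x → x ∉ μ := fun x hx hm => by
      have := le_csSup h2.bddAbove hm
      omega
    simp [this d le_rfl, this c h]
  · have : ∀ x, d ≤ x → x ∈ μ := fun x hx => by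
      by_contra hm
      have := le_csSup (hf.resolve_left h2).bddAbove (show x ∈ μᶜ from hm)
      omega
    simp [this d le_rfl, this c h]

variable {n : ℕ} (G : SimpleGraph (Fin n)) (σ ρ : Set ℕ)

/-- The condition on a vertex inside, respectively outside, of the set `X`. -/
def target (X : Finset (Fin n)) (u : Fin n) : Set ℕ := if u ∈ X then ρ else σ

/-- The complement of `X` dominates. -/
def CoDominates (X : Finset (Fin n)) : Prop := ∀ u, deg G u Xᶜ ∈ target σ ρ X u

/-- The dominating set is the complement of `X`, so it is the vertices of `X` that are tested
against ρ. -/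
theorem isConnectedCoDom_iff {X : Finset (Fin n)} : IsConnectedCoDom G σ ρ X ↔
    (G.induce (X : Set (Fin n))).Connected ∧ CoDominates G σ ρ X := by
  refine and_congr_right fun _ => ?_
  have h : ∀ u, (G.neighborSet u ∩ (X : Set (Fin n))ᶜ).ncard = deg G u Xᶜ := fun u => by
    rw [← ncard_neighborSet_inter, Finset.coe_compl, Set.inter_comm]
  constructor
  · intro hd u
    obtain ⟨h1, h2⟩ := hd u trivial
    rw [h] at h1 h2
    unfold target
    split_ifs with hu
    · exact h2 fun h => h (by simpa using hu)
    · exact h1 (by simpa using hu)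
  · intro hd u _
    have := hd u
    rw [h]
    unfold target at this
    split_ifs at this with hu
    · exact ⟨fun h => absurd (by simpa using hu) h, fun _ => this⟩
    · exact ⟨fun _ => this, fun h => absurd (by simpa using hu) h⟩

/-- `X` is the part inside `A` of a set whose complement has class `f` inside `A` and class `g`
outside of `A`, and satisfies all conditions on the vertices of `A`. -/
structure Sol (d : ℕ) (A : Finset (Fin n)) (f g : Fin n → ℕ) (X : Finset (Fin n)) : Prop where
  sub : X ⊆ A
  cls : classVec G d A (A \ X) = f
  dom : ∀ u ∈ A, min d (deg G u (A \ X) + g u) ∈ target σ ρ X u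

variable {G σ ρ} {d : ℕ} {A : Finset (Fin n)}

theorem target_congr {X Y : Finset (Fin n)} {u : Fin n} (h : u ∈ X ↔ u ∈ Y) :
    target σ ρ X u = target σ ρ Y u := by
  simp only [target, h]

theorem target_min (hσ : σ.Finite ∨ σᶜ.Finite) (hρ : ρ.Finite ∨ ρᶜ.Finite)
    (hdσ : domDepth σ ≤ d) (hdρ : domDepth ρ ≤ d) {X : Finset (Fin n)} {u : Fin n} {c : ℕ} :
    min d c ∈ target σ ρ X u ↔ c ∈ target σ ρ X u := by
  unfold target
  split_ifs
  · exact mem_min_iff hρ hdρ c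
  · exact mem_min_iff hσ hdσ c

/-- The degree into the complement of `D` is the sum of a part inside `A`, which is known exactly,
and a part outside, known only up to truncation at `d`. For vertices of `A` this is enough by
`target_min`. -/
theorem Sol.of_coDominates (hσ : σ.Finite ∨ σᶜ.Finite) (hρ : ρ.Finite ∨ ρᶜ.Finite)
    (hdσ : domDepth σ ≤ d) (hdρ : domDepth ρ ≤ d) {D : Finset (Fin n)} (h : CoDominates G σ ρ D) :
    Sol G σ ρ d A (classVec G d A (A \ D)) (classVec G d Aᶜ (Aᶜ \ D)) (D ∩ A) := by
  have hAD : A \ (D ∩ A) = A \ D := by ext; simp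
  refine ⟨Finset.inter_subset_right, by rw [hAD], fun u hu => ?_⟩
  rw [target_congr (show u ∈ D ∩ A ↔ u ∈ D by simp [hu]), hAD,
    ← target_min hσ hρ hdσ hdρ]
  have h1 : Dᶜ = (A \ D) ∪ (Aᶜ \ D) := by ext; simp; tauto
  have h2 : Disjoint (A \ D) (Aᶜ \ D) := by
    rw [Finset.disjoint_left]; simp; tauto
  have := (target_min hσ hρ hdσ hdρ).2 (h u)
  rw [h1, deg_union G h2] at this
  convert this using 1
  simp [classVec, hu]
  omega

/-- For a vertex of `A` the outer class of `D` is the one that `X` was prepared for. A vertex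
outside of `A` only notices the class of `A \ X`, which is that of `A \ D`. -/
theorem Sol.exchange (hσ : σ.Finite ∨ σᶜ.Finite) (hρ : ρ.Finite ∨ ρᶜ.Finite)
    (hdσ : domDepth σ ≤ d) (hdρ : domDepth ρ ≤ d) {D X : Finset (Fin n)} (h : CoDominates G σ ρ D)
    (hX : Sol G σ ρ d A (classVec G d A (A \ D)) (classVec G d Aᶜ (Aᶜ \ D)) X) :
    CoDominates G σ ρ (X ∪ D \ A) := by
  intro u
  have h1 : (X ∪ D \ A)ᶜ = (A \ X) ∪ (Aᶜ \ D) := by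
    ext v; have := @hX.sub v; simp; tauto
  have h2 : Disjoint (A \ X) (Aᶜ \ D) := by
    rw [Finset.disjoint_left]; simp; tauto
  have h3 : Dᶜ = (A \ D) ∪ (Aᶜ \ D) := by ext; simp; tauto
  have h4 : Disjoint (A \ D) (Aᶜ \ D) := by
    rw [Finset.disjoint_left]; simp; tauto
  rw [← target_min hσ hρ hdσ hdρ, h1, deg_union G h2]
  by_cases hu : u ∈ A
  · have := hX.dom u hu
    rw [target_congr (show u ∈ X ∪ D \ A ↔ u ∈ X by simp [hu])]
    convert this using 1
    simp [classVec, hu]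
    omega
  · have h5 := (target_min hσ hρ hdσ hdρ).2 (h u)
    have h6 : u ∈ X ∪ D \ A ↔ u ∈ D := by
      have := @hX.sub u; simp [hu]; tauto
    rw [target_congr h6]
    rw [h3, deg_union G h4] at h5
    convert h5 using 1
    have h7 := congrFun hX.cls u
    simp only [classVec, hu, if_false] at h7
    omega

/-- Seen from `A`, the outside consists of `A'` and of the outside of `A ∪ A'`. So the outer class
of one child is the truncated sum of the outer class of the parent and the inner class of the other
child. -/
theorem Sol.join {A' : Finset (Fin n)} (hAA : Disjoint A A') {f f' g g' F E : Fin n → ℕ}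
    {X X' : Finset (Fin n)} (h : Sol G σ ρ d A f g X) (h' : Sol G σ ρ d A' f' g' X')
    (hg : ∀ u ∈ A, g u = min d (E u + f' u)) (hg' : ∀ u ∈ A', g' u = min d (E u + f u))
    (hF : ∀ u, F u = if u ∈ A ∪ A' then 0 else min d (f u + f' u)) :
    Sol G σ ρ d (A ∪ A') F E (X ∪ X') := by
  have hdisj := Finset.disjoint_left.1 hAA
  have h1 : (A ∪ A') \ (X ∪ X') = (A \ X) ∪ (A' \ X') := by
    ext v
    have a1 := @h.sub v
    have a2 := @h'.sub v
    have a3 := @hdisj v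
    simp; tauto
  have h2 : Disjoint (A \ X) (A' \ X') := by
    rw [Finset.disjoint_left]
    intro v hv hv'
    simp at hv hv'
    exact hdisj hv.1 hv'.1
  refine ⟨Finset.union_subset_union h.sub h'.sub, ?_, ?_⟩
  · funext u
    rw [hF, ← h.cls, ← h'.cls]
    by_cases hu : u ∈ A ∪ A'
    · simp [classVec, hu]
    · rw [h1, if_neg hu]
      simp only [Finset.mem_union, not_or] at hu
      exact classVec_union h2 hu.1 hu.2
  · intro u hu
    rw [h1, deg_union G h2]
    rcases Finset.mem_union.1 hu with hu | hu
    · have hu' := hdisj hu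
      have h3 := h.dom u hu
      have h4 := congrFun h'.cls u
      simp only [classVec, hu', if_false] at h4
      rw [target_congr (show u ∈ X ∪ X' ↔ u ∈ X by have := @h'.sub u; simp; tauto)]
      rw [hg u hu] at h3
      convert h3 using 1
      omega
    · have hu' : u ∉ A := fun h => hdisj h hu
      have h3 := h'.dom u hu
      have h4 := congrFun h.cls u
      simp only [classVec, hu', if_false] at h4
      rw [target_congr (show u ∈ X ∪ X' ↔ u ∈ X' by have := @h.sub u; simp; tauto)]
      rw [hg' u hu] at h3
      convert h3 using 1
      omega

end Solutions

/-! ### Tables -/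

section Table

variable {n : ℕ} (G : SimpleGraph (Fin n)) (σ ρ : Set ℕ) (w : Fin n → ℚ) (goal : Goal)

/-- An optimal solution, with ties broken. -/
def Best (D : Finset (Fin n)) : Prop := IsConnectedCoDom G σ ρ D ∧
  ∀ D', IsConnectedCoDom G σ ρ D' → key goal w D' ≤ key goal w D

variable {G σ ρ w goal} in
theorem Best.isOptimal {D : Finset (Fin n)} (h : Best G σ ρ w goal D) : IsOptimal goal G σ ρ w D := by
  refine ⟨h.1, fun D' hD' => ?_⟩
  have := (key_le_iff.1 (h.2 D' hD')).1
  cases goal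
  · exact this
  · simpa [Goal.value] using this

theorem exists_best {D : Finset (Fin n)} (h : IsConnectedCoDom G σ ρ D) :
    ∃ D', Best G σ ρ w goal D' := by
  classical
  obtain ⟨D', h1, h2⟩ := Finset.exists_max_image (Finset.univ.filter (IsConnectedCoDom G σ ρ))
    (key goal w) ⟨D, by simpa using h⟩
  exact ⟨D', by simpa using h1, fun D'' h'' => h2 D'' (by simpa using h'')⟩

/-- Slot number `idx` holds the set `X`. -/
def Holds (s : State) (idx : ℕ) (X : Finset (Fin n)) : Prop :=
  s.mem aUsed idx = 1 ∧ s.HoldsSet aSX (idx * n) X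

/-- The first slot of a cell of a table that starts at slot `base`. -/
def cellAt (base c₁ k t j : ℕ) : ℕ := base + (t * c₁ + j) * (k * k + 1)

/-- The table of a node of the tree.  `L₀` lists the classes over `A`, `L₁` and `L₂` those over the
complement. -/
structure TableInv (d : ℕ) (A : Finset (Fin n)) (L₀ : ℕ → Fin n → ℕ) (c₀ : ℕ)
    (L₁ : ℕ → Fin n → ℕ) (c₁ : ℕ) (L₂ : ℕ → Fin n → ℕ) (k : ℕ) (base : ℕ) (s : State) : Prop where
  sound : ∀ t < c₀, ∀ j < c₁, ∀ q ≤ k * k, s.mem aUsed (cellAt base c₁ k t j + q) = 0 ∨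
    ∃ X, Sol G σ ρ d A (L₀ t) (L₁ j) X ∧ Holds s (cellAt base c₁ k t j + q) X
  complete : ∀ D, Best G σ ρ w goal D → ∀ t < c₀, ∀ j < c₁, L₀ t = classVec G d A (A \ D) →
    L₁ j = classVec G d Aᶜ (Aᶜ \ D) → ∃ q ≤ k * k, (D ∩ A ≠ ∅ → q < k * k) ∧
      Holds s (cellAt base c₁ k t j + q) (D ∩ A)
  witness : ∀ t < c₀, ∀ j < c₁, ∀ q < k * k, s.mem aUsed (cellAt base c₁ k t j + q) ≠ 0 →
    ∃ X, Sol G σ ρ d A (L₀ t) (L₁ j) X ∧ X ≠ ∅ ∧ row G L₂ k X q ≠ 0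

variable {G σ ρ w goal}

/-- The three parts of the invariant come from the basis of each cell. Completeness for the best
solution `D` is the point: `D ∩ A` was inserted into its cell, and it is the best set there on which
the functional belonging to `D \ A` does not vanish, so the basis has kept it. -/
theorem TableInv.of_cells {d : ℕ} {A : Finset (Fin n)} {L₀ L₁ L₂ : ℕ → Fin n → ℕ}
    {c₀ c₁ k base : ℕ} {s : State} (hσ : σ.Finite ∨ σᶜ.Finite) (hρ : ρ.Finite ∨ ρᶜ.Finite)
    (hdσ : domDepth σ ≤ d) (hdρ : domDepth ρ ≤ d)
    (hL : ClassList G 1 Aᶜ Finset.univ L₂ k) {𝒵 : ℕ → Set (Finset (Fin n))}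
    (hcell : ∀ t < c₀, ∀ j < c₁,
      CellInv G w goal L₂ k s (cellAt base c₁ k t j) (𝒵 (t * c₁ + j)))
    (hsol : ∀ t < c₀, ∀ j < c₁, ∀ X ∈ 𝒵 (t * c₁ + j), Sol G σ ρ d A (L₀ t) (L₁ j) X)
    (hall : ∀ D, Best G σ ρ w goal D → ∀ t < c₀, ∀ j < c₁, L₀ t = classVec G d A (A \ D) →
      L₁ j = classVec G d Aᶜ (Aᶜ \ D) → D ∩ A ∈ 𝒵 (t * c₁ + j)) :
    TableInv G σ ρ w goal d A L₀ c₀ L₁ c₁ L₂ k base s := by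
  classical
  refine ⟨fun t ht j hj q hq => ?_, fun D hD t ht j hj h0 h1 => ?_, fun t ht j hj q hq hu => ?_⟩
  · obtain ⟨⟨sl, hb, hs⟩, he, hne⟩ := hcell t ht j hj
    rcases Nat.lt_or_eq_of_le hq with hq | rfl
    · have := hs q hq
      rcases hsl : sl q with _ | it
      · rw [hsl] at this; exact Or.inl this
      · rw [hsl] at this
        exact Or.inr ⟨it.1, hsol t ht j hj _ (hb.mem it (Or.inl ⟨q, hq, hsl⟩)).1,
          this.1, this.2.1⟩
    · by_cases h : ∅ ∈ 𝒵 (t * c₁ + j)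
      · exact Or.inr ⟨∅, hsol t ht j hj _ h, he h⟩
      · exact Or.inl (hne h)
  · obtain ⟨⟨sl, hb, hs⟩, he, hne⟩ := hcell t ht j hj
    have hmem := hall D hD t ht j hj h0 h1
    by_cases hDA : D ∩ A = ∅
    · rw [hDA] at hmem ⊢
      exact ⟨k * k, le_rfl, fun h => absurd rfl h, he hmem⟩
    have hdisj : Disjoint A (D \ A) := Finset.disjoint_sdiff
    obtain ⟨y, hy⟩ := exists_functional hdisj hL
    have hDD : D ∩ A ∪ D \ A = D := by ext; simp; tauto
    have hD1 := (isConnectedCoDom_iff G σ ρ).1 hD.1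
    obtain ⟨q, hq, u, hqu⟩ := hb.retained (key_injective goal w) (e := D ∩ A) ⟨hmem, hDA⟩ (y := y)
      (by
        rw [dot, hy _ Finset.inter_subset_right (Finset.nonempty_iff_ne_empty.2 hDA), hDD,
          if_pos hD1.1]
        exact one_ne_zero)
      -- A set of the same cell that becomes connected together with `D \ A` completes to a solution
      -- by exchange. Its key is at most that of `D`, and the common part `D \ A` cancels.
      (by
        rintro X ⟨hX, hXe⟩ hXd
        have hsX := hsol t ht j hj X hX
        rw [dot, hy _ hsX.sub (Finset.nonempty_iff_ne_empty.2 hXe)] at hXd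
        have hcon : (G.induce ((X ∪ D \ A : Finset (Fin n)) : Set (Fin n))).Connected := by
          by_contra hno
          rw [if_neg hno] at hXd
          exact hXd rfl
        rw [h0, h1] at hsX
        have := hD.2 _ ((isConnectedCoDom_iff G σ ρ).2
          ⟨hcon, hsX.exchange hσ hρ hdσ hdρ hD1.2⟩)
        nth_rewrite 2 [← hDD] at this
        rwa [key_union_le_iff (hdisj.mono_left hsX.sub)
          (hdisj.mono_left Finset.inter_subset_right)] at this)
    have := hs q hq
    rw [hqu] at this
    exact ⟨q, hq.le, fun _ => hq, this.1, this.2.1⟩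
  · obtain ⟨⟨sl, hb, hs⟩, -, -⟩ := hcell t ht j hj
    have := hs q hq
    rcases hsl : sl q with _ | it
    · rw [hsl] at this; exact absurd this hu
    · obtain ⟨X, hX, hr⟩ := hb.witness hq hsl
      exact ⟨X, hsol t ht j hj X hX.1, hX.2, hr⟩

/-- At the root all class vectors vanish, so every list has length one and the table consists of one
cell with one basis slot. -/
theorem ClassList.eq_one {t c : ℕ} {A : Finset (Fin n)} {L : ℕ → Fin n → ℕ}
    (h : ClassList G t A Finset.univ L c) (h0 : ∀ X ⊆ A, classVec G t A X = 0) :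
    c = 1 ∧ L 0 = 0 := by
  have h1 := h.one_le
  have hL : ∀ i < c, L i = 0 := fun i hi => by
    obtain ⟨X, hX, -, hLX⟩ := h.mem i hi
    rw [hLX, h0 X hX]
  refine ⟨le_antisymm (not_lt.1 fun hc => ?_) h1, hL 0 h1⟩
  have := h.inj 0 (by omega) 1 hc (by rw [hL 0 h1, hL 1 hc])
  omega

theorem classVec_univ {t : ℕ} (X : Finset (Fin n)) : classVec G t Finset.univ X = 0 := by
  funext u; simp [classVec]

theorem classVec_compl_univ {t : ℕ} (X : Finset (Fin n)) (hX : X ⊆ (Finset.univ : Finset (Fin n))ᶜ) :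
    classVec G t Finset.univᶜ X = 0 := by
  have : X = ∅ := by simpa using hX
  subst this
  funext u; simp [classVec, deg]

/-- If a solution exists, completeness puts the best one into the only basis slot. Conversely, an
occupied slot has a witness with nonzero vector, which is connected and satisfies all conditions, so
a solution exists. -/
theorem TableInv.root {d : ℕ} {L₀ L₁ L₂ : ℕ → Fin n → ℕ} {c₀ c₁ k base : ℕ} {s : State}
    (h : TableInv G σ ρ w goal d Finset.univ L₀ c₀ L₁ c₁ L₂ k base s) (hn : 0 < n)
    (hσ : σ.Finite ∨ σᶜ.Finite) (hρ : ρ.Finite ∨ ρᶜ.Finite)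
    (hdσ : domDepth σ ≤ d) (hdρ : domDepth ρ ≤ d)
    (h₀ : ClassList G d Finset.univ Finset.univ L₀ c₀)
    (h₁ : ClassList G d Finset.univᶜ Finset.univ L₁ c₁)
    (h₂ : ClassList G 1 Finset.univᶜ Finset.univ L₂ k) :
    (s.mem aUsed base = 0 ∧ ∀ D : Finset (Fin n), ¬ IsConnectedCoDom G σ ρ D) ∨
      (s.mem aUsed base = 1 ∧ ∃ D : Finset (Fin n), IsOptimal goal G σ ρ w D ∧
        s.HoldsSet aSX (base * n) D) := by
  obtain ⟨rfl, hL0⟩ := h₀.eq_one fun X _ => classVec_univ X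
  obtain ⟨rfl, hL1⟩ := h₁.eq_one classVec_compl_univ
  obtain ⟨rfl, hL2⟩ := h₂.eq_one classVec_compl_univ
  have hcell : ∀ q, cellAt base 1 1 0 0 + q = base + q := fun q => by simp [cellAt]
  have key : ∀ D : Finset (Fin n), IsConnectedCoDom G σ ρ D → s.mem aUsed base = 1 ∧
      ∃ D : Finset (Fin n), IsOptimal goal G σ ρ w D ∧ s.HoldsSet aSX (base * n) D := by
    intro D hD
    obtain ⟨D', hD'⟩ := exists_best G σ ρ w goal hD
    obtain ⟨q, -, hq, hh⟩ := h.complete D' hD' 0 one_pos 0 one_pos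
      (by rw [hL0, classVec_univ]) (by rw [hL1, classVec_compl_univ _ Finset.sdiff_subset])
    have hne : D' ≠ ∅ := by
      rintro rfl
      obtain ⟨⟨x, hx⟩⟩ := hD'.1.1.nonempty
      simp at hx
    have hq0 : q = 0 := by simpa using hq (by simpa using hne)
    subst hq0
    rw [hcell, Finset.inter_univ] at hh
    exact ⟨hh.1, D', hD'.isOptimal, hh.2⟩
  by_cases hu : s.mem aUsed base = 0
  · refine Or.inl ⟨hu, fun D hD => ?_⟩
    have := (key D hD).1
    omega
  · obtain ⟨X, hX, hXe, hr⟩ := h.witness 0 one_pos 0 one_pos 0 (by simp) (by rwa [hcell])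
    obtain ⟨y, hy⟩ := exists_functional (Y := ∅) (Finset.disjoint_empty_right Finset.univ) h₂
    -- A single vertex induces a connected graph, so the functional is not zero, and a nonzero
    -- vector means connectedness.
    have hy0 : y 0 ≠ 0 := by
      intro h0
      have := hy {⟨0, hn⟩} (Finset.subset_univ _) (Finset.singleton_nonempty _)
      rw [if_pos] at this
      · simp [h0] at this
      · rw [Finset.union_empty, Finset.coe_singleton]
        exact SimpleGraph.Connected.mk (SimpleGraph.Preconnected.of_subsingleton)
    have hcon := hy X (Finset.subset_univ _) (Finset.nonempty_iff_ne_empty.2 hXe)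
    refine Or.inr (key X ((isConnectedCoDom_iff G σ ρ).2 ⟨?_, fun u => ?_⟩))
    · by_contra hno
      rw [Finset.union_empty, if_neg hno] at hcon
      simp [hy0, hr] at hcon
    · have := hX.dom u (Finset.mem_univ u)
      rw [hL1] at this
      simp only [Pi.zero_apply, Nat.add_zero] at this
      rwa [target_min hσ hρ hdσ hdρ, ← Finset.compl_eq_univ_sdiff] at this

end Table

/-! ### Filling the tables of leaves and of inner nodes. -/

/-! ### Filling the table of a node -/

/-- A for-loop that accumulates a growing quantity. -/
theorem Runs.forAcc {α : Type} [Preorder α] {B : ℕ} {x y : ℕ} {p : Prog} {s : State} {N Tb T : ℕ}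
    {a : α} (P : α → State → Prop) (Φ : ℕ → α → Prop) (hΦ : ∀ i b b', b ≤ b' → Φ i b → Φ i b')
    (hN : s.reg y = N) (hB : N ≤ B) (h1 : 1 ≤ B) (h0 : P a s)
    (hP : ∀ b s v, P b s → P b (s.setReg x v))
    (hs : ∀ i < N, ∀ b s1, s1.reg x = i → Agree (forLoop x y p) s s1 → P b s1 →
      Runs B p s1 Tb (fun s2 => ∃ b', b ≤ b' ∧ P b' s2 ∧ Φ i b'))
    (hT : N * (Tb + 7) + 5 ≤ T)
    (hxp : p.writesR x = false) (hy : p.writesR y = false) (hxy : x ≠ y) :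
    Runs B (forLoop x y p) s T (fun s' => ∃ b, a ≤ b ∧ P b s' ∧ ∀ i < N, Φ i b) := by
  refine Runs.for (fun m s' => ∃ b, a ≤ b ∧ P b s' ∧ ∀ i < m, Φ i b) hN hB h1
    ⟨a, le_rfl, hP _ _ _ h0, by simp⟩ ?_ hT hxp hy hxy
  rintro i hi s1 hx1 ha1 ⟨b, hab, hb, hΦb⟩
  refine (hs i hi b s1 hx1 ha1 hb).mono le_rfl ?_
  rintro s2 - ⟨b', hbb, hb', h⟩
  refine ⟨b', hab.trans hbb, hP _ _ _ hb', fun j hj => ?_⟩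
  rcases Nat.lt_or_eq_of_le (Nat.lt_succ_iff.1 hj) with hj | rfl
  · exact hΦ _ _ _ hbb (hΦb j hj)
  · exact h

/-- The slots before number `P` hold the same sets in both states. -/
def Keep (n P : ℕ) (s s' : State) : Prop := ∀ idx < P, s'.mem aUsed idx = s.mem aUsed idx ∧
  ∀ i < n, s'.mem aSX (idx * n + i) = s.mem aSX (idx * n + i)

theorem Keep.of_eq {n P : ℕ} {s s' : State} (h : s'.mem aUsed = s.mem aUsed)
    (h' : s'.mem aSX = s.mem aSX) : Keep n P s s' := fun _ _ => by simp [h, h']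

theorem Keep.trans {n P P' : ℕ} {s s' s'' : State} (h : Keep n P s s') (h' : Keep n P' s' s'')
    (hP : P ≤ P') : Keep n P s s'' := fun idx hidx =>
  ⟨(h' idx (by omega)).1.trans (h idx hidx).1,
    fun i hi => ((h' idx (by omega)).2 i hi).trans ((h idx hidx).2 i hi)⟩

section Fill

variable {n : ℕ} (G : SimpleGraph (Fin n)) (σ ρ : Set ℕ) (w : Fin n → ℚ) (goal : Goal) (d : ℕ)
  (A : Finset (Fin n))

/-- The data of a node of the tree: three lists of classes, with their lengths and the numbers of
their first vectors, and the first slot of the table. -/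
structure NodeData (n : ℕ) where
  L₀ : ℕ → Fin n → ℕ
  L₁ : ℕ → Fin n → ℕ
  L₂ : ℕ → Fin n → ℕ
  c₀ : ℕ
  c₁ : ℕ
  c₂ : ℕ
  s₀ : ℕ
  s₁ : ℕ
  s₂ : ℕ
  base : ℕ

def NodeData.cell (N : NodeData n) (t j : ℕ) : ℕ := cellAt N.base N.c₁ N.c₂ t j

/-- The first slot after the table. -/
def NodeData.tableEnd (N : NodeData n) : ℕ := N.base + N.c₀ * N.c₁ * (N.c₂ * N.c₂ + 1)

theorem NodeData.cell_add_lt (N : NodeData n) {t j q : ℕ} (ht : t < N.c₀) (hj : j < N.c₁)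
    (hq : q ≤ N.c₂ * N.c₂) : N.cell t j + q < N.tableEnd := by
  have := idx_lt (idx_lt ht hj) (Nat.lt_succ_iff.2 hq)
  simp only [cell, cellAt, tableEnd, Nat.succ_eq_add_one] at *
  omega

/-- Cells occupy disjoint ranges of slots, so an insertion into one leaves the others alone. -/
theorem NodeData.cell_ne (N : NodeData n) {t j t' j' q q' : ℕ} (hj : j < N.c₁)
    (hj' : j' < N.c₁) (hq : q ≤ N.c₂ * N.c₂) (hq' : q' ≤ N.c₂ * N.c₂)
    (h : ¬ (t = t' ∧ j = j')) : N.cell t j + q ≠ N.cell t' j' + q' := by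
  intro h'
  have h2 : (t * N.c₁ + j) * (N.c₂ * N.c₂ + 1) + q = (t' * N.c₁ + j') * (N.c₂ * N.c₂ + 1) + q' := by
    simp only [cell, cellAt] at h'; omega
  have h3 := (idx_inj (Nat.lt_succ_iff.2 hq) (Nat.lt_succ_iff.2 hq')).1 h2
  exact h ((idx_inj hj hj').1 h3.1)

/-- During the filling of the table of a node, the sets in `𝒵` have been inserted. -/
structure FillInv (N : NodeData n) (s₀ : State) (𝒵 : ℕ → Set (Finset (Fin n)))
    (s : State) : Prop where
  cells : ∀ t < N.c₀, ∀ j < N.c₁, CellInv G w goal N.L₂ N.c₂ s (N.cell t j) (𝒵 (t * N.c₁ + j))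
  sol : ∀ t < N.c₀, ∀ j < N.c₁, ∀ X ∈ 𝒵 (t * N.c₁ + j), Sol G σ ρ d A (N.L₀ t) (N.L₁ j) X
  keep : Keep n N.base s₀ s

variable {G σ ρ w goal d A} {N : NodeData n} {s₀ s : State} {𝒵 : ℕ → Set (Finset (Fin n))}

theorem FillInv.of_eq {s' : State} (h : FillInv G σ ρ w goal d A N s₀ 𝒵 s)
    (h1 : s'.mem aUsed = s.mem aUsed) (h2 : s'.mem aSX = s.mem aSX)
    (h3 : s'.mem aSU = s.mem aSU) : FillInv G σ ρ w goal d A N s₀ 𝒵 s' :=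
  ⟨fun t ht j hj => (h.cells t ht j hj).of_same fun _ _ => SlotSame.rfl' h1 h2 h3, h.sol,
    h.keep.trans (Keep.of_eq h1 h2) le_rfl⟩

/-- The family `𝒵` exists only in the proof and remembers everything inserted so far, whether or not
a basis has kept it. It only grows, which suits `Runs.forAcc`. -/
theorem FillInv.runs_insertSet {B t j : ℕ} {X : Finset (Fin n)}
    (h : FillInv G σ ρ w goal d A N s₀ 𝒵 s) (he : Env G w N.c₂ N.s₂ s)
    (hL : N.L₂ = fun i => s.vec (N.s₂ + i)) (ht : t < N.c₀) (hj : j < N.c₁)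
    (hcell : s.reg rCell = N.cell t j) (hX : s.HoldsSet aX 0 X)
    (hsol : Sol G σ ρ d A (N.L₀ t) (N.L₁ j) X) (hB : N.tableEnd * n ≤ B)
    (hB' : N.tableEnd * (N.c₂ * N.c₂ + 1) ≤ B) (hst : (N.s₂ + N.c₂) * n ≤ B)
    (hst' : N.s₂ + N.c₂ ≤ B) (hnB : n * n ≤ B) (h1 : 2 ≤ B) :
    Runs B (insertSet goal) s
      (100 * ((n + 1) * (n + 1)) + 450 * ((N.c₂ * N.c₂ + 1) * (n + N.c₂ * N.c₂ + 1))) fun s' =>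
      ∃ 𝒵', 𝒵 ≤ 𝒵' ∧ FillInv G σ ρ w goal d A N s₀ 𝒵' s' ∧ X ∈ 𝒵' (t * N.c₁ + j) := by
  have hend := N.cell_add_lt ht hj (le_refl (N.c₂ * N.c₂))
  refine (insertSet_spec he hcell (hL ▸ h.cells t ht j hj) hX
    (le_trans (Nat.mul_le_mul_right _ (by omega)) hB)
    (le_trans (Nat.mul_le_mul_right _ (by omega)) hB') hst hst' hnB h1).mono le_rfl ?_
  rintro s' - ⟨k1, k2⟩
  rw [← hL] at k1
  have hu : ∀ c, 𝒵 c ⊆ Function.update 𝒵 (t * N.c₁ + j) (insert X (𝒵 (t * N.c₁ + j))) c := by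
    intro c
    by_cases hc : c = t * N.c₁ + j
    · subst hc; rw [Function.update_self]; exact Set.subset_insert _ _
    · rw [Function.update_of_ne hc]
  refine ⟨Function.update 𝒵 (t * N.c₁ + j) (insert X (𝒵 (t * N.c₁ + j))), hu, ⟨?_, ?_, ?_⟩, ?_⟩
  · intro t' ht' j' hj'
    by_cases hc : t' = t ∧ j' = j
    · obtain ⟨rfl, rfl⟩ := hc
      rw [Function.update_self]; exact k1
    · rw [Function.update_of_ne fun h => hc ((idx_inj hj' hj).1 h)]
      exact (h.cells t' ht' j' hj').of_same fun q hq => k2 _ fun q' hq' =>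
        N.cell_ne hj' hj hq hq' hc
  · intro t' ht' j' hj' Y hY
    by_cases hc : t' = t ∧ j' = j
    · obtain ⟨rfl, rfl⟩ := hc
      rw [Function.update_self] at hY
      rcases hY with rfl | hY
      · exact hsol
      · exact h.sol _ ht _ hj Y hY
    · rw [Function.update_of_ne fun h => hc ((idx_inj hj' hj).1 h)] at hY
      exact h.sol t' ht' j' hj' Y hY
  · refine h.keep.trans (fun idx hidx => ?_) le_rfl
    have := k2 idx fun q hq => by simp only [NodeData.cell, cellAt]; omega
    exact ⟨this.used, this.set⟩
  · rw [Function.update_self]; exact Set.mem_insert _ _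

theorem FillInv.table (h : FillInv G σ ρ w goal d A N s₀ 𝒵 s)
    (hσ : σ.Finite ∨ σᶜ.Finite) (hρ : ρ.Finite ∨ ρᶜ.Finite)
    (hdσ : domDepth σ ≤ d) (hdρ : domDepth ρ ≤ d) (hL : ClassList G 1 Aᶜ Finset.univ N.L₂ N.c₂)
    (hall : ∀ D, Best G σ ρ w goal D → ∀ t < N.c₀, ∀ j < N.c₁, N.L₀ t = classVec G d A (A \ D) →
      N.L₁ j = classVec G d Aᶜ (Aᶜ \ D) → D ∩ A ∈ 𝒵 (t * N.c₁ + j)) :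
    TableInv G σ ρ w goal d A N.L₀ N.c₀ N.L₁ N.c₁ N.L₂ N.c₂ N.base s :=
  .of_cells hσ hρ hdσ hdρ hL h.cells h.sol hall

end Fill

notation "rNd" => (38 : ℕ)
notation "rNn" => (39 : ℕ)
notation "rSp" => (40 : ℕ)
notation "rCode" => (41 : ℕ)
notation "rLe" => (42 : ℕ)
notation "rRe" => (43 : ℕ)
notation "rTot" => (44 : ℕ)
notation "rCk" => (45 : ℕ)
notation "rBs" => (46 : ℕ)

notation "aTa" => (18 : ℕ)
notation "aTb" => (19 : ℕ)
notation "aTc" => (20 : ℕ)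

/-! ### Preparing a node -/

/-- Set `aMsk` to the vertices in the set of the node in register `x`, if `b = 1`, or to those
outside, if `b = 0`. -/
def mask (x b : ℕ) : Prog :=
  forLoop rGu rN (store aMsk (var rGu) (equ (get aIns (var x * var rN + var rGu)) (lit b)))

theorem mask_spec {B n x b k : ℕ} {s : State} (hn : s.reg rN = n) (hx : s.reg x = k)
    (hxg : x ≠ rGu) (hB : (k + 1) * n ≤ B) (hnB : n ≤ B) (h1 : 1 ≤ B) (hb : b ≤ 1) :
    Runs B (mask x b) s (20 * (n + 1)) fun s' => ∀ u : Fin n,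
      s'.mem aMsk u = if s.mem aIns (k * n + u) = b then 1 else 0 := by
  refine (Runs.for (N := n) (Tb := 12) (fun m s' => ∀ u : Fin n, (u : ℕ) < m →
    s'.mem aMsk u = if s.mem aIns (k * n + u) = b then 1 else 0) hn hnB h1 (by simp) ?_
    (by omega)).mono le_rfl (fun _ _ h u => h u u.2)
  intro i hi s1 hx1 ha1 hinv
  have e0 := (ha1.reg rN rfl).trans hn
  have e1 := (ha1.reg x (by simp [forLoop, writesR, hxg.symm])).trans hx
  have em := ha1.mem aIns rfl
  have hidx := idx_lt (show k < k + 1 by omega) hi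
  refine Runs.straight ?_ ?_ (by simp [dur])
  · simp [safe, e0, e1, hx1, ite_le h1]
    constructorm* _ ∧ _ <;> omega
  · simp only [run, eval_var, eval_equ, eval_get, eval_add, eval_mul, eval_lit, e0, e1, hx1, em,
      setReg_mem, setMem_mem, true_and]
    intro u hu
    by_cases hui : (u : ℕ) = i
    · rw [if_pos hui, hui]
    · rw [if_neg hui]; exact hinv u (by omega)

/-- List classes for the node `rNd`. -/
def lister (b t r : ℕ) : Prog := block [mask rNd b, gen t,
  store (21 + r) (var rNd) (var rSt), store (24 + r) (var rNd) (var rCn)]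

/-- The mask is 1 outside of the ground set of the classes. So `b = 0` lists classes over the vertex
set of the node and `b = 1` classes over its complement. The arrays `21 + r` and `24 + r` hold the
start and the length of list number `r`. -/
theorem lister_spec {n B V S t b r k : ℕ} {G : SimpleGraph (Fin n)} {A A' : Finset (Fin n)}
    {s : State} (hn : s.reg rN = n) (hadj : ∀ u v : Fin n, s.mem aAdj (u * n + v) = adj G u v)
    (hk : s.reg rNd = k) (hins : ∀ u : Fin n, s.mem aIns (k * n + u) = if u ∈ A then 1 else 0)
    (hr : r ≤ 2) (hA : b = 0 ∧ A' = A ∨ b = 1 ∧ A' = Aᶜ) (hvp : s.reg rVp = V)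
    (hS : nec G t (A' : Set (Fin n)) ≤ S) (hB : (V + S + 1) * n ≤ B) (hB' : V + S + 1 ≤ B)
    (hnB : n * n ≤ B) (ht : t + 1 ≤ B) (hkB : (k + 1) * n ≤ B) (hkB' : k ≤ B) :
    Runs B (lister b t r) s (280 * ((n + 1) * (S + 1) * ((S + 1) * (n + 1)))) fun s' => ∃ cn,
      s'.mem (21 + r) k = V ∧ s'.mem (24 + r) k = cn ∧ s'.reg rVp = V + cn ∧
      s'.reg rSt = V ∧ s'.reg rCn = cn ∧ cn ≤ S ∧
      ClassList G t A' Finset.univ (fun i => s'.vec (V + i)) cn ∧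
      (∀ j < V * n, s'.mem aVec j = s.mem aVec j) ∧
      ∀ k' ≠ k, s'.mem (21 + r) k' = s.mem (21 + r) k' ∧ s'.mem (24 + r) k' = s.mem (24 + r) k' := by
  have hnB' : n ≤ B := le_trans (Nat.le_mul_self n) hnB
  have hb : b ≤ 1 := by rcases hA with ⟨h, -⟩ | ⟨h, -⟩ <;> omega
  have hn1 : n + 1 ≤ (n + 1) * (S + 1) * ((S + 1) * (n + 1)) := by
    calc n + 1 = (n + 1) * 1 * (1 * 1) := by ring
      _ ≤ _ := by gcongr <;> omega
  refine Runs.seq (mask_spec hn hk (by decide) hkB hnB' (by omega) hb)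
    (T₂ := 260 * ((n + 1) * (S + 1) * ((S + 1) * (n + 1)))) ?_ (by omega)
  intro s1 ha1 hm
  have hmem : ∀ a, a ≠ aMsk → s1.mem a = s.mem a := fun a ha => ha1.mem a (by
    simp [mask, forLoop, writesM, ha.symm])
  refine Runs.seq (gen_spec (st := V) (S := S) (G := G) (A := A') ((ha1.reg _ rfl).trans hn)
    (by rw [hmem _ (by decide)]; exact hadj) (fun u => ?_) ((ha1.reg _ rfl).trans hvp) hS hB hB' hnB ht)
    (T₂ := 6) ?_ (by omega)
  · rw [hm, hins]
    rcases hA with ⟨hb, hA'⟩ | ⟨hb, hA'⟩ <;> rw [hb, hA'] <;> by_cases hu : u ∈ A <;> simp [hu]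
  · rintro s2 ha2 ⟨cn, g1, g2, g3, g4, g5, g6⟩
    have f1 := (ha2.reg rNd rfl).trans ((ha1.reg rNd rfl).trans hk)
    have hmem2 : ∀ a, a ≠ aMsk → a ≠ aVec → a ≠ aW → s2.mem a = s.mem a := fun a ha hb hc =>
      (ha2.mem a (by simp [gen, genAdd, find, block, forLoop, writesM, hb.symm, hc.symm])).trans
        (hmem a ha)
    have m1 := hmem2 (21 + r) (by omega) (by omega) (by omega)
    have m2 := hmem2 (24 + r) (by omega) (by omega) (by omega)
    have m3 := hmem aVec (by decide)
    rw [m3] at g6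
    have h5 : 5 ≠ 21 + r := by omega
    have h6 : 5 ≠ 24 + r := by omega
    refine Runs.straight (by simp [safe, run, f1, hkB']) ?_ (by simp [dur])
    refine ⟨cn, ?_, ?_, ?_, ?_, ?_, g4, g5.congr fun i hi => ?_, fun j hj => ?_, fun k' hk' => ?_⟩
    · simp [block, run, f1, g1]
    · simp [block, run, f1, g2]
    · simpa [block, run] using g3
    · simpa [block, run] using g1
    · simpa [block, run] using g2
    · funext u; simp [block, run, State.vec, h5, h6]
    · simp [block, run, h5, h6]; exact g6 j hj
    · simp [block, run, f1, hk', m1, m2]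

/-- Allocate the table for the node `rNd`. -/
def alloc : Prog := block [
  assign rStC (var rSt), assign rKo (var rCn), assign rKp (var rKo * var rKo),
  assign rKs (var rKp + 1), assign rBs (var rSp), store aBase (var rNd) (var rBs),
  assign rCk (get 25 (var rNd)), assign rTot (get 24 (var rNd) * var rCk * var rKs),
  forLoop rGu rTot (store aUsed (var rBs + var rGu) 0),
  assign rSp (var rBs + var rTot)]

/-- Memory may contain anything at first; clearing the flags in `aUsed` suffices to make every cell
an empty basis. -/
theorem alloc_spec {B k c₀ c₁ c₂ st P : ℕ} {s : State} (hk : s.reg rNd = k) (hst : s.reg rSt = st)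
    (hcn : s.reg rCn = c₂) (h₀ : s.mem 24 k = c₀) (h₁ : s.mem 25 k = c₁) (hP : s.reg rSp = P)
    (hB : P + c₀ * c₁ * (c₂ * c₂ + 1) ≤ B) (hK : c₂ * c₂ + 1 ≤ B) (hcc : c₀ * c₁ ≤ B)
    (hkB : k ≤ B) :
    Runs B alloc s (15 * (c₀ * c₁ * (c₂ * c₂ + 1)) + 60) fun s' =>
      s'.reg rStC = st ∧ s'.reg rKo = c₂ ∧ s'.reg rKp = c₂ * c₂ ∧ s'.reg rKs = c₂ * c₂ + 1 ∧
      s'.reg rBs = P ∧ s'.reg rCk = c₁ ∧ s'.reg rSp = P + c₀ * c₁ * (c₂ * c₂ + 1) ∧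
      s'.mem aBase k = P ∧ (∀ k' ≠ k, s'.mem aBase k' = s.mem aBase k') ∧
      (∀ i < P, s'.mem aUsed i = s.mem aUsed i) ∧
      ∀ i < c₀ * c₁ * (c₂ * c₂ + 1), s'.mem aUsed (P + i) = 0 := by
  set M := c₀ * c₁ * (c₂ * c₂ + 1) with hM
  refine Runs.step (T₂ := 15 * M + 57) (by simp [safe]) ?_ (by simp [dur]; omega)
  refine Runs.step (T₂ := 15 * M + 55) (by simp [safe]) ?_ (by simp [dur]; omega)
  refine Runs.step (T₂ := 15 * M + 51) (by simp [safe, run, hcn]; omega) ?_ (by simp [dur]; omega)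
  refine Runs.step (T₂ := 15 * M + 47) (by simp [safe, run, hcn]; omega) ?_ (by simp [dur]; omega)
  refine Runs.step (T₂ := 15 * M + 45) (by simp [safe]) ?_ (by simp [dur]; omega)
  refine Runs.step (T₂ := 15 * M + 42) (by simp [safe, run, hk, hkB]) ?_ (by simp [dur]; omega)
  refine Runs.step (T₂ := 15 * M + 39) (by simp [safe, run, hk, hkB]) ?_ (by simp [dur]; omega)
  refine Runs.step (T₂ := 15 * M + 32)
    (by simp [safe, run, hk, hcn, h₀, h₁, hkB, hcc, ← hM]; omega) ?_ (by simp [dur]; omega)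
  simp only [run, eval_add, eval_mul, eval_var, eval_get, eval_ofNat, setReg_reg, setMem_reg,
    setReg_mem, setMem_mem]
  simp only [Nat.reduceEqDiff, if_true, if_false, false_and, hk, hcn, h₀, h₁, hP, hst, ← hM]
  refine Runs.seq (Runs.for (N := M) (Tb := 6) (fun m s' =>
    (∀ i < P, s'.mem aUsed i = s.mem aUsed i) ∧ ∀ i < m, s'.mem aUsed (P + i) = 0)
    (by simp) (by omega) (by omega) (by simp) ?_ le_rfl) (T₂ := 4) ?_ (by omega)
  · rintro i hi s1 hx1 ha1 ⟨i1, i2⟩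
    have e1 := ha1.reg rBs rfl
    simp at e1
    refine Runs.straight (by simp [safe, e1, hx1]; omega) ?_ (by decide)
    simp [run, e1, hx1]
    refine ⟨fun j hj => ?_, fun j hj => ?_⟩
    · rw [if_neg (by omega)]; exact i1 j hj
    · by_cases hji : j = i
      · simp [hji]
      · simp [hji]; exact i2 j (by omega)
  · rintro s1 ha1 ⟨i1, i2⟩
    have f1 := ha1.reg rStC rfl
    have f2 := ha1.reg rKo rfl
    have f3 := ha1.reg rKp rfl
    have f4 := ha1.reg rKs rfl
    have f5 := ha1.reg rBs rfl
    have f6 := ha1.reg rCk rfl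
    have f7 := ha1.reg rTot rfl
    have m1 := ha1.mem aBase rfl
    simp at f1 f2 f3 f4 f5 f6 f7
    refine Runs.straight (by simp [safe, f5, f7, hB]) ?_ (by decide)
    simp only [block, run, eval_add, eval_var, setReg_reg, setReg_mem]
    simp [f1, f2, f3, f4, f5, f6, f7, m1]
    exact ⟨fun k' hk' h => absurd h hk', i1, i2⟩

section Prep

variable {n : ℕ} (G : SimpleGraph (Fin n)) (σ ρ : Set ℕ) (w : Fin n → ℚ) (goal : Goal) (d : ℕ)

/-- The memory for the lists of node number `k`, which has the set `A` of vertices. -/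
structure NodeLists (A : Finset (Fin n)) (N : NodeData n) (k : ℕ) (s : State) : Prop where
  ins : ∀ u : Fin n, s.mem aIns (k * n + u) = if u ∈ A then 1 else 0
  s₀ : s.mem 21 k = N.s₀
  s₁ : s.mem 22 k = N.s₁
  s₂ : s.mem 23 k = N.s₂
  c₀ : s.mem 24 k = N.c₀
  c₁ : s.mem 25 k = N.c₁
  c₂ : s.mem 26 k = N.c₂
  base : s.mem aBase k = N.base
  vec₀ : ∀ i < N.c₀, s.vec (N.s₀ + i) = N.L₀ i
  vec₁ : ∀ i < N.c₁, s.vec (N.s₁ + i) = N.L₁ i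
  vec₂ : ∀ i < N.c₂, s.vec (N.s₂ + i) = N.L₂ i
  list₀ : ClassList G d A Finset.univ N.L₀ N.c₀
  list₁ : ClassList G d Aᶜ Finset.univ N.L₁ N.c₁
  list₂ : ClassList G 1 Aᶜ Finset.univ N.L₂ N.c₂

/-- The memory for the nodes before number `k`, the vectors before number `V` and the slots before
number `P` is the same in both states. -/
structure Ext (n k V P : ℕ) (s s' : State) : Prop where
  arr : ∀ a, a = aSize ∨ a = aBase ∨ (21 ≤ a ∧ a ≤ 26) → ∀ j < k, s'.mem a j = s.mem a j
  ins : ∀ j < k * n, s'.mem aIns j = s.mem aIns j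
  vec : ∀ j < V * n, s'.mem aVec j = s.mem aVec j
  keep : Keep n P s s'

theorem Ext.trans {n k k' V V' P P' : ℕ} {s s' s'' : State} (h : Ext n k V P s s')
    (h' : Ext n k' V' P' s' s'') (hk : k ≤ k') (hV : V ≤ V') (hP : P ≤ P') :
    Ext n k V P s s'' :=
  ⟨fun a ha j hj => (h'.arr a ha j (by omega)).trans (h.arr a ha j hj),
    fun j hj => (h'.ins j (hj.trans_le (Nat.mul_le_mul_right _ hk))).trans (h.ins j hj),
    fun j hj => (h'.vec j (hj.trans_le (Nat.mul_le_mul_right _ hV))).trans (h.vec j hj),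
    h.keep.trans h'.keep hP⟩

theorem Ext.of_eq {n k V P : ℕ} {s s' : State} (h : s'.mem = s.mem) : Ext n k V P s s' :=
  ⟨fun _ _ _ _ => by rw [h], fun _ _ => by rw [h], fun _ _ => by rw [h],
    Keep.of_eq (by rw [h]) (by rw [h])⟩

theorem Ext.vec_eq {n k V P : ℕ} {s s' : State} (h : Ext n k V P s s') {i : ℕ} (hi : i < V) :
    s'.vec (n := n) i = s.vec i := by
  funext u; exact h.vec _ (idx_lt hi u.2)

variable {G σ ρ w goal d}

theorem NodeLists.ext {A : Finset (Fin n)} {N : NodeData n} {j k V P : ℕ} {s s' : State}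
    (h : NodeLists G d A N j s) (he : Ext n k V P s s') (hj : j < k) (h₀ : N.s₀ + N.c₀ ≤ V)
    (h₁ : N.s₁ + N.c₁ ≤ V) (h₂ : N.s₂ + N.c₂ ≤ V) : NodeLists G d A N j s' where
  ins u := (he.ins _ (idx_lt hj u.2)).trans (h.ins u)
  s₀ := (he.arr _ (by omega) j hj).trans h.s₀
  s₁ := (he.arr _ (by omega) j hj).trans h.s₁
  s₂ := (he.arr _ (by omega) j hj).trans h.s₂
  c₀ := (he.arr _ (by omega) j hj).trans h.c₀
  c₁ := (he.arr _ (by omega) j hj).trans h.c₁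
  c₂ := (he.arr _ (by omega) j hj).trans h.c₂
  base := (he.arr _ (by omega) j hj).trans h.base
  vec₀ i hi := (he.vec_eq (by omega)).trans (h.vec₀ i hi)
  vec₁ i hi := (he.vec_eq (by omega)).trans (h.vec₁ i hi)
  vec₂ i hi := (he.vec_eq (by omega)).trans (h.vec₂ i hi)
  list₀ := h.list₀
  list₁ := h.list₁
  list₂ := h.list₂

/-- Compute the lists for the node `rNd`, and allocate its table. -/
def prep (d : ℕ) : Prog := block [lister 0 d 0, lister 1 d 1, lister 1 1 2, alloc]

/-- The input, with the first free vector and the first free slot. -/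
structure Base (V P : ℕ) (s : State) : Prop where
  reg_n : s.reg rN = n
  adj : ∀ u v : Fin n, s.mem aAdj (u * n + v) = adj G u v
  w : ∀ u : Fin n, s.wt 0 u = w u
  vp : s.reg rVp = V
  sp : s.reg rSp = P

/-- The widths of the cut at `A` are at most `S` and `S₁`. -/
structure Narrow (d S S₁ : ℕ) (A : Finset (Fin n)) : Prop where
  inner : nec G d (A : Set (Fin n)) ≤ S
  outer : nec G d ((Aᶜ : Finset (Fin n)) : Set (Fin n)) ≤ S
  outer_one : nec G 1 ((Aᶜ : Finset (Fin n)) : Set (Fin n)) ≤ S₁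

/-- The word size suffices for the node `k`. -/
structure Room (n d S S₁ B k V P : ℕ) : Prop where
  vec : (V + 2 * S + S₁ + 1) * (n + 1) ≤ B
  slot : (P + S * S * (S₁ * S₁ + 1) + 1) * (n + S₁ * S₁ + 1) ≤ B
  node : (k + 2) * (n + 1) ≤ B
  sq : n * n ≤ B
  depth : 2 * d + 2 ≤ B

/-- The registers and memory after preparing a node. -/
structure Prepared (A : Finset (Fin n)) (N : NodeData n) (k V P S S₁ : ℕ) (s s' : State) :
    Prop where
  lists : NodeLists G d A N k s'
  base : Base (G := G) (w := w) (N.s₂ + N.c₂) N.tableEnd s'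
  env : Env G w N.c₂ N.s₂ s'
  L₂ : N.L₂ = fun i => s'.vec (N.s₂ + i)
  ck : s'.reg rCk = N.c₁
  bs : s'.reg rBs = N.base
  ext : Ext n k V P s s'
  fill : FillInv G σ ρ w goal d A N s (fun _ => ∅) s'
  s₀ : N.s₀ = V
  s₁ : N.s₁ = V + N.c₀
  s₂ : N.s₂ = V + N.c₀ + N.c₁
  start : N.base = P
  c₀ : N.c₀ ≤ S
  c₁ : N.c₁ ≤ S
  c₂ : N.c₂ ≤ S₁

/-- Vectors and slots are allocated consecutively and never freed, so what belongs to earlier nodes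
lies below `V` and `P` and is untouched. -/
theorem prep_spec {B k V P S S₁ : ℕ} {A : Finset (Fin n)} {s : State}
    (hb : Base (G := G) (w := w) V P s) (hk : s.reg rNd = k)
    (hins : ∀ u : Fin n, s.mem aIns (k * n + u) = if u ∈ A then 1 else 0)
    (hA : Narrow (G := G) d S S₁ A) (hB : Room n d S S₁ B k V P) :
    Runs B (prep d) s (560 * ((n + 1) * (S + 1) * ((S + 1) * (n + 1))) +
      280 * ((n + 1) * (S₁ + 1) * ((S₁ + 1) * (n + 1))) + 15 * (S * S * (S₁ * S₁ + 1)) + 60)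
      fun s' => ∃ N, Prepared (G := G) (σ := σ) (ρ := ρ) (w := w) (goal := goal) (d := d)
        A N k V P S S₁ s s' := by
  obtain ⟨b1, b2, b3, b4, b5⟩ := hB
  have bV : ∀ x ≤ V + 2 * S + S₁ + 1, x * n ≤ B ∧ x ≤ B := fun x hx =>
    ⟨(Nat.mul_le_mul hx (by omega)).trans b1, (Nat.le_mul_of_pos_right _ (by omega)).trans
      ((Nat.mul_le_mul_right _ hx).trans b1)⟩
  have hP : P + S * S * (S₁ * S₁ + 1) + 1 ≤ B := (Nat.le_mul_of_pos_right _ (by omega)).trans b2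
  have hkn : (k + 1) * n ≤ B := (Nat.mul_le_mul (by omega) (by omega)).trans b3
  have hk' : k + 2 ≤ B := (Nat.le_mul_of_pos_right _ (by omega)).trans b3
  refine Runs.seq (lister_spec (G := G) (A := A) hb.reg_n hb.adj hk hins (by omega)
    (Or.inl ⟨rfl, rfl⟩) hb.vp hA.inner (bV _ (by omega)).1 (bV _ (by omega)).2 b4 (by omega) hkn
    (by omega)) (T₂ := 280 * ((n + 1) * (S + 1) * ((S + 1) * (n + 1))) +
      280 * ((n + 1) * (S₁ + 1) * ((S₁ + 1) * (n + 1))) + 15 * (S * S * (S₁ * S₁ + 1)) + 60) ?_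
    (by omega)
  rintro s1 a1 ⟨c₀, f1, f2, f3, f4, f5, f6, f7, f8, f9⟩
  have hins1 : ∀ u : Fin n, s1.mem aIns (k * n + u) = if u ∈ A then 1 else 0 := by
    rw [a1.mem _ rfl]; exact hins
  have hadj1 : ∀ u v : Fin n, s1.mem aAdj (u * n + v) = adj G u v := by
    rw [a1.mem _ rfl]; exact hb.adj
  refine Runs.seq (lister_spec (G := G) (A := A) ((a1.reg _ rfl).trans hb.reg_n) hadj1
    ((a1.reg _ rfl).trans hk) hins1 (by omega)
    (Or.inr ⟨rfl, rfl⟩) f3 hA.outer (bV _ (by omega)).1 (bV _ (by omega)).2 b4 (by omega) hkn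
    (by omega)) (T₂ :=
      280 * ((n + 1) * (S₁ + 1) * ((S₁ + 1) * (n + 1))) + 15 * (S * S * (S₁ * S₁ + 1)) + 60) ?_
    (by omega)
  rintro s2 a2 ⟨c₁, g1, g2, g3, g4, g5, g6, g7, g8, g9⟩
  have hins2 : ∀ u : Fin n, s2.mem aIns (k * n + u) = if u ∈ A then 1 else 0 := by
    rw [a2.mem _ rfl]; exact hins1
  have hadj2 : ∀ u v : Fin n, s2.mem aAdj (u * n + v) = adj G u v := by
    rw [a2.mem _ rfl]; exact hadj1
  have n2 := (a2.reg rN rfl).trans ((a1.reg rN rfl).trans hb.reg_n)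
  have k2 := (a2.reg rNd rfl).trans ((a1.reg rNd rfl).trans hk)
  refine Runs.seq (lister_spec (G := G) (A := A) n2 hadj2 k2 hins2 (by omega)
    (Or.inr ⟨rfl, rfl⟩) g3 hA.outer_one (bV _ (by omega)).1 (bV _ (by omega)).2 b4 (by omega) hkn
    (by omega)) (T₂ := 15 * (S * S * (S₁ * S₁ + 1)) + 60) ?_ (by omega)
  rintro s3 a3 ⟨c₂, h1, h2, h3, h4, h5, h6, h7, h8, h9⟩
  have n3 := (a3.reg rN rfl).trans n2
  have k3 := (a3.reg rNd rfl).trans k2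
  have sp3 : s3.reg rSp = P :=
    (a3.reg rSp rfl).trans ((a2.reg rSp rfl).trans ((a1.reg rSp rfl).trans hb.sp))
  have hSS : c₀ * c₁ ≤ S * S := Nat.mul_le_mul f6 g6
  have hS1 : c₂ * c₂ ≤ S₁ * S₁ := Nat.mul_le_mul h6 h6
  have hM : c₀ * c₁ * (c₂ * c₂ + 1) ≤ S * S * (S₁ * S₁ + 1) :=
    Nat.mul_le_mul hSS (by omega)
  have hSS' : S * S ≤ S * S * (S₁ * S₁ + 1) := Nat.le_mul_of_pos_right _ (by omega)
  have hn' : n + S₁ * S₁ + 1 ≤ B := (Nat.le_mul_of_pos_left _ (by omega)).trans b2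
  refine (alloc_spec (c₀ := c₀) (c₁ := c₁) k3 h4 h5
    (by rw [a3.mem _ rfl, a2.mem _ rfl]; exact f2) (by rw [a3.mem _ rfl]; exact g2) sp3
    (by omega) (by omega) (by omega) (by omega)).mono (by omega) ?_
  rintro s4 a4 ⟨r1, r2, r3, r4, r5, r6, r7, r8, r9, r10, r11⟩
  have hvec4 : s4.mem aVec = s3.mem aVec := a4.mem _ rfl
  have v1 : ∀ j < (V + c₀ + c₁) * n, s4.mem aVec j = s2.mem aVec j := fun j hj => by
    rw [hvec4]; exact h8 j hj
  have v2 : ∀ j < (V + c₀) * n, s4.mem aVec j = s1.mem aVec j := fun j hj =>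
    (v1 j (hj.trans_le (Nat.mul_le_mul_right _ (by omega)))).trans (g8 j hj)
  have v3 : ∀ j < V * n, s4.mem aVec j = s.mem aVec j := fun j hj =>
    (v2 j (hj.trans_le (Nat.mul_le_mul_right _ (by omega)))).trans (f8 j hj)
  -- The lists are read off from the final memory; `v1` and `v2` show that the later lists did not
  -- overwrite the earlier ones.
  refine ⟨⟨fun i => s4.vec (V + i), fun i => s4.vec (V + c₀ + i), fun i => s4.vec (V + c₀ + c₁ + i),
    c₀, c₁, c₂, V, V + c₀, V + c₀ + c₁, P⟩, ?_, ?_, ?_, rfl, r6, r5, ?_, ?_, rfl, rfl, rfl, rfl, f6, g6, h6⟩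
  · exact {
      ins := fun u => by rw [a4.mem _ rfl, a3.mem _ rfl]; exact hins2 u
      s₀ := by rw [a4.mem _ rfl, a3.mem _ rfl, a2.mem _ rfl]; exact f1
      s₁ := by rw [a4.mem _ rfl, a3.mem _ rfl]; exact g1
      s₂ := by rw [a4.mem _ rfl]; exact h1
      c₀ := by rw [a4.mem _ rfl, a3.mem _ rfl, a2.mem _ rfl]; exact f2
      c₁ := by rw [a4.mem _ rfl, a3.mem _ rfl]; exact g2
      c₂ := by rw [a4.mem _ rfl]; exact h2
      base := r8
      vec₀ := fun _ _ => rfl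
      vec₁ := fun _ _ => rfl
      vec₂ := fun _ _ => rfl
      list₀ := f7.congr fun i hi => by
        funext u; exact v2 _ (idx_lt (by omega) u.2)
      list₁ := g7.congr fun i hi => by
        funext u; exact v1 _ (idx_lt (by omega) u.2)
      list₂ := h7.congr fun i hi => by
        funext u; simp only [State.vec, hvec4] }
  · refine ⟨(a4.reg _ rfl).trans n3, ?_, ?_, (a4.reg _ rfl).trans h3, r7⟩
    · rw [a4.mem _ rfl, a3.mem _ rfl]; exact hadj2
    · rw [a4.wt _ rfl, a3.wt _ rfl, a2.wt _ rfl, a1.wt _ rfl]; exact hb.w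
  · refine ⟨(a4.reg _ rfl).trans n3, ?_, ?_, r1, r2, r3, r4⟩
    · rw [a4.mem _ rfl, a3.mem _ rfl]; exact hadj2
    · rw [a4.wt _ rfl, a3.wt _ rfl, a2.wt _ rfl, a1.wt _ rfl]; exact hb.w
  · refine ⟨fun a ha j hj => ?_, fun j hj => ?_, v3, ?_⟩
    · have hjk : j ≠ k := by omega
      have ha' : a = 4 ∨ a = 14 ∨ a = 21 ∨ a = 22 ∨ a = 23 ∨ a = 24 ∨ a = 25 ∨ a = 26 := by omega
      rcases ha' with rfl | rfl | rfl | rfl | rfl | rfl | rfl | rfl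
      · rw [a4.mem _ rfl, a3.mem _ rfl, a2.mem _ rfl, a1.mem _ rfl]
      · rw [r9 j hjk, a3.mem _ rfl, a2.mem _ rfl, a1.mem _ rfl]
      · rw [a4.mem _ rfl, a3.mem _ rfl, a2.mem _ rfl]; exact (f9 j hjk).1
      · rw [a4.mem _ rfl, a3.mem _ rfl, (g9 j hjk).1, a1.mem _ rfl]
      · rw [a4.mem _ rfl, (h9 j hjk).1, a2.mem _ rfl, a1.mem _ rfl]
      · rw [a4.mem _ rfl, a3.mem _ rfl, a2.mem _ rfl]; exact (f9 j hjk).2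
      · rw [a4.mem _ rfl, a3.mem _ rfl, (g9 j hjk).2, a1.mem _ rfl]
      · rw [a4.mem _ rfl, (h9 j hjk).2, a2.mem _ rfl, a1.mem _ rfl]
    · rw [a4.mem _ rfl, a3.mem _ rfl, a2.mem _ rfl, a1.mem _ rfl]
    · intro idx hidx
      refine ⟨?_, fun i _ => ?_⟩
      · rw [r10 idx hidx, a3.mem _ rfl, a2.mem _ rfl, a1.mem _ rfl]
      · rw [a4.mem _ rfl, a3.mem _ rfl, a2.mem _ rfl, a1.mem _ rfl]
  · refine ⟨fun t ht j hj => CellInv.empty fun q hq => ?_, by simp, ?_⟩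
    · have := idx_lt (idx_lt ht hj) (Nat.lt_succ_iff.2 hq)
      simp only [NodeData.cell, cellAt, Nat.succ_eq_add_one] at *
      rw [Nat.add_assoc]; exact r11 _ this
    · intro idx hidx
      refine ⟨?_, fun i _ => ?_⟩
      · rw [r10 idx hidx, a3.mem _ rfl, a2.mem _ rfl, a1.mem _ rfl]
      · rw [a4.mem _ rfl, a3.mem _ rfl, a2.mem _ rfl, a1.mem _ rfl]

end Prep

notation "rI" => (47 : ℕ)

/-- Count the occurrences of the value of `e` in a fixed list. -/
def memE (l : List ℕ) (e : Expr) : Expr := l.foldr (fun i f => equ e (lit i) + f) 0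

theorem eval_memE_le (l : List ℕ) (e : Expr) (s : State) : (memE l e).eval s ≤ l.length := by
  induction l with
  | nil => simp [memE]
  | cons a l ih =>
    have : (memE (a :: l) e).eval s = (if e.eval s = a then 1 else 0) + (memE l e).eval s := rfl
    rw [this, List.length_cons]
    split_ifs <;> omega

theorem eval_memE_ne_zero {l : List ℕ} {e : Expr} {s : State} :
    (memE l e).eval s ≠ 0 ↔ e.eval s ∈ l := by
  induction l with
  | nil => simp [memE]
  | cons a l ih =>
    have : (memE (a :: l) e).eval s = (if e.eval s = a then 1 else 0) + (memE l e).eval s := rfl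
    rw [this, List.mem_cons, ← ih]
    split_ifs with h <;> simp [h]

/-- The membership test is unrolled over a list fixed in the program, so it takes a number of steps
that depends only on the list and the tested expression, and its value is at most the length of the
list. -/
theorem fits_memE {B : ℕ} {l : List ℕ} {e : Expr} {s : State} (he : e.Fits B s)
    (hl : ∀ i ∈ l, i ≤ B) (hB : l.length ≤ B) : (memE l e).Fits B s := by
  induction l with
  | nil => simp [memE]
  | cons a l ih =>
    have h1 := ih (fun i hi => hl i (List.mem_cons_of_mem _ hi)) (by simp at hB; omega)
    have h2 := eval_memE_le (a :: l) e s
    refine ⟨⟨he, hl a List.mem_cons_self, ite_le (by simp at hB; omega)⟩, h1, h2.trans hB⟩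

theorem cost_memE (l : List ℕ) (e : Expr) : (memE l e).cost = l.length * (e.cost + 3) + 1 := by
  induction l with
  | nil => simp [memE]
  | cons a l ih =>
    have : (memE (a :: l) e).cost = (e.cost + 1 + 1) + (memE l e).cost + 1 := rfl
    rw [this, ih, List.length_cons, Nat.succ_mul]; omega

/-- Insert the empty set (`b = 0`) or the set of the leaf `rNd` (`b = 1`) into all suitable cells. -/
def leafSide (goal : Goal) (l : List ℕ) (b : ℕ) : Prog := block [
  forLoop rGu rN (store aW (var rGu)
    (get aAdj ((var rCode - 1) * var rN + var rGu) * lit (1 - b))),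
  assign rSt (get 21 (var rNd)), assign rCn (get 24 (var rNd)),
  find,
  forLoop rI rCk (Prog.ite (memE l (get aVec ((get 22 (var rNd) + var rI) * var rN + (var rCode - 1))))
    (block [
      forLoop rGu rN (store aX (var rGu) (get aIns (var rNd * var rN + var rGu) * lit b)),
      assign rCell (var rBs + (var rF * var rCk + var rI) * var rKs),
      insertSet goal]) skip)]

section Leaf

variable {n : ℕ} {G : SimpleGraph (Fin n)} {σ ρ : Set ℕ} {w : Fin n → ℚ} {goal : Goal} {d : ℕ}

/-- The word size suffices for the memory of node number `k`. -/
structure Bounds (B d k : ℕ) (N : NodeData n) : Prop where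
  stop_n : N.tableEnd * n ≤ B
  stop_k : N.tableEnd * (N.c₂ * N.c₂ + 1) ≤ B
  tableEnd : N.tableEnd ≤ B
  vec₀ : (N.s₀ + N.c₀) * n ≤ B
  vec₁ : (N.s₁ + N.c₁) * n ≤ B
  vec₂ : (N.s₂ + N.c₂) * n ≤ B
  vec₀' : N.s₀ + N.c₀ ≤ B
  vec₁' : N.s₁ + N.c₁ ≤ B
  vec₂' : N.s₂ + N.c₂ ≤ B
  node : (k + 1) * n ≤ B
  node' : k + 1 ≤ B
  sq : n * n ≤ B
  depth : 2 * d + 2 ≤ B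

/-- The time for the insertion of a set into a table with `K + 1` slots per cell. -/
def insertTime (n K : ℕ) : ℕ := 100 * ((n + 1) * (n + 1)) + 450 * ((K + 1) * (n + K + 1))

/-- The part of a solution in a leaf. -/
def leafSet (v : Fin n) (b : ℕ) : Finset (Fin n) := if b = 1 then {v} else ∅

/-- A leaf `v` has two candidates, ∅ for `b = 0` and `{v}` for `b = 1`. The inner class of a
candidate is unique, so the candidate belongs to a single inner class `F`. As `v` has no neighbor
inside the leaf, the only condition is that the outer class has a value at `v` that lies in σ,
respectively ρ. -/
theorem leafSide_spec {B k b : ℕ} {v : Fin n} {N : NodeData n} {l : List ℕ} {s₀ s : State}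
    {𝒵 : ℕ → Set (Finset (Fin n))} (hf : FillInv G σ ρ w goal d {v} N s₀ 𝒵 s)
    (he : Env G w N.c₂ N.s₂ s) (hN : NodeLists G d {v} N k s)
    (hL : N.L₂ = fun i => s.vec (N.s₂ + i)) (hk : s.reg rNd = k) (hc : s.reg rCode = v + 1)
    (hck : s.reg rCk = N.c₁) (hbs : s.reg rBs = N.base) (hB : Bounds B d k N) (hb : b ≤ 1)
    (hd : 1 ≤ d) (hl : ∀ x ≤ d, x ∈ l ↔ x ∈ if b = 1 then ρ else σ) (hl' : ∀ x ∈ l, x ≤ d)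
    (hlen : l.length ≤ d + 1) :
    Runs B (leafSide goal l b) s (100 * ((N.c₀ + 1) * (n + 1)) +
      N.c₁ * (insertTime n (N.c₂ * N.c₂) + 14 * (d + 1) + 60 * (n + 1))) fun s' =>
      ∃ 𝒵', 𝒵 ≤ 𝒵' ∧ FillInv G σ ρ w goal d {v} N s₀ 𝒵' s' ∧ ∀ t < N.c₀, ∀ j < N.c₁,
        Sol G σ ρ d {v} (N.L₀ t) (N.L₁ j) (leafSet v b) → leafSet v b ∈ 𝒵' (t * N.c₁ + j) := by
  obtain ⟨b1, b2, b3, b4, b5, b6, b7, b8, b9, b10, b11, b12, b13⟩ := hB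
  have hnB : n ≤ B := le_trans (Nat.le_mul_self n) b12
  have hv := v.2
  set f : Fin n → ℕ := classVec G d {v} ({v} \ leafSet v b) with hfdef
  -- The complement of the candidate inside the leaf is `{v}` for `b = 0` and empty for `b = 1`.
  -- Truncation is harmless because `d ≥ 1`, and the entry at `v` is 0 as there are no loops.
  have hfu : ∀ u, adj G v u * (1 - b) = f u := by
    intro u
    have h1 := adj_le_one G v u
    by_cases hu : u = v
    · subst hu; simp [hfdef, classVec, adj_self]
    · rcases Nat.le_one_iff_eq_zero_or_eq_one.1 hb with rfl | rfl
      · simp [hfdef, classVec, hu, leafSet, deg, adj_comm G u v]; omega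
      · simp [hfdef, classVec, hu, leafSet, deg]
  have hdeg : deg G v ({v} \ leafSet v b) = 0 := by
    rw [deg_eq_zero]
    intro u hu
    have : u = v := by simp at hu; exact hu.1
    subst this; simp
  have hsolL : ∀ j < N.c₁, N.L₁ j v ∈ l ↔ min d (deg G v ({v} \ leafSet v b) + N.L₁ j v) ∈
      target σ ρ (leafSet v b) v := by
    intro j hj
    obtain ⟨Y, -, -, hY⟩ := hN.list₁.mem j hj
    have hle : N.L₁ j v ≤ d := by rw [hY]; exact classVec_le v
    rw [hl _ hle, hdeg, Nat.zero_add, min_eq_right hle, target]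
    rcases Nat.le_one_iff_eq_zero_or_eq_one.1 hb with rfl | rfl <;> simp [leafSet]
  refine Runs.seq (Runs.for (N := n) (Tb := 14) (fun m s' => ∀ u : Fin n, (u : ℕ) < m →
      s'.mem aW u = f u) he.reg_n hnB (by omega) (by simp) ?_ le_rfl)
    (T₂ := 60 * ((N.c₀ + 1) * (n + 1)) + N.c₁ * (insertTime n (N.c₂ * N.c₂) + 14 * (d + 1) + 60 * (n + 1))
      + 11) ?_ ?_
  · intro i hi s1 hx1 ha1 hinv
    have e0 := (ha1.reg rN rfl).trans he.reg_n
    have e1 := (ha1.reg rCode rfl).trans hc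
    have em := ha1.mem aAdj rfl
    have hidx := idx_lt hv hi
    have had := he.adj v ⟨i, hi⟩
    simp only at had
    have h1 := adj_le_one G v ⟨i, hi⟩
    have h2 : adj G v ⟨i, hi⟩ * (1 - b) ≤ 1 := by
      calc _ ≤ 1 * 1 := Nat.mul_le_mul h1 (by omega)
        _ = 1 := rfl
    refine Runs.straight ?_ ?_ (by simp [dur])
    · simp [safe, e0, e1, hx1, em, had]
      constructorm* _ ∧ _ <;> omega
    · simp [run, e0, e1, hx1, em, had, hfu]
      intro u hu
      by_cases hui : (u : ℕ) = i
      · rw [if_pos hui]; congr 1; exact Fin.ext hui.symm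
      · rw [if_neg hui]; exact hinv u (by omega)
  · rintro s1 ha1 hW
    have e0 := (ha1.reg rN rfl).trans he.reg_n
    have e1 := (ha1.reg rNd rfl).trans hk
    have m1 := ha1.mem 21 rfl
    have m2 := ha1.mem 24 rfl
    have m3 := ha1.mem aVec rfl
    have q1 := hN.s₀
    have q2 := hN.c₀
    refine Runs.step (T₂ := 60 * ((N.c₀ + 1) * (n + 1)) +
      N.c₁ * (insertTime n (N.c₂ * N.c₂) + 14 * (d + 1) + 60 * (n + 1)) + 8)
      (by simp [safe, e1]; omega) ?_ (by simp [dur]; omega)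
    refine Runs.step (T₂ := 60 * ((N.c₀ + 1) * (n + 1)) +
      N.c₁ * (insertTime n (N.c₂ * N.c₂) + 14 * (d + 1) + 60 * (n + 1)) + 5)
      (by simp [safe, run, e1]; omega) ?_ (by simp [dur]; omega)
    simp only [run, eval_get, eval_var, setReg_reg, setReg_mem, Nat.reduceEqDiff, if_false, e1, m1, m2,
      q1, q2]
    refine Runs.seq (find_spec (n := n) (f := f) (st := N.s₀) (cn := N.c₀) (by simp [e0])
      (by simp) (by simp) (fun u => by simpa using hW u u.2) b4 b7 (by omega) hnB)
      (T₂ := N.c₁ * (insertTime n (N.c₂ * N.c₂) + 14 * (d + 1) + 60 * (n + 1)) + 5) ?_ (by omega)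
    rintro s2 ha2 ⟨k1, k2, k3⟩
    simp only [setReg_mem, m3] at k2 k3
    have hFlt : s2.reg rF < N.c₀ := by
      rcases Nat.lt_or_eq_of_le k1 with h | h
      · exact h
      · exfalso
        obtain ⟨i, hi, hLi⟩ := hN.list₀.surj ({v} \ leafSet v b) Finset.sdiff_subset
          (Finset.subset_univ _)
        obtain ⟨u, hu⟩ := k3 h i hi
        apply hu
        have := congrFun (hN.vec₀ i hi) u
        simp only [State.vec] at this
        rw [this, hLi]
    have hLF : N.L₀ (s2.reg rF) = f := by
      rw [← hN.vec₀ _ hFlt]; funext u; exact k2 hFlt u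
    generalize hF : s2.reg rF = F at *
    have g0 := (ha2.reg rN rfl).trans e0
    have g1 := (ha2.reg rNd rfl).trans e1
    have g2 := (ha2.reg rCk rfl).trans ((ha1.reg rCk rfl).trans hck)
    have g3 := (ha2.reg rBs rfl).trans ((ha1.reg rBs rfl).trans hbs)
    have g4 := (ha2.reg rCode rfl).trans ((ha1.reg rCode rfl).trans hc)
    have g5 := (ha2.reg rKs rfl).trans ((ha1.reg rKs rfl).trans he.ks)
    have hmem2 : ∀ a, a ≠ aW → s2.mem a = s.mem a := fun a ha =>
      (ha2.mem a (by simp [find, block, forLoop, writesM])).trans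
        (ha1.mem a (by simp [forLoop, writesM, ha.symm]))
    have hf2 : FillInv G σ ρ w goal d {v} N s₀ 𝒵 s2 :=
      hf.of_eq (hmem2 _ (by decide)) (hmem2 _ (by decide)) (hmem2 _ (by decide))
    refine (Runs.forAcc (N := N.c₁) (Tb := insertTime n (N.c₂ * N.c₂) + 14 * (d + 1) + 50 * (n + 1))
      (a := 𝒵) (fun 𝒵 s => FillInv G σ ρ w goal d {v} N s₀ 𝒵 s)
      (fun j 𝒵' => Sol G σ ρ d {v} (N.L₀ F) (N.L₁ j) (leafSet v b) →
        leafSet v b ∈ 𝒵' (F * N.c₁ + j)) ?_ g2 (by omega) (by omega) hf2 ?_ ?_ ?_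
        (by cases goal <;> rfl) (by cases goal <;> rfl) (by decide)).mono le_rfl ?_
    · intro j 𝒵₁ 𝒵₂ hle h hs
      exact hle _ (h hs)
    · intro 𝒵₁ s3 x h
      exact h.of_eq rfl rfl rfl
    · intro j hj 𝒵₁ s3 hx3 ha3 hf3
      have hr3 : ∀ x, x = rN ∨ x = rNd ∨ x = rCk ∨ x = rBs ∨ x = rCode ∨ x = rKs ∨ x = rF ∨
          x = rKo ∨ x = rKp ∨ x = rStC → s3.reg x = s2.reg x := fun x hx => ha3.reg x (by
        rcases hx with rfl | rfl | rfl | rfl | rfl | rfl | rfl | rfl | rfl | rfl <;>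
          cases goal <;> rfl)
      have t0 := (hr3 rN (by simp)).trans g0
      have t1 := (hr3 rNd (by simp)).trans g1
      have t2 := (hr3 rCk (by simp)).trans g2
      have t3 := (hr3 rBs (by simp)).trans g3
      have t4 := (hr3 rCode (by simp)).trans g4
      have t5 := (hr3 rKs (by simp)).trans g5
      have t6 := (hr3 rF (by simp)).trans hF
      have hm3 : ∀ a, a = aAdj ∨ a = aIns ∨ a = aVec ∨ a = 22 → s3.mem a = s.mem a := fun a ha =>
        (ha3.mem a (by rcases ha with rfl | rfl | rfl | rfl <;> cases goal <;> rfl)).trans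
          (hmem2 a (by rcases ha with rfl | rfl | rfl | rfl <;> decide))
      have hw3 : s3.wt 0 = s.wt 0 := (ha3.wt 0 (by cases goal <;> rfl)).trans
        ((ha2.wt 0 rfl).trans (ha1.wt 0 rfl))
      have q3 := hN.s₁
      have hidx := idx_lt (show N.s₁ + j < N.s₁ + N.c₁ by omega) hv
      have hv1 := congrFun (hN.vec₁ j hj) v
      simp only [State.vec] at hv1
      have heval : (get aVec ((get 22 (var rNd) + var rI) * var rN + (var rCode - 1))).eval s3 =
          N.L₁ j v := by
        simp [t0, t1, hx3, t4, hm3, q3, hv1]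
      refine Runs.ite (T := insertTime n (N.c₂ * N.c₂) + 40 * (n + 1)) (fits_memE ?_ ?_ ?_) ?_ ?_ ?_
      · simp [t0, t1, hx3, t4, hm3, q3]
        constructorm* _ ∧ _ <;> omega
      · intro i hi; have := hl' i hi; omega
      · omega
      · intro hc3
        rw [eval_memE_ne_zero, heval, hsolL j hj] at hc3
        have hsol : Sol G σ ρ d {v} (N.L₀ F) (N.L₁ j) (leafSet v b) := by
          refine ⟨?_, hLF.symm, fun u hu => ?_⟩
          · unfold leafSet; split_ifs <;> simp
          · obtain rfl := Finset.mem_singleton.1 hu; exact hc3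
        refine Runs.seq (Runs.for (N := n) (Tb := 12) (fun m s' => ∀ u : Fin n, (u : ℕ) < m →
            s'.mem aX u = if u ∈ leafSet v b then 1 else 0) t0 hnB (by omega) (by simp) ?_ le_rfl)
          (T₂ := insertTime n (N.c₂ * N.c₂) + 10) ?_ (by omega)
        · intro i hi s4 hx4 ha4 hinv
          have u0 := (ha4.reg rN rfl).trans t0
          have u1 := (ha4.reg rNd rfl).trans t1
          have um := (ha4.mem aIns rfl).trans (hm3 aIns (by simp))
          have hidx := idx_lt (show k < k + 1 by omega) hi
          have hin := hN.ins ⟨i, hi⟩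
          simp only at hin
          have hle : (if (⟨i, hi⟩ : Fin n) ∈ ({v} : Finset (Fin n)) then 1 else 0) ≤ 1 := by
            split_ifs <;> omega
          have hle2 : (if (⟨i, hi⟩ : Fin n) ∈ ({v} : Finset (Fin n)) then 1 else 0) * b ≤ 1 := by
            calc _ ≤ 1 * 1 := Nat.mul_le_mul hle hb
              _ = 1 := rfl
          refine Runs.straight ?_ ?_ (by simp [dur])
          · simp only [safe, fits_var, fits_mul, fits_get, fits_add, fits_lit, eval_var, eval_mul,
              eval_add, eval_get, eval_lit, u0, u1, hx4, um, hin]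
            constructorm* _ ∧ _ <;> first | trivial | omega
          · simp only [run, eval_var, eval_mul, eval_add, eval_get, eval_lit, u0, u1, hx4, um, hin,
              setReg_mem, setMem_mem, true_and]
            intro u hu
            by_cases hui : (u : ℕ) = i
            · have : u = ⟨i, hi⟩ := Fin.ext hui
              subst this
              rcases Nat.le_one_iff_eq_zero_or_eq_one.1 hb with rfl | rfl <;> simp [leafSet]
            · rw [if_neg hui]; exact hinv u (by omega)
        · intro s4 ha4 hX4
          have hcl := N.cell_add_lt hFlt hj (Nat.zero_le _)
          have hcl2 : N.cell F j = N.base + (F * N.c₁ + j) * (N.c₂ * N.c₂ + 1) := rfl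
          have hFc : F * N.c₁ + j ≤ (F * N.c₁ + j) * (N.c₂ * N.c₂ + 1) :=
            Nat.le_mul_of_pos_right _ (by omega)
          refine Runs.step (T₂ := insertTime n (N.c₂ * N.c₂)) ?_ ?_ (by simp [dur]; omega)
          · simp [safe, ha4.reg rBs rfl, ha4.reg rF rfl, ha4.reg rCk rfl, ha4.reg rI rfl,
              ha4.reg rKs rfl, t2, t3, t5, t6, hx3]
            constructorm* _ ∧ _ <;> omega
          · simp only [run, eval_var, eval_add, eval_mul, ha4.reg rBs rfl, ha4.reg rF rfl,
              ha4.reg rCk rfl, ha4.reg rI rfl, ha4.reg rKs rfl, t2, t3, t5, t6, hx3]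
            have hf4 : FillInv G σ ρ w goal d {v} N s₀ 𝒵₁ s4 :=
              hf3.of_eq (ha4.mem _ rfl) (ha4.mem _ rfl) (ha4.mem _ rfl)
            refine ((hf4.of_eq (s' := s4.setReg rCell (N.base + (F * N.c₁ + j) * (N.c₂ * N.c₂ + 1)))
              rfl rfl rfl).runs_insertSet ?_ ?_ hFlt hj (by simp [hcl2]) ?_ hsol b1 b2 b6 b9 b12
              (by omega)).mono le_rfl ?_
            · refine ⟨by simp [ha4.reg rN rfl, t0], ?_, ?_, ?_, ?_, ?_, ?_⟩
              · simp only [setReg_mem, ha4.mem aAdj rfl, hm3 aAdj (by simp)]; exact he.adj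
              · simp only [setReg_wt, ha4.wt 0 rfl, hw3]; exact he.w
              · simp [ha4.reg rStC rfl, hr3, ha2.reg rStC rfl, ha1.reg rStC rfl, he.stC]
              · simp [ha4.reg rKo rfl, hr3, ha2.reg rKo rfl, ha1.reg rKo rfl, he.ko]
              · simp [ha4.reg rKp rfl, hr3, ha2.reg rKp rfl, ha1.reg rKp rfl, he.kp]
              · simp [ha4.reg rKs rfl, t5]
            · rw [hL]; funext i u
              simp only [State.vec, setReg_mem, ha4.mem aVec rfl, hm3 aVec (by simp)]
            · intro u; simpa using hX4 u u.2
            · rintro s5 - ⟨𝒵₂, h1, h2, h3⟩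
              exact ⟨𝒵₂, h1, h2, fun _ => h3⟩
      · intro hc3
        refine Runs.straight trivial ⟨𝒵₁, le_rfl, hf3, fun hs => ?_⟩ (by simp [dur]; omega)
        exfalso
        apply eval_memE_ne_zero.2 _ hc3
        rw [heval, hsolL j hj]
        exact hs.dom v (Finset.mem_singleton_self v)
      · rw [cost_memE]; simp
        have := Nat.mul_le_mul_right 14 hlen
        omega
    · refine Nat.add_le_add_right (Nat.mul_le_mul_left _ ?_) 5
      omega
    · rintro s3 - ⟨𝒵', h1, h2, h3⟩
      refine ⟨𝒵', h1, h2, fun t ht j hj hs => ?_⟩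
      -- The list has no repetitions, so no other inner class can match the candidate.
      have htF : t = F := hN.list₀.inj t ht F hFlt (by rw [hLF, ← hs.cls])
      subst htF
      exact h3 j hj hs
  · have : n + 1 ≤ (N.c₀ + 1) * (n + 1) := Nat.le_mul_of_pos_left _ (by omega)
    omega

end Leaf

/-! ### Joining the tables of two children. -/

section Join

variable {n : ℕ} {G : SimpleGraph (Fin n)} {σ ρ : Set ℕ} {w : Fin n → ℚ} {goal : Goal} {d : ℕ}

theorem State.HoldsSet.unique {s : State} {a o : ℕ} {X Y : Finset (Fin n)} (h : s.HoldsSet a o X)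
    (h' : s.HoldsSet a o Y) : X = Y := by
  ext u
  have h1 := h u
  have h2 := h' u
  by_cases hX : u ∈ X <;> by_cases hY : u ∈ Y <;> simp_all

theorem Holds.keep {s s' : State} {P idx : ℕ} {X : Finset (Fin n)} (hk : Keep n P s s')
    (hidx : idx < P) : Holds s' idx X ↔ Holds s idx X := by
  have h := hk idx hidx
  unfold Holds State.HoldsSet
  rw [h.1]
  exact and_congr_right fun _ => forall_congr' fun u => by rw [h.2 u u.2]

theorem TableInv.keep {A : Finset (Fin n)} {N : NodeData n} {s s' : State} {P : ℕ}
    (h : TableInv G σ ρ w goal d A N.L₀ N.c₀ N.L₁ N.c₁ N.L₂ N.c₂ N.base s) (hk : Keep n P s s')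
    (hP : N.tableEnd ≤ P) : TableInv G σ ρ w goal d A N.L₀ N.c₀ N.L₁ N.c₁ N.L₂ N.c₂ N.base s' := by
  have hlt : ∀ t < N.c₀, ∀ j < N.c₁, ∀ q ≤ N.c₂ * N.c₂, cellAt N.base N.c₁ N.c₂ t j + q < P :=
    fun t ht j hj q hq => (N.cell_add_lt ht hj hq).trans_le hP
  refine ⟨fun t ht j hj q hq => ?_, fun D hD t ht j hj h0 h1 => ?_, fun t ht j hj q hq hu => ?_⟩
  · rw [(hk _ (hlt t ht j hj q hq)).1]
    refine (h.sound t ht j hj q hq).imp_right fun ⟨X, hX, hh⟩ => ⟨X, hX, ?_⟩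
    exact (Holds.keep hk (hlt t ht j hj q hq)).2 hh
  · obtain ⟨q, hq, hne, hh⟩ := h.complete D hD t ht j hj h0 h1
    exact ⟨q, hq, hne, (Holds.keep hk (hlt t ht j hj q hq)).2 hh⟩
  · rw [(hk _ (hlt t ht j hj q hq.le)).1] at hu
    exact h.witness t ht j hj q hq hu

/-- The numbers of the classes of sums of classes. -/
structure JoinTabs (d : ℕ) (A A' : Finset (Fin n)) (N N' M : NodeData n) (ta tb tc : ℕ → ℕ → ℕ) :
    Prop where
  ta_lt : ∀ i < N.c₀, ∀ j < N'.c₀, ta i j < M.c₀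
  tb_lt : ∀ j < N'.c₀, ∀ k < M.c₁, tb j k < N.c₁
  tc_lt : ∀ i < N.c₀, ∀ k < M.c₁, tc i k < N'.c₁
  ta_eq : ∀ i < N.c₀, ∀ j < N'.c₀, ∀ u, M.L₀ (ta i j) u =
    if u ∈ A ∪ A' then 0 else min d (N.L₀ i u + N'.L₀ j u)
  tb_eq : ∀ j < N'.c₀, ∀ k < M.c₁, ∀ u, N.L₁ (tb j k) u =
    if u ∈ A then min d (M.L₁ k u + N'.L₀ j u) else 0
  tc_eq : ∀ i < N.c₀, ∀ k < M.c₁, ∀ u, N'.L₁ (tc i k) u =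
    if u ∈ A' then min d (M.L₁ k u + N.L₀ i u) else 0

variable {A A' : Finset (Fin n)} {N N' M : NodeData n} {ta tb tc : ℕ → ℕ → ℕ}

theorem JoinTabs.sol (h : JoinTabs d A A' N N' M ta tb tc) (hAA : Disjoint A A') {i j k : ℕ}
    (hi : i < N.c₀) (hj : j < N'.c₀) (hk : k < M.c₁) {X X' : Finset (Fin n)}
    (hX : Sol G σ ρ d A (N.L₀ i) (N.L₁ (tb j k)) X)
    (hX' : Sol G σ ρ d A' (N'.L₀ j) (N'.L₁ (tc i k)) X') :
    Sol G σ ρ d (A ∪ A') (M.L₀ (ta i j)) (M.L₁ k) (X ∪ X') :=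
  hX.join hAA hX' (fun u hu => by rw [h.tb_eq j hj k hk, if_pos hu])
    (fun u hu => by rw [h.tc_eq i hi k hk, if_pos hu]) (h.ta_eq i hi j hj)

theorem exists_class_union {L : ℕ → Fin n → ℕ} {c : ℕ} (hAA : Disjoint A A')
    (h : ClassList G d (A ∪ A') Finset.univ L c) {f f' : Fin n → ℕ}
    (hf : ∃ X ⊆ A, f = classVec G d A X) (hf' : ∃ X ⊆ A', f' = classVec G d A' X) :
    ∃ t < c, ∀ u, L t u = if u ∈ A ∪ A' then 0 else min d (f u + f' u) := by
  obtain ⟨X, hX, rfl⟩ := hf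
  obtain ⟨X', hX', rfl⟩ := hf'
  obtain ⟨t, ht, hL⟩ := h.surj (X ∪ X') (Finset.union_subset_union hX hX') (Finset.subset_univ _)
  refine ⟨t, ht, fun u => ?_⟩
  rw [hL]
  split_ifs with hu
  · simp only [classVec, hu, if_true]
  · simp only [Finset.mem_union, not_or] at hu
    exact classVec_union (hAA.mono hX hX') hu.1 hu.2

/-- The complement of `A` is the disjoint union of `A'` and the complement of `A ∪ A'`, so this is
an instance of `exists_class_union`. -/
theorem exists_class_outer {L : ℕ → Fin n → ℕ} {c : ℕ} (hAA : Disjoint A A')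
    (h : ClassList G d Aᶜ Finset.univ L c) {f g : Fin n → ℕ}
    (hf : ∃ X ⊆ A', f = classVec G d A' X)
    (hg : ∃ X ⊆ (A ∪ A')ᶜ, g = classVec G d (A ∪ A')ᶜ X) :
    ∃ t < c, ∀ u, L t u = if u ∈ A then min d (g u + f u) else 0 := by
  have h1 : (A ∪ A')ᶜ ∪ A' = Aᶜ := by
    ext u
    have : u ∈ A → u ∉ A' := fun h => Finset.disjoint_left.1 hAA h
    simp; tauto
  have h2 : Disjoint (A ∪ A')ᶜ A' := by
    rw [Finset.disjoint_left]; simp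
  rw [← h1] at h
  obtain ⟨t, ht, hL⟩ := exists_class_union h2 h hg hf
  refine ⟨t, ht, fun u => ?_⟩
  rw [hL, h1]
  by_cases hu : u ∈ A <;> simp [hu]

/-- The traces of the best solution on the two children are stored in the cells given by the inner
classes of `A \ D` and `A' \ D` and the matching outer classes. Since all unions of stored sets are
inserted, the trace on the parent is among them. -/
theorem JoinTabs.complete (h : JoinTabs d A A' N N' M ta tb tc) (hAA : Disjoint A A') {s : State}
    (hN : TableInv G σ ρ w goal d A N.L₀ N.c₀ N.L₁ N.c₁ N.L₂ N.c₂ N.base s)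
    (hN' : TableInv G σ ρ w goal d A' N'.L₀ N'.c₀ N'.L₁ N'.c₁ N'.L₂ N'.c₂ N'.base s)
    (l₀ : ClassList G d A Finset.univ N.L₀ N.c₀)
    (l₀' : ClassList G d A' Finset.univ N'.L₀ N'.c₀)
    (hM : ClassList G d (A ∪ A') Finset.univ M.L₀ M.c₀) {𝒵 : ℕ → Set (Finset (Fin n))}
    (h𝒵 : ∀ i < N.c₀, ∀ j < N'.c₀, ∀ k < M.c₁, ∀ q ≤ N.c₂ * N.c₂, ∀ q' ≤ N'.c₂ * N'.c₂,
      ∀ X X', Holds s (N.cell i (tb j k) + q) X → Holds s (N'.cell j (tc i k) + q') X' →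
        X ∪ X' ∈ 𝒵 (ta i j * M.c₁ + k))
    (D : Finset (Fin n)) (hD : Best G σ ρ w goal D) (t : ℕ) (ht : t < M.c₀) (k : ℕ) (hk : k < M.c₁)
    (h0 : M.L₀ t = classVec G d (A ∪ A') ((A ∪ A') \ D))
    (h1 : M.L₁ k = classVec G d (A ∪ A')ᶜ ((A ∪ A')ᶜ \ D)) : D ∩ (A ∪ A') ∈ 𝒵 (t * M.c₁ + k) := by
  have hdisj := Finset.disjoint_left.1 hAA
  obtain ⟨i, hi, hLi⟩ := l₀.surj (A \ D) Finset.sdiff_subset (Finset.subset_univ _)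
  obtain ⟨j, hj, hLj⟩ := l₀'.surj (A' \ D) Finset.sdiff_subset (Finset.subset_univ _)
  have hAD : (A ∪ A') \ D = A \ D ∪ A' \ D := Finset.union_sdiff_distrib ..
  have hd : Disjoint (A \ D) (A' \ D) := hAA.mono Finset.sdiff_subset Finset.sdiff_subset
  have hta : ta i j = t := by
    refine hM.inj _ (h.ta_lt i hi j hj) _ ht ?_
    rw [h0]
    funext u
    rw [h.ta_eq i hi j hj]
    split_ifs with hu
    · simp only [classVec, hu, if_true]
    · simp only [Finset.mem_union, not_or] at hu
      rw [hAD, classVec_union hd hu.1 hu.2, hLi, hLj]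
  -- Stated for arbitrary sets because it is used for both children, with their roles exchanged.
  have outer : ∀ {A A' : Finset (Fin n)}, Disjoint A A' → ∀ u ∈ A,
      min d (classVec G d (A ∪ A')ᶜ ((A ∪ A')ᶜ \ D) u + classVec G d A' (A' \ D) u) =
        classVec G d Aᶜ (Aᶜ \ D) u := by
    intro A A' hAA u hu
    have hu' := Finset.disjoint_left.1 hAA hu
    have e1 : (A ∪ A')ᶜ ∪ A' = Aᶜ := by
      ext v
      have : v ∈ A → v ∉ A' := fun h => Finset.disjoint_left.1 hAA h
      simp; tauto
    have e2 : Disjoint ((A ∪ A')ᶜ \ D) (A' \ D) := by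
      rw [Finset.disjoint_left]
      intro v; simp; tauto
    rw [← e1, Finset.union_sdiff_distrib, classVec_union e2 (by simp [hu]) hu']
  have htb : N.L₁ (tb j k) = classVec G d Aᶜ (Aᶜ \ D) := by
    funext u
    rw [h.tb_eq j hj k hk]
    split_ifs with hu
    · rw [h1, hLj, outer hAA u hu]
    · simp [classVec, hu]
  have htc : N'.L₁ (tc i k) = classVec G d A'ᶜ (A'ᶜ \ D) := by
    funext u
    rw [h.tc_eq i hi k hk]
    split_ifs with hu
    · rw [h1, hLi, Finset.union_comm A A', outer hAA.symm u hu]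
    · simp [classVec, hu]
  obtain ⟨q, hq, -, hh⟩ := hN.complete D hD i hi _ (h.tb_lt j hj k hk) hLi htb
  obtain ⟨q', hq', -, hh'⟩ := hN'.complete D hD j hj _ (h.tc_lt i hi k hk) hLj htc
  have := h𝒵 i hi j hj k hk q hq q' hq' _ _ hh hh'
  rwa [hta, ← Finset.inter_union_distrib_left] at this

end Join

/-! ### Tables of sums -/

/-- Apply `pair` to the inner list of the node in register `xa`, a list of the node in `xb`, and a
list of the node in `xt`, on the inside or outside of the node in `m`. -/
def tab (d m b xa xb eb xt et o : ℕ) : Prog := block [mask m b,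
  assign rSa (get 21 (var xa)), assign rCa (get 24 (var xa)),
  assign rSb (get (21 + eb) (var xb)), assign rCb (get (24 + eb) (var xb)),
  assign rSt (get (21 + et) (var xt)), assign rCn (get (24 + et) (var xt)), pair d o]

theorem tab_spec {n B d m b xa xb eb xt et o km ka kb kt sa ca sb cb st ct : ℕ}
    {Am : Finset (Fin n)} {La Lb Lt : ℕ → Fin n → ℕ} {s : State} (hn : s.reg rN = n)
    (hx : 38 ≤ m ∧ 38 ≤ xa ∧ 38 ≤ xb ∧ 38 ≤ xt) (ho : 18 ≤ o) (hb : b ≤ 1)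
    (hm : s.reg m = km) (hxa : s.reg xa = ka) (hxb : s.reg xb = kb) (hxt : s.reg xt = kt)
    (hins : ∀ u : Fin n, s.mem aIns (km * n + u) = if u ∈ Am then 1 else 0)
    (hsa : s.mem 21 ka = sa) (hca : s.mem 24 ka = ca)
    (hsb : s.mem (21 + eb) kb = sb) (hcb : s.mem (24 + eb) kb = cb)
    (hst : s.mem (21 + et) kt = st) (hct : s.mem (24 + et) kt = ct)
    (va : ∀ i < ca, s.vec (sa + i) = La i) (vb : ∀ i < cb, s.vec (sb + i) = Lb i)
    (vt : ∀ i < ct, s.vec (st + i) = Lt i)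
    (hla : ∀ i < ca, ∀ u, La i u ≤ d) (hlb : ∀ i < cb, ∀ u, Lb i u ≤ d)
    (hex : ∀ i < ca, ∀ j < cb, ∃ k < ct, ∀ u,
      Lt k u = (if (if u ∈ Am then 1 else 0) = b then 1 else 0) * min d (La i u + Lb j u))
    (hkm : (km + 1) * n ≤ B) (hk : ka ≤ B ∧ kb ≤ B ∧ kt ≤ B)
    (hBa : (sa + ca) * n ≤ B) (hBa' : sa + ca ≤ B) (hBb : (sb + cb) * n ≤ B) (hBb' : sb + cb ≤ B)
    (hBt : (st + ct) * n ≤ B) (hBt' : st + ct ≤ B) (hcc : ca * cb ≤ B)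
    (hnB : n ≤ B) (hd : 2 * d + 1 ≤ B) :
    Runs B (tab d m b xa xb eb xt et o) s (300 * ((ca + 1) * (cb + 1) * ((ct + 1) * (n + 1))))
      fun s' => ∀ i < ca, ∀ j < cb, s'.mem o (i * cb + j) < ct ∧ ∀ u, Lt (s'.mem o (i * cb + j)) u =
        (if (if u ∈ Am then 1 else 0) = b then 1 else 0) * min d (La i u + Lb j u) := by
  obtain ⟨x1, x2, x3, x4⟩ := hx
  have hle : n + 1 ≤ (ca + 1) * (cb + 1) * ((ct + 1) * (n + 1)) := by
    calc n + 1 = 1 * 1 * (1 * (n + 1)) := by ring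
      _ ≤ _ := by gcongr <;> omega
  refine Runs.seq (mask_spec (n := n) hn hm (by omega) hkm hnB (by omega) hb)
    (T₂ := 250 * ((ca + 1) * (cb + 1) * ((ct + 1) * (n + 1))) + 24) ?_ (by omega)
  intro s1 ha1 hmk
  have hr : ∀ x, x ≠ rGu → s1.reg x = s.reg x := fun x hx =>
    ha1.reg x (by simp [mask, forLoop, writesR, hx.symm])
  have hmem : ∀ a, a ≠ aMsk → s1.mem a = s.mem a := fun a hx =>
    ha1.mem a (by simp [mask, forLoop, writesM, hx.symm])
  have r1 := (hr xa (by omega)).trans hxa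
  have r2 := (hr xb (by omega)).trans hxb
  have r3 := (hr xt (by omega)).trans hxt
  have r0 := (hr rN (by omega)).trans hn
  have hab : ∀ a, (a = 21 ∨ a = 24 ∨ a = 21 + eb ∨ a = 24 + eb ∨ a = 21 + et ∨ a = 24 + et ∨
    a = aVec) → s1.mem a = s.mem a := fun a h => hmem a (by omega)
  set c := 250 * ((ca + 1) * (cb + 1) * ((ct + 1) * (n + 1))) with hc
  have e1 : ∀ x y, 38 ≤ x → y < 38 → x ≠ y := fun x y _ _ => by omega
  refine Runs.step (T₂ := c + 20) (by simp [safe, r1]; omega) ?_ (by simp [dur]; omega)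
  refine Runs.step (T₂ := c + 16) (by simp [safe, run, r1, e1 xa _ x2]; omega) ?_
    (by simp [dur]; omega)
  refine Runs.step (T₂ := c + 12) (by simp [safe, run, r2, e1 xb _ x3]; omega) ?_
    (by simp [dur]; omega)
  refine Runs.step (T₂ := c + 8) (by simp [safe, run, r2, e1 xb _ x3]; omega) ?_
    (by simp [dur]; omega)
  refine Runs.step (T₂ := c + 4) (by simp [safe, run, r3, e1 xt _ x4]; omega) ?_
    (by simp [dur]; omega)
  refine Runs.step (T₂ := c) (by simp [safe, run, r3, e1 xt _ x4]; omega) ?_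
    (by simp [dur]; omega)
  have hmk' : ∀ u : Fin n, s1.mem aMsk u =
      if (if u ∈ Am then 1 else 0) = b then 1 else 0 := fun u => by rw [hmk, hins]
  refine (pair_spec (d := d) (o := o) (sa := sa) (ca := ca) (sb := sb) (cb := cb) (st := st) (cn := ct)
    (m := fun u : Fin n => if (if u ∈ Am then 1 else 0) = b then 1 else 0)
    (by omega) (by omega) (by omega) ?_ ?_ (fun u => by split_ifs <;> omega) ?_ ?_ ?_ ?_ ?_ ?_ ?_ ?_ ?_
    hBa hBa' hBb hBb' hBt hBt' hcc hnB hd).mono le_rfl ?_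
  · simp [run, r0]
  · simpa [run] using hmk'
  · simp [run, r1, hab, hsa]
  · simp [run, r1, e1 xa _ x2, hab, hca]
  · simp [run, r2, e1 xb _ x3, hab, hsb]
  · simp [run, r2, e1 xb _ x3, hab, hcb]
  · simp [run, r3, e1 xt _ x4, hab, hst]
  · simp [run, r3, e1 xt _ x4, hab, hct]
  · intro i hi u
    have := congrFun (va i hi) u
    simp only [State.vec] at this
    simp only [run, State.vec, setReg_mem, hab aVec (by simp), this]
    exact hla i hi u
  · intro i hi u
    have := congrFun (vb i hi) u
    simp only [State.vec] at this
    simp only [run, State.vec, setReg_mem, hab aVec (by simp), this]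
    exact hlb i hi u
  · intro i hi j hj
    obtain ⟨k, hk, h⟩ := hex i hi j hj
    refine ⟨k, hk, fun u => ?_⟩
    have h1 := congrFun (va i hi) u
    have h2 := congrFun (vb j hj) u
    have h3 := congrFun (vt k hk) u
    simp only [State.vec] at h1 h2 h3
    simp only [run, State.vec, setReg_mem, hab aVec (by simp), h1, h2, h3]
    exact h u
  · rintro s2 - h i hi j hj
    obtain ⟨h1, h2⟩ := h i hi j hj
    refine ⟨h1, fun u => ?_⟩
    have h3 := h2 u
    have k1 := congrFun (va i hi) u
    have k2 := congrFun (vb j hj) u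
    have k3 := congrFun (vt _ h1) u
    simp only [State.vec] at k1 k2 k3
    simp only [run, State.vec, setReg_mem, hab aVec (by simp), k1, k2, k3] at h3
    exact h3

notation "rCi" => (48 : ℕ)
notation "rJ" => (49 : ℕ)
notation "rCj" => (50 : ℕ)
notation "rK" => (51 : ℕ)
notation "rQa" => (52 : ℕ)
notation "rKl" => (53 : ℕ)
notation "rQb" => (54 : ℕ)
notation "rKr" => (55 : ℕ)
notation "rCa0" => (56 : ℕ)
notation "rCb0" => (57 : ℕ)
notation "rCl" => (58 : ℕ)
notation "rCr" => (59 : ℕ)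
notation "rBl" => (60 : ℕ)
notation "rBr" => (61 : ℕ)

/-! ### Combining the tables of two children -/

/-- Insert the union of the sets in two slots. -/
def combine (goal : Goal) : Prog := block [
  forLoop rGu rN (store aX (var rGu) (get aSX ((var rCa0 + var rQa) * var rN + var rGu) +
    get aSX ((var rCb0 + var rQb) * var rN + var rGu))),
  assign rCell (var rBs + (get aTa (var rI * var rCj + var rJ) * var rCk + var rK) * var rKs),
  insertSet goal]

def combineSlots (goal : Goal) : Prog :=
  Prog.ite (get aUsed (var rCa0 + var rQa) * get aUsed (var rCb0 + var rQb)) (combine goal) skip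

/-- Insert the unions of all sets in two cells. -/
def combineCells (goal : Goal) : Prog := block [
  assign rCa0 (var rBl + (var rI * var rCl + get aTb (var rJ * var rCk + var rK)) * var rKl),
  assign rCb0 (var rBr + (var rJ * var rCr + get aTc (var rI * var rCk + var rK)) * var rKr),
  forLoop rQa rKl (forLoop rQb rKr (combineSlots goal))]

def combineAll (goal : Goal) : Prog :=
  forLoop rI rCi (forLoop rJ rCj (forLoop rK rCk (combineCells goal)))

section Combine

variable {n : ℕ} {G : SimpleGraph (Fin n)} {σ ρ : Set ℕ} {w : Fin n → ℚ} {goal : Goal} {d : ℕ}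
  {A A' : Finset (Fin n)} {N N' M : NodeData n} {ta tb tc : ℕ → ℕ → ℕ}

/-- Registers and memory that do not change while the tables of two children are combined. -/
structure JoinEnv (G : SimpleGraph (Fin n)) (w : Fin n → ℚ) (N N' M : NodeData n)
    (ta tb tc : ℕ → ℕ → ℕ) (s : State) : Prop where
  env : Env G w M.c₂ M.s₂ s
  vec : M.L₂ = fun i => s.vec (M.s₂ + i)
  ck : s.reg rCk = M.c₁
  bs : s.reg rBs = M.base
  ci : s.reg rCi = N.c₀
  cj : s.reg rCj = N'.c₀
  kl : s.reg rKl = N.c₂ * N.c₂ + 1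
  kr : s.reg rKr = N'.c₂ * N'.c₂ + 1
  cl : s.reg rCl = N.c₁
  cr : s.reg rCr = N'.c₁
  bl : s.reg rBl = N.base
  br : s.reg rBr = N'.base
  ta : ∀ i < N.c₀, ∀ j < N'.c₀, s.mem aTa (i * N'.c₀ + j) = ta i j
  tb : ∀ j < N'.c₀, ∀ k < M.c₁, s.mem aTb (j * M.c₁ + k) = tb j k
  tc : ∀ i < N.c₀, ∀ k < M.c₁, s.mem aTc (i * M.c₁ + k) = tc i k

def joinRegs : List ℕ :=
  [rN, rStC, rKo, rKp, rKs, rCk, rBs, rCi, rCj, rKl, rKr, rCl, rCr, rBl, rBr]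

theorem JoinEnv.of_agree {p : Prog} {s s' : State} (h : JoinEnv G w N N' M ta tb tc s)
    (ha : Agree p s s') (hr : (joinRegs.all fun x => !p.writesR x) = true)
    (hm : ([aAdj, aVec, aTa, aTb, aTc].all fun x => !p.writesM x) = true)
    (hw : p.writesW 0 = false) : JoinEnv G w N N' M ta tb tc s' := by
  simp only [joinRegs, List.all_cons, Bool.and_eq_true, Bool.not_eq_true', List.all_nil] at hr hm
  obtain ⟨r1, r2, r3, r4, r5, r6, r7, r8, r9, r10, r11, r12, r13, r14, r15, -⟩ := hr
  obtain ⟨m1, m2, m3, m4, m5, -⟩ := hm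
  refine ⟨⟨(ha.reg _ r1).trans h.env.reg_n, ?_, ?_, (ha.reg _ r2).trans h.env.stC,
    (ha.reg _ r3).trans h.env.ko, (ha.reg _ r4).trans h.env.kp, (ha.reg _ r5).trans h.env.ks⟩, ?_,
    (ha.reg _ r6).trans h.ck, (ha.reg _ r7).trans h.bs, (ha.reg _ r8).trans h.ci,
    (ha.reg _ r9).trans h.cj, (ha.reg _ r10).trans h.kl, (ha.reg _ r11).trans h.kr,
    (ha.reg _ r12).trans h.cl, (ha.reg _ r13).trans h.cr, (ha.reg _ r14).trans h.bl,
    (ha.reg _ r15).trans h.br, ?_, ?_, ?_⟩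
  · rw [ha.mem _ m1]; exact h.env.adj
  · rw [ha.wt _ hw]; exact h.env.w
  · rw [h.vec]; funext i u; simp only [State.vec, ha.mem _ m2]
  · rw [ha.mem _ m3]; exact h.ta
  · rw [ha.mem _ m4]; exact h.tb
  · rw [ha.mem _ m5]; exact h.tc

/-- The children's tables lie below the table being filled, so their slots can still be read as they
were in `s₀`. The two sets are disjoint, so their characteristic vectors can simply be added. As the
contents of a slot are unique, treating the found pair covers all `X` and `X'` in the conclusion. -/
theorem combineSlots_spec {B κ i j k a b : ℕ} {s₀ s : State} {𝒵 : ℕ → Set (Finset (Fin n))}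
    (hAA : Disjoint A A') (hT : JoinTabs d A A' N N' M ta tb tc)
    (hN : TableInv G σ ρ w goal d A N.L₀ N.c₀ N.L₁ N.c₁ N.L₂ N.c₂ N.base s₀)
    (hN' : TableInv G σ ρ w goal d A' N'.L₀ N'.c₀ N'.L₁ N'.c₁ N'.L₂ N'.c₂ N'.base s₀)
    (hend : N.tableEnd ≤ M.base) (hend' : N'.tableEnd ≤ M.base)
    (hf : FillInv G σ ρ w goal d (A ∪ A') M s₀ 𝒵 s) (he : JoinEnv G w N N' M ta tb tc s)
    (hB : Bounds B d κ M) (hcc : N.c₀ * N'.c₀ ≤ B)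
    (hi : i < N.c₀) (hj : j < N'.c₀) (hk : k < M.c₁) (ha : a ≤ N.c₂ * N.c₂)
    (hb : b ≤ N'.c₂ * N'.c₂) (ri : s.reg rI = i) (rj : s.reg rJ = j) (rk : s.reg rK = k)
    (ra : s.reg rQa = a) (rb : s.reg rQb = b) (rca : s.reg rCa0 = N.cell i (tb j k))
    (rcb : s.reg rCb0 = N'.cell j (tc i k)) :
    Runs B (combineSlots goal) s (insertTime n (M.c₂ * M.c₂) + 60 * (n + 1)) fun s' =>
      ∃ 𝒵', 𝒵 ≤ 𝒵' ∧ FillInv G σ ρ w goal d (A ∪ A') M s₀ 𝒵' s' ∧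
        ∀ X X', Holds s₀ (N.cell i (tb j k) + a) X → Holds s₀ (N'.cell j (tc i k) + b) X' →
          X ∪ X' ∈ 𝒵' (ta i j * M.c₁ + k) := by
  obtain ⟨b1, b2, b3, b4, b5, b6, b7, b8, b9, b10, b11, b12, b13⟩ := hB
  have hnB : n ≤ B := le_trans (Nat.le_mul_self n) b12
  have hMs : M.base ≤ M.tableEnd := Nat.le_add_right _ _
  have lta := (N.cell_add_lt hi (hT.tb_lt j hj k hk) ha).trans_le hend
  have ltb := (N'.cell_add_lt hj (hT.tc_lt i hi k hk) hb).trans_le hend'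
  generalize hP : N.cell i (tb j k) + a = P at *
  generalize hP' : N'.cell j (tc i k) + b = P' at *
  have sa := hN.sound i hi _ (hT.tb_lt j hj k hk) a ha
  have sb := hN'.sound j hj _ (hT.tc_lt i hi k hk) b hb
  change s₀.mem aUsed (N.cell i (tb j k) + a) = 0 ∨
    ∃ X, _ ∧ Holds s₀ (N.cell i (tb j k) + a) X at sa
  change s₀.mem aUsed (N'.cell j (tc i k) + b) = 0 ∨
    ∃ X, _ ∧ Holds s₀ (N'.cell j (tc i k) + b) X at sb
  rw [hP] at sa
  rw [hP'] at sb
  have ua := (hf.keep P lta).1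
  have ub := (hf.keep P' ltb).1
  have ule : s₀.mem aUsed P ≤ 1 ∧ s₀.mem aUsed P' ≤ 1 :=
    ⟨by rcases sa with h | ⟨X, -, h⟩ <;> [omega; exact h.1.le],
      by rcases sb with h | ⟨X, -, h⟩ <;> [omega; exact h.1.le]⟩
  have umul : s₀.mem aUsed P * s₀.mem aUsed P' ≤ 1 := by
    calc _ ≤ 1 * 1 := Nat.mul_le_mul ule.1 ule.2
      _ = 1 := rfl
  refine Runs.ite (T := insertTime n (M.c₂ * M.c₂) + 50 * (n + 1)) ?_ ?_ ?_ (by simp; omega)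
  · simp [rca, ra, rcb, rb, hP, hP', ua, ub]
    omega
  · intro h
    simp [rca, ra, rcb, rb, hP, hP', ua, ub] at h
    obtain ⟨X, hX, hhX⟩ := sa.resolve_left h.1
    obtain ⟨X', hX', hhX'⟩ := sb.resolve_left h.2
    have hsol := hT.sol hAA hi hj hk hX hX'
    have hXX : Disjoint X X' := hAA.mono hX.sub hX'.sub
    have hXd := Finset.disjoint_left.1 hXX
    refine Runs.seq (Runs.for (N := n) (Tb := 25) (fun m s' => ∀ u : Fin n, (u : ℕ) < m →
        s'.mem aX u = if u ∈ X ∪ X' then 1 else 0) he.env.reg_n hnB (by omega) (by simp) ?_ le_rfl)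
      (T₂ := insertTime n (M.c₂ * M.c₂) + 16) ?_ (by omega)
    · intro x hx s1 hx1 ha1 hinv
      have e0 := (ha1.reg rN rfl).trans he.env.reg_n
      have e1 := (ha1.reg rCa0 rfl).trans rca
      have e2 := (ha1.reg rQa rfl).trans ra
      have e3 := (ha1.reg rCb0 rfl).trans rcb
      have e4 := (ha1.reg rQb rfl).trans rb
      have em := ha1.mem aSX rfl
      have i1 := idx_lt (show P < M.tableEnd by omega) hx
      have i2 := idx_lt (show P' < M.tableEnd by omega) hx
      have v1 : s.mem aSX (P * n + x) = if (⟨x, hx⟩ : Fin n) ∈ X then 1 else 0 :=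
        ((hf.keep P lta).2 x hx).trans (hhX.2 ⟨x, hx⟩)
      have v2 : s.mem aSX (P' * n + x) = if (⟨x, hx⟩ : Fin n) ∈ X' then 1 else 0 :=
        ((hf.keep P' ltb).2 x hx).trans (hhX'.2 ⟨x, hx⟩)
      refine Runs.straight ?_ ?_ (by simp [dur])
      · simp only [safe, fits_var, fits_add, fits_get, fits_mul, eval_var, eval_add, eval_get,
          eval_mul, e0, e1, e2, e3, e4, hx1, hP, hP', em, v1, v2]
        constructorm* _ ∧ _ <;> first | trivial | omega | (split_ifs <;> omega)
      · simp only [run, eval_var, eval_add, eval_get, eval_mul, e0, e1, e2, e3, e4, hx1, hP, hP', em,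
          v1, v2, setReg_mem, setMem_mem, true_and]
        intro u hu
        by_cases hui : (u : ℕ) = x
        · have : u = ⟨x, hx⟩ := Fin.ext hui
          subst this
          have h3 := @hXd ⟨x, hx⟩
          by_cases h1 : (⟨x, hx⟩ : Fin n) ∈ X <;> by_cases h2 : (⟨x, hx⟩ : Fin n) ∈ X' <;>
            simp_all
        · rw [if_neg hui]; exact hinv u (by omega)
    · intro s1 ha1 hX1
      have he1 := he.of_agree ha1 (by decide) (by decide) rfl
      have r1 := (ha1.reg rI rfl).trans ri
      have r2 := (ha1.reg rJ rfl).trans rj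
      have r3 := (ha1.reg rK rfl).trans rk
      have hta := hT.ta_lt i hi j hj
      have hcl := M.cell_add_lt hta hk (Nat.zero_le _)
      have hcl2 : M.cell (ta i j) k = M.base + (ta i j * M.c₁ + k) * (M.c₂ * M.c₂ + 1) := rfl
      have hFc : ta i j * M.c₁ + k ≤ (ta i j * M.c₁ + k) * (M.c₂ * M.c₂ + 1) :=
        Nat.le_mul_of_pos_right _ (by omega)
      have hij := idx_lt hi hj
      refine Runs.step (T₂ := insertTime n (M.c₂ * M.c₂)) ?_ ?_ (by simp [dur]; omega)
      · simp [safe, r1, r2, r3, he1.cj, he1.ck, he1.bs, he1.env.ks, he1.ta i hi j hj]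
        constructorm* _ ∧ _ <;> omega
      · simp only [run, eval_var, eval_add, eval_mul, eval_get, r1, r2, r3, he1.cj, he1.ck, he1.bs,
          he1.env.ks, he1.ta i hi j hj]
        have hf1 : FillInv G σ ρ w goal d (A ∪ A') M s₀ 𝒵 s1 :=
          hf.of_eq (ha1.mem _ rfl) (ha1.mem _ rfl) (ha1.mem _ rfl)
        -- Agreement is used for the update of a register that the environment does not mention; the
        -- program here only serves to name that register.
        have he2 := he1.of_agree (p := assign rCell 0) (s' := s1.setReg rCell
          (M.base + (ta i j * M.c₁ + k) * (M.c₂ * M.c₂ + 1))) ⟨fun x hx => by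
            have : 29 ≠ x := by simpa [writesR] using hx
            simp [this.symm], fun _ _ => rfl, fun _ _ => rfl⟩ (by decide) (by decide) rfl
        refine ((hf1.of_eq (s' := s1.setReg rCell
          (M.base + (ta i j * M.c₁ + k) * (M.c₂ * M.c₂ + 1))) rfl rfl rfl).runs_insertSet
          he2.env he2.vec hta hk (by simp [hcl2]) ?_ hsol b1 b2 b6 b9 b12 (by omega)).mono le_rfl ?_
        · intro u; simpa using hX1 u u.2
        · rintro s2 - ⟨𝒵₂, h1, h2, h3⟩
          refine ⟨𝒵₂, h1, h2, fun Y Y' hY hY' => ?_⟩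
          rw [hY.2.unique hhX.2, hY'.2.unique hhX'.2]
          exact h3
  · intro h
    simp [rca, ra, rcb, rb, hP, hP', ua, ub] at h
    refine Runs.straight trivial ⟨𝒵, le_rfl, hf, fun Y Y' hY hY' => ?_⟩ (by simp [dur]; omega)
    have := hY.1
    have := hY'.1
    omega

end Combine

section Combine

variable {n : ℕ} {G : SimpleGraph (Fin n)} {σ ρ : Set ℕ} {w : Fin n → ℚ} {goal : Goal} {d : ℕ}
  {A A' : Finset (Fin n)} {N N' M : NodeData n} {ta tb tc : ℕ → ℕ → ℕ}

/-- The loops have `N.c₂ * N.c₂ + 1` and `N'.c₂ * N'.c₂ + 1` rounds, so the extra slots for the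
empty set take part. -/
theorem combineCells_spec {B κ i j k : ℕ} {s₀ s : State} {𝒵 : ℕ → Set (Finset (Fin n))}
    (hAA : Disjoint A A') (hT : JoinTabs d A A' N N' M ta tb tc)
    (hN : TableInv G σ ρ w goal d A N.L₀ N.c₀ N.L₁ N.c₁ N.L₂ N.c₂ N.base s₀)
    (hN' : TableInv G σ ρ w goal d A' N'.L₀ N'.c₀ N'.L₁ N'.c₁ N'.L₂ N'.c₂ N'.base s₀)
    (hend : N.tableEnd ≤ M.base) (hend' : N'.tableEnd ≤ M.base)
    (hf : FillInv G σ ρ w goal d (A ∪ A') M s₀ 𝒵 s) (he : JoinEnv G w N N' M ta tb tc s)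
    (hB : Bounds B d κ M) (hcc : N.c₀ * N'.c₀ ≤ B) (hcb : N'.c₀ * M.c₁ ≤ B) (hca : N.c₀ * M.c₁ ≤ B)
    (hi : i < N.c₀) (hj : j < N'.c₀) (hk : k < M.c₁)
    (ri : s.reg rI = i) (rj : s.reg rJ = j) (rk : s.reg rK = k) :
    Runs B (combineCells goal) s ((N.c₂ * N.c₂ + 1) * ((N'.c₂ * N'.c₂ + 1) *
        (insertTime n (M.c₂ * M.c₂) + 67 * (n + 1)) + 12) + 50) fun s' =>
      ∃ 𝒵', 𝒵 ≤ 𝒵' ∧ FillInv G σ ρ w goal d (A ∪ A') M s₀ 𝒵' s' ∧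
        ∀ a < N.c₂ * N.c₂ + 1, ∀ b < N'.c₂ * N'.c₂ + 1, ∀ X X',
          Holds s₀ (N.cell i (tb j k) + a) X → Holds s₀ (N'.cell j (tc i k) + b) X' →
          X ∪ X' ∈ 𝒵' (ta i j * M.c₁ + k) := by
  have hB' := hB
  obtain ⟨b1, b2, b3, b4, b5, b6, b7, b8, b9, b10, b11, b12, b13⟩ := hB'
  have hMs : M.base ≤ M.tableEnd := Nat.le_add_right _ _
  have htb := hT.tb_lt j hj k hk
  have htc := hT.tc_lt i hi k hk
  have l1 := N.cell_add_lt hi htb (Nat.zero_le _)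
  have l2 := N'.cell_add_lt hj htc (Nat.zero_le _)
  have d1 : N.cell i (tb j k) = N.base + (i * N.c₁ + tb j k) * (N.c₂ * N.c₂ + 1) := rfl
  have d2 : N'.cell j (tc i k) = N'.base + (j * N'.c₁ + tc i k) * (N'.c₂ * N'.c₂ + 1) := rfl
  have hF1 : i * N.c₁ + tb j k ≤ (i * N.c₁ + tb j k) * (N.c₂ * N.c₂ + 1) :=
    Nat.le_mul_of_pos_right _ (by omega)
  have hF2 : j * N'.c₁ + tc i k ≤ (j * N'.c₁ + tc i k) * (N'.c₂ * N'.c₂ + 1) :=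
    Nat.le_mul_of_pos_right _ (by omega)
  have i1 := idx_lt hj hk
  have i2 := idx_lt hi hk
  have hk1 := (N.cell_add_lt hi htb (le_refl (N.c₂ * N.c₂))).trans_le hend
  have hk2 := (N'.cell_add_lt hj htc (le_refl (N'.c₂ * N'.c₂))).trans_le hend'
  set U := insertTime n (M.c₂ * M.c₂) + 67 * (n + 1) with hU
  refine Runs.step (T₂ := (N.c₂ * N.c₂ + 1) * ((N'.c₂ * N'.c₂ + 1) * U + 12) + 30) ?_ ?_
    (by simp [dur]; omega)
  · simp [safe, ri, rj, rk, he.bl, he.cl, he.kl, he.ck, he.tb j hj k hk]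
    constructorm* _ ∧ _ <;> omega
  simp only [run, eval_var, eval_add, eval_mul, eval_get, ri, rj, rk, he.bl, he.cl, he.kl, he.ck,
    he.tb j hj k hk, ← d1]
  have he1 := he.of_agree (p := assign rCa0 0) (s' := s.setReg rCa0 (N.cell i (tb j k)))
    ⟨fun x hx => by
      have : 56 ≠ x := by simpa [writesR] using hx
      simp [this.symm], fun _ _ => rfl, fun _ _ => rfl⟩ (by decide) (by decide) rfl
  have hf1 := hf.of_eq (s' := s.setReg rCa0 (N.cell i (tb j k))) rfl rfl rfl
  have p1 : (s.setReg rCa0 (N.cell i (tb j k))).reg rI = i := by simp [ri]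
  have p2 : (s.setReg rCa0 (N.cell i (tb j k))).reg rJ = j := by simp [rj]
  have p3 : (s.setReg rCa0 (N.cell i (tb j k))).reg rK = k := by simp [rk]
  have p4 : (s.setReg rCa0 (N.cell i (tb j k))).reg rCa0 = N.cell i (tb j k) := by simp
  generalize s.setReg rCa0 (N.cell i (tb j k)) = s1 at *
  refine Runs.step (T₂ := (N.c₂ * N.c₂ + 1) * ((N'.c₂ * N'.c₂ + 1) * U + 12) + 5) ?_ ?_
    (by simp [dur]; omega)
  · simp [safe, p1, p2, p3, he1.br, he1.cr, he1.kr, he1.ck, he1.tc i hi k hk]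
    constructorm* _ ∧ _ <;> omega
  simp only [run, eval_var, eval_add, eval_mul, eval_get, p1, p2, p3, he1.br, he1.cr, he1.kr, he1.ck,
    he1.tc i hi k hk, ← d2]
  have he2 := he1.of_agree (p := assign rCb0 0) (s' := s1.setReg rCb0 (N'.cell j (tc i k)))
    ⟨fun x hx => by
      have : 57 ≠ x := by simpa [writesR] using hx
      simp [this.symm], fun _ _ => rfl, fun _ _ => rfl⟩ (by decide) (by decide) rfl
  have hf2 := hf1.of_eq (s' := s1.setReg rCb0 (N'.cell j (tc i k))) rfl rfl rfl
  have q1 : (s1.setReg rCb0 (N'.cell j (tc i k))).reg rI = i := by simp [p1]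
  have q2 : (s1.setReg rCb0 (N'.cell j (tc i k))).reg rJ = j := by simp [p2]
  have q3 : (s1.setReg rCb0 (N'.cell j (tc i k))).reg rK = k := by simp [p3]
  have q4 : (s1.setReg rCb0 (N'.cell j (tc i k))).reg rCa0 = N.cell i (tb j k) := by simp [p4]
  have q5 : (s1.setReg rCb0 (N'.cell j (tc i k))).reg rCb0 = N'.cell j (tc i k) := by simp
  generalize s1.setReg rCb0 (N'.cell j (tc i k)) = s2 at *
  refine Runs.forAcc (fun 𝒵 s => FillInv G σ ρ w goal d (A ∪ A') M s₀ 𝒵 s) _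
    (Tb := (N'.c₂ * N'.c₂ + 1) * U + 5) ?_ he2.kl (by omega) (by omega) hf2
    (fun _ _ _ h => h.of_eq rfl rfl rfl) ?_ le_rfl (by cases goal <;> rfl)
    (by cases goal <;> rfl) (by decide)
  · intro a 𝒵₁ 𝒵₂ hle h b hb X X' hX hX'
    exact hle _ (h b hb X X' hX hX')
  intro a ha 𝒵₃ s3 hx3 a3 hf3
  have he3 := he2.of_agree a3 (by cases goal <;> decide) (by cases goal <;> decide)
    (by cases goal <;> rfl)
  have h3 : ∀ x, x = rI ∨ x = rJ ∨ x = rK ∨ x = rCa0 ∨ x = rCb0 → s3.reg x = s2.reg x :=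
    fun x hx => a3.reg x (by rcases hx with rfl | rfl | rfl | rfl | rfl <;> cases goal <;> rfl)
  refine Runs.forAcc (fun 𝒵 s => FillInv G σ ρ w goal d (A ∪ A') M s₀ 𝒵 s) _
    (Tb := insertTime n (M.c₂ * M.c₂) + 60 * (n + 1)) ?_ he3.kr (by omega) (by omega) hf3
    (fun _ _ _ h => h.of_eq rfl rfl rfl) ?_ ?_ (by cases goal <;> rfl)
    (by cases goal <;> rfl) (by decide)
  · intro b 𝒵₁ 𝒵₂ hle h X X' hX hX'
    exact hle _ (h X X' hX hX')
  · intro b hb 𝒵₄ s4 hx4 a4 hf4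
    have he4 := he3.of_agree a4 (by cases goal <;> decide) (by cases goal <;> decide)
      (by cases goal <;> rfl)
    have h4 : ∀ x, x = rI ∨ x = rJ ∨ x = rK ∨ x = rCa0 ∨ x = rCb0 ∨ x = rQa →
      s4.reg x = s3.reg x := fun x hx =>
        a4.reg x (by rcases hx with rfl | rfl | rfl | rfl | rfl | rfl <;> cases goal <;> rfl)
    exact combineSlots_spec hAA hT hN hN' hend hend' hf4 he4 hB hcc hi hj hk (by omega) (by omega)
      ((h4 _ (by simp)).trans ((h3 _ (by simp)).trans q1))
      ((h4 _ (by simp)).trans ((h3 _ (by simp)).trans q2))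
      ((h4 _ (by simp)).trans ((h3 _ (by simp)).trans q3))
      ((h4 _ (by simp)).trans hx3) hx4
      ((h4 _ (by simp)).trans ((h3 _ (by simp)).trans q4))
      ((h4 _ (by simp)).trans ((h3 _ (by simp)).trans q5))
  · refine Nat.add_le_add_right (Nat.mul_le_mul_left _ ?_) 5
    omega

/-- The inner classes of the two children and the outer class of the parent determine all other
classes. So three nested loops suffice, and this is the origin of the third power of `S`. -/
theorem combineAll_spec {B κ : ℕ} {s₀ s : State} {𝒵 : ℕ → Set (Finset (Fin n))}
    (hAA : Disjoint A A') (hT : JoinTabs d A A' N N' M ta tb tc)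
    (hN : TableInv G σ ρ w goal d A N.L₀ N.c₀ N.L₁ N.c₁ N.L₂ N.c₂ N.base s₀)
    (hN' : TableInv G σ ρ w goal d A' N'.L₀ N'.c₀ N'.L₁ N'.c₁ N'.L₂ N'.c₂ N'.base s₀)
    (hend : N.tableEnd ≤ M.base) (hend' : N'.tableEnd ≤ M.base)
    (hf : FillInv G σ ρ w goal d (A ∪ A') M s₀ 𝒵 s) (he : JoinEnv G w N N' M ta tb tc s)
    (hB : Bounds B d κ M) (hcc : N.c₀ * N'.c₀ ≤ B) (hcb : N'.c₀ * M.c₁ ≤ B)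
    (hca : N.c₀ * M.c₁ ≤ B) (h0 : N.c₀ ≤ B) (h0' : N'.c₀ ≤ B) :
    Runs B (combineAll goal) s (N.c₀ * (N'.c₀ * (M.c₁ * ((N.c₂ * N.c₂ + 1) * ((N'.c₂ * N'.c₂ + 1) *
        (insertTime n (M.c₂ * M.c₂) + 67 * (n + 1)) + 12) + 57) + 12) + 12) + 5) fun s' =>
      ∃ 𝒵', 𝒵 ≤ 𝒵' ∧ FillInv G σ ρ w goal d (A ∪ A') M s₀ 𝒵' s' ∧
        ∀ i < N.c₀, ∀ j < N'.c₀, ∀ k < M.c₁,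
        ∀ a < N.c₂ * N.c₂ + 1, ∀ b < N'.c₂ * N'.c₂ + 1, ∀ X X',
          Holds s₀ (N.cell i (tb j k) + a) X → Holds s₀ (N'.cell j (tc i k) + b) X' →
          X ∪ X' ∈ 𝒵' (ta i j * M.c₁ + k) := by
  have b8 := hB.vec₁'
  have b11 := hB.node'
  set U := (N.c₂ * N.c₂ + 1) * ((N'.c₂ * N'.c₂ + 1) *
        (insertTime n (M.c₂ * M.c₂) + 67 * (n + 1)) + 12) + 50 with hU
  refine Runs.forAcc (fun 𝒵 s => FillInv G σ ρ w goal d (A ∪ A') M s₀ 𝒵 s) _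
    (Tb := N'.c₀ * (M.c₁ * (U + 7) + 12) + 5) ?_ he.ci h0 (by omega) hf
    (fun _ _ _ h => h.of_eq rfl rfl rfl) ?_ (by rw [hU]) (by cases goal <;> rfl)
    (by cases goal <;> rfl) (by decide)
  · intro i 𝒵₁ 𝒵₂ hle h j hj k hk a ha b hb X X' hX hX'
    exact hle _ (h j hj k hk a ha b hb X X' hX hX')
  intro i hi 𝒵₁ s1 ri a1 hf1
  have he1 := he.of_agree a1 (by cases goal <;> decide) (by cases goal <;> decide)
    (by cases goal <;> rfl)
  refine Runs.forAcc (fun 𝒵 s => FillInv G σ ρ w goal d (A ∪ A') M s₀ 𝒵 s) _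
    (Tb := M.c₁ * (U + 7) + 5) ?_ he1.cj h0' (by omega) hf1
    (fun _ _ _ h => h.of_eq rfl rfl rfl) ?_ le_rfl (by cases goal <;> rfl)
    (by cases goal <;> rfl) (by decide)
  · intro j 𝒵₁ 𝒵₂ hle h k hk a ha b hb X X' hX hX'
    exact hle _ (h k hk a ha b hb X X' hX hX')
  intro j hj 𝒵₂ s2 rj a2 hf2
  have he2 := he1.of_agree a2 (by cases goal <;> decide) (by cases goal <;> decide)
    (by cases goal <;> rfl)
  have ri2 := (a2.reg rI (by cases goal <;> rfl)).trans ri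
  refine Runs.forAcc (fun 𝒵 s => FillInv G σ ρ w goal d (A ∪ A') M s₀ 𝒵 s) _
    (Tb := U) ?_ he2.ck (by omega) (by omega) hf2
    (fun _ _ _ h => h.of_eq rfl rfl rfl) ?_ le_rfl (by cases goal <;> rfl)
    (by cases goal <;> rfl) (by decide)
  · intro k 𝒵₁ 𝒵₂ hle h a ha b hb X X' hX hX'
    exact hle _ (h a ha b hb X X' hX hX')
  intro k hk 𝒵₃ s3 rk a3 hf3
  have he3 := he2.of_agree a3 (by cases goal <;> decide) (by cases goal <;> decide)
    (by cases goal <;> rfl)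
  have ri3 := (a3.reg rI (by cases goal <;> rfl)).trans ri2
  have rj3 := (a3.reg rJ (by cases goal <;> rfl)).trans rj
  exact combineCells_spec hAA hT hN hN' hend hend' hf3 he3 hB hcc hcb hca hi hj hk ri3 rj3 rk

end Combine

section Node

variable {n : ℕ} (G : SimpleGraph (Fin n)) (σ ρ : Set ℕ) (w : Fin n → ℚ) (goal : Goal) (d : ℕ)

/-- Node number `k` has been processed. -/
structure NodeMem (A : Finset (Fin n)) (N : NodeData n) (k V P S S₁ : ℕ) (s : State) : Prop where
  lists : NodeLists G d A N k s
  table : TableInv G σ ρ w goal d A N.L₀ N.c₀ N.L₁ N.c₁ N.L₂ N.c₂ N.base s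
  v₀ : N.s₀ + N.c₀ ≤ V
  v₁ : N.s₁ + N.c₁ ≤ V
  v₂ : N.s₂ + N.c₂ ≤ V
  tableEnd : N.tableEnd ≤ P
  c₀ : N.c₀ ≤ S
  c₁ : N.c₁ ≤ S
  c₂ : N.c₂ ≤ S₁

variable {G σ ρ w goal d} {A : Finset (Fin n)} {N : NodeData n} {k V P S S₁ : ℕ} {s s' : State}

theorem NodeMem.ext {V' P' k' : ℕ} (h : NodeMem G σ ρ w goal d A N k V P S S₁ s)
    (he : Ext n k' V P s s') (hk : k < k') (hV : V ≤ V') (hP : P ≤ P') :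
    NodeMem G σ ρ w goal d A N k V' P' S S₁ s' :=
  ⟨h.lists.ext he hk h.v₀ h.v₁ h.v₂, h.table.keep he.keep h.tableEnd, h.v₀.trans hV, h.v₁.trans hV,
    h.v₂.trans hV, h.tableEnd.trans hP, h.c₀, h.c₁, h.c₂⟩

theorem NodeLists.of_agree {p : Prog} (h : NodeLists G d A N k s) (ha : Agree p s s')
    (hm : ([aIns, aBase, aVec, 21, 22, 23, 24, 25, 26].all fun x => !p.writesM x) = true) :
    NodeLists G d A N k s' := by
  simp only [List.all_cons, Bool.and_eq_true, Bool.not_eq_true', List.all_nil] at hm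
  obtain ⟨m1, m2, m3, m4, m5, m6, m7, m8, m9, -⟩ := hm
  have hv : ∀ i, s'.vec (n := n) i = s.vec i := fun i => by
    funext u; simp only [State.vec, ha.mem _ m3]
  constructor
  · rw [ha.mem _ m1]; exact h.ins
  · rw [ha.mem _ m4]; exact h.s₀
  · rw [ha.mem _ m5]; exact h.s₁
  · rw [ha.mem _ m6]; exact h.s₂
  · rw [ha.mem _ m7]; exact h.c₀
  · rw [ha.mem _ m8]; exact h.c₁
  · rw [ha.mem _ m9]; exact h.c₂
  · rw [ha.mem _ m2]; exact h.base
  · intro i hi; rw [hv]; exact h.vec₀ i hi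
  · intro i hi; rw [hv]; exact h.vec₁ i hi
  · intro i hi; rw [hv]; exact h.vec₂ i hi
  · exact h.list₀
  · exact h.list₁
  · exact h.list₂

theorem Env.of_agree {p : Prog} {k st : ℕ} (h : Env G w k st s) (ha : Agree p s s')
    (hr : ([rN, rStC, rKo, rKp, rKs].all fun x => !p.writesR x) = true)
    (hm : p.writesM aAdj = false) (hw : p.writesW 0 = false) : Env G w k st s' := by
  simp only [List.all_cons, Bool.and_eq_true, Bool.not_eq_true', List.all_nil] at hr
  obtain ⟨r1, r2, r3, r4, r5, -⟩ := hr
  refine ⟨(ha.reg _ r1).trans h.reg_n, ?_, ?_, (ha.reg _ r2).trans h.stC,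
    (ha.reg _ r3).trans h.ko, (ha.reg _ r4).trans h.kp, (ha.reg _ r5).trans h.ks⟩
  · rw [ha.mem _ hm]; exact h.adj
  · rw [ha.wt _ hw]; exact h.w

theorem Base.of_agree {p : Prog} (h : Base (G := G) (w := w) V P s) (ha : Agree p s s')
    (hr : ([rN, rVp, rSp].all fun x => !p.writesR x) = true)
    (hm : p.writesM aAdj = false) (hw : p.writesW 0 = false) : Base (G := G) (w := w) V P s' := by
  simp only [List.all_cons, Bool.and_eq_true, Bool.not_eq_true', List.all_nil] at hr
  obtain ⟨r1, r2, r3, -⟩ := hr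
  refine ⟨(ha.reg _ r1).trans h.reg_n, ?_, ?_, (ha.reg _ r2).trans h.vp, (ha.reg _ r3).trans h.sp⟩
  · rw [ha.mem _ hm]; exact h.adj
  · rw [ha.wt _ hw]; exact h.w

theorem Ext.of_agree {p : Prog} {P' : ℕ} {s₀ : State} (h : Ext n k V P s₀ s) (ha : Agree p s s')
    (hm : ([aSize, aBase, aIns, aVec, 21, 22, 23, 24, 25, 26].all fun x => !p.writesM x) = true)
    (hk : Keep n P' s₀ s') (hP : P ≤ P') : Ext n k V P s₀ s' := by
  simp only [List.all_cons, Bool.and_eq_true, Bool.not_eq_true', List.all_nil] at hm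
  obtain ⟨m0, m1, m2, m3, m4, m5, m6, m7, m8, m9, -⟩ := hm
  refine ⟨fun a ha' j hj => ?_, fun j hj => ?_, fun j hj => ?_, fun idx hidx => hk idx (by omega)⟩
  · have ha'' : a = 4 ∨ a = 14 ∨ a = 21 ∨ a = 22 ∨ a = 23 ∨ a = 24 ∨ a = 25 ∨ a = 26 := by omega
    rw [ha.mem a (by rcases ha'' with rfl | rfl | rfl | rfl | rfl | rfl | rfl | rfl <;> assumption)]
    exact h.arr a ha' j hj
  · rw [ha.mem _ m2]; exact h.ins j hj
  · rw [ha.mem _ m3]; exact h.vec j hj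

theorem Prepared.bounds {B : ℕ} (h : Prepared (G := G) (σ := σ) (ρ := ρ) (w := w) (goal := goal)
    (d := d) A N k V P S S₁ s s') (hB : Room n d S S₁ B k V P) : Bounds B d k N := by
  obtain ⟨b1, b2, b3, b4, b5⟩ := hB
  have e0 := h.c₀
  have e1 := h.c₁
  have e2 := h.c₂
  have f0 := h.s₀
  have f1 := h.s₁
  have f2 := h.s₂
  have bV : ∀ x ≤ V + 2 * S + S₁ + 1, x * n ≤ B ∧ x ≤ B := fun x hx =>
    ⟨(Nat.mul_le_mul hx (by omega)).trans b1, (Nat.le_mul_of_pos_right _ (by omega)).trans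
      ((Nat.mul_le_mul_right _ hx).trans b1)⟩
  have hend : N.tableEnd ≤ P + S * S * (S₁ * S₁ + 1) + 1 := by
    have : N.c₀ * N.c₁ * (N.c₂ * N.c₂ + 1) ≤ S * S * (S₁ * S₁ + 1) := by gcongr
    have := h.start
    simp only [NodeData.tableEnd]; omega
  have hcc : N.c₂ * N.c₂ ≤ S₁ * S₁ := Nat.mul_le_mul e2 e2
  refine ⟨(Nat.mul_le_mul hend (by omega)).trans b2, (Nat.mul_le_mul hend (by omega)).trans b2,
    hend.trans ((Nat.le_mul_of_pos_right _ (by omega)).trans b2), (bV _ (by omega)).1,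
    (bV _ (by omega)).1, (bV _ (by omega)).1, (bV _ (by omega)).2, (bV _ (by omega)).2,
    (bV _ (by omega)).2, (Nat.mul_le_mul (by omega) (by omega)).trans b3,
    (show k + 1 ≤ k + 2 by omega).trans ((Nat.le_mul_of_pos_right _ (by omega)).trans b3), b4, b5⟩

/-- Process a leaf.  The lists `l` and `l'` are the relevant parts of `σ` and `ρ`. -/
def leafNode (goal : Goal) (d : ℕ) (l l' : List ℕ) : Prog := block [
  store aSize (var rNd) 1,
  forLoop rGu rN (store aIns (var rNd * var rN + var rGu) (equ (var rGu + 1) (var rCode))),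
  prep d, leafSide goal l 0, leafSide goal l' 1]

def prepTime (n S S₁ : ℕ) : ℕ := 560 * ((n + 1) * (S + 1) * ((S + 1) * (n + 1))) +
      280 * ((n + 1) * (S₁ + 1) * ((S₁ + 1) * (n + 1))) + 15 * (S * S * (S₁ * S₁ + 1)) + 60

def sideTime (n d S S₁ : ℕ) : ℕ := 100 * ((S + 1) * (n + 1)) +
  S * (insertTime n (S₁ * S₁) + 14 * (d + 1) + 60 * (n + 1))

theorem insertTime_mono {n K K' : ℕ} (h : K ≤ K') : insertTime n K ≤ insertTime n K' := by
  unfold insertTime; gcongr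

/-- `l` lists the elements of `μ` that are at most `d`. -/
structure Lists (μ : Set ℕ) (d : ℕ) (l : List ℕ) : Prop where
  mem : ∀ x ≤ d, x ∈ l ↔ x ∈ μ
  le : ∀ x ∈ l, x ≤ d
  length : l.length ≤ d + 1

/-- This finite information is all that the program has to know about σ and ρ; it is built into its
code. -/
theorem exists_lists (μ : Set ℕ) (d : ℕ) : ∃ l, Lists μ d l := by
  classical
  refine ⟨(List.range (d + 1)).filter (· ∈ μ), fun x hx => ?_, fun x hx => ?_, ?_⟩
  · simp; omega
  · simp at hx; omega
  · exact (List.length_filter_le _ _).trans (by simp)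

/-- The result of processing node number `k`. -/
def NodeDone (G : SimpleGraph (Fin n)) (σ ρ : Set ℕ) (w : Fin n → ℚ) (goal : Goal) (d : ℕ)
    (A : Finset (Fin n)) (k m V P S S₁ : ℕ) (s s' : State) : Prop :=
  ∃ N V' P', NodeMem G σ ρ w goal d A N k V' P' S S₁ s' ∧ Base (G := G) (w := w) V' P' s' ∧
    V ≤ V' ∧ V' ≤ V + 2 * S + S₁ ∧ P ≤ P' ∧ P' ≤ P + S * S * (S₁ * S₁ + 1) ∧
    Ext n k V P s s' ∧ s'.mem aSize k = m

theorem leafNode_spec {B : ℕ} {v : Fin n} {l l' : List ℕ} (hσ : σ.Finite ∨ σᶜ.Finite)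
    (hρ : ρ.Finite ∨ ρᶜ.Finite) (hdσ : domDepth σ ≤ d) (hdρ : domDepth ρ ≤ d) (hd : 1 ≤ d)
    (hl : Lists σ d l) (hl' : Lists ρ d l')
    (hb : Base (G := G) (w := w) V P s) (hk : s.reg rNd = k) (hc : s.reg rCode = v + 1)
    (hA : Narrow (G := G) d S S₁ {v}) (hB : Room n d S S₁ B k V P) :
    Runs B (leafNode goal d l l') s (prepTime n S S₁ + 2 * sideTime n d S S₁ + 40 * (n + 1)) fun s' =>
      NodeDone G σ ρ w goal d {v} k 1 V P S S₁ s s' := by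
  have hB' := hB
  obtain ⟨b1, b2, b3, b4, b5⟩ := hB'
  have hnB : n ≤ B := le_trans (Nat.le_mul_self n) b4
  have hkB : (k + 1) * n ≤ B := (Nat.mul_le_mul (by omega) (by omega)).trans b3
  have hkB' : k + 2 ≤ B := (Nat.le_mul_of_pos_right _ (by omega)).trans b3
  have hkn := b3
  have hn2 : n + 1 ≤ (k + 2) * (n + 1) := Nat.le_mul_of_pos_left _ (by omega)
  refine Runs.step (T₂ := prepTime n S S₁ + 2 * sideTime n d S S₁ + 30 * (n + 1)) ?_ ?_
    (by simp [dur]; omega)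
  · simp [safe, hk]; omega
  simp only [run, eval_var, eval_ofNat, hk]
  set s1 := s.setMem aSize k 1 with hs1
  refine Runs.seq (Runs.for (N := n) (Tb := 15) (fun m s' => (∀ u : Fin n, (u : ℕ) < m →
      s'.mem aIns (k * n + u) = if u ∈ ({v} : Finset (Fin n)) then 1 else 0) ∧
      ∀ j < k * n, s'.mem aIns j = s.mem aIns j)
      (by simpa [hs1] using hb.reg_n) hnB (by omega) (by simp [hs1]) ?_ le_rfl)
    (T₂ := prepTime n S S₁ + 2 * sideTime n d S S₁) ?_ (by omega)
  · rintro i hi s2 hx2 ha2 ⟨i1, i2⟩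
    have e0 := (ha2.reg rN rfl).trans hb.reg_n
    have e1 := (ha2.reg rNd rfl).trans hk
    have e2 := (ha2.reg rCode rfl).trans hc
    have hidx := idx_lt (show k < k + 1 by omega) hi
    refine Runs.straight ?_ ?_ (by simp [dur])
    · simp [safe, e0, e1, hx2]
      constructorm* _ ∧ _ <;> first | (split_ifs <;> omega) | omega
    · simp only [run, eval_add, eval_mul, eval_var, eval_equ, eval_ofNat, e0, e1, e2, hx2, setReg_mem,
        setMem_mem, true_and]
      refine ⟨fun u hu => ?_, fun j hj => ?_⟩
      · by_cases hui : (u : ℕ) = i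
        · subst hui
          simp [Fin.ext_iff]
        · rw [if_neg (by omega)]; exact i1 u (by omega)
      · rw [if_neg (by omega)]; exact i2 j hj
  rintro s2 a2 ⟨hins, hinsk⟩
  have hb2 : Base (G := G) (w := w) V P s2 := by
    refine Base.of_agree (p := forLoop rGu rN (store aIns (var rNd * var rN + var rGu)
      (equ (var rGu + 1) (var rCode)))) (s := s1) ?_ a2 (by decide) rfl rfl
    refine ⟨hb.reg_n, ?_, hb.w, hb.vp, hb.sp⟩
    intro u v; simp [hs1]; exact hb.adj u v
  have k2 : s2.reg rNd = k := (a2.reg _ rfl).trans hk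
  have c2 : s2.reg rCode = v + 1 := (a2.reg _ rfl).trans hc
  have ext2 : Ext n k V P s s2 := by
    refine ⟨fun a ha j hj => ?_, hinsk, fun j hj => ?_, Keep.of_eq ?_ ?_⟩
    · have ha' : a ≠ 3 := by omega
      rw [a2.mem a (by simp [forLoop, writesM, ha'.symm])]
      simp only [hs1, setMem_mem]
      rw [if_neg (by omega)]
    · rw [a2.mem _ rfl]; simp [hs1]
    · rw [a2.mem _ rfl]; funext; simp [hs1]
    · rw [a2.mem _ rfl]; funext; simp [hs1]
  have sz2 : s2.mem aSize k = 1 := by rw [a2.mem _ rfl]; simp [hs1]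
  refine Runs.seq (prep_spec (σ := σ) (ρ := ρ) (goal := goal) hb2 k2
    (fun u => hins u u.2) hA hB) (T₂ := 2 * sideTime n d S S₁) ?_
    (by unfold prepTime; omega)
  rintro s3 a3 ⟨N, h3⟩
  have hbd := h3.bounds hB
  have hside : 100 * ((N.c₀ + 1) * (n + 1)) +
      N.c₁ * (insertTime n (N.c₂ * N.c₂) + 14 * (d + 1) + 60 * (n + 1)) ≤ sideTime n d S S₁ := by
    have e0 := h3.c₀
    have e1 := h3.c₁
    have := insertTime_mono (n := n) (Nat.mul_le_mul h3.c₂ h3.c₂)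
    unfold sideTime; gcongr
  have k3 := (a3.reg rNd rfl).trans k2
  have c3 := (a3.reg rCode rfl).trans c2
  refine Runs.seq (leafSide_spec (goal := goal) (b := 0) h3.fill h3.env h3.lists h3.L₂ k3 c3 h3.ck h3.bs hbd
    (by omega) hd (by simpa using hl.mem) hl.le hl.length) (T₂ := sideTime n d S S₁) ?_ (by omega)
  rintro s4 a4 ⟨𝒵, -, f4, z4⟩
  have env4 := h3.env.of_agree a4 (by cases goal <;> rfl) (by cases goal <;> rfl) (by cases goal <;> rfl)
  have lists4 := h3.lists.of_agree a4 (by cases goal <;> rfl)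
  have k4 := (a4.reg rNd (by cases goal <;> rfl)).trans k3
  have c4 := (a4.reg rCode (by cases goal <;> rfl)).trans c3
  have ck4 := (a4.reg rCk (by cases goal <;> rfl)).trans h3.ck
  have bs4 := (a4.reg rBs (by cases goal <;> rfl)).trans h3.bs
  have L4 : N.L₂ = fun i => s4.vec (N.s₂ + i) := by
    rw [h3.L₂]; funext i u; simp only [State.vec, a4.mem aVec (by cases goal <;> rfl)]
  refine (leafSide_spec (goal := goal) (b := 1) f4 env4 lists4 L4 k4 c4 ck4 bs4 hbd le_rfl hd
    (by simpa using hl'.mem) hl'.le hl'.length).mono hside ?_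
  rintro s5 a5 ⟨𝒵', hle, f5, z5⟩
  have start := h3.start
  refine ⟨N, N.s₂ + N.c₂, N.tableEnd, ⟨?_, ?_, ?_, ?_, le_rfl, le_rfl, h3.c₀, h3.c₁, h3.c₂⟩, ?_, ?_, ?_,
    ?_, ?_, ?_, ?_⟩
  · exact lists4.of_agree a5 (by cases goal <;> rfl)
  · refine f5.table hσ hρ hdσ hdρ h3.lists.list₂ ?_
    intro D hD t ht j hj h0 h1
    -- The trace of any solution on the leaf is one of the two candidates, and it satisfies the
    -- condition under which that candidate was inserted.
    have hsol := Sol.of_coDominates (A := {v}) hσ hρ hdσ hdρ ((isConnectedCoDom_iff G σ ρ).1 hD.1).2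
    rw [← h0, ← h1] at hsol
    by_cases hv : v ∈ D
    · have hDv : D ∩ {v} = leafSet v 1 := by simp [leafSet, hv]
      rw [hDv] at hsol ⊢
      exact z5 t ht j hj hsol
    · have hDv : D ∩ {v} = leafSet v 0 := by simp [leafSet, hv]
      rw [hDv] at hsol ⊢
      exact hle _ (z4 t ht j hj hsol)
  · have := h3.s₀; have := h3.s₂; omega
  · have := h3.s₁; have := h3.s₂; omega
  · exact (h3.base.of_agree a4 (by cases goal <;> rfl) (by cases goal <;> rfl)
      (by cases goal <;> rfl)).of_agree a5 (by cases goal <;> rfl) (by cases goal <;> rfl)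
      (by cases goal <;> rfl)
  · have := h3.s₂; omega
  · have := h3.s₂; have := h3.c₀; have := h3.c₁; have := h3.c₂; omega
  · unfold NodeData.tableEnd; omega
  · have : N.c₀ * N.c₁ * (N.c₂ * N.c₂ + 1) ≤ S * S * (S₁ * S₁ + 1) := by
      have := h3.c₀; have := h3.c₁; have := h3.c₂; gcongr
    unfold NodeData.tableEnd; omega
  · have hk4 := f4.keep
    have hk5 := f5.keep
    rw [start] at hk4 hk5
    exact ext2.trans ((h3.ext.of_agree a4 (by cases goal <;> rfl) hk4 le_rfl).of_agree a5
      (by cases goal <;> rfl) hk5 le_rfl) le_rfl le_rfl le_rfl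
  · rw [a5.mem _ (by cases goal <;> rfl), a4.mem _ (by cases goal <;> rfl), a3.mem _ rfl, sz2]

end Node

/-- Locate the children of the node `rNd`, and compute its size and its set of vertices. -/
def joinStart : Prog := block [
  assign rRe (var rNd - 1), assign rLe (var rRe - get aSize (var rRe)),
  store aSize (var rNd) (get aSize (var rLe) + get aSize (var rRe) + 1),
  forLoop rGu rN (store aIns (var rNd * var rN + var rGu)
    (get aIns (var rLe * var rN + var rGu) + get aIns (var rRe * var rN + var rGu)))]

def joinRegsInit : Prog := block [
  assign rCi (get 24 (var rLe)), assign rCj (get 24 (var rRe)),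
  assign rCl (get 25 (var rLe)), assign rCr (get 25 (var rRe)),
  assign rKl (get 26 (var rLe) * get 26 (var rLe) + 1),
  assign rKr (get 26 (var rRe) * get 26 (var rRe) + 1),
  assign rBl (get aBase (var rLe)), assign rBr (get aBase (var rRe))]

/-- Process an inner node. -/
def joinNode (goal : Goal) (d : ℕ) : Prog := block [
  joinStart, prep d,
  tab d rNd 0 rLe rRe 0 rNd 0 aTa,
  tab d rLe 1 rRe rNd 1 rLe 1 aTb,
  tab d rRe 1 rLe rNd 1 rRe 1 aTc,
  joinRegsInit, combineAll goal]

theorem mask_zero {p : Prop} [Decidable p] (x : ℕ) :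
    (if (if p then 1 else 0) = 0 then 1 else 0) * x = if p then 0 else x := by
  by_cases h : p <;> simp [h]

theorem mask_one {p : Prop} [Decidable p] (x : ℕ) :
    (if (if p then 1 else 0) = 1 then 1 else 0) * x = if p then x else 0 := by
  by_cases h : p <;> simp [h]

section Node

variable {n : ℕ} {G : SimpleGraph (Fin n)} {σ ρ : Set ℕ} {w : Fin n → ℚ} {goal : Goal} {d : ℕ}
  {A A' : Finset (Fin n)} {N N' : NodeData n} {k kl V P S S₁ m m' : ℕ} {s : State}

/-- In postorder the right child immediately precedes its parent, and the left child precedes the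
whole right subtree. So the recorded size `m'` of the right subtree locates the left child at `kl =
k - 1 - m'`. -/
theorem joinStart_spec {B : ℕ} (hAA : Disjoint A A') (hn : s.reg rN = n) (hk : s.reg rNd = k)
    (hkl : kl + m' + 1 = k) (hm' : s.mem aSize (k - 1) = m') (hm : s.mem aSize kl = m)
    (hins : ∀ u : Fin n, s.mem aIns (kl * n + u) = if u ∈ A then 1 else 0)
    (hins' : ∀ u : Fin n, s.mem aIns ((k - 1) * n + u) = if u ∈ A' then 1 else 0)
    (hkB : (k + 2) * (n + 1) ≤ B) (hmk : m + m' + 1 ≤ B) :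
    Runs B joinStart s (40 * (n + 1)) fun s' => s'.reg rLe = kl ∧ s'.reg rRe = k - 1 ∧
      s'.mem aSize k = m + m' + 1 ∧ (∀ j < k, s'.mem aSize j = s.mem aSize j) ∧
      (∀ u : Fin n, s'.mem aIns (k * n + u) = if u ∈ A ∪ A' then 1 else 0) ∧
      ∀ j < k * n, s'.mem aIns j = s.mem aIns j := by
  have hk2 : k + 2 ≤ B := (Nat.le_mul_of_pos_right _ (by omega)).trans hkB
  have hn2 : n + 1 ≤ (k + 2) * (n + 1) := Nat.le_mul_of_pos_left _ (by omega)
  have hkn : (k + 1) * n ≤ B := (Nat.mul_le_mul (by omega) (by omega)).trans hkB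
  have hd := Finset.disjoint_left.1 hAA
  refine Runs.step (T₂ := 40 * (n + 1) - 4) (by simp [safe, hk]; omega) ?_ (by simp [dur]; omega)
  have e1 : k - 1 - m' = kl := by omega
  refine Runs.step (T₂ := 40 * (n + 1) - 9)
    (by simp [safe, run, hk, hm', e1]; omega) ?_ (by simp [dur]; omega)
  refine Runs.step (T₂ := n * 30 + 5)
    (by simp [safe, run, hk, hm', e1, hm]; omega) ?_ (by simp [dur]; omega)
  simp only [run, eval_var, eval_sub, eval_ofNat, eval_get, eval_add, setReg_reg, setReg_mem,
    Nat.reduceEqDiff, if_true, if_false, hk, hm', e1, hm]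
  set s1 := ((s.setReg rRe (k - 1)).setReg rLe kl).setMem aSize k (m + m' + 1) with hs1
  refine (Runs.for (N := n) (Tb := 23) (fun x s' => (∀ u : Fin n, (u : ℕ) < x →
      s'.mem aIns (k * n + u) = if u ∈ A ∪ A' then 1 else 0) ∧
      ∀ j < k * n, s'.mem aIns j = s.mem aIns j)
      (by simpa [hs1] using hn) (by omega) (by omega) (by simp [hs1]) ?_ le_rfl).mono le_rfl ?_
  · rintro i hi s2 hx2 ha2 ⟨i1, i2⟩
    have f0 := ha2.reg rN rfl
    have f1 := ha2.reg rNd rfl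
    have f2 := ha2.reg rLe rfl
    have f3 := ha2.reg rRe rfl
    simp [hs1, hn, hk] at f0 f1 f2 f3
    have j0 := idx_lt (show k < k + 1 by omega) hi
    have j1 := idx_lt (show kl < k by omega) hi
    have j2 := idx_lt (show k - 1 < k by omega) hi
    have g1 := (i2 _ j1).trans (hins ⟨i, hi⟩)
    have g2 := (i2 _ j2).trans (hins' ⟨i, hi⟩)
    refine Runs.straight ?_ ?_ (by simp [dur])
    · simp only [safe, fits_var, fits_add, fits_get, fits_mul, eval_var, eval_add, eval_get,
          eval_mul, f0, f1, f2, f3, hx2, g1, g2]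
      constructorm* _ ∧ _ <;> first | trivial | omega | (split_ifs <;> omega)
    · simp only [run, eval_add, eval_mul, eval_var, eval_get, f0, f1, f2, f3, hx2, g1, g2, setReg_mem,
        setMem_mem, true_and]
      refine ⟨fun u hu => ?_, fun j hj => ?_⟩
      · by_cases hui : (u : ℕ) = i
        · have : u = ⟨i, hi⟩ := Fin.ext hui
          subst this
          have h3 := @hd ⟨i, hi⟩
          by_cases h1 : (⟨i, hi⟩ : Fin n) ∈ A <;> by_cases h2 : (⟨i, hi⟩ : Fin n) ∈ A' <;>
            simp_all
        · rw [if_neg (by omega)]; exact i1 u (by omega)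
      · rw [if_neg (by omega)]; exact i2 j hj
  · rintro s2 a2 ⟨i1, i2⟩
    have f2 := a2.reg rLe rfl
    have f3 := a2.reg rRe rfl
    have f4 := a2.mem aSize rfl
    simp [hs1] at f2 f3
    refine ⟨f2, f3, ?_, fun j hj => ?_, fun u => i1 u u.2, i2⟩
    · rw [f4]; simp [hs1]
    · rw [f4]; simp [hs1]; intro h; omega

theorem joinRegsInit_spec {B k' : ℕ} (hk : s.reg rLe = k) (hk' : s.reg rRe = k')
    (h : NodeLists G d A N k s) (h' : NodeLists G d A' N' k' s) (hkB : k ≤ B ∧ k' ≤ B)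
    (hc : N.c₂ * N.c₂ + 1 ≤ B) (hc' : N'.c₂ * N'.c₂ + 1 ≤ B) :
    Runs B joinRegsInit s 40 fun s' => s'.reg rCi = N.c₀ ∧ s'.reg rCj = N'.c₀ ∧ s'.reg rCl = N.c₁ ∧
      s'.reg rCr = N'.c₁ ∧ s'.reg rKl = N.c₂ * N.c₂ + 1 ∧ s'.reg rKr = N'.c₂ * N'.c₂ + 1 ∧
      s'.reg rBl = N.base ∧ s'.reg rBr = N'.base := by
  refine Runs.straight ?_ ?_ (by decide)
  · simp [joinRegsInit, safe, run, hk, hk', h.c₂, h'.c₂]; omega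
  · simp [joinRegsInit, run, hk, hk', h.c₀, h.c₁, h.c₂, h.base, h'.c₀, h'.c₁, h'.c₂, h'.base]

def combineTime (n S S₁ : ℕ) : ℕ := S * (S * (S * ((S₁ * S₁ + 1) * ((S₁ * S₁ + 1) *
  (insertTime n (S₁ * S₁) + 67 * (n + 1)) + 12) + 57) + 12) + 12) + 5

/-- The three tables of sums are computed beforehand, in O(S³n). Inside the nested loops the target
cell and the two source cells are then found by constant-time lookups. -/
theorem joinNode_spec {B : ℕ} (hσ : σ.Finite ∨ σᶜ.Finite)
    (hρ : ρ.Finite ∨ ρᶜ.Finite) (hdσ : domDepth σ ≤ d) (hdρ : domDepth ρ ≤ d)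
    (hAA : Disjoint A A') (hb : Base (G := G) (w := w) V P s) (hk : s.reg rNd = k)
    (hkl : kl + m' + 1 = k) (h1m : 1 ≤ m') (hm' : s.mem aSize (k - 1) = m') (hm : s.mem aSize kl = m)
    (hN : NodeMem G σ ρ w goal d A N kl V P S S₁ s)
    (hN' : NodeMem G σ ρ w goal d A' N' (k - 1) V P S S₁ s)
    (hmk : m + m' + 1 ≤ k + 1)
    (hA : Narrow (G := G) d S S₁ (A ∪ A')) (hB : Room n d S S₁ B k V P) :
    Runs B (joinNode goal d) s (prepTime n S S₁ +
      900 * ((S + 1) * (S + 1) * ((S + 1) * (n + 1))) + combineTime n S S₁ + 80 * (n + 1)) fun s' =>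
      NodeDone G σ ρ w goal d (A ∪ A') k (m + m' + 1) V P S S₁ s s' := by
  have hB' := hB
  obtain ⟨b1, b2, b3, b4, b5⟩ := hB'
  have hnB : n ≤ B := le_trans (Nat.le_mul_self n) b4
  have hk2 : k + 2 ≤ B := (Nat.le_mul_of_pos_right _ (by omega)).trans b3
  have bV : ∀ x ≤ V, x * n ≤ B ∧ x ≤ B := fun x hx =>
    ⟨(Nat.mul_le_mul (by omega) (by omega)).trans b1, le_trans (by omega)
      ((Nat.le_mul_of_pos_right _ (by omega)).trans b1)⟩
  have bS : S * S ≤ B := by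
    have h1 : S * S ≤ S * S * (S₁ * S₁ + 1) := Nat.le_mul_of_pos_right _ (by omega)
    have h2 := (Nat.le_mul_of_pos_right (P + S * S * (S₁ * S₁ + 1) + 1)
      (show 0 < n + S₁ * S₁ + 1 by omega)).trans b2
    omega
  have bS1 : S₁ * S₁ + 1 ≤ B := by
    have := (Nat.le_mul_of_pos_left (n + S₁ * S₁ + 1)
      (show 0 < P + S * S * (S₁ * S₁ + 1) + 1 by omega)).trans b2
    omega
  refine Runs.seq (joinStart_spec hAA hb.reg_n hk hkl hm' hm hN.lists.ins hN'.lists.ins b3 (by omega))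
    (T₂ := prepTime n S S₁ + 900 * ((S + 1) * (S + 1) * ((S + 1) * (n + 1))) +
      combineTime n S S₁ + 40) ?_ (by omega)
  rintro s2 a2 ⟨le2, re2, sz2, szk, hins, hinsk⟩
  have hb2 := hb.of_agree a2 (by decide) rfl rfl
  have k2 : s2.reg rNd = k := (a2.reg _ rfl).trans hk
  have ext2 : Ext n k V P s s2 := by
    refine ⟨fun a ha j hj => ?_, hinsk, fun j hj => ?_, Keep.of_eq ?_ ?_⟩
    · by_cases ha4 : a = 4
      · subst ha4; exact szk j hj
      · have ha' : a ≠ 3 := by omega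
        rw [a2.mem a (by simp [joinStart, block, forLoop, writesM, ha'.symm, Ne.symm ha4])]
    · rw [a2.mem _ rfl]
    · rw [a2.mem _ rfl]
    · rw [a2.mem _ rfl]
  refine Runs.seq (prep_spec (σ := σ) (ρ := ρ) (goal := goal) hb2 k2 hins hA hB)
    (T₂ := 900 * ((S + 1) * (S + 1) * ((S + 1) * (n + 1))) + combineTime n S S₁ + 40) ?_
    (by unfold prepTime; omega)
  rintro s3 a3 ⟨M, h3⟩
  have hbd := h3.bounds hB
  have n3 := h3.env.reg_n
  have k3 := (a3.reg rNd rfl).trans k2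
  have le3 := (a3.reg rLe rfl).trans le2
  have re3 := (a3.reg rRe rfl).trans re2
  have hN2 := hN.ext ext2 (by omega) le_rfl le_rfl
  have hN2' := hN'.ext ext2 (by omega) le_rfl le_rfl
  have L3 := (hN2.ext h3.ext (by omega) le_rfl le_rfl).lists
  have L3' := (hN2'.ext h3.ext (by omega) le_rfl le_rfl).lists
  have M3 := h3.lists
  have vle : ∀ {t : ℕ} {A F : Finset (Fin n)} {L : ℕ → Fin n → ℕ} {c : ℕ}, ClassList G t A F L c →
      ∀ i < c, ∀ u, L i u ≤ t := fun h i hi u => by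
    obtain ⟨X, -, -, hX⟩ := h.mem i hi
    rw [hX]; exact classVec_le u
  have cls : ∀ {t : ℕ} {A F : Finset (Fin n)} {L : ℕ → Fin n → ℕ} {c : ℕ}, ClassList G t A F L c →
      ∀ i < c, ∃ X ⊆ A, L i = classVec G t A X := fun h i hi => by
    obtain ⟨X, hX, -, h⟩ := h.mem i hi
    exact ⟨X, hX, h⟩
  have bV0 := bV _ hN.v₀
  have bV0' := bV _ hN'.v₀
  have bV1 := bV _ hN.v₁
  have bV1' := bV _ hN'.v₁
  have tabT : ∀ a ≤ S, ∀ b ≤ S, ∀ c ≤ S, 300 * ((a + 1) * (b + 1) * ((c + 1) * (n + 1))) ≤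
      300 * ((S + 1) * (S + 1) * ((S + 1) * (n + 1))) := fun a ha b hb c hc => by gcongr
  refine Runs.seq ((tab_spec (d := d) (La := N.L₀) (Lb := N'.L₀) (Lt := M.L₀) n3 (by omega) (by omega)
    (by omega) k3 le3 re3 k3 M3.ins L3.s₀ L3.c₀ L3'.s₀ L3'.c₀ M3.s₀ M3.c₀ L3.vec₀ L3'.vec₀ M3.vec₀
    (vle L3.list₀) (vle L3'.list₀) ?_ hbd.node (by omega) bV0.1 bV0.2 bV0'.1 bV0'.2
    hbd.vec₀ hbd.vec₀' ((Nat.mul_le_mul hN.c₀ hN'.c₀).trans bS) hnB (by omega)).mono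
    (tabT _ hN.c₀ _ hN'.c₀ _ h3.c₀) (fun _ _ h => h))
    (T₂ := 600 * ((S + 1) * (S + 1) * ((S + 1) * (n + 1))) + combineTime n S S₁ + 40) ?_ (by omega)
  · intro i hi j hj
    obtain ⟨t, ht, h⟩ := exists_class_union hAA M3.list₀ (cls L3.list₀ i hi) (cls L3'.list₀ j hj)
    exact ⟨t, ht, fun u => by rw [mask_zero]; exact h u⟩
  intro s4 a4 t4
  have n4 := (a4.reg rN rfl).trans n3
  have k4 := (a4.reg rNd rfl).trans k3
  have le4 := (a4.reg rLe rfl).trans le3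
  have re4 := (a4.reg rRe rfl).trans re3
  have L4 := L3.of_agree a4 rfl
  have L4' := L3'.of_agree a4 rfl
  have M4 := M3.of_agree a4 rfl
  have hkn : (kl + 1) * n ≤ B := (Nat.mul_le_mul (by omega) (by omega)).trans b3
  have hkn' : (k - 1 + 1) * n ≤ B := (Nat.mul_le_mul (by omega) (by omega)).trans b3
  refine Runs.seq ((tab_spec (d := d) (La := N'.L₀) (Lb := M.L₁) (Lt := N.L₁) n4 (by omega) (by omega)
    (by omega) le4 re4 k4 le4 L4.ins L4'.s₀ L4'.c₀ M4.s₁ M4.c₁ L4.s₁ L4.c₁ L4'.vec₀ M4.vec₁ L4.vec₁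
    (vle L4'.list₀) (vle M4.list₁) ?_ hkn (by omega) bV0'.1 bV0'.2 hbd.vec₁ hbd.vec₁'
    bV1.1 bV1.2 ((Nat.mul_le_mul hN'.c₀ h3.c₁).trans bS) hnB (by omega)).mono
    (tabT _ hN'.c₀ _ h3.c₁ _ hN.c₁) (fun _ _ h => h))
    (T₂ := 300 * ((S + 1) * (S + 1) * ((S + 1) * (n + 1))) + combineTime n S S₁ + 40) ?_ (by omega)
  · intro j hj x hx
    obtain ⟨t, ht, h⟩ := exists_class_outer hAA L3.list₁ (cls L3'.list₀ j hj) (cls M3.list₁ x hx)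
    exact ⟨t, ht, fun u => by rw [mask_one, h u, Nat.add_comm]⟩
  intro s5 a5 t5
  have n5 := (a5.reg rN rfl).trans n4
  have k5 := (a5.reg rNd rfl).trans k4
  have le5 := (a5.reg rLe rfl).trans le4
  have re5 := (a5.reg rRe rfl).trans re4
  have L5 := L4.of_agree a5 rfl
  have L5' := L4'.of_agree a5 rfl
  have M5 := M4.of_agree a5 rfl
  refine Runs.seq ((tab_spec (d := d) (La := N.L₀) (Lb := M.L₁) (Lt := N'.L₁) n5 (by omega) (by omega)
    (by omega) re5 le5 k5 re5 L5'.ins L5.s₀ L5.c₀ M5.s₁ M5.c₁ L5'.s₁ L5'.c₁ L5.vec₀ M5.vec₁ L5'.vec₁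
    (vle L5.list₀) (vle M5.list₁) ?_ hkn' (by omega) bV0.1 bV0.2 hbd.vec₁ hbd.vec₁'
    bV1'.1 bV1'.2 ((Nat.mul_le_mul hN.c₀ h3.c₁).trans bS) hnB (by omega)).mono
    (tabT _ hN.c₀ _ h3.c₁ _ hN'.c₁) (fun _ _ h => h))
    (T₂ := combineTime n S S₁ + 40) ?_ (by omega)
  · intro i hi x hx
    -- The children change roles, so the union has to be commuted first.
    obtain ⟨t, ht, h⟩ := exists_class_outer hAA.symm L3'.list₁ (cls L3.list₀ i hi)
      (Finset.union_comm A A' ▸ cls M3.list₁ x hx)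
    exact ⟨t, ht, fun u => by rw [mask_one, h u, Nat.add_comm]⟩
  intro s6 a6 t6
  have le6 := (a6.reg rLe rfl).trans le5
  have re6 := (a6.reg rRe rfl).trans re5
  have L6 := L5.of_agree a6 rfl
  have L6' := L5'.of_agree a6 rfl
  have M6 := M5.of_agree a6 rfl
  refine Runs.seq (joinRegsInit_spec le6 re6 L6 L6' (by omega)
    (le_trans (by have := Nat.mul_le_mul hN.c₂ hN.c₂; omega) bS1)
    (le_trans (by have := Nat.mul_le_mul hN'.c₂ hN'.c₂; omega) bS1))
    (T₂ := combineTime n S S₁) ?_ (by omega)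
  rintro s7 a7 ⟨r1, r2, r3, r4, r5, r6, r7, r8⟩
  have hT : JoinTabs d A A' N N' M (fun i j => s4.mem aTa (i * N'.c₀ + j))
      (fun j x => s5.mem aTb (j * M.c₁ + x)) (fun i x => s6.mem aTc (i * M.c₁ + x)) := by
    refine ⟨fun i hi j hj => (t4 i hi j hj).1, fun i hi j hj => (t5 i hi j hj).1,
      fun i hi j hj => (t6 i hi j hj).1, fun i hi j hj u => ?_, fun i hi j hj u => ?_,
      fun i hi j hj u => ?_⟩
    · rw [(t4 i hi j hj).2 u, mask_zero]
    · rw [(t5 i hi j hj).2 u, mask_one, Nat.add_comm]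
    · rw [(t6 i hi j hj).2 u, mask_one, Nat.add_comm]
  have env7 := (((h3.env.of_agree a4 rfl rfl rfl).of_agree a5 rfl rfl rfl).of_agree a6
    rfl rfl rfl).of_agree a7 rfl rfl rfl
  have hv7 : s7.mem aVec = s3.mem aVec := (a7.mem _ rfl).trans ((a6.mem _ rfl).trans
    ((a5.mem _ rfl).trans (a4.mem _ rfl)))
  have he7 : JoinEnv G w N N' M (fun i j => s4.mem aTa (i * N'.c₀ + j))
      (fun j x => s5.mem aTb (j * M.c₁ + x)) (fun i x => s6.mem aTc (i * M.c₁ + x)) s7 := by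
    refine ⟨env7, ?_, ?_, ?_, r1, r2, r5, r6, r3, r4, r7, r8, ?_, ?_, ?_⟩
    · rw [h3.L₂]; funext i u; simp only [State.vec, hv7]
    · rw [a7.reg _ rfl, a6.reg _ rfl, a5.reg _ rfl, a4.reg _ rfl]; exact h3.ck
    · rw [a7.reg _ rfl, a6.reg _ rfl, a5.reg _ rfl, a4.reg _ rfl]; exact h3.bs
    · intro i _ j _; rw [a7.mem _ rfl, a6.mem _ rfl, a5.mem _ rfl]
    · intro i _ j _; rw [a7.mem _ rfl, a6.mem _ rfl]
    · intro i _ j _; rw [a7.mem _ rfl]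
  have fr : ∀ a, a = aUsed ∨ a = aSX ∨ a = aSU → s7.mem a = s3.mem a := fun a ha => by
    rcases ha with rfl | rfl | rfl <;> rw [a7.mem _ rfl, a6.mem _ rfl, a5.mem _ rfl, a4.mem _ rfl]
  have f7 := h3.fill.of_eq (fr _ (by simp)) (fr _ (by simp)) (fr _ (by simp))
  have start := h3.start
  have hMs : N.c₀ ≤ B ∧ N'.c₀ ≤ B := ⟨by omega, by omega⟩
  refine (combineAll_spec (goal := goal) hAA hT hN2.table hN2'.table (start ▸ hN.tableEnd) (start ▸ hN'.tableEnd) f7 he7 hbd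
    ((Nat.mul_le_mul hN.c₀ hN'.c₀).trans bS) ((Nat.mul_le_mul hN'.c₀ h3.c₁).trans bS)
    ((Nat.mul_le_mul hN.c₀ h3.c₁).trans bS) hMs.1 hMs.2).mono ?_ ?_
  · have e1 := hN.c₀
    have e2 := hN'.c₀
    have e3 := h3.c₁
    have e4 := Nat.mul_le_mul hN.c₂ hN.c₂
    have e5 := Nat.mul_le_mul hN'.c₂ hN'.c₂
    have := insertTime_mono (n := n) (Nat.mul_le_mul h3.c₂ h3.c₂)
    unfold combineTime; gcongr
  rintro s8 a8 ⟨𝒵, -, f8, z8⟩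
  refine ⟨M, M.s₂ + M.c₂, M.tableEnd, ⟨?_, ?_, ?_, ?_, le_rfl, le_rfl, h3.c₀, h3.c₁, h3.c₂⟩, ?_, ?_, ?_,
    ?_, ?_, ?_, ?_⟩
  · exact (M6.of_agree a7 rfl).of_agree a8 (by cases goal <;> rfl)
  · refine f8.table hσ hρ hdσ hdρ h3.lists.list₂ ?_
    exact hT.complete hAA hN2.table hN2'.table L3.list₀ L3'.list₀ M3.list₀
      fun i hi j hj x hx q hq q' hq' X X' hX hX' =>
        z8 i hi j hj x hx q (by omega) q' (by omega) X X' hX hX'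
  · have := h3.s₀; have := h3.s₂; omega
  · have := h3.s₁; have := h3.s₂; omega
  · exact ((((h3.base.of_agree a4 rfl rfl rfl).of_agree a5 rfl rfl rfl).of_agree a6
      rfl rfl rfl).of_agree a7 rfl rfl rfl).of_agree a8 (by cases goal <;> rfl)
      (by cases goal <;> rfl) (by cases goal <;> rfl)
  · have := h3.s₂; omega
  · have := h3.s₂; have := h3.c₀; have := h3.c₁; have := h3.c₂; omega
  · unfold NodeData.tableEnd; omega
  · have : M.c₀ * M.c₁ * (M.c₂ * M.c₂ + 1) ≤ S * S * (S₁ * S₁ + 1) := by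
      have := h3.c₀; have := h3.c₁; have := h3.c₂; gcongr
    unfold NodeData.tableEnd; omega
  · have hk8 := f8.keep
    have hk7 := f7.keep
    rw [start] at hk8 hk7
    have e4 := h3.ext.of_agree a4 rfl (h3.ext.keep.trans (Keep.of_eq (a4.mem _ rfl) (a4.mem _ rfl)) le_rfl) le_rfl
    have e5 := e4.of_agree a5 rfl (e4.keep.trans (Keep.of_eq (a5.mem _ rfl) (a5.mem _ rfl)) le_rfl) le_rfl
    have e6 := e5.of_agree a6 rfl (e5.keep.trans (Keep.of_eq (a6.mem _ rfl) (a6.mem _ rfl)) le_rfl) le_rfl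
    have e7 := e6.of_agree a7 rfl hk7 le_rfl
    exact ext2.trans (e7.of_agree a8 (by cases goal <;> rfl) hk8 le_rfl) le_rfl le_rfl le_rfl
  · rw [a8.mem _ (by cases goal <;> rfl), a7.mem _ rfl, a6.mem _ rfl, a5.mem _ rfl, a4.mem _ rfl,
      a3.mem _ rfl, sz2]

end Node

/-- One iteration of a for-loop. -/
theorem Runs.loop_step {B : ℕ} {x y i : ℕ} {p : Prog} {s : State} {Tb T T' : ℕ}
    {R Q : State → Prop} (hx : s.reg x = i) (hy : i < s.reg y) (hB : s.reg y ≤ B)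
    (hxp : p.writesR x = false) (h : Runs B p s Tb R)
    (h' : ∀ s', Agree p s s' → R s' →
      Runs B (.loop (.less (.var x) (.var y)) (.seq p (.assign x (.var x + 1))))
        (s'.setReg x (i + 1)) T Q) (hT : Tb + 7 + T ≤ T') :
    Runs B (.loop (.less (.var x) (.var y)) (.seq p (.assign x (.var x + 1)))) s T' Q := by
  obtain ⟨t, s', hp, ht, hr⟩ := h
  obtain ⟨t', s'', hl, ht', hq⟩ := h' s' hp.agree hr
  have e1 : s'.reg x = i := (hp.agree.reg x hxp).trans hx
  have ha : Exec B (.assign x (.var x + 1)) s' 4 (s'.setReg x (i + 1)) := by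
    have := Exec.assign (B := B) s' x (.var x + 1) (by simp [e1]; omega)
    have hc : (Expr.var x + 1 : Expr).cost = 3 := rfl
    simpa [e1, hc] using this
  have he : (Expr.less (.var x) (.var y)).Fits B s := by
    simp only [Expr.fits_less, Expr.fits_var, true_and]; exact ite_le (by omega)
  refine ⟨_, s'', .loop_step he (by simp [hx, hy]) (.seq hp ha) hl, ?_, hq⟩
  have : (Expr.less (.var x) (.var y)).cost = 3 := rfl
  omega

/-! ### Traversing the layout in postorder and reading off the answer. -/

namespace BinTree

variable {n : ℕ}

theorem leaves_pos {V : Type} (t : BinTree V) : 1 ≤ t.leaves.length := by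
  induction t with
  | leaf v => simp [leaves]
  | node l r ihl ihr => simp [leaves]; omega

/-- A binary tree has one inner node fewer than leaves. Hence the program can compute the number of
nodes from `n`. -/
theorem code_length (t : BinTree (Fin n)) : t.code.length + 1 = 2 * t.leaves.length := by
  induction t with
  | leaf v => simp [code, leaves]
  | node l r ihl ihr => simp [code, leaves]; omega

theorem code_pos (t : BinTree (Fin n)) : 1 ≤ t.code.length := by
  have := t.code_length; have := t.leaves_pos; omega

theorem le_width {V : Type} (f : Set V → ℕ) (t : BinTree V) : f {v | v ∈ t.leaves} ≤ t.width f := by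
  cases t with
  | leaf v => simp [leaves, width]
  | node l r => simp [leaves, width]

end BinTree

section Tree

variable {n : ℕ} {G : SimpleGraph (Fin n)} {σ ρ : Set ℕ} {w : Fin n → ℚ} {goal : Goal}
  {d B S S₁ : ℕ} {l l' : List ℕ}

theorem narrow_of_width {A : Set (Fin n)} {F : Finset (Fin n)} (hA : (F : Set (Fin n)) = A)
    (h : snec G d A ≤ S) (h' : snec G 1 A ≤ S₁) : Narrow (G := G) d S S₁ F := by
  subst hA
  exact ⟨(le_max_left _ _).trans h, by simpa using (le_max_right _ _).trans h,
    by simpa using (le_max_right _ _).trans h'⟩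

/-- Process the node `rNd`. -/
def nodeStep (goal : Goal) (d : ℕ) (l l' : List ℕ) : Prog := block [
  assign rCode (get aCode (var rNd)), .ite (var rCode) (leafNode goal d l l') (joinNode goal d)]

/-- Process all nodes from `rNd` on. -/
def nodeLoop (goal : Goal) (d : ℕ) (l l' : List ℕ) : Prog :=
  .loop (less (var rNd) (var rNn)) (.seq (nodeStep goal d l l') (assign rNd (var rNd + 1)))

def nodeTime (n d S S₁ : ℕ) : ℕ := prepTime n S S₁ + 2 * sideTime n d S S₁ +
  900 * ((S + 1) * (S + 1) * ((S + 1) * (n + 1))) + combineTime n S S₁ + 80 * (n + 1) + 10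

theorem Room.mono {k V P k' V' P' : ℕ} (h : Room n d S S₁ B k V P) (hk : k' ≤ k) (hV : V' ≤ V)
    (hP : P' ≤ P) : Room n d S S₁ B k' V' P' := by
  refine ⟨le_trans ?_ h.vec, le_trans ?_ h.slot, le_trans ?_ h.node, h.sq, h.depth⟩ <;> gcongr

/-- The nodes before number `k` have been processed. -/
structure Ready (G : SimpleGraph (Fin n)) (w : Fin n → ℚ) (S S₁ : ℕ) (c : ℕ → ℕ) (M k V P : ℕ)
    (s : State) : Prop where
  base : Base (G := G) (w := w) V P s
  nd : s.reg rNd = k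
  nn : s.reg rNn = M
  code : s.mem aCode = c
  vec : V ≤ k * (2 * S + S₁)
  slot : P ≤ k * (S * S * (S₁ * S₁ + 1))

variable {c : ℕ → ℕ} {M : ℕ}

theorem Ready.room {k V P : ℕ} {s : State} (h : Ready G w S S₁ c M k V P s) (hk : k < M)
    (hB : Room n d S S₁ B M (M * (2 * S + S₁)) (M * (S * S * (S₁ * S₁ + 1)))) :
    Room n d S S₁ B k V P :=
  hB.mono hk.le (h.vec.trans (by gcongr)) (h.slot.trans (by gcongr))

/-- The specification concerns all remaining iterations: what happens after this node is left to the
continuation `h'`. This lets an induction on the tree unroll a flat loop. -/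
theorem nodeStep_spec {A : Finset (Fin n)} {k m V P T : ℕ} {s : State} {Q : State → Prop}
    (hr : Ready G w S S₁ c M k V P s) (hk : k < M)
    (hB : Room n d S S₁ B M (M * (2 * S + S₁)) (M * (S * S * (S₁ * S₁ + 1))))
    (h : ∀ s', s'.mem = s.mem → s'.reg rNd = k → s'.reg rCode = c k →
      Base (G := G) (w := w) V P s' →
      Runs B (.ite (var rCode) (leafNode goal d l l') (joinNode goal d)) s'
        (nodeTime n d S S₁ - 5) fun s'' => NodeDone G σ ρ w goal d A k m V P S S₁ s s'')
    (h' : ∀ s' N V' P', NodeMem G σ ρ w goal d A N k V' P' S S₁ s' →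
      Ready G w S S₁ c M (k + 1) V' P' s' → V ≤ V' → P ≤ P' → Ext n k V P s s' →
      s'.mem aSize k = m → Runs B (nodeLoop goal d l l') s' T Q) :
    Runs B (nodeLoop goal d l l') s (nodeTime n d S S₁ + 7 + T) Q := by
  have hnn := hr.nn
  have hMB : M + 2 ≤ B := (Nat.le_mul_of_pos_right _ (by omega)).trans hB.node
  refine Runs.loop_step (i := k) (Tb := nodeTime n d S S₁) hr.nd (by rw [hnn]; exact hk)
    (by rw [hnn]; omega) (by cases goal <;> rfl) (R := fun s'' =>
      NodeDone G σ ρ w goal d A k m V P S S₁ s s'') ?_ ?_ le_rfl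
  · refine Runs.step (T₂ := nodeTime n d S S₁ - 5) ?_ (h _ rfl ?_ ?_ ?_) (by
      simp [dur]; unfold nodeTime; omega)
    · simp [safe, hr.nd]; omega
    · simp [run, hr.nd]
    · simp [run, hr.nd, hr.code]
    · exact ⟨hr.base.reg_n, hr.base.adj, hr.base.w, hr.base.vp, hr.base.sp⟩
  rintro s' ha ⟨N, V', P', hN, hb, hV, hV', hP, hP', he, hm⟩
  refine h' _ N V' P' (hN.ext (k' := k + 1) (Ext.of_eq rfl) (by omega) le_rfl le_rfl) ?_ hV hP
    (he.trans (k' := k) (V' := V) (P' := P) (Ext.of_eq rfl) le_rfl le_rfl le_rfl) hm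
  refine ⟨⟨hb.reg_n, hb.adj, hb.w, hb.vp, hb.sp⟩, by simp, ?_, ?_, ?_, ?_⟩
  · simpa using (ha.reg rNn (by cases goal <;> rfl)).trans hnn
  · exact (ha.mem aCode (by cases goal <;> rfl)).trans hr.code
  · have := hr.vec; rw [Nat.succ_mul]; omega
  · have := hr.slot; rw [Nat.succ_mul]; omega

/-- By induction on the tree, for an arbitrary continuation: the code of a subtree is a contiguous
segment, so the loop works through the left segment, then the right one, then the root of the
subtree. The layout of the left child survives the right segment because memory only grows (`Ext`).
-/
theorem tree_spec (hσ : σ.Finite ∨ σᶜ.Finite) (hρ : ρ.Finite ∨ ρᶜ.Finite)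
    (hdσ : domDepth σ ≤ d) (hdρ : domDepth ρ ≤ d) (hd : 1 ≤ d)
    (hl : Lists σ d l) (hl' : Lists ρ d l')
    (hB : Room n d S S₁ B M (M * (2 * S + S₁)) (M * (S * S * (S₁ * S₁ + 1))))
    (t : BinTree (Fin n)) {k V P T : ℕ} {s : State} {Q : State → Prop} (hnd : t.leaves.Nodup)
    (hw : t.width (snec G d) ≤ S) (hw' : t.width (snec G 1) ≤ S₁)
    (hc : ∀ i < t.code.length, t.code[i]? = some (c (k + i))) (hM : k + t.code.length ≤ M)
    (hr : Ready G w S S₁ c M k V P s)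
    (h : ∀ s' N V' P', NodeMem G σ ρ w goal d t.leaves.toFinset N (k + t.code.length - 1) V' P' S S₁ s' →
      Ready G w S S₁ c M (k + t.code.length) V' P' s' → V ≤ V' → P ≤ P' → Ext n k V P s s' →
      s'.mem aSize (k + t.code.length - 1) = t.code.length →
      Runs B (nodeLoop goal d l l') s' T Q) :
    Runs B (nodeLoop goal d l l') s (t.code.length * (nodeTime n d S S₁ + 7) + T) Q := by
  induction t generalizing k V P T s with
  | leaf v =>
    have hck : c k = v + 1 := by simpa [BinTree.code, eq_comm] using hc 0 (by simp [BinTree.code])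
    have hk : k < M := by simpa [BinTree.code] using hM
    have hA : Narrow (G := G) d S S₁ {v} := narrow_of_width (A := {v}) (by simp) hw hw'
    simp only [BinTree.code, BinTree.leaves, List.length_singleton, one_mul] at h ⊢
    refine nodeStep_spec (σ := σ) (ρ := ρ) (A := {v}) (m := 1) hr hk hB ?_ ?_
    · intro s1 m1 k1 c1 b1
      have hc1 : s1.reg rCode = v + 1 := c1.trans hck
      refine Runs.ite (T := nodeTime n d S S₁ - 6) (by simp) (fun _ => ?_) (fun h0 => ?_)
        (by simp [nodeTime]; omega)
      · refine (leafNode_spec hσ hρ hdσ hdρ hd hl hl' b1 k1 hc1 hA (hr.room hk hB)).mono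
          (by unfold nodeTime; omega) ?_
        rintro s2 - ⟨N, V', P', h1, h2, h3, h4, h5, h6, h7, h8⟩
        exact ⟨N, V', P', h1, h2, h3, h4, h5, h6,
          (Ext.of_eq (k := k) (V := V) (P := P) m1).trans h7 le_rfl le_rfl le_rfl, h8⟩
      · simp [hc1] at h0
    · intro s' N V' P' h1 h2 h3 h4 h5 h6
      exact h s' N V' P' (by simpa using h1) h2 h3 h4 h5 h6
  | node t t' ih ih' =>
    have p := t.code_pos
    have p' := t'.code_pos
    have hlen : (t.node t').code.length = t.code.length + t'.code.length + 1 := by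
      simp [BinTree.code]; omega
    rw [hlen] at hc hM h ⊢
    simp only [← Nat.add_assoc, Nat.add_sub_cancel] at h
    simp only [BinTree.width, max_le_iff] at hw hw'
    have hnd' := List.nodup_append.1 hnd
    have hc1 : ∀ i < t.code.length, t.code[i]? = some (c (k + i)) := fun i hi => by
      rw [← hc i (by omega), BinTree.code, List.append_assoc, List.getElem?_append_left hi]
    have hc2 : ∀ i < t'.code.length, t'.code[i]? = some (c (k + t.code.length + i)) :=
      fun i hi => by
        rw [Nat.add_assoc, ← hc (t.code.length + i) (by omega), BinTree.code, List.append_assoc,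
          List.getElem?_append_right (by omega), Nat.add_sub_cancel_left,
          List.getElem?_append_left hi]
    have hc3 : c (k + t.code.length + t'.code.length) = 0 := by
      have := hc (t.code.length + t'.code.length) (by omega)
      rw [BinTree.code, List.getElem?_append_right (by simp)] at this
      simpa [Nat.add_assoc, eq_comm] using this
    have hdisj : Disjoint t.leaves.toFinset t'.leaves.toFinset := by
      rw [List.disjoint_toFinset_iff_disjoint]
      exact fun a ha ha' => hnd'.2.2 a ha a ha' rfl
    have hA : Narrow (G := G) d S S₁ (t.leaves.toFinset ∪ t'.leaves.toFinset) :=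
      narrow_of_width (A := {v | v ∈ t.leaves ++ t'.leaves}) (by ext; simp) hw.1 hw'.1
    rw [show (t.code.length + t'.code.length + 1) * (nodeTime n d S S₁ + 7) + T =
      t.code.length * (nodeTime n d S S₁ + 7) + (t'.code.length * (nodeTime n d S S₁ + 7) +
        (nodeTime n d S S₁ + 7 + T)) by ring]
    refine ih hnd'.1 hw.2.1 hw'.2.1 hc1 (by omega) hr ?_
    intro s1 N1 V1 P1 n1 r1 v1 p1 e1 z1
    refine ih' hnd'.2.1 hw.2.2 hw'.2.2 hc2 (by omega) r1 ?_
    intro s2 N2 V2 P2 n2 r2 v2 p2 e2 z2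
    have hk : k + t.code.length + t'.code.length < M := by omega
    refine nodeStep_spec (σ := σ) (ρ := ρ) (A := t.leaves.toFinset ∪ t'.leaves.toFinset)
      (m := t.code.length + t'.code.length + 1) r2 hk hB ?_ ?_
    · intro s3 m3 k3 c3 b3
      have hc4 : s3.reg rCode = 0 := c3.trans hc3
      refine Runs.ite (T := nodeTime n d S S₁ - 6) (by simp) (fun h0 => ?_) (fun _ => ?_)
        (by simp [nodeTime]; omega)
      · simp [hc4] at h0
      · have hext := Ext.of_eq (n := n) (k := k + t.code.length + t'.code.length) (V := V2)
          (P := P2) m3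
        refine (joinNode_spec (kl := k + t.code.length - 1) (m := t.code.length)
          (m' := t'.code.length) hσ hρ hdσ hdρ hdisj b3 k3
          (by omega) p' (by rw [m3]; exact z2) ?_ ((n1.ext e2 (by omega) v2 p2).ext hext (by omega)
            le_rfl le_rfl) (n2.ext hext (by omega) le_rfl le_rfl) (by omega) hA
            (r2.room hk hB)).mono (by unfold nodeTime; omega) ?_
        · rw [m3, e2.arr aSize (Or.inl rfl) _ (by omega)]; exact z1
        rintro s4 - ⟨N, V', P', h1, h2, h3, h4, h5, h6, h7, h8⟩
        exact ⟨N, V', P', h1, h2, h3, h4, h5, h6, hext.trans h7 le_rfl le_rfl le_rfl, h8⟩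
    · intro s' N V' P' h1 h2 h3 h4 h5 h6
      refine h s' N V' P' ?_ h2 (v1.trans (v2.trans h3)) (p1.trans (p2.trans h4)) ?_ h6
      · have : (t.node t').leaves.toFinset = t.leaves.toFinset ∪ t'.leaves.toFinset := by
          simp [BinTree.leaves]
        rw [this]; exact h1
      · exact e1.trans (e2.trans h5 (by omega) v2 p2) (by omega) v1 p1

end Tree

/-- Return the solution in the table of the last node. -/
def output : Prog := block [assign rBl (get aBase (var rNn - 1)), assign rRes (get aUsed (var rBl)),
  forLoop rGu rN (store aOut (var rGu) (get aSX (var rBl * var rN + var rGu)))]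

/-- The algorithm.  The lists `l` and `l'` are the relevant parts of `σ` and `ρ`. -/
def optimize (goal : Goal) (d : ℕ) (l l' : List ℕ) : Prog := block [assign rVp 0, assign rSp 0,
  assign rNn (var rN + var rN - 1), assign rNd 0, nodeLoop goal d l l', output]

section Main

variable {n : ℕ} {G : SimpleGraph (Fin n)} {σ ρ : Set ℕ} {w : Fin n → ℚ} {goal : Goal}
  {d B S S₁ : ℕ} {l l' : List ℕ} {s : State}

/-- In postorder the root is the last node, and the first slot of its table is its only basis slot.
-/
theorem output_spec {N : NodeData n} {M V P : ℕ} {c : ℕ → ℕ} (hn : 0 < n)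
    (hσ : σ.Finite ∨ σᶜ.Finite) (hρ : ρ.Finite ∨ ρᶜ.Finite)
    (hdσ : domDepth σ ≤ d) (hdρ : domDepth ρ ≤ d)
    (hN : NodeMem G σ ρ w goal d Finset.univ N (M - 1) V P S S₁ s)
    (hr : Ready G w S S₁ c M M V P s) (hM : M ≤ B) (hB : (P + 1) * (n + 1) ≤ B) :
    Runs B output s (40 * (n + 1)) (IsOutput goal G σ ρ w) := by
  have hbase := hN.lists.base
  have hn' := hr.base.reg_n
  have hPB : P + 1 ≤ B := (Nat.le_mul_of_pos_right _ (by omega)).trans hB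
  have hnB : n + 1 ≤ B := (Nat.le_mul_of_pos_left _ (by omega)).trans hB
  have hend : N.base ≤ P := le_trans (by unfold NodeData.tableEnd; omega) hN.tableEnd
  refine Runs.step (T₂ := 34 * (n + 1)) ?_ ?_ (by simp [dur]; omega)
  · simp [safe, hr.nn]; omega
  refine Runs.step (T₂ := 30 * (n + 1)) ?_ ?_ (by simp [dur]; omega)
  · simp [safe, run, hr.nn, hbase]; omega
  simp only [run, eval_var, eval_get, eval_sub, eval_ofNat, hr.nn, hbase, setReg_reg, setReg_mem]
  simp only [if_pos]
  have hroot := hN.table.root hn hσ hρ hdσ hdρ hN.lists.list₀ hN.lists.list₁ hN.lists.list₂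
  refine (Runs.for (N := n) (Tb := 12) (T := 30 * (n + 1)) (fun m s' => ∀ u : Fin n, (u : ℕ) < m →
      s'.mem aOut u = s.mem aSX (N.base * n + u)) (by simpa using hn') (by omega) (by omega) (by simp)
    ?_ (by omega)).mono le_rfl ?_
  · intro i hi s2 hx2 ha2 i1
    have e0 := ha2.reg rN rfl
    have e1 := ha2.reg rBl rfl
    simp [hn'] at e0 e1
    have e2 : s2.mem aSX = s.mem aSX := (ha2.mem aSX rfl)
    have hidx : N.base * n + i < (P + 1) * (n + 1) := by
      have := idx_lt (show N.base < P + 1 by omega) hi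
      have := Nat.mul_le_mul_left (P + 1) (Nat.le_succ n)
      simp only [Nat.succ_eq_add_one] at this
      omega
    refine Runs.straight ?_ ?_ (by simp [dur])
    · simp [safe, e0, e1, hx2]; omega
    · simp only [run, eval_add, eval_mul, eval_var, eval_get, e0, e1, e2, hx2, setReg_mem,
        setMem_mem, true_and]
      intro u hu
      by_cases hui : (u : ℕ) = i
      · simp [hui]
      · rw [if_neg hui]; exact i1 u (by omega)
  · intro s2 ha2 h2
    have e3 := ha2.reg rRes rfl
    simp at e3
    rcases hroot with ⟨h0, hno⟩ | ⟨h1, D, hD, hX⟩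
    · exact Or.inl ⟨e3.trans h0, hno⟩
    · refine Or.inr ⟨e3.trans h1, D, hD, fun u => ?_⟩
      rw [h2 u u.2, hX u]

/-- A binary tree has at least one leaf, so a layout exists only for `n > 0`. The traversal has `2n
- 1` nodes, and after `k` of them at most `k * (2 * S + S₁)` vectors and `k * (S * S * (S₁ * S₁ +
1))` slots are in use, which fixes the word size. -/
theorem optimize_spec (hσ : σ.Finite ∨ σᶜ.Finite) (hρ : ρ.Finite ∨ ρᶜ.Finite)
    (hdσ : domDepth σ ≤ d) (hdρ : domDepth ρ ≤ d) (hd : 1 ≤ d)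
    (hl : Lists σ d l) (hl' : Lists ρ d l') {L : RootedLayout (Fin n)} (hs : IsInput G w L s)
    (hS : layoutSnec G d L ≤ S) (hS₁ : layoutSnec G 1 L ≤ S₁)
    (hB : Room n d S S₁ B (2 * n) (2 * n * (2 * S + S₁)) (2 * n * (S * S * (S₁ * S₁ + 1)))) :
    0 < n ∧ Runs B (optimize goal d l l') s (2 * n * (nodeTime n d S S₁ + 7) + 60 * (n + 1))
      (IsOutput goal G σ ρ w) := by
  obtain ⟨i1, i2, i3, i4⟩ := hs
  have hleaf : L.tree.leaves.toFinset = Finset.univ := by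
    ext v; simp [L.complete v]
  have hlen : L.tree.leaves.length = n := by
    rw [← List.toFinset_card_of_nodup L.nodup, hleaf, Finset.card_univ, Fintype.card_fin]
  have hpos := L.tree.leaves_pos
  have hcode := L.tree.code_length
  rw [hlen] at hcode hpos
  refine ⟨hpos, ?_⟩
  set M := L.tree.code.length with hM
  have hM2 : M ≤ 2 * n := by omega
  have hMB : 2 * n + 2 ≤ B := (Nat.le_mul_of_pos_right _ (by omega)).trans hB.node
  have hB' := hB.mono hM2 (show M * (2 * S + S₁) ≤ _ by gcongr)
    (show M * (S * S * (S₁ * S₁ + 1)) ≤ _ by gcongr)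
  refine Runs.step (T₂ := 2 * n * (nodeTime n d S S₁ + 7) + 55 * (n + 1)) ?_ ?_
    (by simp [dur]; omega)
  · simp [safe]
  refine Runs.step (T₂ := 2 * n * (nodeTime n d S S₁ + 7) + 53 * (n + 1)) ?_ ?_
    (by simp [dur]; omega)
  · simp [safe]
  refine Runs.step (T₂ := 2 * n * (nodeTime n d S S₁ + 7) + 47 * (n + 1)) ?_ ?_
    (by simp [dur]; omega)
  · simp [safe, run, i1]; omega
  refine Runs.step (T₂ := 2 * n * (nodeTime n d S S₁ + 7) + 45 * (n + 1)) ?_ ?_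
    (by simp [dur]; omega)
  · simp [safe]
  have hM1 : n + n - 1 = M := by omega
  simp only [run, eval_var, eval_sub, eval_add, eval_ofNat, setReg_reg]
  simp [i1, hM1]
  have htime : M * (nodeTime n d S S₁ + 7) ≤ 2 * n * (nodeTime n d S S₁ + 7) := by gcongr
  -- The continuation consists of the failing loop test only, hence `T := 3`.
  refine Runs.seq (tree_spec (goal := goal) (k := 0) (V := 0) (P := 0) (T := 3) (M := M)
    (c := s.mem aCode) (w := w)
    (Q := fun s' => ∃ N V' P', NodeMem G σ ρ w goal d Finset.univ N (M - 1) V' P' S S₁ s' ∧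
      Ready G w S S₁ (s.mem aCode) M M V' P' s') hσ hρ hdσ hdρ hd hl hl' hB' L.tree L.nodup hS hS₁
      ?_ (by omega) ?_ ?_) (T₂ := 40 * (n + 1)) ?_ (by rw [← hM]; omega)
  · intro i hi
    rw [Nat.zero_add, List.getElem?_eq_getElem hi, ← i3 i hi]
  · refine ⟨⟨by simpa using i1, fun u v => ?_, fun u => ?_, by simp, by simp⟩, by simp, by simp,
      by simp, by simp, by simp⟩
    · refine (i2 u v).trans ?_
      unfold adj; congr
    · exact i4 u
  · intro s' N V' P' h1 h2 h3 h4 h5 h6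
    rw [← hM, Nat.zero_add] at h1 h2
    rw [hleaf] at h1
    have hl : (less (var rNd) (var rNn)).eval s' = 0 := by simp [h2.nd, h2.nn]
    exact ⟨3, s', .loop_done (by simp [h2.nd, h2.nn]) hl, le_rfl, N, V', P', h1, h2⟩
  · rintro s' - ⟨N, V', P', h1, h2⟩
    refine output_spec hpos hσ hρ hdσ hdρ h1 h2 (by omega) (le_trans ?_ hB.slot)
    have := h2.slot.trans (Nat.mul_le_mul_right (S * S * (S₁ * S₁ + 1)) hM2)
    gcongr <;> omega

end Main

/-! ### From the concrete running time to the asymptotic bound. -/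

section Bounds

/-- All three parameters are at least 1, so every term of the running time is below one common
monomial. -/
theorem monomial_le {n S S₁ : ℕ} (hn : 1 ≤ n) (hS : 1 ≤ S) (hS₁ : 1 ≤ S₁) (a b c : ℕ)
    {a' b' c' : ℕ} (ha : a ≤ a') (hb : b ≤ b') (hc : c ≤ c') :
    S ^ a * S₁ ^ b * n ^ c ≤ S ^ a' * S₁ ^ b' * n ^ c' := by
  gcongr

/-- The leading term comes from `combineTime`: `S ^ 3` triples of classes, `S₁ ^ 4` pairs of slots,
and `S₁ ^ 4 * n ^ 2` for an insertion. The dependence on `d` comes from the membership tests at the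
leaves. -/
theorem nodeTime_le {n d S S₁ : ℕ} (hn : 1 ≤ n) (hS : 1 ≤ S) (hS₁ : 1 ≤ S₁) :
    nodeTime n d S S₁ + 7 ≤ (60000 + 28 * d) * (S ^ 3 * S₁ ^ 8 * n ^ 2) := by
  have m := fun a b c ha hb hc => @monomial_le n S S₁ hn hS hS₁ a b c 3 8 2 ha hb hc
  set X := S ^ 3 * S₁ ^ 8 * n ^ 2 with hX
  have hn2 : n + 1 ≤ 2 * n := by omega
  have hS2 : S + 1 ≤ 2 * S := by omega
  have hS12 : S₁ + 1 ≤ 2 * S₁ := by omega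
  have hq : 1 ≤ S₁ * S₁ := Nat.mul_pos hS₁ hS₁
  have hK : S₁ * S₁ + 1 ≤ 2 * (S₁ * S₁) := by omega
  have hX1 : 1 ≤ X := by simpa using m 0 0 0 (by omega) (by omega) (by omega)
  have prep : prepTime n S S₁ ≤ 13530 * X := by
    have h1 : (n + 1) * (S + 1) * ((S + 1) * (n + 1)) ≤ 2 * n * (2 * S) * (2 * S * (2 * n)) := by
      gcongr
    have h2 : (n + 1) * (S₁ + 1) * ((S₁ + 1) * (n + 1)) ≤
        2 * n * (2 * S₁) * (2 * S₁ * (2 * n)) := by gcongr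
    have h3 : S * S * (S₁ * S₁ + 1) ≤ S * S * (2 * (S₁ * S₁)) := by gcongr
    have m1 := m 2 0 2 (by omega) (by omega) (by omega)
    have m2 := m 0 2 2 (by omega) (by omega) (by omega)
    have m3 := m 2 2 0 (by omega) (by omega) (by omega)
    unfold prepTime
    nlinarith
  have ins : insertTime n (S₁ * S₁) ≤ 3100 * (S₁ ^ 4 * n ^ 2) := by
    have h1 : (n + 1) * (n + 1) ≤ 2 * n * (2 * n) := by gcongr
    have h2 : n + S₁ * S₁ + 1 ≤ 3 * (S₁ * S₁ * n) := by nlinarith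
    have h3 : (S₁ * S₁ + 1) * (n + S₁ * S₁ + 1) ≤ 2 * (S₁ * S₁) * (3 * (S₁ * S₁ * n)) := by gcongr
    have m1 := @monomial_le n S S₁ hn hS hS₁ 0 0 2 0 4 2 (by omega) (by omega) (by omega)
    have m2 := @monomial_le n S S₁ hn hS hS₁ 0 4 1 0 4 2 (by omega) (by omega) (by omega)
    unfold insertTime
    nlinarith
  have side : sideTime n d S S₁ ≤ (3700 + 14 * d) * X := by
    have h1 : (S + 1) * (n + 1) ≤ 2 * S * (2 * n) := by gcongr
    have h2 : S * (insertTime n (S₁ * S₁) + 14 * (d + 1) + 60 * (n + 1)) ≤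
        S * (3100 * (S₁ ^ 4 * n ^ 2) + 14 * (d + 1) + 60 * (2 * n)) := by gcongr
    have m1 := m 1 0 1 (by omega) (by omega) (by omega)
    have m2 := m 1 4 2 (by omega) (by omega) (by omega)
    have m3 := m 1 0 0 (by omega) (by omega) (by omega)
    have m4 := Nat.mul_le_mul_left (14 * (d + 1)) m3
    unfold sideTime
    nlinarith
  have join : (S + 1) * (S + 1) * ((S + 1) * (n + 1)) ≤ 16 * X := by
    have h1 : (S + 1) * (S + 1) * ((S + 1) * (n + 1)) ≤ 2 * S * (2 * S) * (2 * S * (2 * n)) := by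
      gcongr
    have m1 := m 3 0 1 (by omega) (by omega) (by omega)
    nlinarith
  have comb : combineTime n S S₁ ≤ 13100 * X := by
    have h1 : combineTime n S S₁ ≤ S * (S * (S * ((2 * (S₁ * S₁)) * ((2 * (S₁ * S₁)) *
        (3100 * (S₁ ^ 4 * n ^ 2) + 67 * (2 * n)) + 12) + 57) + 12) + 12) + 5 := by
      unfold combineTime; gcongr
    have m1 := m 3 4 1 (by omega) (by omega) (by omega)
    have m2 := m 3 2 0 (by omega) (by omega) (by omega)
    have m3 := m 3 0 0 (by omega) (by omega) (by omega)
    have m4 := m 2 0 0 (by omega) (by omega) (by omega)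
    have m5 := m 1 0 0 (by omega) (by omega) (by omega)
    refine h1.trans ?_
    simp only [pow_zero, mul_one, pow_one] at m1 m2 m3 m4 m5
    calc _ = 12400 * X + 536 * (S ^ 3 * S₁ ^ 4 * n) + 24 * (S ^ 3 * S₁ ^ 2) + 57 * S ^ 3 +
          12 * S ^ 2 + 12 * S + 5 := by rw [hX]; ring
      _ ≤ _ := by linarith
  have m1 := m 0 0 1 (by omega) (by omega) (by omega)
  simp only [pow_zero, mul_one, pow_one, one_mul] at m1
  unfold nodeTime
  nlinarith

/-- A word size that suffices for all nodes. -/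
def wordBound (n d S S₁ : ℕ) : ℕ := (2 * n * (2 * S + S₁) + 2 * S + S₁ + 1) * (n + 1) +
  (2 * n * (S * S * (S₁ * S₁ + 1)) + S * S * (S₁ * S₁ + 1) + 1) * (n + S₁ * S₁ + 1) +
  (2 * n + 2) * (n + 1) + n * n + (2 * d + 2)

theorem room_wordBound (n d S S₁ : ℕ) : Room n d S S₁ (wordBound n d S S₁) (2 * n)
    (2 * n * (2 * S + S₁)) (2 * n * (S * S * (S₁ * S₁ + 1))) := by
  constructor <;> unfold wordBound <;> omega

/-- The same monomial as in the running time bounds the words, so integers have O(log τ) bits. -/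
theorem wordBound_le {n d S S₁ : ℕ} (hn : 1 ≤ n) (hS : 1 ≤ S) (hS₁ : 1 ≤ S₁) :
    wordBound n d S S₁ ≤ (100 + 2 * d) * (S ^ 3 * S₁ ^ 8 * n ^ 3) := by
  have m := fun a b c ha hb hc => @monomial_le n S S₁ hn hS hS₁ a b c 3 8 3 ha hb hc
  set X := S ^ 3 * S₁ ^ 8 * n ^ 3
  have hq : 1 ≤ S₁ * S₁ := Nat.mul_pos hS₁ hS₁
  have h0 : 2 * S + S₁ ≤ 3 * (S * S₁) := by nlinarith
  have h1 : 2 * n * (2 * S + S₁) + 2 * S + S₁ + 1 ≤ 10 * (S * S₁ * n) := by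
    have h1 : 2 * n * (2 * S + S₁) ≤ 2 * n * (3 * (S * S₁)) := by gcongr
    have h2 : S * S₁ ≤ S * S₁ * n := Nat.le_mul_of_pos_right _ hn
    have h3 : 1 ≤ S * S₁ := Nat.mul_pos hS hS₁
    linarith
  have h2 : 2 * n * (S * S * (S₁ * S₁ + 1)) + S * S * (S₁ * S₁ + 1) + 1 ≤
      7 * (S * S * (S₁ * S₁) * n) := by
    have h1 : S * S * (S₁ * S₁ + 1) ≤ S * S * (2 * (S₁ * S₁)) := by gcongr; omega
    have h2 : 2 * n * (S * S * (S₁ * S₁ + 1)) ≤ 2 * n * (S * S * (2 * (S₁ * S₁))) := by gcongr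
    have h3 : S * S * (S₁ * S₁) ≤ S * S * (S₁ * S₁) * n := Nat.le_mul_of_pos_right _ hn
    have h4 : 1 ≤ S * S * (S₁ * S₁) := Nat.mul_pos (Nat.mul_pos hS hS) hq
    linarith
  have h3 : n + S₁ * S₁ + 1 ≤ 3 * (S₁ * S₁ * n) := by nlinarith
  have e1 : (2 * n * (2 * S + S₁) + 2 * S + S₁ + 1) * (n + 1) ≤ 10 * (S * S₁ * n) * (2 * n) := by
    gcongr; omega
  have e2 := Nat.mul_le_mul h2 h3
  have e3 : (2 * n + 2) * (n + 1) ≤ (4 * n) * (2 * n) := by gcongr <;> omega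
  have m1 := m 1 1 2 (by omega) (by omega) (by omega)
  have m2 := m 2 4 2 (by omega) (by omega) (by omega)
  have m3 := m 0 0 2 (by omega) (by omega) (by omega)
  have m4 := Nat.mul_le_mul_left (2 * d + 2) (m 0 0 0 (by omega) (by omega) (by omega))
  unfold wordBound
  simp only [pow_zero, mul_one, pow_one, one_mul] at m1 m2 m3 m4
  have e4 : 10 * (S * S₁ * n) * (2 * n) = 20 * (S * S₁ * n ^ 2) := by ring
  have e5 : 7 * (S * S * (S₁ * S₁) * n) * (3 * (S₁ * S₁ * n)) = 21 * (S ^ 2 * S₁ ^ 4 * n ^ 2) := by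
    ring
  have e6 : 4 * n * (2 * n) = 8 * n ^ 2 := by ring
  have e7 : n * n = n ^ 2 := by ring
  rw [e4] at e1
  rw [e5] at e2
  rw [e6] at e3
  linarith

variable {V : Type} [Finite V] (G : SimpleGraph V)

theorem nec_pos (d : ℕ) (A : Set V) : 1 ≤ nec G d A := by
  have : Nonempty {X : Set V // X ⊆ A} := ⟨⟨∅, Set.empty_subset A⟩⟩
  have : Nonempty (Quotient (neighborEquiv G d A)) := this.map (Quotient.mk _)
  exact Nat.card_pos

theorem layoutSnec_pos (d : ℕ) (L : RootedLayout V) : 1 ≤ layoutSnec G d L :=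
  ((nec_pos G d _).trans (le_max_left _ _)).trans (L.tree.le_width (snec G d))

/-- The exponent 8 is at most `2 * ω + 5` as `ω ≥ 2`, and the base is at least 1. The logarithm is
at least 1 because `1 + s-nec_d ≥ 2`. -/
theorem le_timeBound {n : ℕ} {σ ρ : Set ℕ} {ω : ℝ} (hω : 2 ≤ ω) (G : SimpleGraph (Fin n))
    (L : RootedLayout (Fin n)) :
    ((layoutSnec G (domD σ ρ) L ^ 3 * layoutSnec G 1 L ^ 8 * n ^ 3 : ℕ) : ℝ) ≤
      timeBound σ ρ ω G L := by
  have hS : (1 : ℝ) ≤ layoutSnec G (domD σ ρ) L := by exact_mod_cast layoutSnec_pos G _ L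
  have hS₁ : (1 : ℝ) ≤ layoutSnec G 1 L := by exact_mod_cast layoutSnec_pos G _ L
  have hlog : 1 ≤ Real.logb 2 (1 + layoutSnec G (domD σ ρ) L) := by
    rw [Real.le_logb_iff_rpow_le (by norm_num) (by linarith), Real.rpow_one]; linarith
  have hpow : (layoutSnec G 1 L : ℝ) ^ 8 ≤ (layoutSnec G 1 L : ℝ) ^ (2 * ω + 5) := by
    rw [← Real.rpow_natCast]
    exact Real.rpow_le_rpow_of_exponent_le hS₁ (by push_cast; linarith)
  unfold timeBound
  push_cast
  refine mul_le_mul_of_nonneg_right ?_ (by positivity)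
  refine (mul_le_mul_of_nonneg_left hpow (by positivity)).trans ?_
  exact le_mul_of_one_le_right (by positivity) hlog

end Bounds

end CoDom

theorem corollary4p5 (σ ρ : Set ℕ) (hσ : σ.Nonempty) (hρ : ρ.Nonempty)
    (hσf : σ.Finite ∨ σᶜ.Finite) (hρf : ρ.Finite ∨ ρᶜ.Finite)
    (ω : ℝ) (hω : CoDom.IsMatMulExponent ω) (goal : CoDom.Goal) :
    ∃ (p : CoDom.Prog) (C : ℕ), ∀ (n : ℕ) (G : SimpleGraph (Fin n)) (w : Fin n → ℚ)
      (L : CoDom.RootedLayout (Fin n)) (s : CoDom.State), CoDom.IsInput G w L s →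
        CoDom.RunsWithin p s C (CoDom.timeBound σ ρ ω G L)
          (CoDom.IsOutput goal G σ ρ w) := by
  obtain ⟨l, hl⟩ := CoDom.exists_lists σ (CoDom.domD σ ρ)
  obtain ⟨l', hl'⟩ := CoDom.exists_lists ρ (CoDom.domD σ ρ)
  set d := CoDom.domD σ ρ with hd
  have hd1 : 1 ≤ d := le_max_left _ _
  -- The nodes account for `120000 + 56 * d` and the rest of the program for at most 120. The
  -- constant depends on σ and ρ through `d` alone.
  refine ⟨CoDom.optimize goal d l l', 130000 + 60 * d, fun n G w L s hs => ?_⟩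
  have hS := CoDom.layoutSnec_pos G d L
  have hS₁ := CoDom.layoutSnec_pos G 1 L
  have hτ := CoDom.le_timeBound (σ := σ) (ρ := ρ) hω.1 G L
  rw [← hd] at hτ
  obtain ⟨hn, t, s', hx, ht, hq⟩ := CoDom.optimize_spec (goal := goal) (ρ := ρ) hσf hρf
    ((le_max_left _ _).trans (le_max_right _ _)) ((le_max_right _ _).trans (le_max_right _ _))
    hd1 hl hl' hs le_rfl le_rfl (CoDom.room_wordBound n d _ _)
  have hB := CoDom.wordBound_le (d := d) hn hS hS₁
  set S := CoDom.layoutSnec G d L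
  set S₁ := CoDom.layoutSnec G 1 L
  set X := S ^ 3 * S₁ ^ 8 * n ^ 3 with hX
  have hX1 : 1 ≤ X := Nat.mul_pos (Nat.mul_pos (pow_pos hS 3) (pow_pos hS₁ 8)) (pow_pos hn 3)
  have hnX : n ≤ X := by
    simpa using CoDom.monomial_le hn hS hS₁ 0 0 1 (a' := 3) (b' := 8) (c' := 3) (by omega)
      (by omega) (by omega)
  have htime : t ≤ (130000 + 60 * d) * X := by
    have h1 := Nat.mul_le_mul_left (2 * n) (CoDom.nodeTime_le (d := d) hn hS hS₁)
    have h2 : 2 * n * ((60000 + 28 * d) * (S ^ 3 * S₁ ^ 8 * n ^ 2)) = (120000 + 56 * d) * X := by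
      rw [hX]; ring
    have h3 : 60 * (n + 1) ≤ 120 * X := by omega
    rw [h2] at h1
    refine ht.trans ((Nat.add_le_add h1 h3).trans ?_)
    rw [← add_mul]
    exact Nat.mul_le_mul_right _ (by omega)
  have hτ1 : 1 ≤ CoDom.timeBound σ ρ ω G L := le_trans (by exact_mod_cast hX1) hτ
  refine ⟨_, t, s', hx, ?_, ?_, hq⟩
  · refine le_trans (Nat.cast_le.2 htime) ?_
    rw [Nat.cast_mul]
    gcongr
  · refine le_trans (Nat.cast_le.2 hB) ?_
    rw [Nat.cast_mul]
    -- The word bound is even linear in τ; the larger power in `RunsWithin` is reached because τ is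
    -- at least 1.
    have : CoDom.timeBound σ ρ ω G L ≤ CoDom.timeBound σ ρ ω G L ^ (130000 + 60 * d) :=
      le_self_pow₀ hτ1 (by omega)
    exact mul_le_mul (by exact_mod_cast (by omega : 100 + 2 * d ≤ 130000 + 60 * d))
      (hτ.trans this) (Nat.cast_nonneg _) (Nat.cast_nonneg _)
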